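/- **Conventions.** A Hilbert superspace of parity $n\in\mathbb Z_2$ is a complex $\mathbb Z_2$-graded vector space $\mathcal H=\mathcal H_0\oplus\mathcal H_1$ with a homogeneous sesquilinear inner product $\langle\cdot,\cdot\rangle$ of degree $n$ which is superhermitian ($\overline{\langle x,y\rangle}=(-1)^{|x||y|}\langle y,x\rangle$) and admits a fundamental symmetry: a linear map $J$ of degree $n$ with $J^2x=(-1)^{(n+1)|x|}x$, $\langle Jx,Jy\rangle=\langle x,y\rangle$, such that $(x,y)_J=\langle x,Jy\rangle$ is a hermitian positive definite scalar product for which $\mathcal H$ is complete. The topology of $\mathcal H$ is that of $(\cdot,\cdot)_J$. Let $m,r,s\ge 0$. The Heisenberg supergroup $G$ is $\mathbb R^{2m|2(r+s)}\times\mathbb R Z$ with $[a+tZ,a'+t'Z]=\omega(a,a')Z$ on points, where $\omega$ is the standard symplectic form on the even part and the symmetric form $\mathrm{diag}(1_{r+2s},-1_r)$ on the odd part (so that $[e_i,e_j]=-\omega_{ij}Z$ for odd basis vectors, the odd coordinates of points being anticommuting). A superunitary representation of $G$ on a Hilbert superspace $\mathcal H$ consists of a strongly continuous representation $\pi$ of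 the body of $G$ by even operators that preserve $\langle\cdot,\cdot\rangle$ and are uniformly bounded, and of odd operators $\rho(X)$ on the smooth vectors of $\pi$, real-linear in the odd vector $X$, commuting with $\pi$, with $\rho(X)\rho(Y)+\rho(Y)\rho(X)=-\omega(X,Y)\,d\pi(Z)$ and $\langle\rho(X)x,y\rangle+(-1)^{|x|}\langle x,\rho(X)y\rangle=0$. It is irreducible if $\mathcal H\ne0$ and it has no closed graded invariant subspace other than $0$ and $\mathcal H$. For real $\theta\neq0$ let $\mathcal H_\theta=L^2(\mathbb R^{m|r})\otimes Hol(\mathbb C^{0|s})$ with $$\langle\varphi,\psi\rangle=(2i)^s\int dq\,d\xi\,d\zeta\,d\bar\zeta\ \overline{\varphi(q,\xi,\zeta)}\,\psi(q,\xi,\zeta)\,e^{\frac i\theta\zeta\bar\zeta},$$ and let $U_\theta$ be the representation $$U_\theta(g)\varphi(q_0,\xi_0,\zeta_0)=e^{\frac{2i}{\theta}\left(t+(\frac12q-q_0)p+(\frac12\xi-\xi_0)\eta+\frac12(\frac12\zeta-\zeta_0)\bar\zeta\right)}\varphi(q_0-q,\xi_0-\xi,\zeta_0-\zeta).$$ **Theorem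 (extended Stone–von Neumann).** For all $m,r,s\ge0$ and all real $\theta\ne0$: 1. $U_\theta$ is an irreducible superunitary representation of $G$, with central character $e^{\frac{2i}{\theta}t}$, on the Hilbert superspace $\mathcal H_\theta$ of parity $r$ mod 2. 2. Let $\mathcal H$ be a Hilbert superspace of parity $n$ (either parity) with a superunitary representation of $G$ with central character $e^{\frac{2i}{\theta}t}$. If $n=r$ mod 2, it is an orthogonal direct sum of copies of $U_\theta$, each up to change of parity and of the sign of the inner product. If $n=r+1$ mod 2, it is an orthogonal direct sum of copies (again up to these changes) of $U_\theta\otimes 1$ on $\mathcal H_\theta\otimes\mathbb C^{1|1}$, where $\mathbb C^{1|1}$ has the odd inner product $\langle e_0,e_1\rangle=\langle e_1,e_0\rangle=1$, $\langle e_0,e_0\rangle=\langle e_1,e_1\rangle=0$. In both cases the sum is a Hilbert sum: the summands are stable under a common fundamental symmetry, hence mutually orthogonal also for its scalar product, their span is dense, and the identifications of the summands with the model are uniformly bounded above and below. 3. The irreducible superunitary representations of $G$ with this central character are identified with the irreducible representations of the complex Clifford algebra of the odd part, with relations $\gamma(X)^2=-\frac i\theta\,\omega(X,X)$. To such a representation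 on $\mathcal H$ one attaches the space of bounded operators $L^2(\mathbb R^m)\to\mathcal H$ that intertwine the Schrödinger representation of the body of $G$ with $\pi$, on which $\gamma(X)$ acts by composition with $\rho(X)$. For irreducible $\mathcal H$ this is an irreducible Clifford module; every irreducible Clifford module arises so (from $U_\theta$); and two irreducible superunitary representations are equivalent (up to parity and sign of the inner product) if and only if their Clifford modules are isomorphic. Moreover, every irreducible superunitary representation with this central character has parity $n=r$ mod 2 and is equivalent in this sense to $U_\theta$. -/

import Mathlib

open MeasureTheory
open scoped ENNReal ComplexConjugate

universe u v w

noncomputable section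

/-! ### Hilbert superspaces -/

/-- A `ℤ/2`-grading (`comp 0` even part, `comp 1` odd part) and a sesquilinear inner product,
conjugate-linear in the first variable. -/
structure SuperspaceData (H : Type*) [NormedAddCommGroup H] [NormedSpace ℂ H] where
  comp : ZMod 2 → Submodule ℂ H
  form : H →ₗ⋆[ℂ] H →ₗ[ℂ] ℂ

/-- `J` is a fundamental symmetry of degree `n`: it is homogeneous of degree `n`,
`J² x = (-1)^((n+1)|x|) x`, `⟨J x, J y⟩ = ⟨x, y⟩`, and `(x, y)_J = ⟨x, J y⟩` is a hermitian positive
definite scalar product. The last clause says that the norm `√(x,x)_J` is equivalent to the norm of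
`H`; as `H` will be complete, `H` is then complete for `(·,·)_J`, and the topology of `H` is the
Hilbert topology of the superspace. -/
structure SuperspaceData.IsFundamentalSymmetry {H : Type*} [NormedAddCommGroup H] [NormedSpace ℂ H]
    (S : SuperspaceData H) (n : ZMod 2) (J : H →ₗ[ℂ] H) : Prop where
  degree : ∀ a, ∀ x ∈ S.comp a, J x ∈ S.comp (a + n)
  square : ∀ a, ∀ x ∈ S.comp a, J (J x) = (-1 : ℂ) ^ ((n + 1).val * a.val) • x
  isometric : ∀ x y, S.form (J x) (J y) = S.form x y
  hermitian : ∀ x y, conj (S.form x (J y)) = S.form y (J x)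
  equivalent_norm : ∃ c C : ℝ, 0 < c ∧
    ∀ x, c * ‖x‖ ^ 2 ≤ (S.form x (J x)).re ∧ (S.form x (J x)).re ≤ C * ‖x‖ ^ 2

/-- Hilbert superspace of parity `n`, on a complete normed space whose topology is the Hilbert
topology. -/
structure SuperspaceData.IsHilbertSuperspace {H : Type*} [NormedAddCommGroup H] [NormedSpace ℂ H]
    (S : SuperspaceData H) (n : ZMod 2) : Prop where
  complete : CompleteSpace H
  grading : IsCompl (S.comp 0) (S.comp 1)
  superhermitian : ∀ a b, ∀ x ∈ S.comp a, ∀ y ∈ S.comp b,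
    conj (S.form x y) = (-1 : ℂ) ^ (a.val * b.val) * S.form y x
  homogeneous : ∀ a b, a + b ≠ n → ∀ x ∈ S.comp a, ∀ y ∈ S.comp b, S.form x y = 0
  exists_symmetry : ∃ J : H →ₗ[ℂ] H, S.IsFundamentalSymmetry n J

/-! ### The Heisenberg supergroup, as a pair (body, odd part of the Lie superalgebra) -/

/-- The underlying space of the body of the Heisenberg supergroup; `(q, p, t)`. -/
abbrev HeisBody (m : ℕ) : Type :=
  EuclideanSpace ℝ (Fin m) × EuclideanSpace ℝ (Fin m) × ℝ

/-- The even block of the symplectic superform: `ω((q,p),(q',p')) = q·p' - p·q'`. -/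
def omegaEven {m : ℕ} (g h : HeisBody m) : ℝ :=
  inner ℝ g.1 h.2.1 - inner ℝ g.2.1 h.1

/-- Group law of the body: `exp (a + t Z) exp (a' + t' Z) = exp (a + a' + (t + t' + ω(a,a')/2) Z)`;
the unit is `0`. -/
def heisMul {m : ℕ} (g h : HeisBody m) : HeisBody m :=
  (g.1 + h.1, g.2.1 + h.2.1, g.2.2 + h.2.2 + omegaEven g h / 2)

/-- Indices of the canonical basis of the odd part: `r + 2 s` of positive sign, then `r` of negative
sign. -/
abbrev OddIndex (r s : ℕ) : Type := (Fin r ⊕ (Fin s ⊕ Fin s)) ⊕ Fin r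

/-- The (real) odd part of the Heisenberg Lie superalgebra, in its canonical basis. -/
abbrev OddPart (r s : ℕ) : Type := OddIndex r s → ℝ

/-- The odd block `diag (1_{r+2s}, -1_r)` of the symplectic superform. -/
def omegaOdd {r s : ℕ} (X Y : OddPart r s) : ℝ :=
  ∑ k, X (Sum.inl k) * Y (Sum.inl k) - ∑ j, X (Sum.inr j) * Y (Sum.inr j)

/-- Real-polarization coordinate `ξ_j = (x_j + y_j)/√2`. -/
def OddPart.xi {r s : ℕ} (X : OddPart r s) (j : Fin r) : ℝ :=
  (X (Sum.inl (Sum.inl j)) + X (Sum.inr j)) / Real.sqrt 2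

/-- Real-polarization coordinate `η_j = (x_j - y_j)/√2`. -/
def OddPart.eta {r s : ℕ} (X : OddPart r s) (j : Fin r) : ℝ :=
  (X (Sum.inl (Sum.inl j)) - X (Sum.inr j)) / Real.sqrt 2

/-- Complex coordinate `ζ_k = z_k + i z'_k` on the remaining `2 s` directions. -/
def OddPart.zeta {r s : ℕ} (X : OddPart r s) (k : Fin s) : ℂ :=
  (X (Sum.inl (Sum.inr (Sum.inl k))) : ℂ) + Complex.I * (X (Sum.inl (Sum.inr (Sum.inr k))) : ℂ)

/-! ### Representations -/

/-- Smooth vectors of a family of operators indexed by the body. -/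
def smoothVectors {m : ℕ} {H : Type*} [NormedAddCommGroup H] [NormedSpace ℂ H]
    (π : HeisBody m → H →L[ℂ] H) : Submodule ℂ H where
  carrier := {v | ContDiff ℝ ((⊤ : ℕ∞) : WithTop ℕ∞) fun g => π g v}
  zero_mem' := by
    simp only [Set.mem_ofPred_eq, map_zero]
    exact contDiff_const
  add_mem' := by
    intro v w hv hw
    simp only [Set.mem_ofPred_eq, map_add] at hv hw ⊢
    exact hv.add hw
  smul_mem' := by
    intro c v hv
    simp only [Set.mem_ofPred_eq, map_smul] at hv ⊢
    exact hv.const_smul c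

/-- Data of a representation of the Heisenberg supergroup: the operators `π g` of the body, and the
operators `ρ X` of the odd part, defined on the smooth vectors. -/
structure HeisRep (m r s : ℕ) (H : Type*) [NormedAddCommGroup H] [NormedSpace ℂ H] where
  π : HeisBody m → H →L[ℂ] H
  ρ : OddPart r s → smoothVectors π →ₗ[ℂ] H

/-- Superunitary representation on the Hilbert superspace `S` of parity `n`.

The body acts by a strongly continuous representation by even operators that preserve the inner
product and are uniformly bounded for the Hilbert topology. The odd part acts
real-linearly on the smooth vectors by odd operators that are infinitesimally superunitary
(`ρ X` has superadjoint `- ρ X`), commute with the body and satisfy the bracket relations, where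
`Z` acts by the derivative of `t ↦ π (exp (t Z))`.

The bracket `[a, a'] = ω(a, a') Z` is between points `a = ∑ τ_i e_i`, `a' = ∑ τ'_i e_i` with odd,
hence anticommuting, coordinates, and `ω(a, a') = ∑ τ_i ω_ij τ'_j`. As
`[τ e_i, τ' e_j] = - τ τ' [e_i, e_j]`, it says `[e_i, e_j] = - ω_ij Z` for the odd basis vectors. -/
structure IsSuperunitaryRep {m r s : ℕ} {H : Type*} [NormedAddCommGroup H] [NormedSpace ℂ H]
    (n : ZMod 2) (S : SuperspaceData H) (R : HeisRep m r s H) : Prop where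
  hilbert : S.IsHilbertSuperspace n
  π_one : R.π 0 = 1
  π_mul : ∀ g h, R.π (heisMul g h) = R.π g ∘L R.π h
  π_continuous : ∀ v, Continuous fun g => R.π g v
  π_bounded : ∃ C : ℝ, ∀ g, ‖R.π g‖ ≤ C
  π_even : ∀ g a, ∀ x ∈ S.comp a, R.π g x ∈ S.comp a
  π_superunitary : ∀ g x y, S.form (R.π g x) (R.π g y) = S.form x y
  ρ_add : ∀ X Y v, R.ρ (X + Y) v = R.ρ X v + R.ρ Y v
  ρ_smul : ∀ (c : ℝ) X v, R.ρ (c • X) v = (c : ℂ) • R.ρ X v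
  ρ_odd : ∀ X a (v : smoothVectors R.π), (v : H) ∈ S.comp a → R.ρ X v ∈ S.comp (a + 1)
  ρ_equivariant : ∀ g X (v : smoothVectors R.π),
    ∃ h : R.π g v ∈ smoothVectors R.π, R.ρ X ⟨R.π g v, h⟩ = R.π g (R.ρ X v)
  ρ_bracket : ∀ X Y (v : smoothVectors R.π),
    ∃ (hX : R.ρ X v ∈ smoothVectors R.π) (hY : R.ρ Y v ∈ smoothVectors R.π),
      R.ρ X ⟨R.ρ Y v, hY⟩ + R.ρ Y ⟨R.ρ X v, hX⟩
        = -(omegaOdd X Y : ℂ) • deriv (fun t : ℝ => R.π (0, 0, t) v) 0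
  ρ_superunitary : ∀ X a (v w : smoothVectors R.π), (v : H) ∈ S.comp a →
    S.form (R.ρ X v) w + (-1 : ℂ) ^ a.val * S.form v (R.ρ X w) = 0

/-- The central subgroup acts by the character `t ↦ e^{2 i t / θ}`. -/
def HasCentralCharacter {m r s : ℕ} {H : Type*} [NormedAddCommGroup H] [NormedSpace ℂ H]
    (θ : ℝ) (R : HeisRep m r s H) : Prop :=
  ∀ (t : ℝ) (v : H), R.π (0, 0, t) v = Complex.exp (2 * Complex.I / θ * t) • v

/-- Irreducibility: `H ≠ 0` and the only closed graded invariant subspaces are `0` and `H`. -/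
def IsIrreducibleRep {m r s : ℕ} {H : Type*} [NormedAddCommGroup H] [NormedSpace ℂ H]
    (S : SuperspaceData H) (R : HeisRep m r s H) : Prop :=
  Nontrivial H ∧ ∀ W : Submodule ℂ H, IsClosed (W : Set H) →
    W = (W ⊓ S.comp 0) ⊔ (W ⊓ S.comp 1) →
    (∀ g, ∀ x ∈ W, R.π g x ∈ W) →
    (∀ X (v : smoothVectors R.π), (v : H) ∈ W → R.ρ X v ∈ W) →
    W = ⊥ ∨ W = ⊤

/-- `V` intertwines two representations; in particular it maps smooth vectors to smooth vectors. -/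
def Intertwines {m r s : ℕ} {H K : Type*} [NormedAddCommGroup H] [NormedSpace ℂ H]
    [NormedAddCommGroup K] [NormedSpace ℂ K]
    (R : HeisRep m r s H) (R' : HeisRep m r s K) (V : H →L[ℂ] K) : Prop :=
  (∀ g v, V (R.π g v) = R'.π g (V v)) ∧
  ∀ X (v : smoothVectors R.π),
    ∃ h : V v ∈ smoothVectors R'.π, R'.ρ X ⟨V v, h⟩ = V (R.ρ X v)

/-- `V` is homogeneous of degree `d` and preserves the inner products up to the sign `ε`. For `d = 1`
this means that `V` is an isometry from the parity-changed superspace, i.e. from the tensor product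
with an odd line spanned by `e` with `⟨e, e⟩ = ε i`: one has
`⟨φ ⊗ e, ψ ⊗ e⟩ = (-1)^{|e||ψ|} ⟨φ, ψ⟩ ⟨e, e⟩`. -/
def IsIsometryUpTo {H K : Type*} [NormedAddCommGroup H] [NormedSpace ℂ H]
    [NormedAddCommGroup K] [NormedSpace ℂ K]
    (S : SuperspaceData H) (S' : SuperspaceData K) (d : ZMod 2) (ε : ℤˣ) (V : H →L[ℂ] K) : Prop :=
  (∀ a, ∀ x ∈ S.comp a, V x ∈ S'.comp (a + d)) ∧
  ∀ b x, ∀ y ∈ S.comp b, S'.form (V x) (V y)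
    = ((ε : ℤ) : ℂ) * Complex.I ^ d.val * (-1 : ℂ) ^ (d.val * b.val) * S.form x y

/-- Equivalence of superunitary representations, up to change of parity and of the sign of the inner
product. -/
def EquivalentUpToParityAndSign {m r s : ℕ} {H K : Type*}
    [NormedAddCommGroup H] [NormedSpace ℂ H] [NormedAddCommGroup K] [NormedSpace ℂ K]
    (S : SuperspaceData H) (R : HeisRep m r s H)
    (S' : SuperspaceData K) (R' : HeisRep m r s K) : Prop :=
  ∃ (d : ZMod 2) (ε : ℤˣ) (V : H ≃L[ℂ] K),
    IsIsometryUpTo S S' d ε (V : H →L[ℂ] K) ∧ Intertwines R R' (V : H →L[ℂ] K)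

/-- `(S, R)`, of parity `n`, is an orthogonal (Hilbert) direct sum of copies of `(S₀, R₀)`, each
taken up to change of parity and of the sign of its inner product: the images of the `V i` are pairwise
orthogonal, they are stable under a common fundamental symmetry, hence also pairwise orthogonal for
its scalar product, they span a dense subspace, and the identifications `V i` are uniformly
bounded above and below. -/
def IsOrthogonalSumOfCopies {m r s : ℕ} {K : Type*} {H : Type u}
    [NormedAddCommGroup K] [NormedSpace ℂ K] [NormedAddCommGroup H] [NormedSpace ℂ H]
    (S₀ : SuperspaceData K) (R₀ : HeisRep m r s K)
    (n : ZMod 2) (S : SuperspaceData H) (R : HeisRep m r s H) : Prop :=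
  ∃ (ι : Type u) (d : ι → ZMod 2) (ε : ι → ℤˣ) (V : ι → K →L[ℂ] H) (J : H →ₗ[ℂ] H),
    (∀ i, IsIsometryUpTo S₀ S (d i) (ε i) (V i)) ∧
    (∀ i, Intertwines R₀ R (V i)) ∧
    (∀ i j, i ≠ j → ∀ x y, S.form (V i x) (V j y) = 0) ∧
    S.IsFundamentalSymmetry n J ∧
    (∀ i x, ∃ y, J (V i x) = V i y) ∧
    (∃ c C : ℝ, 0 < c ∧ ∀ i x, c * ‖x‖ ≤ ‖V i x‖ ∧ ‖V i x‖ ≤ C * ‖x‖) ∧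
    (⨆ i, LinearMap.range (V i : K →ₗ[ℂ] H)).topologicalClosure = ⊤

/-! ### The Schrödinger representation of the body -/

/-- `L²(ℝᵐ)` -/
abbrev L2 (m : ℕ) : Type := Lp ℂ 2 (volume : Measure (EuclideanSpace ℝ (Fin m)))

/-- The function `q₀ ↦ e^{(2i/θ)(t + (q/2 - q₀)·p)}`. -/
def schrodingerPhase {m : ℕ} (θ : ℝ) (g : HeisBody m) (q₀ : EuclideanSpace ℝ (Fin m)) : ℂ :=
  Complex.exp (2 * Complex.I / θ *
    ((g.2.2 + inner ℝ ((1 / 2 : ℝ) • g.1 - q₀) g.2.1 : ℝ) : ℂ))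

theorem schrodingerPhase_memLp {m : ℕ} (θ : ℝ) (g : HeisBody m) :
    MemLp (schrodingerPhase θ g) ∞ (volume : Measure (EuclideanSpace ℝ (Fin m))) := by
  have hc : Continuous (schrodingerPhase θ g) := by
    unfold schrodingerPhase
    fun_prop
  refine memLp_top_of_bound hc.aestronglyMeasurable 1 (Filter.Eventually.of_forall fun q₀ => ?_)
  rw [schrodingerPhase, Complex.norm_exp]
  refine le_of_eq (Real.exp_eq_one_iff _ |>.2 ?_)
  rw [Complex.re_mul_ofReal, Complex.div_ofReal_re]
  simp

/-- `(U(q,p,t) f)(q₀) = e^{(2i/θ)(t + (q/2 - q₀)·p)} f(q₀ - q)` -/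
def schrodinger {m : ℕ} (θ : ℝ) (g : HeisBody m) : L2 m →L[ℂ] L2 m :=
  ((ContinuousLinearMap.mul ℂ ℂ).holderL volume ∞ 2 2 (schrodingerPhase_memLp θ g).toLp) ∘L
    (Lp.compMeasurePreservingₗᵢ ℂ (fun q₀ => q₀ - g.1)
      (measurePreserving_sub_right volume g.1)).toContinuousLinearMap

/-! ### The representation `U_θ` -/

/-- Index `(I, J)` of the monomial `ξ^I ζ^J`. -/
abbrev Monomial (r s : ℕ) : Type := Finset (Fin r) × Finset (Fin s)

/-- `L²(ℝ^{m|r}) ⊗ Hol(ℂ^{0|s})`: elements `φ = ∑ φ_{IJ}(q) ξ^I ζ^J`. -/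
abbrev ModelSpace (m r s : ℕ) : Type := Monomial r s → L2 m

/-- The degree `|I| + |J|` mod 2 of `ξ^I ζ^J`. -/
def Monomial.degree {r s : ℕ} (M : Monomial r s) : ZMod 2 := ((M.1.card + M.2.card : ℕ) : ZMod 2)

/-- `ξ^I ξ^J = ε(I, J) ξ^{I ∪ J}` -/
def grassmannSign {r : ℕ} (I J : Finset (Fin r)) : ℂ :=
  if Disjoint I J then (-1) ^ ((I ×ˢ J).filter fun x => x.2 < x.1).card else 0

/-- The Berezin integral
`(2i)^s ∫ dξ dζ dζ̄ (ξ^I ζ̄^J) (ξ^{Iᶜ} ζ^J) e^{(i/θ) ζ ζ̄}`, with `∫ dζ_k dζ̄_k ζ̄_k ζ_k = 1`.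
All other pairings of monomials vanish. The factors come from
`e^{(i/θ) ζ ζ̄} = ∏_k (1 - (i/θ) ζ̄_k ζ_k)`, from `ζ̄^J ζ^J = (-1)^{|J|(|J|-1)/2} ∏_{k ∈ J} ζ̄_k ζ_k`
and from `ζ̄^J ξ^{Iᶜ} = (-1)^{|J||Iᶜ|} ξ^{Iᶜ} ζ̄^J`. -/
def berezinCoeff {r s : ℕ} (θ : ℝ) (M : Monomial r s) : ℂ :=
  (2 * Complex.I) ^ s * (-(Complex.I / θ)) ^ (M.2ᶜ).card * (-1) ^ (M.2.card).choose 2 *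
    (-1) ^ (M.2.card * (M.1ᶜ).card) * grassmannSign M.1 M.1ᶜ

/-- The superhermitian inner product
`⟨φ, ψ⟩ = (2i)^s ∫ dq dξ dζ dζ̄ conj(φ) ψ e^{(i/θ) ζ ζ̄}`, where
`conj(φ) = ∑ conj(φ_{IJ}) ξ^I ζ̄^J`. -/
def modelForm (m r s : ℕ) (θ : ℝ) : ModelSpace m r s →ₗ⋆[ℂ] ModelSpace m r s →ₗ[ℂ] ℂ :=
  LinearMap.mk₂'ₛₗ (starRingEnd ℂ) (RingHom.id ℂ)
    (fun φ ψ => ∑ M : Monomial r s, berezinCoeff θ M * inner ℂ (φ M) (ψ (M.1ᶜ, M.2)))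
    (by intro a b c; simp [inner_add_left, mul_add, Finset.sum_add_distrib])
    (by
      intro k a b
      simp only [Pi.smul_apply, inner_smul_left, smul_eq_mul, Finset.mul_sum]
      exact Finset.sum_congr rfl fun _ _ => by ring)
    (by intro a b c; simp [inner_add_right, mul_add, Finset.sum_add_distrib])
    (by
      intro k a b
      simp only [Pi.smul_apply, inner_smul_right, smul_eq_mul, Finset.mul_sum, RingHom.id_apply]
      exact Finset.sum_congr rfl fun _ _ => by ring)

/-- `φ` is homogeneous of degree `a` when only monomials of degree `a` occur. -/
def modelComp (m r s : ℕ) (a : ZMod 2) : Submodule ℂ (ModelSpace m r s) where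
  carrier := {φ | ∀ M : Monomial r s, M.degree ≠ a → φ M = 0}
  zero_mem' := fun _ _ => rfl
  add_mem' := by
    intro φ ψ hφ hψ M hM
    simp [hφ M hM, hψ M hM]
  smul_mem' := by
    intro c φ hφ M hM
    simp [hφ M hM]

/-- The superspace `H_θ`. -/
def modelSuperspace (m r s : ℕ) (θ : ℝ) : SuperspaceData (ModelSpace m r s) where
  comp := modelComp m r s
  form := modelForm m r s θ

/-- `(-1)^{#{i ∈ I, i < j}}`, so that `ξ_j ξ^I` is this sign times `ξ^{I ∪ {j}}` if `j ∉ I`. -/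
def moveSign {r : ℕ} (j : Fin r) (I : Finset (Fin r)) : ℂ := (-1) ^ (I.filter fun i => i < j).card

/-- Multiplication by `ξ_j`. -/
def mulXi (m r s : ℕ) (j : Fin r) : ModelSpace m r s →L[ℂ] ModelSpace m r s :=
  ContinuousLinearMap.pi fun M => if j ∈ M.1 then
    moveSign j M.1 • ContinuousLinearMap.proj (R := ℂ) ((M.1.erase j, M.2) : Monomial r s) else 0

/-- The left derivative `∂/∂ξ_j`. -/
def dXi (m r s : ℕ) (j : Fin r) : ModelSpace m r s →L[ℂ] ModelSpace m r s :=
  ContinuousLinearMap.pi fun M => if j ∉ M.1 then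
    moveSign j M.1 • ContinuousLinearMap.proj (R := ℂ) ((insert j M.1, M.2) : Monomial r s) else 0

/-- Multiplication by `ζ_k`. -/
def mulZeta (m r s : ℕ) (k : Fin s) : ModelSpace m r s →L[ℂ] ModelSpace m r s :=
  ContinuousLinearMap.pi fun M => if k ∈ M.2 then
    ((-1 : ℂ) ^ M.1.card * moveSign k M.2) •
      ContinuousLinearMap.proj (R := ℂ) ((M.1, M.2.erase k) : Monomial r s) else 0

/-- The left derivative `∂/∂ζ_k`. -/
def dZeta (m r s : ℕ) (k : Fin s) : ModelSpace m r s →L[ℂ] ModelSpace m r s :=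
  ContinuousLinearMap.pi fun M => if k ∉ M.2 then
    ((-1 : ℂ) ^ M.1.card * moveSign k M.2) •
      ContinuousLinearMap.proj (R := ℂ) ((M.1, insert k M.2) : Monomial r s) else 0

/-- The action of the odd vector with coordinates `(ξ, η, ζ)`: the part of first order in the odd
parameters of
`φ ↦ e^{(2i/θ)((ξ/2 - ξ₀) η + (1/2)(ζ/2 - ζ₀) ζ̄)} φ(q₀, ξ₀ - ξ, ζ₀ - ζ)`,
the parameters being written on the left, e.g. `- ξ₀ η = η ξ₀`. -/
def oddOperator (m : ℕ) {r s : ℕ} (θ : ℝ) (X : OddPart r s) :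
    ModelSpace m r s →L[ℂ] ModelSpace m r s :=
  ∑ j, (-(X.xi j : ℂ) • dXi m r s j + ((X.eta j : ℂ) * (2 * Complex.I / θ)) • mulXi m r s j) +
  ∑ k, (-(X.zeta k) • dZeta m r s k + (conj (X.zeta k) * (Complex.I / θ)) • mulZeta m r s k)

/-- The operators of the body in `U_θ`; they act on every component `φ_{IJ}`. -/
def modelBody (m r s : ℕ) (θ : ℝ) (g : HeisBody m) : ModelSpace m r s →L[ℂ] ModelSpace m r s :=
  ContinuousLinearMap.pi fun M => schrodinger θ g ∘L ContinuousLinearMap.proj M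

/-- The representation `U_θ` on `H_θ`. -/
def modelRep (m r s : ℕ) (θ : ℝ) : HeisRep m r s (ModelSpace m r s) where
  π := modelBody m r s θ
  ρ X := (oddOperator m θ X).toLinearMap ∘ₗ (smoothVectors (modelBody m r s θ)).subtype

/-- The grading operator `φ ↦ (-1)^{|φ|} φ`. -/
def gradingOperator (m r s : ℕ) : ModelSpace m r s →ₗ[ℂ] ModelSpace m r s :=
  LinearMap.pi fun M => (-1 : ℂ) ^ M.degree.val • LinearMap.proj M

/-- The tensor product of `H_θ` with the parity-1 Hilbert superspace `ℂ^{1|1}`, which has a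
homogeneous basis `e₀`, `e₁` with `⟨e₀, e₁⟩ = ⟨e₁, e₀⟩ = 1`, `⟨e₀, e₀⟩ = ⟨e₁, e₁⟩ = 0`. The pair
`(φ₀, φ₁)` is `φ₀ ⊗ e₀ + φ₁ ⊗ e₁`. -/
def doubleSuperspace (m r s : ℕ) (θ : ℝ) :
    SuperspaceData (ModelSpace m r s × ModelSpace m r s) where
  comp a := (modelComp m r s a).prod (modelComp m r s (a + 1))
  form := ((modelForm m r s θ).compl₂ (LinearMap.snd ℂ _ _)).comp (LinearMap.fst ℂ _ _) +
    ((modelForm m r s θ).compl₂ (gradingOperator m r s ∘ₗ LinearMap.fst ℂ _ _)).comp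
      (LinearMap.snd ℂ _ _)

/-- The representation `U_θ ⊗ 1` on `H_θ ⊗ ℂ^{1|1}`. -/
def doubleRep (m r s : ℕ) (θ : ℝ) : HeisRep m r s (ModelSpace m r s × ModelSpace m r s) where
  π g := (modelBody m r s θ g).prodMap (modelBody m r s θ g)
  ρ X := ((oddOperator m θ X).prodMap (oddOperator m θ X)).toLinearMap ∘ₗ
    (smoothVectors fun g => (modelBody m r s θ g).prodMap (modelBody m r s θ g)).subtype

/-! ### The Clifford algebra -/

/-- The complexification of the quadratic form `X ↦ -(i/θ) ω(X, X)` on the odd part. -/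
def cliffordForm (r s : ℕ) (θ : ℝ) : QuadraticForm ℂ (OddIndex r s → ℂ) :=
  QuadraticMap.weightedSumSquares ℂ
    (Sum.elim (fun _ => -(Complex.I / θ)) (fun _ => Complex.I / θ) : OddIndex r s → ℂ)

/-- The complex Clifford algebra of rank `2 r + 2 s`. -/
abbrev OddClifford (r s : ℕ) (θ : ℝ) : Type := CliffordAlgebra (cliffordForm r s θ)

/-- The Clifford generator attached to a (real) odd vector. -/
def cliffordGen {r s : ℕ} (θ : ℝ) (X : OddPart r s) : OddClifford r s θ :=
  CliffordAlgebra.ι (cliffordForm r s θ) fun i => (X i : ℂ)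

/-- The Clifford module `E` is the multiplicity space of the Schrödinger representation of the body
in `R`: `E` is identified with the space of bounded intertwiners `L²(ℝᵐ) → H` of the body, in such a
way that Clifford generators act on it by composition with the operators of the odd part. -/
def CorrespondsTo {m r s : ℕ} {H E : Type*} [NormedAddCommGroup H] [NormedSpace ℂ H]
    [AddCommGroup E] [Module ℂ E] (θ : ℝ) [Module (OddClifford r s θ) E]
    (R : HeisRep m r s H) : Prop :=
  ∃ Φ : E →ₗ[ℂ] (L2 m →L[ℂ] H), Function.Injective Φ ∧
    (∀ T : L2 m →L[ℂ] H, (∃ e, Φ e = T) ↔ ∀ g, T ∘L schrodinger θ g = R.π g ∘L T) ∧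
    ∀ X e, ∀ f ∈ smoothVectors (schrodinger (m := m) θ),
      ∃ h : Φ e f ∈ smoothVectors R.π, R.ρ X ⟨Φ e f, h⟩ = Φ (cliffordGen θ X • e) f

end

open scoped RealInnerProductSpace

/-! ### Weyl systems -/

/-- A bounded, strongly continuous projective representation `W` of the vector group `Z`, with
cocycle `e^{i c ω(z, w)}` for the symplectic form `ω(z, w) = ⟪K z, w⟫`, where `K` is a
skew-symmetric isometry. -/
structure IsWeylSystem {Z H : Type*} [NormedAddCommGroup Z] [InnerProductSpace ℝ Z]
    [NormedAddCommGroup H] [NormedSpace ℂ H] (c : ℝ) (K : Z →ₗᵢ[ℝ] Z) (W : Z → H →L[ℂ] H) :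
    Prop where
  ne_zero : c ≠ 0
  skew : ∀ z w, ⟪K z, w⟫ = -⟪z, K w⟫
  zero : W 0 = 1
  mul : ∀ z w x, W z (W w x) = Complex.exp (Complex.I * (c * ⟪K z, w⟫ : ℝ)) • W (z + w) x
  cont : ∀ x, Continuous fun z => W z x
  bdd : ∃ C : ℝ, ∀ z, ‖W z‖ ≤ C

section Gaussian

variable {Z : Type*} [NormedAddCommGroup Z]

/-- The Gaussian `e^{-|c| ‖z‖² / 2}`. -/
noncomputable def gauss (c : ℝ) (z : Z) : ℝ := Real.exp (-(|c| / 2) * ‖z‖ ^ 2)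

theorem gauss_pos (c : ℝ) (z : Z) : 0 < gauss c z := Real.exp_pos _

theorem gauss_neg (c : ℝ) (z : Z) : gauss c (-z) = gauss c z := by simp [gauss]

theorem continuous_gauss (c : ℝ) : Continuous (gauss c : Z → ℝ) := by
  unfold gauss; fun_prop

theorem gauss_zero (c : ℝ) : gauss c (0 : Z) = 1 := by simp [gauss]

variable [InnerProductSpace ℝ Z] [FiniteDimensional ℝ Z] [MeasurableSpace Z] [BorelSpace Z]

theorem integrable_exp_neg_mul_norm_sq {b : ℝ} (hb : 0 < b) :
    Integrable fun z : Z => Real.exp (-b * ‖z‖ ^ 2) := by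
  have h := (GaussianFourier.integrable_cexp_neg_mul_sq_norm_add (V := Z) (b := (b : ℂ))
    (by simpa using hb) 0 0).norm
  refine h.congr (Filter.Eventually.of_forall fun z => ?_)
  simp only [Complex.norm_exp]
  norm_cast
  simp

theorem integrable_gauss {c : ℝ} (hc : c ≠ 0) : Integrable (gauss c : Z → ℝ) :=
  integrable_exp_neg_mul_norm_sq (by positivity)

/-- The normalization constant of the Gaussian projection. -/
noncomputable def gaussConst (Z : Type*) [NormedAddCommGroup Z] [InnerProductSpace ℝ Z]
    [FiniteDimensional ℝ Z] [MeasurableSpace Z] [BorelSpace Z] (c : ℝ) : ℝ :=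
  (∫ z : Z, Real.exp (-|c| * ‖z‖ ^ 2))⁻¹

theorem integral_exp_neg_norm_sq_pos {b : ℝ} (hb : 0 < b) :
    0 < ∫ z : Z, Real.exp (-b * ‖z‖ ^ 2) := by
  rw [integral_pos_iff_support_of_nonneg (fun _ => (Real.exp_pos _).le)
    (integrable_exp_neg_mul_norm_sq hb)]
  have : (Function.support fun z : Z => Real.exp (-b * ‖z‖ ^ 2)) = Set.univ := by
    ext z; simp [(Real.exp_pos _).ne']
  rw [this]
  exact isOpen_univ.measure_pos _ Set.univ_nonempty

theorem gaussConst_pos {c : ℝ} (hc : c ≠ 0) : 0 < gaussConst Z c :=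
  inv_pos.2 (integral_exp_neg_norm_sq_pos (by positivity))

/-- The convolution identity for Gaussians twisted by the Weyl cocycle. -/
theorem integral_gauss_mul_gauss {c : ℝ} (hc : c ≠ 0) (K : Z →ₗᵢ[ℝ] Z)
    (hK : ∀ z w, ⟪K z, w⟫ = -⟪z, K w⟫) (u w : Z) :
    ∫ z : Z, ((gauss c z * gauss c (u - w - z) : ℝ) : ℂ) *
      Complex.exp (Complex.I * (c * (⟪K z, u + w⟫ + ⟪K w, u⟫) : ℝ)) =
    (((gaussConst Z c)⁻¹ * gauss c u * gauss c w : ℝ) : ℂ) := by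
  have hb : 0 < (((|c| : ℝ)) : ℂ).re := by simpa using hc
  have h0 := GaussianFourier.integral_cexp_neg_mul_sq_norm_add (V := Z) hb 0 0
  have h1 := GaussianFourier.integral_cexp_neg_mul_sq_norm_add (V := Z) hb (-(Complex.I * c))
    (K (u + w))
  have hk : (((gaussConst Z c)⁻¹ : ℝ) : ℂ)
      = (Real.pi / ((|c| : ℝ) : ℂ)) ^ (Module.finrank ℝ Z / 2 : ℂ) := by
    rw [gaussConst, inv_inv, ← integral_complex_ofReal]
    have : (Real.pi / ((|c| : ℝ) : ℂ)) ^ (Module.finrank ℝ Z / 2 : ℂ)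
        = (Real.pi / ((|c| : ℝ) : ℂ)) ^ (Module.finrank ℝ Z / 2 : ℂ)
          * Complex.exp (0 ^ 2 * ‖(0 : Z)‖ ^ 2 / (4 * ((|c| : ℝ) : ℂ))) := by simp
    rw [this, ← h0]
    refine integral_congr_ae (Filter.Eventually.of_forall fun z => ?_)
    push_cast
    simp
  rw [← integral_add_right_eq_self _ ((1 / 2 : ℝ) • (u - w))]
  have hskew : ∀ z : Z, ⟪K z, z⟫ = 0 := fun z => by
    have := hK z z
    rw [real_inner_comm] at this
    rw [real_inner_comm]; linarith
  have hanti : ∀ z w : Z, ⟪K z, w⟫ = -⟪K w, z⟫ := fun z w => by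
    rw [hK, real_inner_comm]
  have key : ∀ v : Z, ((gauss c (v + (1 / 2 : ℝ) • (u - w)) *
      gauss c (u - w - (v + (1 / 2 : ℝ) • (u - w))) : ℝ) : ℂ) *
      Complex.exp (Complex.I * (c * (⟪K (v + (1 / 2 : ℝ) • (u - w)), u + w⟫ + ⟪K w, u⟫) : ℝ))
      = Complex.exp (-(|c| : ℝ) * ‖v‖ ^ 2 + -(Complex.I * c) * ⟪K (u + w), v⟫) *
        Complex.exp ((-(|c| / 4) * ‖u - w‖ ^ 2 : ℝ)) := by
    intro v
    have e1 : u - w - (v + (1 / 2 : ℝ) • (u - w)) = (1 / 2 : ℝ) • (u - w) - v := by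
      module
    rw [e1, gauss, gauss, ← Real.exp_add, Complex.ofReal_exp, ← Complex.exp_add, ← Complex.exp_add]
    congr 1
    have e2 : ‖v + (1 / 2 : ℝ) • (u - w)‖ ^ 2 + ‖(1 / 2 : ℝ) • (u - w) - v‖ ^ 2
        = 2 * ‖v‖ ^ 2 + ‖u - w‖ ^ 2 / 2 := by
      have := parallelogram_law_with_norm ℝ ((1 / 2 : ℝ) • (u - w)) v
      rw [norm_smul] at this
      rw [add_comm v]
      norm_num at this
      linarith
    have e3 : ⟪K (v + (1 / 2 : ℝ) • (u - w)), u + w⟫ + ⟪K w, u⟫ = -⟪K (u + w), v⟫ := by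
      simp only [map_add, map_smul, map_sub, inner_add_left, inner_add_right, inner_smul_left,
        inner_sub_left, hskew, hanti v u, hanti v w, hanti w u]
      simp
      ring
    have e2' : -(|c| / 2) * ‖v + (1 / 2 : ℝ) • (u - w)‖ ^ 2
        + -(|c| / 2) * ‖(1 / 2 : ℝ) • (u - w) - v‖ ^ 2
        = -|c| * ‖v‖ ^ 2 + -(|c| / 4) * ‖u - w‖ ^ 2 := by
      linear_combination -(|c| / 2) * e2
    rw [e2', e3]
    push_cast
    ring
  simp_rw [key]
  rw [integral_mul_const, h1, ← hk, mul_assoc, ← Complex.exp_add, mul_assoc, gauss, gauss,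
    ← Real.exp_add, Complex.ofReal_mul _ (Real.exp _), Complex.ofReal_exp]
  congr 2
  rw [K.norm_map]
  have e : ‖u + w‖ ^ 2 + ‖u - w‖ ^ 2 = 2 * (‖u‖ ^ 2 + ‖w‖ ^ 2) := by
    have := parallelogram_law_with_norm ℝ u w
    linarith
  have hcc : (c : ℂ) ^ 2 = ((|c| : ℝ) : ℂ) ^ 2 := by
    rw [← Complex.ofReal_pow, ← Complex.ofReal_pow, sq_abs]
  have hne : ((|c| : ℝ) : ℂ) ≠ 0 := by simpa using hc
  have e' : (‖u + w‖ : ℂ) ^ 2 + (‖u - w‖ : ℂ) ^ 2 = 2 * ((‖u‖ : ℂ) ^ 2 + (‖w‖ : ℂ) ^ 2) := by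
    exact_mod_cast e
  have : (-(Complex.I * (c : ℂ))) ^ 2 = -((|c| : ℝ) : ℂ) ^ 2 := by
    rw [neg_sq, mul_pow, Complex.I_sq, hcc]; ring
  rw [this]
  push_cast
  field_simp
  linear_combination (-2 : ℂ) * e'

/-- The integrability that allows to exchange the integrals in `P W(w) P`. -/
theorem integrable_gauss_mul_gauss_prod {c : ℝ} (hc : c ≠ 0) (w : Z) :
    Integrable (fun p : Z × Z => gauss c p.1 * gauss c (p.2 - w - p.1)) (volume.prod volume) := by
  have h : Integrable (fun p : Z × Z => Real.exp (-(|c| / 4) * ‖p.1‖ ^ 2) *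
      Real.exp (-(|c| / 8) * ‖p.2 - w‖ ^ 2)) (volume.prod volume) :=
    (integrable_exp_neg_mul_norm_sq (by positivity)).mul_prod
      ((integrable_exp_neg_mul_norm_sq (by positivity)).comp_sub_right w)
  refine h.mono' ?_ (Filter.Eventually.of_forall fun p => ?_)
  · have : Continuous fun p : Z × Z => gauss c p.1 * gauss c (p.2 - w - p.1) :=
      ((continuous_gauss c).comp continuous_fst).mul
        ((continuous_gauss c).comp (by fun_prop))
    exact this.aestronglyMeasurable
  · rw [Real.norm_of_nonneg (mul_pos (gauss_pos _ _) (gauss_pos _ _)).le, gauss, gauss,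
      ← Real.exp_add, ← Real.exp_add]
    refine Real.exp_le_exp.2 ?_
    have h1 : ‖p.2 - w‖ ^ 2 ≤ 2 * (‖p.1‖ ^ 2 + ‖p.2 - w - p.1‖ ^ 2) := by
      have h := norm_add_le p.1 (p.2 - w - p.1)
      rw [add_sub_cancel] at h
      nlinarith [norm_nonneg (p.2 - w), sq_nonneg (‖p.1‖ - ‖p.2 - w - p.1‖),
        norm_nonneg p.1, norm_nonneg (p.2 - w - p.1)]
    have h2 := abs_nonneg c
    nlinarith [mul_le_mul_of_nonneg_left h1 h2, mul_nonneg h2 (sq_nonneg ‖p.2 - w - p.1‖)]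

end Gaussian

namespace IsWeylSystem

variable {Z H H' : Type*} [NormedAddCommGroup Z] [InnerProductSpace ℝ Z]
  [NormedAddCommGroup H] [NormedSpace ℂ H] [NormedAddCommGroup H'] [NormedSpace ℂ H']
  {c : ℝ} {K : Z →ₗᵢ[ℝ] Z} {W : Z → H →L[ℂ] H} {W' : Z → H' →L[ℂ] H'}

theorem inner_anti (hW : IsWeylSystem c K W) (z w : Z) : ⟪K z, w⟫ = -⟪K w, z⟫ := by
  rw [hW.skew, real_inner_comm]

theorem inner_self (hW : IsWeylSystem c K W) (z : Z) : ⟪K z, z⟫ = 0 := by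
  have := hW.inner_anti z z
  linarith

theorem apply_neg (hW : IsWeylSystem c K W) (z : Z) (x : H) : W z (W (-z) x) = x := by
  rw [hW.mul, inner_neg_right, hW.inner_self]
  simp [hW.zero]

theorem neg_apply (hW : IsWeylSystem c K W) (z : Z) (x : H) : W (-z) (W z x) = x := by
  simpa using hW.apply_neg (-z) x

theorem exists_bound (hW : IsWeylSystem c K W) : ∃ C : ℝ, 0 ≤ C ∧ ∀ z x, ‖W z x‖ ≤ C * ‖x‖ := by
  obtain ⟨C, hC⟩ := hW.bdd
  exact ⟨C, (norm_nonneg _).trans (hC 0), fun z x => (W z).le_of_opNorm_le (hC z) x⟩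

theorem skew_sq (hW : IsWeylSystem c K W) (z : Z) : K (K z) = -z := by
  refine ext_inner_right ℝ fun w => ?_
  rw [hW.skew, K.inner_map_map, inner_neg_left]

variable [FiniteDimensional ℝ Z] [MeasurableSpace Z] [BorelSpace Z]

/-- A scalar integrable density may be integrated against the orbit of a vector. -/
theorem integrable_smul (hW : IsWeylSystem c K W) {f : Z → ℝ} (hf : Integrable f) (x : H) :
    Integrable fun z => f z • W z x := by
  obtain ⟨C, hC, h⟩ := hW.exists_bound
  refine (hf.norm.mul_const (C * ‖x‖)).mono' (hf.1.smul (hW.cont x).aestronglyMeasurable)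
    (Filter.Eventually.of_forall fun z => ?_)
  rw [norm_smul]
  exact mul_le_mul_of_nonneg_left (h z x) (norm_nonneg _)

theorem integrable_gauss_smul (hW : IsWeylSystem c K W) (x : H) :
    Integrable fun z => gauss c z • W z x :=
  hW.integrable_smul (integrable_gauss hW.ne_zero) x

/-- The Gaussian projection `κ ∫ e^{-|c| ‖z‖² / 2} W(z) dz` onto the vacuum vectors. -/
noncomputable def proj (hW : IsWeylSystem c K W) : H →L[ℂ] H :=
  LinearMap.mkContinuousOfExistsBound
    { toFun := fun x => gaussConst Z c • ∫ z, gauss c z • W z x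
      map_add' := fun x y => by
        rw [← smul_add, ← integral_add (hW.integrable_gauss_smul x) (hW.integrable_gauss_smul y)]
        simp
      map_smul' := fun a x => by
        simp only [map_smul, RingHom.id_apply]
        rw [smul_comm a, ← integral_smul a]
        simp_rw [smul_comm a] }
    (by
      obtain ⟨C, hC, h⟩ := hW.exists_bound
      refine ⟨gaussConst Z c * (∫ z : Z, gauss c z * C), fun x => ?_⟩
      simp only [LinearMap.coe_mk, AddHom.coe_mk]
      rw [norm_smul, Real.norm_of_nonneg (gaussConst_pos hW.ne_zero).le, mul_assoc]
      refine mul_le_mul_of_nonneg_left ?_ (gaussConst_pos hW.ne_zero).le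
      rw [← integral_mul_const]
      refine norm_integral_le_of_norm_le
        (((integrable_gauss hW.ne_zero).mul_const _).mul_const _)
        (Filter.Eventually.of_forall fun z => ?_)
      rw [norm_smul, Real.norm_of_nonneg (gauss_pos c z).le, mul_assoc]
      exact mul_le_mul_of_nonneg_left (h z x) (gauss_pos c z).le)

theorem proj_apply (hW : IsWeylSystem c K W) (x : H) :
    hW.proj x = gaussConst Z c • ∫ z, gauss c z • W z x := rfl

/-- Bounded real-linear maps may be exchanged with the Gaussian average. -/
theorem map_proj {E : Type*} [NormedAddCommGroup E] [NormedSpace ℝ E] [CompleteSpace E]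
    [CompleteSpace H]
    (hW : IsWeylSystem c K W) (L : H →L[ℝ] E) (x : H) :
    L (hW.proj x) = gaussConst Z c • ∫ z, gauss c z • L (W z x) := by
  rw [proj_apply, map_smul, ← L.integral_comp_comm (hW.integrable_gauss_smul x)]
  simp

theorem map_proj' {E : Type*} [NormedAddCommGroup E] [NormedSpace ℂ E] [CompleteSpace E]
    [CompleteSpace H]
    (hW : IsWeylSystem c K W) (L : H →L[ℂ] E) (x : H) :
    L (hW.proj x) = gaussConst Z c • ∫ z, gauss c z • L (W z x) :=
  hW.map_proj (L.restrictScalars ℝ) x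

theorem intertwine_proj [CompleteSpace H] [CompleteSpace H'] (hW : IsWeylSystem c K W)
    (hW' : IsWeylSystem c K W') (T : H →L[ℂ] H') (hT : ∀ z x, T (W z x) = W' z (T x)) (x : H) :
    T (hW.proj x) = hW'.proj (T x) := by
  rw [hW.map_proj' T, proj_apply]
  simp_rw [hT]

/-- `P W(w) P = e^{-|c| ‖w‖² / 2} P` -/
theorem proj_mul_proj [CompleteSpace H] (hW : IsWeylSystem c K W) (w : Z) (x : H) :
    hW.proj (W w (hW.proj x)) = gauss c w • hW.proj x := by
  set κ := gaussConst Z c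
  have hκ : κ ≠ 0 := (gaussConst_pos hW.ne_zero).ne'
  obtain ⟨C, hC, hb⟩ := hW.exists_bound
  have hint : Integrable (fun p : Z × Z => ((gauss c p.1 * gauss c (p.2 - w - p.1) : ℝ) : ℂ) •
      Complex.exp (Complex.I * (c * (⟪K p.1, p.2 + w⟫ + ⟪K w, p.2⟫) : ℝ)) • W p.2 x)
      (volume.prod volume) := by
    refine ((integrable_gauss_mul_gauss_prod hW.ne_zero w).mul_const (C * ‖x‖)).mono' ?_
      (Filter.Eventually.of_forall fun p => ?_)
    · have h1 : Continuous fun p : Z × Z => W p.2 x := (hW.cont x).comp continuous_snd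
      have h2 : Continuous fun p : Z × Z => gauss c p.1 * gauss c (p.2 - w - p.1) :=
        ((continuous_gauss c).comp continuous_fst).mul ((continuous_gauss c).comp (by fun_prop))
      have h3 : Continuous fun p : Z × Z => 
          Complex.exp (Complex.I * (c * (⟪K p.1, p.2 + w⟫ + ⟪K w, p.2⟫) : ℝ)) := by
        have := K.continuous
        fun_prop
      exact ((Complex.continuous_ofReal.comp h2).smul (h3.smul h1)).aestronglyMeasurable
    · rw [norm_smul, norm_smul, mul_comm Complex.I, Complex.norm_exp_ofReal_mul_I, one_mul,
        Complex.norm_real, Real.norm_of_nonneg (mul_pos (gauss_pos _ _) (gauss_pos _ _)).le]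
      exact mul_le_mul_of_nonneg_left (hb _ _) (mul_pos (gauss_pos _ _) (gauss_pos _ _)).le
  have step : ∀ z, gauss c z • W z (W w (hW.proj x)) = κ • ∫ u,
      ((gauss c z * gauss c (u - w - z) : ℝ) : ℂ) •
      Complex.exp (Complex.I * (c * (⟪K z, u + w⟫ + ⟪K w, u⟫) : ℝ)) • W u x := by
    intro z
    have h := hW.map_proj' ((W z).comp (W w)) x
    simp only [ContinuousLinearMap.comp_apply] at h
    rw [h, smul_comm, ← integral_smul, ← integral_sub_right_eq_self _ (w + z)]
    congr 1
    refine integral_congr_ae (Filter.Eventually.of_forall fun u => ?_)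
    simp only
    rw [hW.mul w, map_smul, hW.mul z, smul_smul (Complex.exp _), ← Complex.exp_add, smul_smul,
      show z + (w + (u - (w + z))) = u by abel, sub_add_eq_sub_sub,
      show w + (u - w - z) = u - z by abel, Complex.coe_smul]
    congr 3
    simp only [inner_sub_right, inner_add_right, hW.inner_self, hW.inner_anti z w]
    push_cast
    ring
  calc hW.proj (W w (hW.proj x)) 
      = κ • ∫ z, κ • ∫ u, ((gauss c z * gauss c (u - w - z) : ℝ) : ℂ) •
      Complex.exp (Complex.I * (c * (⟪K z, u + w⟫ + ⟪K w, u⟫) : ℝ)) • W u x := by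
        rw [hW.proj_apply]; simp_rw [step]; rfl
    _ = κ • κ • ∫ u, ∫ z, ((gauss c z * gauss c (u - w - z) : ℝ) : ℂ) •
      Complex.exp (Complex.I * (c * (⟪K z, u + w⟫ + ⟪K w, u⟫) : ℝ)) • W u x := by
        rw [integral_smul, integral_integral_swap hint]
    _ = κ • κ • ∫ u, (κ⁻¹ * gauss c w) • gauss c u • W u x := by
        congr 2
        refine integral_congr_ae (Filter.Eventually.of_forall fun u => ?_)
        simp only [smul_smul]
        rw [integral_smul_const, integral_gauss_mul_gauss hW.ne_zero K hW.skew, Complex.coe_smul]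
        congr 1
        ring
    _ = gauss c w • hW.proj x := by
        rw [integral_smul, hW.proj_apply, smul_smul, smul_smul, smul_smul]
        congr 1
        field_simp
        ring

theorem proj_proj [CompleteSpace H] (hW : IsWeylSystem c K W) (x : H) :
    hW.proj (hW.proj x) = hW.proj x := by
  simpa [hW.zero, gauss_zero] using hW.proj_mul_proj 0 x

/-- An invariant bounded sesquilinear form sees `P` as self-adjoint. -/
theorem form_proj [CompleteSpace H] (hW : IsWeylSystem c K W) (B : H →L⋆[ℂ] H →L[ℂ] ℂ)
    (hB : ∀ z x y, B (W z x) (W z y) = B x y) (x y : H) : B (hW.proj x) y = B x (hW.proj y) := by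
  have h : ∀ z, B (W z x) y = B x (W (-z) y) := fun z => by
    rw [← hB z x (W (-z) y), hW.apply_neg]
  let L : H →L[ℝ] ℂ :=
    { toFun := fun v => B v y
      map_add' := fun a b => by simp
      map_smul' := fun a b => by simp [← Complex.coe_smul]
      cont := (B.flip y).continuous }
  have h1 : B (hW.proj x) y = gaussConst Z c • ∫ z, gauss c z • B (W z x) y := hW.map_proj L x
  rw [hW.map_proj' (B x), h1, ← integral_neg_eq_self]
  simp_rw [h, neg_neg, gauss_neg]

/-- `W(w) P W(-w) = κ ∫ g(z) e^{2 i c ω(w, z)} W(z) dz` -/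
theorem conj_proj [CompleteSpace H] (hW : IsWeylSystem c K W) (w : Z) (x : H) :
    W w (hW.proj (W (-w) x)) = gaussConst Z c • ∫ z,
      Complex.exp (Complex.I * (2 * c * ⟪K w, z⟫ : ℝ)) • gauss c z • W z x := by
  rw [hW.map_proj' (W w)]
  congr 2
  ext z
  rw [hW.mul, hW.mul, smul_smul, ← Complex.exp_add, smul_comm, inner_neg_right,
    map_add, inner_add_left, hW.inner_self, hW.inner_anti z w]
  congr 2
  · push_cast; ring_nf
  · simp

/-- The vector functions `z ↦ e^{-|c| ‖z‖² / 2} W(z) x` have integrable moments. -/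
theorem integrable_pow_mul_gauss_smul (hW : IsWeylSystem c K W) (x : H) (n : ℕ) :
    Integrable fun z => ‖z‖ ^ n * ‖gauss c z • W z x‖ := by
  obtain ⟨C, hC, h⟩ := hW.exists_bound
  have hc := hW.ne_zero
  have h1 : Integrable fun z : Z => ((n.factorial : ℝ) * Real.exp (2 / |c|) ) * 
      (Real.exp (-(|c| / 4) * ‖z‖ ^ 2) * (C * ‖x‖)) :=
    ((integrable_exp_neg_mul_norm_sq (by positivity)).mul_const _).const_mul _
  refine h1.mono' ?_ (Filter.Eventually.of_forall fun z => ?_)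
  · exact (Continuous.mul (by fun_prop)
      ((continuous_gauss c).smul (hW.cont x)).norm).aestronglyMeasurable
  · have h2 : ‖z‖ ^ n ≤ n.factorial * Real.exp ‖z‖ := by
      have := Real.pow_div_factorial_le_exp ‖z‖ (norm_nonneg z) n
      rwa [div_le_iff₀' (by positivity)] at this
    have h3 : Real.exp ‖z‖ * gauss c z ≤ Real.exp (2 / |c|) * Real.exp (-(|c| / 4) * ‖z‖ ^ 2) := by
      rw [gauss, ← Real.exp_add, ← Real.exp_add]
      refine Real.exp_le_exp.2 ?_
      have hpos : 0 < |c| := by positivity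
      have : 0 ≤ |c| * (‖z‖ / 2 - 1 / |c|) ^ 2 := by positivity
      have e : |c| * (‖z‖ / 2 - 1 / |c|) ^ 2 = |c| / 4 * ‖z‖ ^ 2 - ‖z‖ + 1 / |c| := by
        field_simp
        ring
      have e2 : 2 / |c| = 1 / |c| + 1 / |c| := by ring
      have : 0 ≤ 1 / |c| := by positivity
      linarith
    rw [norm_mul, norm_norm, norm_pow, norm_norm, norm_smul,
      Real.norm_of_nonneg (gauss_pos c z).le]
    calc ‖z‖ ^ n * (gauss c z * ‖W z x‖)
        ≤ (n.factorial * Real.exp ‖z‖) * (gauss c z * (C * ‖x‖)) := by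
          refine mul_le_mul h2 (mul_le_mul_of_nonneg_left (h z x) (gauss_pos c z).le) ?_ ?_
          · exact mul_nonneg (gauss_pos c z).le (norm_nonneg _)
          · positivity
      _ = n.factorial * (Real.exp ‖z‖ * gauss c z) * (C * ‖x‖) := by ring
      _ ≤ n.factorial * (Real.exp (2 / |c|) * Real.exp (-(|c| / 4) * ‖z‖ ^ 2)) * (C * ‖x‖) := by
          gcongr
      _ = _ := by ring

open scoped FourierTransform in
theorem conj_proj_eq_fourier [CompleteSpace H] (hW : IsWeylSystem c K W) (w : Z) (x : H) :
    W w (hW.proj (W (-w) x)) = gaussConst Z c •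
      𝓕 (fun z => gauss c z • W z x) (-(c / Real.pi) • K w) := by
  rw [hW.conj_proj, Real.fourier_eq']
  congr 2
  ext z
  congr 2
  rw [inner_smul_right, real_inner_comm]
  have : (Real.pi : ℂ) ≠ 0 := by exact_mod_cast Real.pi_ne_zero
  push_cast
  field_simp

open scoped FourierTransform in
/-- Every vector is approximated by the translates `W(w) P W(-w) x` of vacuum vectors. -/
theorem mem_closure_span [CompleteSpace H] (hW : IsWeylSystem c K W) (x : H) :
    x ∈ (Submodule.span ℂ
      (Set.range fun w => W w (hW.proj (W (-w) x)))).topologicalClosure := by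
  by_contra hx
  set N := (Submodule.span ℂ (Set.range fun w => W w (hW.proj (W (-w) x)))).topologicalClosure
  have : IsClosed (N : Set H) := Submodule.isClosed_topologicalClosure _
  have hx' : N.mkQL x ≠ 0 := fun h => hx ((Submodule.Quotient.mk_eq_zero _).1 h)
  obtain ⟨f, hf⟩ := SeparatingDual.exists_ne_zero (R := ℂ) hx'
  have hf0 : ∀ w, f (N.mkQL (W w (hW.proj (W (-w) x)))) = 0 := fun w => by
    have : N.mkQL (W w (hW.proj (W (-w) x))) = 0 := (Submodule.Quotient.mk_eq_zero _).2
      (Submodule.le_topologicalClosure _ (Submodule.subset_span ⟨w, rfl⟩))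
    rw [this, map_zero]
  let L : H →L[ℂ] ℂ := f ∘L N.mkQL
  let h : Z → ℂ := fun z => L (gauss c z • W z x)
  have hcont : Continuous h := L.continuous.comp ((continuous_gauss c).smul (hW.cont x))
  have hF : 𝓕 h = 0 := by
    ext v
    have h1 := hf0 ((Real.pi / c) • K v)
    rw [hW.conj_proj_eq_fourier] at h1
    have h2 : -(c / Real.pi) • K ((Real.pi / c) • K v) = v := by
      rw [map_smul, hW.skew_sq, smul_smul, smul_neg, neg_mul, neg_smul, neg_neg,
        div_mul_div_comm, mul_comm c, div_self (mul_ne_zero Real.pi_ne_zero hW.ne_zero), one_smul]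
    rw [h2, ← ContinuousLinearMap.comp_apply] at h1
    change L _ = 0 at h1
    rw [← Complex.coe_smul, map_smul, smul_eq_zero, or_iff_right
      (by simpa using (gaussConst_pos hW.ne_zero).ne')] at h1
    rw [Pi.zero_apply, ← h1, Real.fourier_eq', Real.fourier_eq',
      ← L.integral_comp_comm]
    · simp only [h, map_smul]
    · refine (integrable_norm_iff ?_).1 ?_
      · exact (Continuous.smul (by fun_prop)
          ((continuous_gauss c).smul (hW.cont x))).aestronglyMeasurable
      · refine (hW.integrable_gauss_smul x).norm.congr (Filter.Eventually.of_forall fun z => ?_)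
        simp only [norm_smul, Complex.norm_exp_ofReal_mul_I, one_mul]
  have h0 := hcont.fourierInv_fourier_eq (L.integrable_comp (hW.integrable_gauss_smul x))
    (by rw [hF]; exact integrable_zero _ _ _)
  rw [hF] at h0
  have h1 : h 0 = 0 := by
    rw [← h0, Real.fourierInv_eq']
    simp
  apply hf
  simpa [h, L, hW.zero, gauss_zero] using h1

/-- Translates of vacuum vectors depend smoothly on the translation. -/
theorem contDiff_proj [CompleteSpace H] (hW : IsWeylSystem c K W) (x : H) :
    ContDiff ℝ ((⊤ : ℕ∞) : WithTop ℕ∞) fun w => W w (hW.proj x) := by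
  have h1 : ∀ w, W w (hW.proj x) = (gauss c w)⁻¹ • gaussConst Z c •
      FourierTransform.fourier (fun z => gauss c z • W z (hW.proj x))
        (-(c / Real.pi) • K w) := by
    intro w
    rw [← hW.conj_proj_eq_fourier, hW.proj_mul_proj, gauss_neg, ← Complex.coe_smul (gauss c w), map_smul,
      Complex.coe_smul, smul_smul,
      inv_mul_cancel₀ (gauss_pos c w).ne', one_smul]
  rw [funext h1]
  have h2 := Real.contDiff_fourier (f := fun z => gauss c z • W z (hW.proj x)) (N := ⊤)
    fun n _ => hW.integrable_pow_mul_gauss_smul _ n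
  have h3 : ContDiff ℝ ((⊤ : ℕ∞) : WithTop ℕ∞) (gauss c : Z → ℝ) := by
    unfold gauss
    exact (contDiff_const.mul (contDiff_norm_sq ℝ)).exp
  refine (h3.inv fun w => (gauss_pos c w).ne').smul (contDiff_const.smul (h2.comp ?_))
  exact contDiff_const.smul K.contDiff

end IsWeylSystem

/-! ### The Weyl system of a representation of the body -/

/-- The phase space `ℝ^{2m}`, with coordinates `(q, p)`. -/
abbrev PhaseSpace (m : ℕ) : Type :=
  WithLp 2 (EuclideanSpace ℝ (Fin m) × EuclideanSpace ℝ (Fin m))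

/-- The complex structure `(q, p) ↦ (-p, q)`. -/
noncomputable def phaseRot (m : ℕ) : PhaseSpace m →ₗᵢ[ℝ] PhaseSpace m where
  toFun z := WithLp.toLp 2 (-z.snd, z.fst)
  map_add' a b := WithLp.ofLp_injective 2 (by ext <;> simp [add_comm])
  map_smul' a b := WithLp.ofLp_injective 2 (by ext <;> simp)
  norm_map' z := by
    rw [← sq_eq_sq₀ (norm_nonneg _) (norm_nonneg _), LinearMap.coe_mk, AddHom.coe_mk,
      WithLp.prod_norm_sq_eq_of_L2, WithLp.prod_norm_sq_eq_of_L2]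
    simp [add_comm]

/-- The element of the body with coordinates `(q, p, 0)`. -/
def phaseBody {m : ℕ} (z : PhaseSpace m) : HeisBody m := (z.fst, z.snd, 0)

theorem inner_phaseRot {m : ℕ} (z w : PhaseSpace m) :
    ⟪phaseRot m z, w⟫ = omegaEven (phaseBody z) (phaseBody w) := by
  simp [phaseRot, omegaEven, phaseBody, WithLp.prod_inner_apply, sub_eq_add_neg, add_comm]

theorem phaseRot_skew {m : ℕ} (z w : PhaseSpace m) : ⟪phaseRot m z, w⟫ = -⟪z, phaseRot m w⟫ := by
  simp [phaseRot, WithLp.prod_inner_apply, add_comm]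

theorem continuous_phaseBody {m : ℕ} : Continuous (phaseBody (m := m)) := by
  unfold phaseBody
  fun_prop

theorem body_eq {m : ℕ} {H : Type*} [NormedAddCommGroup H] [NormedSpace ℂ H]
    {π : HeisBody m → H →L[ℂ] H} {θ : ℝ}
    (hmul : ∀ g h, π (heisMul g h) = π g ∘L π h)
    (hchar : ∀ (t : ℝ) (v : H), π (0, 0, t) v = Complex.exp (2 * Complex.I / θ * t) • v)
    (g : HeisBody m) (x : H) :
    π g x = Complex.exp (2 * Complex.I / θ * (g.2.2 : ℝ)) •
      π (phaseBody (WithLp.toLp 2 (g.1, g.2.1))) x := by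
  rw [← hchar, ← ContinuousLinearMap.comp_apply, ← hmul]
  congr 2
  simp [heisMul, phaseBody, omegaEven]

theorem isWeylSystem_of_body {m : ℕ} {H : Type*} [NormedAddCommGroup H] [NormedSpace ℂ H]
    {π : HeisBody m → H →L[ℂ] H} {θ : ℝ} (hθ : θ ≠ 0) (hone : π 0 = 1)
    (hmul : ∀ g h, π (heisMul g h) = π g ∘L π h) (hcont : ∀ v, Continuous fun g => π g v)
    (hbdd : ∃ C : ℝ, ∀ g, ‖π g‖ ≤ C)
    (hchar : ∀ (t : ℝ) (v : H), π (0, 0, t) v = Complex.exp (2 * Complex.I / θ * t) • v) :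
    IsWeylSystem θ⁻¹ (phaseRot m) fun z => π (phaseBody z) where
  ne_zero := inv_ne_zero hθ
  skew := phaseRot_skew
  zero := hone
  mul z w x := by
    rw [← ContinuousLinearMap.comp_apply, ← hmul, body_eq hmul hchar, inner_phaseRot]
    have h1 : heisMul (phaseBody z) (phaseBody w)
        = (z.fst + w.fst, z.snd + w.snd, omegaEven (phaseBody z) (phaseBody w) / 2) := by
      simp [heisMul, phaseBody]
    rw [h1]
    congr 2
    push_cast
    ring
  cont x := (hcont x).comp continuous_phaseBody
  bdd := hbdd.imp fun C h z => h _

/-! ### The Schrödinger representation -/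

section Schrodinger

variable {m : ℕ}

theorem norm_schrodingerPhase (θ : ℝ) (g : HeisBody m) (x : EuclideanSpace ℝ (Fin m)) : ‖schrodingerPhase θ g x‖ = 1 := by
  rw [schrodingerPhase, Complex.norm_exp]
  refine Real.exp_eq_one_iff _ |>.2 ?_
  rw [Complex.re_mul_ofReal, Complex.div_ofReal_re]
  simp

theorem schrodinger_coeFn (θ : ℝ) (g : HeisBody m) (f : L2 m) :
    schrodinger θ g f =ᵐ[volume] fun x => schrodingerPhase θ g x * f (x - g.1) := by
  have h1 := (ContinuousLinearMap.mul ℂ ℂ).coeFn_holder (r := 2)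
    (schrodingerPhase_memLp θ g).toLp
    (Lp.compMeasurePreservingₗᵢ ℂ (fun q₀ => q₀ - g.1)
      (measurePreserving_sub_right volume g.1) f)
  have h2 := (schrodingerPhase_memLp θ g).coeFn_toLp
  have h3 := Lp.coeFn_compMeasurePreserving f (measurePreserving_sub_right volume g.1)
  have h0 : schrodinger θ g f = (ContinuousLinearMap.mul ℂ ℂ).holder 2
    (schrodingerPhase_memLp θ g).toLp
    (Lp.compMeasurePreservingₗᵢ ℂ (fun q₀ => q₀ - g.1)
      (measurePreserving_sub_right volume g.1) f) := rfl
  rw [h0]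
  filter_upwards [h1, h2, h3] with x h1 h2 h3
  rw [h1, h2]
  simp only [ContinuousLinearMap.mul_apply']
  congr 1

theorem schrodinger_one (θ : ℝ) : schrodinger (m := m) θ 0 = 1 := by
  ext f
  filter_upwards [schrodinger_coeFn θ 0 f] with x h
  rw [h]
  simp [schrodingerPhase]

theorem schrodinger_mul (θ : ℝ) (g h : HeisBody m) :
    schrodinger θ (heisMul g h) = schrodinger θ g ∘L schrodinger θ h := by
  ext f
  filter_upwards [schrodinger_coeFn θ (heisMul g h) f, schrodinger_coeFn θ g (schrodinger θ h f),
    (measurePreserving_sub_right volume g.1).quasiMeasurePreserving.ae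
      (schrodinger_coeFn θ h f)] with x h1 h2 h3
  rw [h1, ContinuousLinearMap.comp_apply, h2, h3, ← mul_assoc]
  congr 1
  · simp only [schrodingerPhase, ← Complex.exp_add, ← mul_add, ← Complex.ofReal_add]
    congr 3
    simp only [heisMul, omegaEven, inner_sub_left, inner_add_left, inner_add_right,
      inner_smul_left, smul_add]
    rw [real_inner_comm h.1 g.2.1]
    simp
    ring
  · rw [sub_sub]
    rfl

theorem norm_schrodinger (θ : ℝ) (g : HeisBody m) (f : L2 m) : ‖schrodinger θ g f‖ = ‖f‖ := by
  rw [← (Lp.compMeasurePreservingₗᵢ ℂ (fun q₀ => q₀ - g.1)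
      (measurePreserving_sub_right volume g.1)).norm_map f, Lp.norm_def, Lp.norm_def]
  congr 1
  refine eLpNorm_congr_norm_ae ?_
  filter_upwards [schrodinger_coeFn θ g f,
    Lp.coeFn_compMeasurePreserving f (measurePreserving_sub_right volume g.1)] with x h1 h2
  rw [h1, norm_mul, norm_schrodingerPhase, one_mul]
  exact congrArg norm h2.symm

theorem schrodinger_central (θ : ℝ) (t : ℝ) (f : L2 m) :
    schrodinger θ (0, 0, t) f = Complex.exp (2 * Complex.I / θ * t) • f := by
  ext
  filter_upwards [schrodinger_coeFn θ (0, 0, t) f,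
    Lp.coeFn_smul (Complex.exp (2 * Complex.I / θ * t)) f] with x h1 h2
  rw [h1, h2]
  simp [schrodingerPhase]

theorem inner_schrodinger (θ : ℝ) (g : HeisBody m) (f h : L2 m) :
    inner ℂ (schrodinger θ g f) (schrodinger θ g h) = inner ℂ f h :=
  (⟨(schrodinger θ g).toLinearMap, norm_schrodinger θ g⟩ : L2 m →ₗᵢ[ℂ] L2 m).inner_map_map f h

/-- An integrable function with vanishing Fourier transform vanishes almost everywhere. -/
theorem ae_eq_zero_of_fourier_eq_zero {E : Type*} [NormedAddCommGroup E] [InnerProductSpace ℝ E]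
    [FiniteDimensional ℝ E] [MeasurableSpace E] [BorelSpace E] {h : E → ℂ} (hi : Integrable h)
    (h0 : ∀ v, FourierTransform.fourier h v = 0) : ∀ᵐ x, h x = 0 := by
  refine ae_eq_zero_of_integral_contDiff_smul_eq_zero hi.locallyIntegrable fun g hg hs => ?_
  have hs' : HasCompactSupport fun x => (g x : ℂ) := hs.comp_left (g := Complex.ofReal) rfl
  have hg' : ContDiff ℝ ((⊤ : ℕ∞) : WithTop ℕ∞) fun x => (g x : ℂ) :=
    Complex.ofRealCLM.contDiff.comp hg
  let φ : SchwartzMap E ℂ := hs'.toSchwartzMap hg'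
  obtain ⟨ψ, hψ⟩ : ∃ ψ : SchwartzMap E ℂ, FourierTransform.fourier ψ = φ :=
    ⟨FourierTransformInv.fourierInv φ, FourierTransform.fourier_fourierInv_eq φ⟩
  have h1 := VectorFourier.integral_fourierIntegral_smul_eq_flip (μ := volume) (ν := volume)
    (L := innerₗ E) (f := ψ) (g := h) Real.continuous_fourierChar
    (by exact continuous_inner) ψ.integrable hi
  rw [flip_innerₗ] at h1
  have h2 : ∀ x, VectorFourier.fourierIntegral Real.fourierChar volume (innerₗ E) h x = 0 := h0
  simp only [h2, smul_zero, integral_zero] at h1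
  rw [← h1]
  refine integral_congr_ae (Filter.Eventually.of_forall fun x => ?_)
  have h3 : VectorFourier.fourierIntegral Real.fourierChar volume (innerₗ E) ψ x = (g x : ℂ) := by
    change FourierTransform.fourier (ψ : E → ℂ) x = _
    rw [← SchwartzMap.fourier_coe, hψ]
    rfl
  simp only [h3]
  rfl

/-- The normalized Gaussian `(2|c|/π)^{m/4} e^{-|c| ‖x‖²}` with `c = 1/θ`. -/
noncomputable def vacuumFun (m : ℕ) (θ : ℝ) (x : EuclideanSpace ℝ (Fin m)) : ℝ :=
  (Real.sqrt (∫ y : EuclideanSpace ℝ (Fin m), Real.exp (-(2 * |θ⁻¹|) * ‖y‖ ^ 2)))⁻¹ *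
    Real.exp (-|θ⁻¹| * ‖x‖ ^ 2)

theorem continuous_vacuumFun (θ : ℝ) : Continuous (vacuumFun m θ) := by
  unfold vacuumFun
  fun_prop

theorem vacuumFun_pos {θ : ℝ} (hθ : θ ≠ 0) (x : EuclideanSpace ℝ (Fin m)) : 0 < vacuumFun m θ x := by
  have h : 0 < ∫ y : EuclideanSpace ℝ (Fin m), Real.exp (-(2 * |θ⁻¹|) * ‖y‖ ^ 2) :=
    integral_exp_neg_norm_sq_pos (by positivity)
  unfold vacuumFun
  positivity

theorem memLp_vacuumFun {θ : ℝ} (hθ : θ ≠ 0) :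
    MemLp (fun x => (vacuumFun m θ x : ℂ)) 2 (volume : Measure (EuclideanSpace ℝ (Fin m))) := by
  refine (memLp_two_iff_integrable_sq_norm
    (Complex.continuous_ofReal.comp (continuous_vacuumFun θ)).aestronglyMeasurable).2 ?_
  have : Integrable fun x : EuclideanSpace ℝ (Fin m) => Real.exp (-(2 * |θ⁻¹|) * ‖x‖ ^ 2) :=
    integrable_exp_neg_mul_norm_sq (by positivity)
  refine (this.const_mul (((Real.sqrt (∫ y : EuclideanSpace ℝ (Fin m),
    Real.exp (-(2 * |θ⁻¹|) * ‖y‖ ^ 2)))⁻¹) ^ 2)).congr (Filter.Eventually.of_forall fun x => ?_)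
  dsimp only [Function.comp_apply]
  rw [Complex.norm_real, Real.norm_eq_abs, sq_abs, vacuumFun, mul_pow,
    ← Real.exp_nat_mul]
  congr 2
  push_cast
  ring

/-- The vacuum vector of the Schrödinger representation. -/
noncomputable def vacuum (m : ℕ) {θ : ℝ} (hθ : θ ≠ 0) : L2 m := (memLp_vacuumFun hθ).toLp

theorem vacuum_coeFn {θ : ℝ} (hθ : θ ≠ 0) :
    vacuum m hθ =ᵐ[volume] fun x => (vacuumFun m θ x : ℂ) := MemLp.coeFn_toLp _

/-- The matrix coefficient of the vacuum is the Gaussian. -/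
theorem inner_vacuum_schrodinger {θ : ℝ} (hθ : θ ≠ 0) (z : PhaseSpace m) :
    inner ℂ (vacuum m hθ) (schrodinger θ (phaseBody z) (vacuum m hθ)) = (gauss θ⁻¹ z : ℂ) := by
  set c := θ⁻¹ with hc
  have hc0 : c ≠ 0 := inv_ne_zero hθ
  set N := ∫ y : EuclideanSpace ℝ (Fin m), Real.exp (-(2 * |c|) * ‖y‖ ^ 2) with hN
  have hNpos : 0 < N := integral_exp_neg_norm_sq_pos (by positivity)
  have hb : 0 < (((2 * |c| : ℝ)) : ℂ).re := by simpa using hc0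
  have h0 := GaussianFourier.integral_cexp_neg_mul_sq_norm_add (V := EuclideanSpace ℝ (Fin m)) hb 0 0
  have h1 := GaussianFourier.integral_cexp_neg_mul_sq_norm_add (V := EuclideanSpace ℝ (Fin m)) hb
    (-(2 * Complex.I * c)) z.snd
  have hk : (N : ℂ) = (Real.pi / ((2 * |c| : ℝ) : ℂ)) ^ (Module.finrank ℝ (EuclideanSpace ℝ (Fin m)) / 2 : ℂ) := by
    have : (Real.pi / ((2 * |c| : ℝ) : ℂ)) ^ (Module.finrank ℝ (EuclideanSpace ℝ (Fin m)) / 2 : ℂ)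
        = (Real.pi / ((2 * |c| : ℝ) : ℂ)) ^ (Module.finrank ℝ (EuclideanSpace ℝ (Fin m)) / 2 : ℂ)
          * Complex.exp (0 ^ 2 * ‖(0 : EuclideanSpace ℝ (Fin m))‖ ^ 2 / (4 * ((2 * |c| : ℝ) : ℂ))) := by simp
    rw [this, ← h0, hN, ← integral_complex_ofReal]
    refine integral_congr_ae (Filter.Eventually.of_forall fun z => ?_)
    push_cast
    simp
  rw [L2.inner_def]
  have e1 : ∫ a, inner ℂ (vacuum m hθ a) (schrodinger θ (phaseBody z) (vacuum m hθ) a) =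
      ∫ x : EuclideanSpace ℝ (Fin m), (N : ℂ)⁻¹ * (Complex.exp (-(2 * |c| : ℝ) * ‖x - (1 / 2 : ℝ) • z.fst‖ ^ 2
        + -(2 * Complex.I * c) * ⟪z.snd, x - (1 / 2 : ℝ) • z.fst⟫) *
          Complex.exp ((-(|c| / 2) * ‖z.fst‖ ^ 2 : ℝ))) := by
    refine integral_congr_ae ?_
    filter_upwards [vacuum_coeFn hθ, schrodinger_coeFn θ (phaseBody z) (vacuum m hθ),
      (measurePreserving_sub_right volume z.fst).quasiMeasurePreserving.ae (vacuum_coeFn hθ)]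
      with x h1 h2 h3
    simp only [RCLike.inner_apply]
    rw [h1, h2, show (phaseBody z).1 = z.fst from rfl, h3, Complex.conj_ofReal, vacuumFun,
      vacuumFun, ← hc, ← hN, schrodingerPhase]
    have hs : ((Real.sqrt N : ℝ) : ℂ)⁻¹ * ((Real.sqrt N : ℝ) : ℂ)⁻¹ = (N : ℂ)⁻¹ := by
      rw [← mul_inv, ← Complex.ofReal_mul, Real.mul_self_sqrt hNpos.le]
    have e2 : ‖x‖ ^ 2 + ‖x - z.fst‖ ^ 2
        = 2 * ‖x - (1 / 2 : ℝ) • z.fst‖ ^ 2 + ‖z.fst‖ ^ 2 / 2 := by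
      have := parallelogram_law_with_norm ℝ (x - (1 / 2 : ℝ) • z.fst) ((1 / 2 : ℝ) • z.fst)
      rw [sub_add_cancel, sub_sub, ← add_smul, norm_smul] at this
      norm_num at this
      norm_num
      linarith
    have e3 : ((phaseBody z).2.2 + ⟪(1 / 2 : ℝ) • (phaseBody z).1 - x, (phaseBody z).2.1⟫ : ℝ)
        = -⟪z.snd, x - (1 / 2 : ℝ) • z.fst⟫ := by
      rw [← inner_neg_right, neg_sub, real_inner_comm]
      simp [phaseBody]
    rw [e3, ← hs, ← Complex.exp_add]
    push_cast
    rw [show ∀ a b c d : ℂ, a * (d * b) * (d * c) = d * d * (a * b * c) by intros; ring,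
      ← Complex.exp_add, ← Complex.exp_add]
    congr 2
    have e2' : (‖x‖ : ℂ) ^ 2 + (‖x - z.fst‖ : ℂ) ^ 2
        = 2 * (‖x - (1 / 2 : ℝ) • z.fst‖ : ℂ) ^ 2 + (‖z.fst‖ : ℂ) ^ 2 / 2 := by exact_mod_cast e2
    have e4 : (c : ℂ) = (θ : ℂ)⁻¹ := by simp [hc]
    rw [e4]
    linear_combination (-((|c| : ℝ) : ℂ)) * e2'
  rw [e1, integral_const_mul, integral_mul_const,
    integral_sub_right_eq_self (fun x : EuclideanSpace ℝ (Fin m) => Complex.exp (-(2 * |c| : ℝ) * ‖x‖ ^ 2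
        + -(2 * Complex.I * c) * ⟪z.snd, x⟫)), h1, ← hk, mul_assoc,
    inv_mul_cancel_left₀ (by exact_mod_cast hNpos.ne'), ← Complex.exp_add, gauss,
    Complex.ofReal_exp]
  congr 1
  rw [WithLp.prod_norm_sq_eq_of_L2]
  have hcc : (c : ℂ) ^ 2 = ((|c| : ℝ) : ℂ) ^ 2 := by
    rw [← Complex.ofReal_pow, ← Complex.ofReal_pow, sq_abs]
  have hne : ((|c| : ℝ) : ℂ) ≠ 0 := by simpa using hc0
  have : (-(2 * Complex.I * (c : ℂ))) ^ 2 = -4 * ((|c| : ℝ) : ℂ) ^ 2 := by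
    rw [neg_sq, mul_pow, mul_pow, Complex.I_sq, hcc]; ring
  rw [this]
  push_cast
  field_simp
  ring

theorem norm_vacuum {θ : ℝ} (hθ : θ ≠ 0) : ‖vacuum m hθ‖ = 1 := by
  have h := inner_vacuum_schrodinger (m := m) hθ 0
  have h1 : phaseBody (0 : PhaseSpace m) = 0 := by simp [phaseBody]
  rw [h1, schrodinger_one, gauss_zero, one_apply_eq_self,
    inner_self_eq_norm_sq_to_K] at h
  have h2 : ‖vacuum m hθ‖ ^ 2 = 1 := Complex.ofReal_injective (by push_cast at h ⊢; exact h)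
  exact (pow_eq_one_iff_of_nonneg (norm_nonneg _) two_ne_zero).1 h2

/-- The coherent states span a dense subspace. -/
theorem span_coherent_dense {θ : ℝ} (hθ : θ ≠ 0) :
    (Submodule.span ℂ (Set.range fun z : PhaseSpace m =>
      schrodinger θ (phaseBody z) (vacuum m hθ))).topologicalClosure = ⊤ := by
  rw [Submodule.topologicalClosure_eq_top_iff, Submodule.eq_bot_iff]
  intro f hf
  have hf' : ∀ z : PhaseSpace m, inner ℂ (schrodinger θ (phaseBody z) (vacuum m hθ)) f = 0 :=
    fun z => (Submodule.mem_orthogonal _ _).1 hf _ (Submodule.subset_span ⟨z, rfl⟩)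
  have hi : Integrable fun x => (vacuumFun m θ x : ℂ) * f x := by
    have h := L2.integrable_inner (𝕜 := ℂ) (vacuum m hθ) f
    refine h.congr ?_
    filter_upwards [vacuum_coeFn hθ] with x h
    rw [RCLike.inner_apply, h, Complex.conj_ofReal, mul_comm]
  have h0 := ae_eq_zero_of_fourier_eq_zero hi fun v => by
    have h1 := hf' (WithLp.toLp 2 (0, -(θ * Real.pi) • v))
    rw [L2.inner_def] at h1
    rw [Real.fourier_eq', ← h1]
    refine integral_congr_ae ?_
    filter_upwards [vacuum_coeFn hθ, schrodinger_coeFn θ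
      (phaseBody (WithLp.toLp 2 (0, -(θ * Real.pi) • v))) (vacuum m hθ)] with x h2 h3
    rw [RCLike.inner_apply, h3]
    have h4 : x - (phaseBody (WithLp.toLp 2 (0, -(θ * Real.pi) • v) : PhaseSpace m)).1 = x := by
      simp [phaseBody]
    rw [h4, h2, map_mul, Complex.conj_ofReal, schrodingerPhase, ← Complex.exp_conj, smul_eq_mul,
      show ∀ b d : ℂ, f x * (b * d) = b * (d * f x) by intros; ring]
    have hθ' : (θ : ℂ) ≠ 0 := by exact_mod_cast hθ
    congr 2
    simp only [phaseBody, WithLp.toLp_fst, WithLp.toLp_snd, smul_zero, zero_sub, inner_neg_left,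
      inner_smul_right, zero_add, map_mul, map_div₀, Complex.conj_ofReal, Complex.conj_I,
      Complex.conj_ofNat]
    push_cast
    field_simp
  refine Lp.ext ?_
  filter_upwards [h0, Lp.coeFn_zero ℂ 2 (volume : Measure (EuclideanSpace ℝ (Fin m)))] with x h h'
  rw [h']
  exact (mul_eq_zero.1 h).resolve_left (by exact_mod_cast (vacuumFun_pos hθ x).ne')

/-- Two bounded operators on `L²` agree when they agree on coherent states. -/
theorem ext_coherent {θ : ℝ} (hθ : θ ≠ 0) {E : Type*} [NormedAddCommGroup E] [NormedSpace ℂ E]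
    {S T : L2 m →L[ℂ] E}
    (h : ∀ z : PhaseSpace m, S (schrodinger θ (phaseBody z) (vacuum m hθ))
      = T (schrodinger θ (phaseBody z) (vacuum m hθ))) : S = T :=
  ContinuousLinearMap.ext_on
    ((Submodule.dense_iff_topologicalClosure_eq_top).2 (span_coherent_dense hθ))
    (by rintro _ ⟨z, rfl⟩; exact h z)

/-- A family of isometric operators which is pointwise continuous on a set of vectors spanning a
dense subspace is strongly continuous. -/
theorem continuous_of_dense_span {X E : Type*} [TopologicalSpace X] [NormedAddCommGroup E]
    [NormedSpace ℂ E] {U : X → E →L[ℂ] E} (hU : ∀ x v, ‖U x v‖ ≤ ‖v‖) {s : Set E}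
    (hs : (Submodule.span ℂ s).topologicalClosure = ⊤)
    (h : ∀ v ∈ s, Continuous fun x => U x v) (v : E) : Continuous fun x => U x v := by
  have hspan : ∀ v ∈ Submodule.span ℂ s, Continuous fun x => U x v := by
    intro v hv
    induction hv using Submodule.span_induction with
    | mem v hv => exact h v hv
    | zero => simpa using continuous_const
    | add v w _ _ h1 h2 => simp only [map_add]; exact h1.add h2
    | smul a v _ h1 => simp only [map_smul]; exact h1.const_smul a
  rw [continuous_iff_continuousAt]
  intro x
  rw [Metric.continuousAt_iff']
  intro ε hε
  have hv : v ∈ closure (Submodule.span ℂ s : Set E) := by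
    rw [← Submodule.topologicalClosure_coe, hs]; trivial
  obtain ⟨w, hw, hvw⟩ := Metric.mem_closure_iff.1 hv (ε / 3) (by positivity)
  have h1 := Metric.continuousAt_iff'.1 ((hspan w hw).continuousAt (x := x)) (ε / 3)
    (by positivity)
  filter_upwards [h1] with y hy
  have h2 : ∀ z, dist (U z v) (U z w) < ε / 3 := fun z => by
    rw [dist_eq_norm, ← map_sub]
    exact (hU z _).trans_lt (by rwa [← dist_eq_norm])
  calc dist (U y v) (U x v) ≤ dist (U y v) (U y w) + dist (U y w) (U x w) + dist (U x w) (U x v) :=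
        dist_triangle4 _ _ _ _
    _ < ε / 3 + ε / 3 + ε / 3 := by
        have := h2 x
        rw [dist_comm] at this
        linarith [h2 y]
    _ = ε := by ring

theorem body_add {m : ℕ} {H : Type*} [NormedAddCommGroup H] [NormedSpace ℂ H]
    {π : HeisBody m → H →L[ℂ] H} {θ : ℝ}
    (hmul : ∀ g h, π (heisMul g h) = π g ∘L π h)
    (hchar : ∀ (t : ℝ) (v : H), π (0, 0, t) v = Complex.exp (2 * Complex.I / θ * t) • v)
    (z w : PhaseSpace m) (x : H) :
    π (phaseBody z) (π (phaseBody w) x) = Complex.exp (Complex.I * (θ⁻¹ * ⟪phaseRot m z, w⟫ : ℝ)) •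
      π (phaseBody (z + w)) x := by
  rw [← ContinuousLinearMap.comp_apply, ← hmul, body_eq hmul hchar, inner_phaseRot]
  have h1 : heisMul (phaseBody z) (phaseBody w)
      = (z.fst + w.fst, z.snd + w.snd, omegaEven (phaseBody z) (phaseBody w) / 2) := by
    simp [heisMul, phaseBody]
  rw [h1]
  congr 2
  push_cast
  ring

theorem inner_coherent {θ : ℝ} (hθ : θ ≠ 0) (z w : PhaseSpace m) :
    inner ℂ (schrodinger θ (phaseBody z) (vacuum m hθ))
      (schrodinger θ (phaseBody w) (vacuum m hθ)) =
    Complex.exp (Complex.I * (θ⁻¹ * ⟪phaseRot m (-z), w⟫ : ℝ)) * (gauss θ⁻¹ (w - z) : ℂ) := by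
  rw [← inner_schrodinger θ (phaseBody (-z)), body_add (schrodinger_mul θ) (schrodinger_central θ),
    body_add (schrodinger_mul θ) (schrodinger_central θ), neg_add_cancel, neg_add_eq_sub,
    inner_smul_left, inner_smul_right, map_neg, inner_neg_left, inner_neg_left,
    ← inner_vacuum_schrodinger hθ]
  have h : ⟪phaseRot m z, z⟫ = 0 := by
    have := phaseRot_skew z z
    rw [real_inner_comm] at this
    rw [real_inner_comm]; linarith
  have h1 : phaseBody (0 : PhaseSpace m) = 0 := by simp [phaseBody]
  rw [h, h1, schrodinger_one]
  simp

theorem continuous_schrodinger_vacuum {θ : ℝ} (hθ : θ ≠ 0) :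
    Continuous fun z : PhaseSpace m => schrodinger θ (phaseBody z) (vacuum m hθ) := by
  rw [continuous_iff_continuousAt]
  intro w
  rw [ContinuousAt, tendsto_iff_norm_sub_tendsto_zero]
  have h : ∀ z : PhaseSpace m, ‖schrodinger θ (phaseBody z) (vacuum m hθ)
      - schrodinger θ (phaseBody w) (vacuum m hθ)‖ = Real.sqrt (2 - 2 *
        (Complex.exp (Complex.I * (θ⁻¹ * ⟪phaseRot m (-z), w⟫ : ℝ)) *
          (gauss θ⁻¹ (w - z) : ℂ)).re) := by
    intro z
    rw [← inner_coherent hθ, ← Real.sqrt_sq (norm_nonneg _), @norm_sub_sq ℂ, norm_schrodinger,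
      norm_schrodinger, norm_vacuum]
    congr 1
    simp only [RCLike.re_to_complex]
    ring
  simp_rw [h]
  have hc : Continuous fun z : PhaseSpace m => Real.sqrt (2 - 2 *
        (Complex.exp (Complex.I * (θ⁻¹ * ⟪phaseRot m (-z), w⟫ : ℝ)) *
          (gauss θ⁻¹ (w - z) : ℂ)).re) := by
    have h1 := (continuous_gauss (Z := PhaseSpace m) θ⁻¹)
    have h2 := (phaseRot m).continuous
    fun_prop
  have h0 := hc.tendsto w
  rw [← h w, sub_self, norm_zero] at h0
  exact h0

theorem continuous_schrodinger {θ : ℝ} (hθ : θ ≠ 0) (f : L2 m) :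
    Continuous fun g => schrodinger θ g f := by
  refine continuous_of_dense_span (fun g v => (norm_schrodinger θ g v).le)
    (span_coherent_dense hθ) ?_ f
  rintro _ ⟨z, rfl⟩
  have h : ∀ g : HeisBody m, schrodinger θ g (schrodinger θ (phaseBody z) (vacuum m hθ)) =
      Complex.exp (2 * Complex.I / θ * (g.2.2 : ℝ)) •
      Complex.exp (Complex.I * (θ⁻¹ * ⟪phaseRot m (WithLp.toLp 2 (g.1, g.2.1)), z⟫ : ℝ)) •
      schrodinger θ (phaseBody (WithLp.toLp 2 (g.1, g.2.1) + z)) (vacuum m hθ) := fun g => by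
    rw [body_eq (schrodinger_mul θ) (schrodinger_central θ),
      body_add (schrodinger_mul θ) (schrodinger_central θ)]
  simp_rw [h]
  have h1 : Continuous fun g : HeisBody m => (WithLp.toLp 2 (g.1, g.2.1) : PhaseSpace m) := by
    fun_prop
  have h2 := (continuous_schrodinger_vacuum (m := m) hθ).comp (h1.add_const z)
  have h3 : Continuous fun g : HeisBody m => phaseRot m (WithLp.toLp 2 (g.1, g.2.1)) :=
    (phaseRot m).continuous.comp h1
  have h4 : Continuous fun g : HeisBody m => Complex.exp (2 * Complex.I / θ * (g.2.2 : ℝ)) := by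
    fun_prop
  have h5 : Continuous fun g : HeisBody m => Complex.exp (Complex.I * (θ⁻¹ *
      ⟪phaseRot m (WithLp.toLp 2 (g.1, g.2.1)), z⟫ : ℝ)) := by
    fun_prop
  exact h4.smul (h5.smul h2)

theorem schrodinger_isWeylSystem {θ : ℝ} (hθ : θ ≠ 0) :
    IsWeylSystem θ⁻¹ (phaseRot m) fun z => schrodinger (m := m) θ (phaseBody z) :=
  isWeylSystem_of_body hθ (schrodinger_one θ) (schrodinger_mul θ) (continuous_schrodinger hθ)
    ⟨1, fun g => ContinuousLinearMap.opNorm_le_bound _ zero_le_one fun f => by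
      rw [norm_schrodinger, one_mul]⟩ (schrodinger_central θ)

theorem inner_proj {Z H : Type*} [NormedAddCommGroup Z] [InnerProductSpace ℝ Z]
    [FiniteDimensional ℝ Z] [MeasurableSpace Z] [BorelSpace Z]
    [NormedAddCommGroup H] [InnerProductSpace ℂ H] [CompleteSpace H]
    {c : ℝ} {K : Z →ₗᵢ[ℝ] Z} {W : Z → H →L[ℂ] H} (hW : IsWeylSystem c K W)
    (hU : ∀ z x y, inner ℂ (W z x) (W z y) = inner ℂ x y) (x y : H) :
    inner ℂ (hW.proj x) y = inner ℂ x (hW.proj y) :=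
  hW.form_proj (innerSL ℂ) hU x y

theorem proj_vacuum {θ : ℝ} (hθ : θ ≠ 0) :
    (schrodinger_isWeylSystem hθ).proj (vacuum m hθ) = vacuum m hθ := by
  have hW := schrodinger_isWeylSystem (m := m) hθ
  have hκ := gaussConst_pos (Z := PhaseSpace m) hW.ne_zero
  have key : ∀ w : PhaseSpace m, inner ℂ (schrodinger θ (phaseBody w) (vacuum m hθ))
      (hW.proj (vacuum m hθ)) = inner ℂ (schrodinger θ (phaseBody w) (vacuum m hθ))
      (vacuum m hθ) := by
    intro w
    have h0 := hW.map_proj' (innerSL ℂ (schrodinger θ (phaseBody w) (vacuum m hθ))) (vacuum m hθ)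
    simp only [innerSL_apply_apply] at h0
    have h2 : inner ℂ (schrodinger θ (phaseBody w) (vacuum m hθ)) (vacuum m hθ)
        = (gauss θ⁻¹ w : ℂ) := by
      rw [← inner_conj_symm, inner_vacuum_schrodinger, Complex.conj_ofReal]
    rw [h0, h2]
    have h1 := integral_gauss_mul_gauss hW.ne_zero (phaseRot m) phaseRot_skew w 0
    simp_rw [inner_coherent hθ]
    have h3 : ∀ z : PhaseSpace m, gauss θ⁻¹ z • (Complex.exp (Complex.I * (θ⁻¹ *
        ⟪phaseRot m (-w), z⟫ : ℝ)) * (gauss θ⁻¹ (z - w) : ℂ)) =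
        ((gauss θ⁻¹ z * gauss θ⁻¹ (w - 0 - z) : ℝ) : ℂ) * Complex.exp (Complex.I *
        (θ⁻¹ * (⟪phaseRot m z, w + 0⟫ + ⟪phaseRot m 0, w⟫) : ℝ)) := by
      intro z
      rw [← Complex.coe_smul, smul_eq_mul, hW.inner_anti, sub_zero,
        ← gauss_neg _ (z - w), neg_sub, add_zero, map_zero, inner_zero_left, add_zero,
        inner_neg_right, neg_neg]
      push_cast
      ring
    simp_rw [h3]
    rw [h1, gauss_zero, ← Complex.coe_smul, smul_eq_mul, mul_one, Complex.ofReal_mul,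
      Complex.ofReal_inv, mul_inv_cancel_left₀ (by exact_mod_cast hκ.ne')]
  have h : innerSL ℂ (hW.proj (vacuum m hθ)) = innerSL ℂ (vacuum m hθ) :=
    ext_coherent hθ fun z => by
      simp only [innerSL_apply_apply]
      rw [← inner_conj_symm, key, inner_conj_symm]
  exact ext_inner_right ℂ fun v => by simpa using DFunLike.congr_fun h v

/-- `P = |Ω⟩⟨Ω|` in the Schrödinger representation. -/
theorem schrodinger_proj {θ : ℝ} (hθ : θ ≠ 0) (f : L2 m) :
    (schrodinger_isWeylSystem hθ).proj f = inner ℂ (vacuum m hθ) f • vacuum m hθ := by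
  have hW := schrodinger_isWeylSystem (m := m) hθ
  have h : innerSL ℂ (hW.proj f) = innerSL ℂ (inner ℂ (vacuum m hθ) f • vacuum m hθ) :=
    ext_coherent hθ fun z => by
      simp only [innerSL_apply_apply]
      rw [inner_proj hW fun z => inner_schrodinger θ _]
      have h1 := hW.proj_mul_proj z (vacuum m hθ)
      rw [proj_vacuum hθ] at h1
      rw [h1, inner_smul_left, inner_vacuum_schrodinger, inner_conj_symm, ← Complex.coe_smul,
        inner_smul_right, mul_comm]
  exact ext_inner_right ℂ fun v => DFunLike.congr_fun h v

/-- Schur's lemma for the Schrödinger representation. -/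
theorem schrodinger_schur {θ : ℝ} (hθ : θ ≠ 0) (T : L2 m →L[ℂ] L2 m)
    (hT : ∀ z f, T (schrodinger θ (phaseBody z) f) = schrodinger θ (phaseBody z) (T f)) (f : L2 m) :
    T f = inner ℂ (vacuum m hθ) (T (vacuum m hθ)) • f := by
  have hW := schrodinger_isWeylSystem (m := m) hθ
  have h : T = inner ℂ (vacuum m hθ) (T (vacuum m hθ)) • ContinuousLinearMap.id ℂ (L2 m) :=
    ext_coherent hθ fun z => by
      have h1 := hW.intertwine_proj hW T hT (vacuum m hθ)
      rw [proj_vacuum hθ, schrodinger_proj hθ] at h1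
      rw [hT]
      nth_rw 1 [h1]
      simp
  nth_rw 1 [h]
  simp

end Schrodinger

/-! ### Averaging over a vector group -/

section Mean

open scoped BoundedContinuousFunction
open Filter Topology

variable {Z : Type*} [NormedAddCommGroup Z] [InnerProductSpace ℝ Z]
  [FiniteDimensional ℝ Z] [MeasurableSpace Z] [BorelSpace Z]

/-- The kernel `(1 + ‖z‖ / (n + 1))^{-(dim Z + 1)}`. -/
noncomputable def spreadKernel (Z : Type*) [NormedAddCommGroup Z] [InnerProductSpace ℝ Z]
    (n : ℕ) (z : Z) : ℝ :=
  ((1 + ‖z‖ / (n + 1)) ^ (Module.finrank ℝ Z + 1))⁻¹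

omit [FiniteDimensional ℝ Z] [MeasurableSpace Z] [BorelSpace Z] in
theorem spreadKernel_pos (n : ℕ) (z : Z) : 0 < spreadKernel Z n z := by
  unfold spreadKernel
  positivity

omit [FiniteDimensional ℝ Z] [MeasurableSpace Z] [BorelSpace Z] in
theorem continuous_spreadKernel (n : ℕ) : Continuous (spreadKernel Z n) := by
  unfold spreadKernel
  exact Continuous.inv₀ (by fun_prop) fun z => by positivity

theorem integrable_spreadKernel (n : ℕ) : Integrable (spreadKernel Z n) := by
  have h := integrable_one_add_norm (E := Z) (μ := volume)
    (r := ((Module.finrank ℝ Z + 1 : ℕ) : ℝ)) (by push_cast; linarith)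
  have h2 := h.comp_smul (R := ((n : ℝ) + 1)⁻¹) (by positivity)
  refine h2.congr (Filter.Eventually.of_forall fun z => ?_)
  simp only [spreadKernel]
  rw [Real.rpow_neg (by positivity), Real.rpow_natCast, norm_smul,
    Real.norm_of_nonneg (by positivity), inv_mul_eq_div]

theorem integral_spreadKernel_pos (n : ℕ) : 0 < ∫ z, spreadKernel Z n z := by
  rw [integral_pos_iff_support_of_nonneg (fun _ => (spreadKernel_pos n _).le)
    (integrable_spreadKernel n)]
  have : Function.support (spreadKernel Z n) = Set.univ := by
    ext z; simp [(spreadKernel_pos n z).ne']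
  rw [this]
  exact isOpen_univ.measure_pos _ Set.univ_nonempty

omit [FiniteDimensional ℝ Z] [MeasurableSpace Z] [BorelSpace Z] in
theorem spreadKernel_sub_le (n : ℕ) (z w : Z) : spreadKernel Z n (z - w) ≤
    (1 + ‖w‖ / (n + 1)) ^ (Module.finrank ℝ Z + 1) * spreadKernel Z n z := by
  unfold spreadKernel
  rw [← div_eq_mul_inv, inv_le_comm₀ (by positivity) (by positivity), inv_div,
    div_le_iff₀ (by positivity), ← mul_pow]
  refine pow_le_pow_left₀ (by positivity) ?_ _
  have h : ‖z‖ ≤ ‖z - w‖ + ‖w‖ := by simpa using norm_add_le (z - w) w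
  have h2 : ‖z‖ / (n + 1) ≤ ‖z - w‖ / (n + 1) + ‖w‖ / (n + 1) := by
    rw [← add_div]; gcongr
  nlinarith [mul_nonneg (div_nonneg (norm_nonneg (z - w)) (by positivity : (0 : ℝ) ≤ n + 1))
    (div_nonneg (norm_nonneg w) (by positivity : (0 : ℝ) ≤ n + 1))]

omit [FiniteDimensional ℝ Z] [MeasurableSpace Z] [BorelSpace Z] in
theorem abs_spreadKernel_sub_le (n : ℕ) (z w : Z) :
    |spreadKernel Z n (z - w) - spreadKernel Z n z| ≤
    ((1 + ‖w‖ / (n + 1)) ^ (Module.finrank ℝ Z + 1) - 1) * spreadKernel Z n z := by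
  have h1 := spreadKernel_sub_le n z w
  have h2 := spreadKernel_sub_le n (z - w) (-w)
  rw [sub_neg_eq_add, sub_add_cancel, norm_neg] at h2
  have h3 := spreadKernel_pos n z
  set l := (1 + ‖w‖ / ((n : ℝ) + 1)) ^ (Module.finrank ℝ Z + 1) with hl
  have h4 : 1 ≤ l := one_le_pow₀ (by have : 0 ≤ ‖w‖ / ((n : ℝ) + 1) := by positivity
                                     linarith)
  rw [abs_le]
  constructor
  · by_contra! h
    have h5 : spreadKernel Z n (z - w) < (2 - l) * spreadKernel Z n z := by linarith
    nlinarith [mul_lt_mul_of_pos_left h5 (by linarith : 0 < l),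
      mul_nonneg (sq_nonneg (l - 1)) h3.le]
  · linarith

/-- The normalized average against the spread kernel. -/
noncomputable def spreadAvg (n : ℕ) (F : Z →ᵇ ℂ) : ℂ :=
  ((∫ z, spreadKernel Z n z)⁻¹ : ℝ) • ∫ z, spreadKernel Z n z • F z

theorem integrable_spreadKernel_smul (n : ℕ) (F : Z →ᵇ ℂ) :
    Integrable fun z => spreadKernel Z n z • F z := by
  refine ((integrable_spreadKernel n).mul_const ‖F‖).mono'
    ((continuous_spreadKernel n).smul F.continuous).aestronglyMeasurable
    (Filter.Eventually.of_forall fun z => ?_)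
  rw [norm_smul, Real.norm_of_nonneg (spreadKernel_pos n z).le]
  exact mul_le_mul_of_nonneg_left (F.norm_coe_le_norm z) (spreadKernel_pos n z).le

theorem norm_spreadAvg_le (n : ℕ) (F : Z →ᵇ ℂ) : ‖spreadAvg n F‖ ≤ ‖F‖ := by
  have h := integral_spreadKernel_pos (Z := Z) n
  rw [spreadAvg, norm_smul, norm_inv, Real.norm_of_nonneg h.le, inv_mul_le_iff₀ h,
    ← integral_mul_const]
  refine norm_integral_le_of_norm_le ((integrable_spreadKernel n).mul_const _)
    (Filter.Eventually.of_forall fun z => ?_)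
  rw [norm_smul, Real.norm_of_nonneg (spreadKernel_pos n z).le]
  exact mul_le_mul_of_nonneg_left (F.norm_coe_le_norm z) (spreadKernel_pos n z).le

theorem le_re_spreadAvg (n : ℕ) (F : Z →ᵇ ℂ) {a : ℝ} (h : ∀ z, a ≤ (F z).re) :
    a ≤ (spreadAvg n F).re := by
  have hp := integral_spreadKernel_pos (Z := Z) n
  rw [spreadAvg, Complex.smul_re, smul_eq_mul, ← div_eq_inv_mul, le_div_iff₀ hp,
    mul_comm, ← integral_mul_const]
  have h1 := integral_re (𝕜 := ℂ) (integrable_spreadKernel_smul n F)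
  simp only [RCLike.re_to_complex] at h1
  rw [← h1]
  refine integral_mono ((integrable_spreadKernel n).mul_const _)
    (integrable_spreadKernel_smul n F).re fun z => ?_
  simp only [Complex.smul_re, smul_eq_mul]
  exact mul_le_mul_of_nonneg_left (h z) (spreadKernel_pos n z).le

theorem tendsto_spreadAvg_sub (F G : Z →ᵇ ℂ) (w : Z) (h : ∀ z, G z = F (z + w)) :
    Tendsto (fun n => spreadAvg n G - spreadAvg n F) atTop (𝓝 0) := by
  have hb : ∀ n, ‖spreadAvg n G - spreadAvg n F‖ ≤
      ((1 + ‖w‖ / ((n : ℝ) + 1)) ^ (Module.finrank ℝ Z + 1) - 1) * ‖F‖ := by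
    intro n
    have hp := integral_spreadKernel_pos (Z := Z) n
    have h1 : ∫ z, spreadKernel Z n z • G z = ∫ z, spreadKernel Z n (z - w) • F z := by
      rw [← integral_add_right_eq_self (fun z => spreadKernel Z n (z - w) • F z) w]
      simp only [add_sub_cancel_right, h]
    have hi : Integrable fun z => spreadKernel Z n (z - w) • F z := by
      have := (integrable_spreadKernel_smul n G).comp_sub_right w
      simpa [h] using this
    rw [spreadAvg, spreadAvg, h1, ← smul_sub, ← integral_sub hi (integrable_spreadKernel_smul n F),
      norm_smul, norm_inv, Real.norm_of_nonneg hp.le, inv_mul_le_iff₀ hp, mul_comm (∫ z, _),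
      mul_assoc, ← integral_const_mul, ← integral_const_mul]
    refine norm_integral_le_of_norm_le (((integrable_spreadKernel n).const_mul _).const_mul _)
      (Filter.Eventually.of_forall fun z => ?_)
    rw [← sub_smul, norm_smul]
    have h2 := abs_spreadKernel_sub_le n z w
    rw [← Real.norm_eq_abs] at h2
    calc _ ≤ _ := mul_le_mul h2 (F.norm_coe_le_norm z) (norm_nonneg _) ((norm_nonneg _).trans h2)
      _ = _ := by ring
  refine squeeze_zero_norm hb ?_
  have h0 : Tendsto (fun n : ℕ => ‖w‖ / ((n : ℝ) + 1)) atTop (𝓝 0) :=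
    tendsto_const_nhds.div_atTop (tendsto_natCast_atTop_atTop.atTop_add tendsto_const_nhds)
  have h1 := (((h0.const_add 1).pow (Module.finrank ℝ Z + 1)).sub_const 1).mul_const ‖F‖
  simpa using h1

/-- A translation invariant mean on bounded continuous functions. -/
theorem exists_invariant_mean (Z : Type*) [NormedAddCommGroup Z] [InnerProductSpace ℝ Z]
    [FiniteDimensional ℝ Z] [MeasurableSpace Z] [BorelSpace Z] :
    ∃ M : (Z →ᵇ ℂ) →ₗ[ℂ] ℂ,
      (∀ F G : Z →ᵇ ℂ, ∀ w, (∀ z, G z = F (z + w)) → M G = M F) ∧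
      (∀ F : Z →ᵇ ℂ, ∀ a : ℝ, (∀ z, a ≤ (F z).re) → a ≤ (M F).re) ∧
      (∀ F G : Z →ᵇ ℂ, (∀ z, G z = conj (F z)) → M G = conj (M F)) ∧
      ∀ F, ‖M F‖ ≤ ‖F‖ := by
  have hlim : ∀ F : Z →ᵇ ℂ, ∃ L, Tendsto (fun n => spreadAvg n F) (hyperfilter ℕ) (𝓝 L) := by
    intro F
    obtain ⟨L, -, hL⟩ := (isCompact_closedBall (0 : ℂ) ‖F‖).ultrafilter_le_nhds
      ((hyperfilter ℕ).map fun n => spreadAvg n F) (by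
        rw [le_principal_iff, Ultrafilter.mem_coe, Ultrafilter.mem_map]
        exact Filter.univ_mem' fun n => by simpa using norm_spreadAvg_le n F)
    exact ⟨L, hL⟩
  choose L hL using hlim
  refine ⟨{ toFun := L, map_add' := fun F G => ?_, map_smul' := fun a F => ?_ }, ?_, ?_, ?_, ?_⟩
  · refine tendsto_nhds_unique (hL _) (((hL F).add (hL G)).congr fun n => ?_)
    rw [spreadAvg, spreadAvg, spreadAvg, ← smul_add,
      ← integral_add (integrable_spreadKernel_smul n F) (integrable_spreadKernel_smul n G)]
    simp
  · refine tendsto_nhds_unique (hL _) (((hL F).const_mul a).congr fun n => ?_)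
    rw [spreadAvg, spreadAvg, ← smul_eq_mul, smul_comm, ← integral_smul]
    simp only [BoundedContinuousFunction.coe_smul, smul_comm a]
  · intro F G w h
    have h1 := (tendsto_spreadAvg_sub F G w h).mono_left
      (Nat.hyperfilter_le_atTop)
    exact sub_eq_zero.1 (tendsto_nhds_unique ((hL G).sub (hL F)) h1)
  · intro F a h
    exact ge_of_tendsto ((Complex.continuous_re.tendsto _).comp (hL F))
      (Filter.Eventually.of_forall fun n => le_re_spreadAvg n F h)
  · intro F G h
    refine tendsto_nhds_unique (hL G) (((Complex.continuous_conj.tendsto _).comp (hL F)).congr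
      fun n => ?_)
    simp only [Function.comp_apply, spreadAvg, Complex.real_smul, map_mul, Complex.conj_ofReal]
    rw [← integral_conj]
    simp [h]
  · intro F
    exact le_of_tendsto (hL F).norm (Filter.Eventually.of_forall fun n => norm_spreadAvg_le n F)

end Mean

/-! ### Scalar products -/

/-- A hermitian scalar product on `H` whose norm is equivalent to that of `H`. -/
structure IsScalarProduct {H : Type*} [NormedAddCommGroup H] [NormedSpace ℂ H]
    (B : H →ₗ⋆[ℂ] H →ₗ[ℂ] ℂ) : Prop where
  conj_symm : ∀ x y, conj (B x y) = B y x
  bounds : ∃ c C : ℝ, 0 < c ∧ ∀ x, c * ‖x‖ ^ 2 ≤ (B x x).re ∧ (B x x).re ≤ C * ‖x‖ ^ 2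

namespace IsScalarProduct

variable {H : Type u} [NormedAddCommGroup H] [NormedSpace ℂ H] {B : H →ₗ⋆[ℂ] H →ₗ[ℂ] ℂ}

/-- The space `H`, to be normed by a scalar product. -/
def HilbertCopy (_ : IsScalarProduct B) : Type u := H

noncomputable instance (hB : IsScalarProduct B) : AddCommGroup hB.HilbertCopy :=
  inferInstanceAs (AddCommGroup H)

noncomputable instance (hB : IsScalarProduct B) : Module ℂ hB.HilbertCopy :=
  inferInstanceAs (Module ℂ H)

/-- The identity map to the normed copy. -/
noncomputable def toCopy (hB : IsScalarProduct B) : H ≃ₗ[ℂ] hB.HilbertCopy := LinearEquiv.refl ℂ H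

/-- The positive definite structure of a scalar product. -/
@[reducible] noncomputable def core (hB : IsScalarProduct B) :
    InnerProductSpace.Core ℂ hB.HilbertCopy where
  inner x y := B (hB.toCopy.symm x) (hB.toCopy.symm y)
  conj_inner_symm x y := hB.conj_symm _ _
  re_inner_nonneg x := by
    obtain ⟨c, C, hc, h⟩ := hB.bounds
    exact (by positivity : 0 ≤ c * ‖hB.toCopy.symm x‖ ^ 2).trans (h _).1
  add_left x y z := by simp
  smul_left x y r := by simp
  definite x hx := by
    obtain ⟨c, C, hc, h⟩ := hB.bounds
    have h1 := (h (hB.toCopy.symm x)).1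
    rw [show B (hB.toCopy.symm x) (hB.toCopy.symm x) = 0 from hx, Complex.zero_re] at h1
    have h2 : ‖hB.toCopy.symm x‖ ^ 2 ≤ 0 := by
      by_contra! h2
      linarith [mul_pos hc h2]
    simpa using pow_eq_zero_iff two_ne_zero |>.1 (le_antisymm h2 (sq_nonneg _))

noncomputable instance (hB : IsScalarProduct B) : NormedAddCommGroup hB.HilbertCopy :=
  hB.core.toNormedAddCommGroup

noncomputable instance (hB : IsScalarProduct B) : InnerProductSpace ℂ hB.HilbertCopy :=
  InnerProductSpace.ofCore hB.core.toCore

theorem inner_toCopy (hB : IsScalarProduct B) (x y : H) :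
    inner ℂ (hB.toCopy x) (hB.toCopy y) = B x y := rfl

/-- The Hilbert space of a scalar product. -/
theorem exists_hilbert (hB : IsScalarProduct B) :
    ∃ (K : Type u) (_ : NormedAddCommGroup K) (_ : InnerProductSpace ℂ K) (e : H ≃L[ℂ] K),
      ∀ x y, inner ℂ (e x) (e y) = B x y := by
  obtain ⟨c, C, hc, h⟩ := hB.bounds
  have hn : ∀ x : H, ‖hB.toCopy x‖ ^ 2 = (B x x).re := fun x => by
    rw [← @inner_self_eq_norm_sq ℂ, inner_toCopy]
    rfl
  refine ⟨hB.HilbertCopy, inferInstance, inferInstance,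
    hB.toCopy.toContinuousLinearEquivOfBounds (Real.sqrt C) (Real.sqrt c⁻¹) (fun x => ?_)
      (fun x => ?_), fun x y => hB.inner_toCopy x y⟩
  · refine (Real.le_sqrt_of_sq_le (y := C * ‖x‖ ^ 2) ?_).trans (le_of_eq ?_)
    · rw [hn]; exact (h x).2
    · rw [Real.sqrt_mul' _ (sq_nonneg _), Real.sqrt_sq (norm_nonneg _)]
  · have h1 := (h (hB.toCopy.symm x)).1
    rw [← hn, LinearEquiv.apply_symm_apply] at h1
    refine (Real.le_sqrt_of_sq_le (y := c⁻¹ * ‖x‖ ^ 2) ?_).trans (le_of_eq ?_)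
    · rwa [← div_eq_inv_mul, le_div_iff₀' hc]
    · rw [Real.sqrt_mul' _ (sq_nonneg _), Real.sqrt_sq (norm_nonneg _)]

/-- The Cauchy–Schwarz bound. -/
theorem exists_norm_le (hB : IsScalarProduct B) : ∃ C : ℝ, 0 ≤ C ∧
    ∀ x y, ‖B x y‖ ≤ C * ‖x‖ * ‖y‖ := by
  obtain ⟨K, _, _, e, he⟩ := hB.exists_hilbert
  refine ⟨‖(e : H →L[ℂ] K)‖ * ‖(e : H →L[ℂ] K)‖, by positivity, fun x y => ?_⟩
  rw [← he]
  calc _ ≤ ‖e x‖ * ‖e y‖ := norm_inner_le_norm _ _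
    _ ≤ (‖(e : H →L[ℂ] K)‖ * ‖x‖) * (‖(e : H →L[ℂ] K)‖ * ‖y‖) :=
      mul_le_mul ((e : H →L[ℂ] K).le_opNorm x) ((e : H →L[ℂ] K).le_opNorm y) (norm_nonneg _)
        (by positivity)
    _ = _ := by ring

theorem continuous (hB : IsScalarProduct B) : Continuous fun p : H × H => B p.1 p.2 := by
  obtain ⟨K, _, _, e, he⟩ := hB.exists_hilbert
  simp_rw [← he]
  fun_prop

/-- A bounded Weyl system admits an invariant scalar product, obtained by averaging. -/
theorem exists_invariant {Z : Type*} [NormedAddCommGroup Z] [InnerProductSpace ℝ Z]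
    [FiniteDimensional ℝ Z] {c : ℝ} {K : Z →ₗᵢ[ℝ] Z} {W : Z → H →L[ℂ] H}
    (hB : IsScalarProduct B) (hW : IsWeylSystem c K W) :
    ∃ B' : H →ₗ⋆[ℂ] H →ₗ[ℂ] ℂ, IsScalarProduct B' ∧ (∀ z x y, B' (W z x) (W z y) = B' x y) ∧
      ∀ x y, (∀ z, B (W z x) (W z y) = 0) → B' x y = 0 := by
  let _ : MeasurableSpace Z := borel Z
  have : BorelSpace Z := ⟨rfl⟩
  obtain ⟨M, hM1, hM2, hM3, hM4⟩ := exists_invariant_mean Z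
  obtain ⟨A, hA, hA'⟩ := hB.exists_norm_le
  obtain ⟨D, hD, hD'⟩ := hW.exists_bound
  have hbd : ∀ x y z, ‖B (W z x) (W z y)‖ ≤ A * (D * ‖x‖) * (D * ‖y‖) := fun x y z =>
    (hA' _ _).trans (mul_le_mul (mul_le_mul_of_nonneg_left (hD' _ _) hA) (hD' _ _) (norm_nonneg _)
      (by positivity))
  let F : H → H → BoundedContinuousFunction Z ℂ := fun x y =>
    BoundedContinuousFunction.ofNormedAddCommGroup (fun z => B (W z x) (W z y))
      (hB.continuous.comp ((hW.cont x).prodMk (hW.cont y))) _ (hbd x y)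
  have hF : ∀ x y z, F x y z = B (W z x) (W z y) := fun _ _ _ => rfl
  let B' : H →ₗ⋆[ℂ] H →ₗ[ℂ] ℂ := LinearMap.mk₂'ₛₗ (starRingEnd ℂ) (RingHom.id ℂ)
    (fun x y => M (F x y))
    (fun x x' y => by
      rw [← map_add]; congr 1; ext z; simp [hF])
    (fun a x y => by
      rw [← map_smul]; congr 1; ext z; simp [hF])
    (fun x y y' => by
      rw [← map_add]; congr 1; ext z; simp [hF])
    (fun a x y => by
      rw [RingHom.id_apply, ← map_smul]; congr 1; ext z; simp [hF])
  have hB' : ∀ x y, B' x y = M (F x y) := fun _ _ => rfl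
  refine ⟨B', ⟨fun x y => ?_, ?_⟩, fun w x y => ?_, fun x y h => ?_⟩
  · rw [hB', hB', hM3 (F x y) (F y x) fun z => by rw [hF, hF, hB.conj_symm]]
  · obtain ⟨b, C, hb, h⟩ := hB.bounds
    refine ⟨b / (D + 1) ^ 2, A * D * D, by positivity, fun x => ⟨?_, ?_⟩⟩
    · refine hM2 _ _ fun z => ?_
      rw [hF]
      refine le_trans ?_ (h _).1
      rw [div_mul_eq_mul_div, div_le_iff₀ (by positivity), mul_assoc, ← mul_pow]
      refine mul_le_mul_of_nonneg_left (pow_le_pow_left₀ (norm_nonneg _) ?_ _) hb.le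
      have := hD' (-z) (W z x)
      rw [hW.neg_apply] at this
      nlinarith [norm_nonneg (W z x)]
    · refine (Complex.re_le_norm _).trans ((hM4 _).trans ?_)
      refine (BoundedContinuousFunction.norm_le (by positivity)).2 fun z => ?_
      refine (hbd x x z).trans (le_of_eq ?_)
      ring
  · refine hM1 _ _ w fun z => ?_
    rw [hF, hF, hW.mul, hW.mul]
    simp only [map_smulₛₗ, LinearMap.smul_apply, smul_eq_mul, RingHom.id_apply]
    rw [← mul_assoc, ← Complex.exp_conj, ← Complex.exp_add]
    simp
  · rw [hB', show F x y = 0 from by ext z; exact h z, map_zero]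

end IsScalarProduct

/-! ### Unitary Weyl systems on Hilbert spaces -/

/-- A Weyl system over the phase space, by isometries of a Hilbert space. -/
structure IsUnitaryWeyl {m : ℕ} {H : Type*} [NormedAddCommGroup H] [InnerProductSpace ℂ H]
    (θ : ℝ) (W : PhaseSpace m → H →L[ℂ] H) : Prop where
  ne : θ ≠ 0
  weyl : IsWeylSystem θ⁻¹ (phaseRot m) W
  isom : ∀ z x, ‖W z x‖ = ‖x‖

namespace IsUnitaryWeyl

variable {m : ℕ} {H : Type*} [NormedAddCommGroup H] [InnerProductSpace ℂ H]
  {θ : ℝ} {W : PhaseSpace m → H →L[ℂ] H}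

theorem inner_map (hW : IsUnitaryWeyl θ W) (z : PhaseSpace m) (x y : H) :
    inner ℂ (W z x) (W z y) = inner ℂ x y :=
  (⟨(W z).toLinearMap, hW.isom z⟩ : H →ₗᵢ[ℂ] H).inner_map_map x y

/-- The coherent state `W(z) Ω` of `L²`. -/
noncomputable def coherent (hW : IsUnitaryWeyl θ W) (z : PhaseSpace m) : L2 m :=
  schrodinger θ (phaseBody z) (vacuum m hW.ne)

theorem denseRange_coherent (hW : IsUnitaryWeyl θ W) :
    DenseRange (Finsupp.linearCombination ℂ hW.coherent) := by
  rw [DenseRange, ← LinearMap.coe_range, Finsupp.range_linearCombination,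
    Submodule.dense_iff_topologicalClosure_eq_top]
  exact span_coherent_dense hW.ne

theorem ext_lift (hW : IsUnitaryWeyl θ W) {E : Type*} [NormedAddCommGroup E] [NormedSpace ℂ E]
    {S T : L2 m →L[ℂ] E} (h : ∀ z, S (hW.coherent z) = T (hW.coherent z)) : S = T :=
  ext_coherent hW.ne h

theorem schrodinger_coherent (hW : IsUnitaryWeyl θ W) (z w : PhaseSpace m) :
    schrodinger θ (phaseBody z) (hW.coherent w) =
      Complex.exp (Complex.I * (θ⁻¹ * ⟪phaseRot m z, w⟫ : ℝ)) • hW.coherent (z + w) :=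
  body_add (schrodinger_mul θ) (schrodinger_central θ) z w _

variable [CompleteSpace H]

/-- The Gaussian projection onto the vacuum vectors. -/
noncomputable def P (hW : IsUnitaryWeyl θ W) : H →L[ℂ] H := hW.weyl.proj

theorem P_P (hW : IsUnitaryWeyl θ W) (x : H) : hW.P (hW.P x) = hW.P x := hW.weyl.proj_proj x

theorem inner_P (hW : IsUnitaryWeyl θ W) (x y : H) :
    inner ℂ (hW.P x) y = inner ℂ x (hW.P y) := inner_proj hW.weyl hW.inner_map x y

/-- Invariant forms have the matrix coefficients of the Schrödinger representation. -/
theorem form_orbit (hW : IsUnitaryWeyl θ W) (B : H →L⋆[ℂ] H →L[ℂ] ℂ)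
    (hB : ∀ z x y, B (W z x) (W z y) = B x y) (z w : PhaseSpace m) (x y : H) :
    B (W z (hW.P x)) (W w (hW.P y)) =
      inner ℂ (hW.coherent z) (hW.coherent w) * B (hW.P x) (hW.P y) := by
  have h1 : B (hW.P x) (W (w - z) (hW.P y)) = (gauss θ⁻¹ (w - z) : ℂ) * B (hW.P x) (hW.P y) := by
    nth_rw 1 [← hW.P_P x]
    rw [P, hW.weyl.form_proj B hB, hW.weyl.proj_mul_proj, ← Complex.coe_smul, map_smul, smul_eq_mul]
  rw [coherent, coherent, inner_coherent, ← hB (-z), hW.weyl.neg_apply, hW.weyl.mul, map_smul,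
    neg_add_eq_sub, h1, smul_eq_mul, mul_assoc]

theorem inner_linearCombination (hW : IsUnitaryWeyl θ W) (x : H) (a b : PhaseSpace m →₀ ℂ) :
    inner ℂ (Finsupp.linearCombination ℂ (fun z => W z (hW.P x)) a)
      (Finsupp.linearCombination ℂ (fun z => W z (hW.P x)) b) =
    inner ℂ (Finsupp.linearCombination ℂ hW.coherent a)
      (Finsupp.linearCombination ℂ hW.coherent b) * inner ℂ (hW.P x) (hW.P x) := by
  simp only [Finsupp.linearCombination_apply, Finsupp.sum, sum_inner, inner_sum, inner_smul_left,
    inner_smul_right, Finset.sum_mul, Finset.mul_sum]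
  refine Finset.sum_congr rfl fun i _ => Finset.sum_congr rfl fun j _ => ?_
  rw [show inner ℂ (W j (hW.P x)) (W i (hW.P x)) = _ from
    hW.form_orbit (innerSL ℂ) hW.inner_map j i x x]
  simp only [innerSL_apply_apply]
  ring

theorem norm_linearCombination (hW : IsUnitaryWeyl θ W) (x : H) (a : PhaseSpace m →₀ ℂ) :
    ‖Finsupp.linearCombination ℂ (fun z => W z (hW.P x)) a‖ =
      ‖hW.P x‖ * ‖Finsupp.linearCombination ℂ hW.coherent a‖ := by
  have h := hW.inner_linearCombination x a a
  simp only [inner_self_eq_norm_sq_to_K] at h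
  have h2 : ‖Finsupp.linearCombination ℂ (fun z => W z (hW.P x)) a‖ ^ 2 =
      (‖hW.P x‖ * ‖Finsupp.linearCombination ℂ hW.coherent a‖) ^ 2 := by
    apply Complex.ofReal_injective
    push_cast at h ⊢
    rw [mul_pow, mul_comm (_ ^ 2)]
    exact h
  exact (sq_eq_sq₀ (norm_nonneg _) (by positivity)).1 h2

/-- The intertwiner `L² → H` that maps the vacuum to `P x`. -/
noncomputable def lift (hW : IsUnitaryWeyl θ W) (x : H) : L2 m →L[ℂ] H :=
  (Finsupp.linearCombination ℂ fun z => W z (hW.P x)).extendOfNorm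
    (Finsupp.linearCombination ℂ hW.coherent)

theorem lift_coherent (hW : IsUnitaryWeyl θ W) (x : H) (z : PhaseSpace m) :
    hW.lift x (hW.coherent z) = W z (hW.P x) := by
  have h := LinearMap.extendOfNorm_eq hW.denseRange_coherent
    ⟨‖hW.P x‖, fun a => (hW.norm_linearCombination x a).le⟩ (Finsupp.single z 1)
  simpa [lift] using h

theorem lift_add (hW : IsUnitaryWeyl θ W) (x y : H) :
    hW.lift (x + y) = hW.lift x + hW.lift y :=
  hW.ext_lift fun z => by simp [lift_coherent]

theorem lift_smul (hW : IsUnitaryWeyl θ W) (a : ℂ) (x : H) :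
    hW.lift (a • x) = a • hW.lift x :=
  hW.ext_lift fun z => by simp [lift_coherent]

theorem lift_schrodinger (hW : IsUnitaryWeyl θ W) (x : H) (z : PhaseSpace m) (f : L2 m) :
    hW.lift x (schrodinger θ (phaseBody z) f) = W z (hW.lift x f) := by
  have h : hW.lift x ∘L schrodinger θ (phaseBody z) = W z ∘L hW.lift x := hW.ext_lift fun w => by
    simp only [ContinuousLinearMap.comp_apply]
    rw [schrodinger_coherent, map_smul, lift_coherent, lift_coherent, hW.weyl.mul]
  exact DFunLike.congr_fun h f

theorem form_lift (hW : IsUnitaryWeyl θ W) (B : H →L⋆[ℂ] H →L[ℂ] ℂ)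
    (hB : ∀ z x y, B (W z x) (W z y) = B x y) (x y : H) (f g : L2 m) :
    B (hW.lift x f) (hW.lift y g) = inner ℂ f g * B (hW.P x) (hW.P y) := by
  have h1 : ∀ z, B (W z (hW.P x)) ∘L hW.lift y
      = B (hW.P x) (hW.P y) • innerSL ℂ (hW.coherent z) := fun z => hW.ext_lift fun w => by
    simp only [ContinuousLinearMap.comp_apply, lift_coherent, smul_apply,
      innerSL_apply_apply, smul_eq_mul]
    rw [form_orbit _ _ hB, mul_comm]
  let L : L2 m →L[ℂ] ℂ :=
    { toFun := fun f => conj (B (hW.lift x f) (hW.lift y g))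
      map_add' := fun a b => by simp
      map_smul' := fun a b => by simp
      cont := Complex.continuous_conj.comp
        ((B.flip (hW.lift y g)).continuous.comp (hW.lift x).continuous) }
  have h2 : L = conj (B (hW.P x) (hW.P y)) • innerSL ℂ g := hW.ext_lift fun z => by
    have h3 := DFunLike.congr_fun (h1 z) g
    simp only [ContinuousLinearMap.comp_apply, smul_apply,
      innerSL_apply_apply, smul_eq_mul] at h3 ⊢
    change conj (B (hW.lift x (hW.coherent z)) (hW.lift y g)) = _
    rw [lift_coherent, h3, map_mul, inner_conj_symm]
  have h4 := congrArg conj (DFunLike.congr_fun h2 f)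
  simp only [smul_apply, innerSL_apply_apply, smul_eq_mul, map_mul,
    Complex.conj_conj, inner_conj_symm] at h4
  rw [mul_comm, ← h4]
  exact (Complex.conj_conj _).symm

theorem inner_lift (hW : IsUnitaryWeyl θ W) (x y : H) (f g : L2 m) :
    inner ℂ (hW.lift x f) (hW.lift y g) = inner ℂ f g * inner ℂ (hW.P x) y := by
  rw [show inner ℂ (hW.lift x f) (hW.lift y g) = _ from
    hW.form_lift (innerSL ℂ) hW.inner_map x y f g, innerSL_apply_apply, ← hW.inner_P, P_P]

/-- The canonical map from the algebraic tensor product. -/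
noncomputable def tensorMap (hW : IsUnitaryWeyl θ W) : TensorProduct ℂ H (L2 m) →ₗ[ℂ] H :=
  TensorProduct.lift
    { toFun := fun x => (hW.lift x).toLinearMap
      map_add' := fun x y => by rw [lift_add]; rfl
      map_smul' := fun a x => by rw [lift_smul]; rfl }

theorem tensorMap_tmul (hW : IsUnitaryWeyl θ W) (x : H) (f : L2 m) :
    hW.tensorMap (x ⊗ₜ f) = hW.lift x f := by
  simp [tensorMap]

theorem dense_span_lift (hW : IsUnitaryWeyl θ W) :
    Dense (Submodule.span ℂ (Set.range fun p : H × L2 m => hW.lift p.1 p.2) : Set H) := by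
  intro x
  rw [← Submodule.topologicalClosure_coe]
  refine (Submodule.topologicalClosure_mono (Submodule.span_mono ?_)) (hW.weyl.mem_closure_span x)
  rintro _ ⟨w, rfl⟩
  exact ⟨(W (-w) x, hW.coherent w), by simp only [lift_coherent]; rfl⟩

theorem denseRange_tensorMap (hW : IsUnitaryWeyl θ W) : DenseRange hW.tensorMap := by
  refine hW.dense_span_lift.mono ?_
  rw [← LinearMap.coe_range, SetLike.coe_subset_coe, Submodule.span_le]
  rintro _ ⟨p, rfl⟩
  exact ⟨p.1 ⊗ₜ p.2, hW.tensorMap_tmul _ _⟩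

theorem star_P (hW : IsUnitaryWeyl θ W) : star hW.P = hW.P := by
  rw [ContinuousLinearMap.star_eq_adjoint, ← ContinuousLinearMap.isSelfAdjoint_iff',
    ContinuousLinearMap.isSelfAdjoint_iff_isSymmetric]
  exact hW.inner_P

theorem norm_tensorMap_rTensor_le (hW : IsUnitaryWeyl θ W) (A : H →L[ℂ] H)
    (hA : Commute A hW.P) (t : TensorProduct ℂ H (L2 m)) :
    ‖hW.tensorMap (A.toLinearMap.rTensor (L2 m) t)‖ ≤ ‖A‖ * ‖hW.tensorMap t‖ := by
  have hA' : Commute (star A) hW.P := by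
    have h := hA.star_star
    rwa [hW.star_P] at h
  set D : H →L[ℂ] H := algebraMap ℝ (H →L[ℂ] H) (‖A‖ ^ 2) - star A * A with hD
  have hD0 : 0 ≤ D := sub_nonneg.2 CStarAlgebra.star_mul_le_algebraMap_norm_sq
  have hBB : CFC.sqrt D * CFC.sqrt D = D := CFC.sqrt_mul_sqrt_self D hD0
  have hBs : star (CFC.sqrt D) = CFC.sqrt D := (IsSelfAdjoint.of_nonneg (CFC.sqrt_nonneg D)).star_eq
  have hDP : Commute D hW.P :=
    (Algebra.commute_algebraMap_left _ _).sub_left (hA'.mul_left hA)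
  have hBP : Commute (CFC.sqrt D) hW.P := hDP.cfcₙ_nnreal _
  generalize CFC.sqrt D = B at hBB hBs hBP
  have hPB : ∀ x, hW.P (B x) = B (hW.P x) := fun x => (DFunLike.congr_fun hBP.eq x).symm
  have hPA : ∀ x, hW.P (A x) = A (hW.P x) := fun x => (DFunLike.congr_fun hA.eq x).symm
  have hinner : ∀ (T : H →L[ℂ] H) x y, inner ℂ (T x) (T y) = inner ℂ ((star T * T) x) y :=
    fun T x y => by
      rw [ContinuousLinearMap.star_eq_adjoint]
      exact (ContinuousLinearMap.adjoint_inner_left T y (T x)).symm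
  have key : ∀ s t : TensorProduct ℂ H (L2 m),
      ((‖A‖ : ℂ) ^ 2) * inner ℂ (hW.tensorMap s) (hW.tensorMap t)
      - inner ℂ (hW.tensorMap (A.toLinearMap.rTensor (L2 m) s))
        (hW.tensorMap (A.toLinearMap.rTensor (L2 m) t))
      = inner ℂ (hW.tensorMap (B.toLinearMap.rTensor (L2 m) s))
        (hW.tensorMap (B.toLinearMap.rTensor (L2 m) t)) := by
    intro s t
    induction s with
    | zero => simp
    | add s s' h h' => simp only [map_add, inner_add_left, mul_add] at *; rw [← h, ← h']; ring
    | tmul x f =>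
      induction t with
      | zero => simp
      | add s s' h h' => simp only [map_add, inner_add_right, mul_add] at *; rw [← h, ← h']; ring
      | tmul y g =>
        simp only [LinearMap.rTensor_tmul, tensorMap_tmul, inner_lift,
          ContinuousLinearMap.coe_coe]
        rw [hPA, hPB, hinner, hinner, hBs, hBB, hD, sub_apply, inner_sub_left,
          Algebra.algebraMap_eq_smul_one, smul_apply, one_apply_eq_self, ← Complex.coe_smul,
          inner_smul_left]
        push_cast
        simp only [map_pow, Complex.conj_ofReal]
        ring
  have h := key t t
  simp only [inner_self_eq_norm_sq_to_K] at h
  have h2 : (‖A‖ * ‖hW.tensorMap t‖) ^ 2 - ‖hW.tensorMap (A.toLinearMap.rTensor (L2 m) t)‖ ^ 2 =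
      ‖hW.tensorMap (B.toLinearMap.rTensor (L2 m) t)‖ ^ 2 := by
    apply Complex.ofReal_injective
    push_cast at h ⊢
    rw [mul_pow]
    exact h
  refine (sq_le_sq₀ (norm_nonneg _) (by positivity)).1 ?_
  nlinarith [sq_nonneg ‖hW.tensorMap (B.toLinearMap.rTensor (L2 m) t)‖]

/-- An operator on the vacuum vectors extends to the multiplicity space of `H`. -/
theorem exists_extension (hW : IsUnitaryWeyl θ W) (A : H →L[ℂ] H) (hA : Commute A hW.P) :
    ∃ T : H →L[ℂ] H, ∀ x f, T (hW.lift x f) = hW.lift (A x) f := by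
  refine ⟨(hW.tensorMap ∘ₗ A.toLinearMap.rTensor (L2 m)).extendOfNorm hW.tensorMap,
    fun x f => ?_⟩
  have h := LinearMap.extendOfNorm_eq (f := hW.tensorMap ∘ₗ A.toLinearMap.rTensor (L2 m))
    hW.denseRange_tensorMap ⟨‖A‖, fun t => hW.norm_tensorMap_rTensor_le A hA t⟩ (x ⊗ₜ f)
  simpa [tensorMap_tmul] using h

end IsUnitaryWeyl

/-! ### Canonical anticommutation relations -/

/-- Creation operators `a` and annihilation operators `b`. -/
structure IsCAR {κ A : Type*} [DecidableEq κ] [Ring A] (a b : κ → A) : Prop where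
  aa : ∀ i j, a i * a j + a j * a i = 0
  bb : ∀ i j, b i * b j + b j * b i = 0
  ab : ∀ i j, a i * b j + b j * a i = if i = j then 1 else 0

theorem IsCAR.map {κ A B : Type*} [DecidableEq κ] [Ring A] [Ring B] {a b : κ → A}
    (h : IsCAR a b) (f : A →+* B) : IsCAR (fun i => f (a i)) (fun i => f (b i)) where
  aa i j := by rw [← map_mul, ← map_mul, ← map_add, h.aa, map_zero]
  bb i j := by rw [← map_mul, ← map_mul, ← map_add, h.bb, map_zero]
  ab i j := by
    rw [← map_mul, ← map_mul, ← map_add, h.ab]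
    split_ifs <;> simp

section Sign

variable {r : ℕ}

theorem moveSign_mul_self (j : Fin r) (I : Finset (Fin r)) : moveSign j I * moveSign j I = 1 := by
  rw [moveSign, ← mul_pow]
  simp

theorem moveSign_insert_of_not_lt {i j : Fin r} (h : ¬ i < j) (I : Finset (Fin r)) :
    moveSign j (insert i I) = moveSign j I := by
  rw [moveSign, moveSign, Finset.filter_insert, if_neg h]

theorem moveSign_insert_of_lt {i j : Fin r} (h : i < j) {I : Finset (Fin r)} (hi : i ∉ I) :
    moveSign j (insert i I) = -moveSign j I := by
  rw [moveSign, moveSign, Finset.filter_insert, if_pos h, Finset.card_insert_of_notMem (by simp [hi]),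
    pow_succ, mul_neg_one]

theorem moveSign_of_forall_le {j : Fin r} {I : Finset (Fin r)} (h : ∀ i ∈ I, j ≤ i) :
    moveSign j I = 1 := by
  rw [moveSign, Finset.filter_false_of_mem fun i hi => not_lt.2 (h i hi)]
  simp

theorem moveSign_erase_self (j : Fin r) (I : Finset (Fin r)) :
    moveSign j (I.erase j) = moveSign j I := by
  rw [moveSign, moveSign, Finset.filter_erase, Finset.erase_eq_of_notMem (by simp)]

theorem moveSign_insert_self (j : Fin r) (I : Finset (Fin r)) :
    moveSign j (insert j I) = moveSign j I := moveSign_insert_of_not_lt (lt_irrefl _) I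

end Sign

section OrderedProduct

variable {r : ℕ} {A : Type*} [Ring A]

/-- The product `a_{i₁} ⋯ a_{iₖ}` over `I = {i₁ < ⋯ < iₖ}`. -/
def orderedProd (a : Fin r → A) (I : Finset (Fin r)) : A := (I.sort.map a).prod

@[simp]
theorem orderedProd_empty (a : Fin r → A) : orderedProd a ∅ = 1 := by simp [orderedProd]

theorem orderedProd_insert {a : Fin r → A} {i : Fin r} {I : Finset (Fin r)}
    (h : ∀ j ∈ I, i < j) : orderedProd a (insert i I) = a i * orderedProd a I := by
  rw [orderedProd, orderedProd, Finset.sort_insert _ (fun b hb => (h b hb).le)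
    (fun hi => lt_irrefl i (h i hi)), List.map_cons, List.prod_cons]

variable [Algebra ℂ A] {a b : Fin r → A}

theorem mul_orderedProd (haa : ∀ i j, a i * a j + a j * a i = 0) (j : Fin r)
    (I : Finset (Fin r)) : a j * orderedProd a I =
      if j ∈ I then 0 else moveSign j I • orderedProd a (insert j I) := by
  have hsq : ∀ i, a i * a i = 0 := fun i => by
    have h := haa i i
    rw [← two_smul ℂ] at h
    simpa using h
  induction I using Finset.induction_on_min with
  | empty =>
    have h := orderedProd_insert (a := a) (i := j) (I := ∅) (by simp)
    simpa [moveSign] using h.symm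
  | insert i I hi ih =>
    have hiI : i ∉ I := fun h => lt_irrefl i (hi i h)
    rw [orderedProd_insert hi]
    rcases lt_trichotomy j i with hj | rfl | hj
    · have hjI : ∀ k ∈ insert i I, j < k := by
        intro k hk
        rcases Finset.mem_insert.1 hk with rfl | hk
        · exact hj
        · exact hj.trans (hi k hk)
      rw [if_neg (fun h => lt_irrefl j (hjI j h)), moveSign_of_forall_le fun k hk => (hjI k hk).le,
        one_smul, orderedProd_insert hjI, orderedProd_insert hi]
    · simp [← mul_assoc, hsq]
    · rw [← mul_assoc, eq_neg_of_add_eq_zero_left (haa j i), neg_mul, mul_assoc, ih]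
      by_cases hjI : j ∈ I
      · simp [hjI]
      · rw [if_neg hjI, if_neg (by simp [hjI, hj.ne']), moveSign_insert_of_lt hj hiI,
          Finset.insert_comm, orderedProd_insert (a := a) (i := i) (I := insert j I)]
        · simp
        · intro k hk
          rcases Finset.mem_insert.1 hk with rfl | hk
          · exact hj
          · exact hi k hk

theorem anticomm_mul_orderedProd {c : A} (hc : ∀ i, c * a i = -(a i * c)) (I : Finset (Fin r)) :
    c * orderedProd a I = (-1 : ℂ) ^ I.card • (orderedProd a I * c) := by
  induction I using Finset.induction_on_min with
  | empty => simp
  | insert i I hi ih =>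
    rw [orderedProd_insert hi, ← mul_assoc, hc, neg_mul, mul_assoc, ih,
      Finset.card_insert_of_notMem fun h => lt_irrefl i (hi i h), pow_succ]
    simp [mul_assoc]

theorem annihilate_mul_orderedProd (hab : ∀ i j, a i * b j + b j * a i = if i = j then 1 else 0)
    (j : Fin r) (I : Finset (Fin r)) : b j * orderedProd a I =
      (-1 : ℂ) ^ I.card • (orderedProd a I * b j) +
        if j ∈ I then moveSign j I • orderedProd a (I.erase j) else 0 := by
  induction I using Finset.induction_on_min with
  | empty => simp
  | insert i I hi ih =>
    have hiI : i ∉ I := fun h => lt_irrefl i (hi i h)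
    have hba : b j * a i = (if i = j then 1 else 0) - a i * b j := by
      rw [← hab]; abel
    rw [orderedProd_insert hi, ← mul_assoc, hba, sub_mul, mul_assoc, ih,
      Finset.card_insert_of_notMem hiI, pow_succ]
    by_cases hij : i = j
    · subst hij
      have h1 : moveSign i (insert i I) = 1 := moveSign_of_forall_le fun k hk => by
        rcases Finset.mem_insert.1 hk with rfl | hk
        · exact le_rfl
        · exact (hi k hk).le
      rw [h1, if_pos rfl, if_neg hiI, if_pos (by simp), Finset.erase_insert hiI]
      simp [mul_assoc]
      abel
    · by_cases hj : j ∈ I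
      · rw [if_neg hij, if_pos hj, if_pos (by simp [hj]), moveSign_insert_of_lt (hi j hj) hiI,
          Finset.erase_insert_of_ne hij, orderedProd_insert]
        · simp [mul_add, mul_assoc]
          abel
        · exact fun k hk => hi k (Finset.mem_of_mem_erase hk)
      · simp [hij, hj, Ne.symm hij, mul_assoc]

end OrderedProduct

/-! ### Fock spaces -/

section Modes

variable {r s : ℕ}

/-- The mode `j` occurs in the monomial. -/
def Monomial.Has (M : Monomial r s) : Fin r ⊕ Fin s → Prop
  | .inl j => j ∈ M.1
  | .inr k => k ∈ M.2

instance (M : Monomial r s) : DecidablePred M.Has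
  | .inl j => inferInstanceAs (Decidable (j ∈ M.1))
  | .inr k => inferInstanceAs (Decidable (k ∈ M.2))

/-- Insertion of a mode. -/
def Monomial.ins (M : Monomial r s) : Fin r ⊕ Fin s → Monomial r s
  | .inl j => (insert j M.1, M.2)
  | .inr k => (M.1, insert k M.2)

/-- Removal of a mode. -/
def Monomial.ers (M : Monomial r s) : Fin r ⊕ Fin s → Monomial r s
  | .inl j => (M.1.erase j, M.2)
  | .inr k => (M.1, M.2.erase k)

/-- The sign of moving a mode to its place in the monomial. -/
def Monomial.sgn (M : Monomial r s) : Fin r ⊕ Fin s → ℂ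
  | .inl j => moveSign j M.1
  | .inr k => (-1) ^ M.1.card * moveSign k M.2

/-- The sign of commuting `i` with `j` in the definition of `Monomial.sgn`. -/
def modeSign : Fin r ⊕ Fin s → Fin r ⊕ Fin s → ℂ
  | .inl i, .inl j => if i < j then -1 else 1
  | .inl _, .inr _ => -1
  | .inr _, .inl _ => 1
  | .inr i, .inr j => if i < j then -1 else 1

namespace Monomial

theorem sgn_mul_self (M : Monomial r s) (j) : M.sgn j * M.sgn j = 1 := by
  rcases j with j | k
  · exact moveSign_mul_self _ _
  · rw [sgn, mul_mul_mul_comm, moveSign_mul_self, ← mul_pow]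
    simp

theorem has_ins_self (M : Monomial r s) (j) : (M.ins j).Has j := by
  rcases j with j | k <;> simp [ins, Has]

theorem not_has_ers_self (M : Monomial r s) (j) : ¬ (M.ers j).Has j := by
  rcases j with j | k <;> simp [ers, Has]

theorem has_ins_of_ne {i j : Fin r ⊕ Fin s} (h : i ≠ j) (M : Monomial r s) :
    (M.ins i).Has j ↔ M.Has j := by
  rcases i with i | i <;> rcases j with j | j <;> simp_all [ins, Has, eq_comm]

theorem has_ers_of_ne {i j : Fin r ⊕ Fin s} (h : i ≠ j) (M : Monomial r s) :
    (M.ers i).Has j ↔ M.Has j := by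
  rcases i with i | i <;> rcases j with j | j <;> simp_all [ers, Has, eq_comm]

theorem ins_ers {M : Monomial r s} {j} (h : M.Has j) : (M.ers j).ins j = M := by
  rcases j with j | k <;> simp only [ers, ins, Has] at *
  · rw [Finset.insert_erase h]
  · rw [Finset.insert_erase h]

theorem ers_ins {M : Monomial r s} {j} (h : ¬ M.Has j) : (M.ins j).ers j = M := by
  rcases j with j | k <;> simp only [ers, ins, Has] at *
  · rw [Finset.erase_insert h]
  · rw [Finset.erase_insert h]

theorem ers_ers_comm (M : Monomial r s) (i j) : (M.ers i).ers j = (M.ers j).ers i := by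
  rcases i with i | i <;> rcases j with j | j <;> simp [ers, Finset.erase_right_comm]

theorem ins_ins_comm (M : Monomial r s) (i j) : (M.ins i).ins j = (M.ins j).ins i := by
  rcases i with i | i <;> rcases j with j | j <;> simp [ins, Finset.insert_comm]

theorem ins_ers_comm {i j : Fin r ⊕ Fin s} (h : i ≠ j) (M : Monomial r s) :
    (M.ins i).ers j = (M.ers j).ins i := by
  rcases i with i | i <;> rcases j with j | j <;> simp only [ins, ers]
  · rw [Finset.erase_insert_of_ne (by simpa using h)]
  · rw [Finset.erase_insert_of_ne (by simpa using h)]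

theorem sgn_ins_self (M : Monomial r s) (j) : (M.ins j).sgn j = M.sgn j := by
  rcases j with j | k <;> simp [ins, sgn, moveSign_insert_self]

theorem sgn_ers_self (M : Monomial r s) (j) : (M.ers j).sgn j = M.sgn j := by
  rcases j with j | k <;> simp [ers, sgn, moveSign_erase_self]

theorem sgn_ins {i j : Fin r ⊕ Fin s} {M : Monomial r s} (hi : ¬ M.Has i) :
    (M.ins i).sgn j = modeSign i j * M.sgn j := by
  rcases i with i | i <;> rcases j with j | j <;> simp only [ins, sgn, Has, modeSign] at *
  · split_ifs with h
    · rw [moveSign_insert_of_lt h hi, neg_one_mul]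
    · rw [moveSign_insert_of_not_lt h, one_mul]
  · rw [Finset.card_insert_of_notMem hi, pow_succ]; ring
  · rw [one_mul]
  · split_ifs with h
    · rw [moveSign_insert_of_lt h hi]; ring
    · rw [moveSign_insert_of_not_lt h, one_mul]

theorem modeSign_mul_self (i j : Fin r ⊕ Fin s) : modeSign i j * modeSign i j = 1 := by
  rcases i with i | i <;> rcases j with j | j <;> simp only [modeSign] <;> (try split_ifs) <;> simp

theorem modeSign_swap {i j : Fin r ⊕ Fin s} (h : i ≠ j) : modeSign j i = -modeSign i j := by
  rcases i with i | i <;> rcases j with j | j <;> simp only [modeSign, neg_neg]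
  all_goals
    have h' : i ≠ j := by simpa using h
    rcases lt_or_gt_of_ne h' with h1 | h1 <;> simp [h1, h1.not_gt]

theorem sgn_ers {i j : Fin r ⊕ Fin s} {M : Monomial r s} (hi : M.Has i) :
    (M.ers i).sgn j = modeSign i j * M.sgn j := by
  conv_rhs => rw [← ins_ers hi]
  rw [sgn_ins (not_has_ers_self M i), ← mul_assoc, modeSign_mul_self, one_mul]

theorem degree_ins {M : Monomial r s} {j} (h : ¬ M.Has j) : (M.ins j).degree = M.degree + 1 := by
  rcases j with j | k <;> simp only [ins, degree, Has] at * <;>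
    rw [Finset.card_insert_of_notMem h] <;> push_cast <;> ring

theorem degree_ers {M : Monomial r s} {j} (h : M.Has j) : (M.ers j).degree = M.degree + 1 := by
  conv_rhs => rw [← ins_ers h, degree_ins (not_has_ers_self M j), add_assoc]
  rw [show (1 : ZMod 2) + 1 = 0 from rfl, add_zero]

/-- Induction over monomials by insertion of modes. -/
theorem induction_ins {p : Monomial r s → Prop} (h0 : p (∅, ∅))
    (h1 : ∀ M j, ¬ M.Has j → p M → p (M.ins j)) (M : Monomial r s) : p M := by
  obtain ⟨I, J⟩ := M
  induction I using Finset.induction_on with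
  | empty =>
    induction J using Finset.induction_on with
    | empty => exact h0
    | insert k J hk ih => exact h1 (∅, J) (.inr k) hk ih
  | insert i I hi ih => exact h1 (I, J) (.inl i) hi ih

end Monomial

end Modes

section Fock

variable {r s : ℕ} {A : Type*} [AddCommGroup A] [Module ℂ A]

/-- Multiplication by a generator of the Grassmann algebra. -/
def fockMul (j : Fin r ⊕ Fin s) : Module.End ℂ (Monomial r s → A) :=
  LinearMap.pi fun M => if M.Has j then M.sgn j • LinearMap.proj (M.ers j) else 0

/-- The left derivatives of the Grassmann algebra. -/
def fockDer (j : Fin r ⊕ Fin s) : Module.End ℂ (Monomial r s → A) :=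
  LinearMap.pi fun M => if ¬ M.Has j then M.sgn j • LinearMap.proj (M.ins j) else 0

theorem fockMul_apply (j : Fin r ⊕ Fin s) (φ : Monomial r s → A) (M) :
    fockMul j φ M = if M.Has j then M.sgn j • φ (M.ers j) else 0 := by
  rw [fockMul, LinearMap.pi_apply]
  split_ifs <;> rfl

theorem fockDer_apply (j : Fin r ⊕ Fin s) (φ : Monomial r s → A) (M) :
    fockDer j φ M = if M.Has j then 0 else M.sgn j • φ (M.ins j) := by
  rw [fockDer, LinearMap.pi_apply, ite_not]
  split_ifs <;> rfl

theorem isCAR_fock : IsCAR (fockMul (A := A) : Fin r ⊕ Fin s → _) fockDer where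
  aa i j := by
    refine LinearMap.ext fun φ => funext fun M => ?_
    simp only [LinearMap.add_apply, Module.End.mul_apply, Pi.add_apply, fockMul_apply,
      LinearMap.zero_apply, Pi.zero_apply]
    by_cases hij : i = j
    · subst hij
      simp [Monomial.not_has_ers_self]
    · have h1 := Monomial.has_ers_of_ne hij M
      have h2 := Monomial.has_ers_of_ne (Ne.symm hij) M
      by_cases hi : M.Has i <;> by_cases hj : M.Has j <;> simp only [hi, hj, h1, h2, if_true, if_false,
        smul_zero, add_zero]
      rw [Monomial.sgn_ers hi, Monomial.sgn_ers hj, Monomial.modeSign_swap hij,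
        M.ers_ers_comm j i, smul_smul, smul_smul, ← add_smul]
      convert zero_smul ℂ _ using 2
      ring
  bb i j := by
    refine LinearMap.ext fun φ => funext fun M => ?_
    simp only [LinearMap.add_apply, Module.End.mul_apply, Pi.add_apply, fockDer_apply,
      LinearMap.zero_apply, Pi.zero_apply]
    by_cases hij : i = j
    · subst hij
      simp [Monomial.has_ins_self]
    · have h1 := Monomial.has_ins_of_ne hij M
      have h2 := Monomial.has_ins_of_ne (Ne.symm hij) M
      by_cases hi : M.Has i <;> by_cases hj : M.Has j <;> simp only [hi, hj, h1, h2, if_true, if_false,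
        smul_zero, add_zero]
      rw [Monomial.sgn_ins hi, Monomial.sgn_ins hj, Monomial.modeSign_swap hij,
        M.ins_ins_comm j i, smul_smul, smul_smul, ← add_smul]
      convert zero_smul ℂ _ using 2
      ring
  ab i j := by
    refine LinearMap.ext fun φ => funext fun M => ?_
    simp only [LinearMap.add_apply, Module.End.mul_apply, Pi.add_apply, fockDer_apply,
      fockMul_apply]
    by_cases hij : i = j
    · subst hij
      by_cases hi : M.Has i
      · simp [hi, Monomial.not_has_ers_self, Monomial.ins_ers hi, Monomial.sgn_ers_self, smul_smul,
          Monomial.sgn_mul_self]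
      · simp [hi, Monomial.has_ins_self, Monomial.ers_ins hi, Monomial.sgn_ins_self, smul_smul,
          Monomial.sgn_mul_self]
    · have h1 := Monomial.has_ers_of_ne hij M
      have h2 := Monomial.has_ins_of_ne (Ne.symm hij) M
      by_cases hi : M.Has i <;> by_cases hj : M.Has j <;> simp only [hi, hj, h1, h2, hij, if_true, if_false,
        smul_zero, add_zero, LinearMap.zero_apply, Pi.zero_apply]
      rw [Monomial.sgn_ers hi, Monomial.sgn_ins hj, Monomial.modeSign_swap hij,
        Monomial.ins_ers_comm (Ne.symm hij), smul_smul, smul_smul, ← add_smul]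
      convert zero_smul ℂ _ using 2
      ring

theorem fockMul_single {M : Monomial r s} {j} (h : ¬ M.Has j) (x : A) :
    fockMul j (Pi.single M x) = M.sgn j • Pi.single (M := fun _ => A) (M.ins j) x := by
  funext M'
  rw [fockMul_apply, Pi.smul_apply]
  split_ifs with h'
  · by_cases e : M' = M.ins j
    · subst e
      rw [Monomial.ers_ins h, Pi.single_eq_same, Pi.single_eq_same, Monomial.sgn_ins_self]
    · rw [Pi.single_eq_of_ne e, Pi.single_eq_of_ne, smul_zero, smul_zero]
      rintro rfl
      exact e (Monomial.ins_ers h').symm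
  · rw [Pi.single_eq_of_ne, smul_zero]
    rintro rfl
    exact h' (M.has_ins_self j)

theorem fockMul_single_of_has {M : Monomial r s} {j} (h : M.Has j) (x : A) :
    fockMul j (Pi.single M x) = 0 := by
  funext M'
  rw [fockMul_apply, Pi.zero_apply]
  split_ifs with h'
  · rw [Pi.single_eq_of_ne, smul_zero]
    rintro rfl
    exact M'.not_has_ers_self j h
  · rfl

theorem fockDer_single {M : Monomial r s} {j} (h : M.Has j) (x : A) :
    fockDer j (Pi.single M x) = M.sgn j • Pi.single (M := fun _ => A) (M.ers j) x := by
  funext M'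
  rw [fockDer_apply, Pi.smul_apply]
  split_ifs with h'
  · rw [Pi.single_eq_of_ne, smul_zero]
    rintro rfl
    exact M.not_has_ers_self j h'
  · by_cases e : M' = M.ers j
    · subst e
      rw [Monomial.ins_ers h, Pi.single_eq_same, Pi.single_eq_same, Monomial.sgn_ers_self]
    · rw [Pi.single_eq_of_ne e, Pi.single_eq_of_ne, smul_zero, smul_zero]
      rintro rfl
      exact e (Monomial.ers_ins h').symm

theorem fockDer_single_of_not_has {M : Monomial r s} {j} (h : ¬ M.Has j) (x : A) :
    fockDer j (Pi.single M x) = 0 := by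
  funext M'
  rw [fockDer_apply, Pi.zero_apply]
  split_ifs with h'
  · rfl
  · rw [Pi.single_eq_of_ne, smul_zero]
    rintro rfl
    exact h (M'.has_ins_self j)

end Fock

namespace IsCAR

section Algebra

variable {r s : ℕ} {A : Type*} [Ring A] {a b : Fin r ⊕ Fin s → A}

/-- The product of creation operators attached to a monomial. -/
def monomialProd (a : Fin r ⊕ Fin s → A) (M : Monomial r s) : A :=
  orderedProd (fun i => a (.inl i)) M.1 * orderedProd (fun k => a (.inr k)) M.2

@[simp]
theorem monomialProd_empty (a : Fin r ⊕ Fin s → A) : monomialProd a (∅, ∅) = 1 := by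
  simp [monomialProd]

variable [Algebra ℂ A]

theorem mul_monomialProd (h : IsCAR a b) (j) (M : Monomial r s) : a j * monomialProd a M =
    if M.Has j then 0 else M.sgn j • monomialProd a (M.ins j) := by
  rcases j with j | k
  · rw [monomialProd, ← mul_assoc, mul_orderedProd fun i i' => h.aa (.inl i) (.inl i')]
    simp only [Monomial.Has, Monomial.sgn, Monomial.ins, ite_mul, zero_mul, monomialProd,
      smul_mul_assoc]
    congr
  · rw [monomialProd, ← mul_assoc, anticomm_mul_orderedProd
      fun i => eq_neg_of_add_eq_zero_left (h.aa (.inr k) (.inl i)), smul_mul_assoc, mul_assoc,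
      mul_orderedProd fun i i' => h.aa (.inr i) (.inr i')]
    simp only [Monomial.Has, Monomial.sgn, Monomial.ins, mul_ite, mul_zero, monomialProd,
      mul_smul_comm, smul_ite, smul_zero, smul_smul]
    congr

theorem annihilate_mul_monomialProd (h : IsCAR a b) (j) (M : Monomial r s) :
    b j * monomialProd a M = (-1 : ℂ) ^ (M.1.card + M.2.card) • (monomialProd a M * b j) +
      if M.Has j then M.sgn j • monomialProd a (M.ers j) else 0 := by
  rcases j with j | k
  · have h1 : ∀ i, b (.inl j) * a (.inr i) = -(a (.inr i) * b (.inl j)) := fun i => by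
      have h2 := h.ab (.inr i) (.inl j)
      rw [if_neg (by simp)] at h2
      exact eq_neg_of_add_eq_zero_right h2
    rw [monomialProd, ← mul_assoc, annihilate_mul_orderedProd (a := fun i => a (.inl i))
      (b := fun i => b (.inl i)) (fun i i' => by simpa using h.ab (.inl i) (.inl i')), add_mul,
      smul_mul_assoc, mul_assoc, anticomm_mul_orderedProd h1]
    simp only [Monomial.Has, Monomial.sgn, Monomial.ers, ite_mul, zero_mul, monomialProd,
      smul_mul_assoc, mul_smul_comm, smul_smul, pow_add, mul_assoc]
    congr
  · have h1 : ∀ i, b (.inr k) * a (.inl i) = -(a (.inl i) * b (.inr k)) := fun i => by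
      have h2 := h.ab (.inl i) (.inr k)
      rw [if_neg (by simp)] at h2
      exact eq_neg_of_add_eq_zero_right h2
    rw [monomialProd, ← mul_assoc, anticomm_mul_orderedProd h1, smul_mul_assoc, mul_assoc,
      annihilate_mul_orderedProd (a := fun i => a (.inr i))
      (b := fun i => b (.inr i)) (fun i i' => by simpa using h.ab (.inr i) (.inr i'))]
    simp only [Monomial.Has, Monomial.sgn, Monomial.ers, mul_ite, mul_zero, monomialProd,
      mul_smul_comm, smul_ite, smul_zero, smul_smul, mul_add, smul_add, pow_add, mul_assoc]
    congr

end Algebra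

section Module

variable {r s : ℕ} {V A : Type*} [AddCommGroup V] [Module ℂ V] [AddCommGroup A] [Module ℂ A]

/-- A subspace stable under the creation operators contains a stable subspace when it contains its
vacuum vectors. -/
theorem le_of_vacuum_le {κ : Type*} [Finite κ] [DecidableEq κ] {a b : κ → Module.End ℂ V}
    (h : IsCAR a b) {E Y : Submodule ℂ V}
    (hEa : ∀ j, ∀ x ∈ E, a j x ∈ E) (hEb : ∀ j, ∀ x ∈ E, b j x ∈ E)
    (hYa : ∀ j, ∀ x ∈ Y, a j x ∈ Y) (hN : ∀ x ∈ E, (∀ j, b j x = 0) → x ∈ Y) : E ≤ Y := by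
  have := Fintype.ofFinite κ
  have key : ∀ t : Finset κ, ∀ x ∈ E, (∀ j ∉ t, b j x = 0) → x ∈ Y := by
    intro t
    induction t using Finset.induction_on with
    | empty => exact fun x hx h0 => hN x hx fun j => h0 j (by simp)
    | insert j t hj ih =>
      intro x hx h0
      have hbb : ∀ i y, b i (b j y) = -b j (b i y) := fun i y =>
        eq_neg_of_add_eq_zero_left (DFunLike.congr_fun (h.bb i j) y)
      have hbj : ∀ y, b j (b j y) = 0 := fun y => by
        have h1 := hbb j y
        rw [eq_neg_iff_add_eq_zero, ← two_smul ℂ] at h1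
        simpa using h1
      have hsplit : b j (a j x) + a j (b j x) = x := by
        have h1 := DFunLike.congr_fun (h.ab j j) x
        simpa [add_comm] using h1
      rw [← hsplit]
      refine Y.add_mem (ih _ (hEb _ _ (hEa _ _ hx)) fun i hi => ?_)
        (hYa _ _ (ih _ (hEb _ _ hx) fun i hi => ?_))
      · by_cases hij : i = j
        · rw [hij, hbj]
        · have h1 := DFunLike.congr_fun (h.ab j i) x
          rw [if_neg (Ne.symm hij)] at h1
          simp only [LinearMap.add_apply, Module.End.mul_apply, LinearMap.zero_apply] at h1
          rw [h0 i (by simp [hi, hij]), map_zero, zero_add] at h1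
          rw [hbb, h1, map_zero, neg_zero]
      · by_cases hij : i = j
        · rw [hij, hbj]
        · rw [hbb, h0 i (by simp [hi, hij]), map_zero, neg_zero]
  exact fun x hx => key Finset.univ x hx (by simp)

/-- A nonzero stable subspace contains a nonzero vacuum vector. -/
theorem exists_vacuum {κ : Type*} [Finite κ] [DecidableEq κ] {a b : κ → Module.End ℂ V}
    (h : IsCAR a b) {E : Submodule ℂ V}
    (hEa : ∀ j, ∀ x ∈ E, a j x ∈ E) (hEb : ∀ j, ∀ x ∈ E, b j x ∈ E) (hE : E ≠ ⊥) :
    ∃ x ∈ E, x ≠ 0 ∧ ∀ j, b j x = 0 := by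
  by_contra! H
  refine hE (le_bot_iff.1 (h.le_of_vacuum_le hEa hEb (by simp) fun x hx hb => ?_))
  by_contra h0
  obtain ⟨j, hj⟩ := H x hx h0
  exact hj (hb j)

/-- The map from the Fock space defined by a family of vacuum vectors. -/
def fockMap (a : Fin r ⊕ Fin s → Module.End ℂ V) (L : A →ₗ[ℂ] V) : (Monomial r s → A) →ₗ[ℂ] V :=
  ∑ M, monomialProd a M ∘ₗ L ∘ₗ LinearMap.proj M

variable {a b : Fin r ⊕ Fin s → Module.End ℂ V}

theorem fockMap_single (L : A →ₗ[ℂ] V) (M : Monomial r s) (x : A) :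
    fockMap a L (Pi.single M x) = monomialProd a M (L x) := by
  rw [fockMap, LinearMap.sum_apply, Finset.sum_eq_single M]
  · simp
  · intro M' _ hM
    simp [Pi.single_eq_of_ne hM]
  · simp

theorem fockMap_mul (h : IsCAR a b) (L : A →ₗ[ℂ] V) (j) (φ : Monomial r s → A) :
    fockMap a L (fockMul j φ) = a j (fockMap a L φ) := by
  have h1 : fockMap a L ∘ₗ fockMul j = a j ∘ₗ fockMap a L := by
    refine LinearMap.pi_ext fun M x => ?_
    have h2 := DFunLike.congr_fun (h.mul_monomialProd j M) (L x)
    rw [Module.End.mul_apply] at h2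
    rw [LinearMap.comp_apply, LinearMap.comp_apply, fockMap_single, h2]
    split_ifs with hM
    · rw [fockMul_single_of_has hM, map_zero, LinearMap.zero_apply]
    · rw [fockMul_single hM, map_smul, fockMap_single, LinearMap.smul_apply]
  exact DFunLike.congr_fun h1 φ

theorem fockMap_der (h : IsCAR a b) {L : A →ₗ[ℂ] V} (hL : ∀ j x, b j (L x) = 0) (j)
    (φ : Monomial r s → A) : fockMap a L (fockDer j φ) = b j (fockMap a L φ) := by
  have h1 : fockMap a L ∘ₗ fockDer j = b j ∘ₗ fockMap a L := by
    refine LinearMap.pi_ext fun M x => ?_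
    have h2 := DFunLike.congr_fun (h.annihilate_mul_monomialProd j M) (L x)
    rw [Module.End.mul_apply, LinearMap.add_apply, LinearMap.smul_apply, Module.End.mul_apply, hL,
      map_zero, smul_zero, zero_add] at h2
    rw [LinearMap.comp_apply, LinearMap.comp_apply, fockMap_single, h2]
    split_ifs with hM
    · rw [fockDer_single hM, map_smul, fockMap_single, LinearMap.smul_apply]
    · rw [fockDer_single_of_not_has hM, map_zero, LinearMap.zero_apply]
  exact DFunLike.congr_fun h1 φ

end Module

end IsCAR

section Fock

variable {r s : ℕ} {A : Type*} [AddCommGroup A] [Module ℂ A]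

/-- The grading operator of the Fock space. -/
def fockGrading : Module.End ℂ (Monomial r s → A) :=
  LinearMap.pi fun M => (-1 : ℂ) ^ M.degree.val • LinearMap.proj M

theorem fockGrading_single (M : Monomial r s) (x : A) :
    fockGrading (Pi.single M x) = (-1 : ℂ) ^ M.degree.val • Pi.single (M := fun _ => A) M x := by
  funext M'
  change (-1 : ℂ) ^ M'.degree.val • (Pi.single M x : Monomial r s → A) M' = _
  by_cases h : M' = M
  · subst h; rfl
  · simp [Pi.single_eq_of_ne h]

theorem single_mem_of_invariant {W : Submodule ℂ (Monomial r s → A)}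
    (ha : ∀ j, ∀ φ ∈ W, fockMul j φ ∈ W) (hb : ∀ j, ∀ φ ∈ W, fockDer j φ ∈ W)
    {φ : Monomial r s → A} (hφ : φ ∈ W) (M M' : Monomial r s) : Pi.single M' (φ M) ∈ W := by
  have hsgn : ∀ (M : Monomial r s) j (x : Monomial r s → A), M.sgn j • M.sgn j • x = x :=
    fun M j x => by rw [smul_smul, M.sgn_mul_self, one_smul]
  have key : ∀ t : Finset (Fin r ⊕ Fin s),
      ∃ ψ ∈ W, ψ M = φ M ∧ ∀ M', (∃ j ∈ t, ¬ (M'.Has j ↔ M.Has j)) → ψ M' = 0 := by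
    intro t
    induction t using Finset.induction_on with
    | empty => exact ⟨φ, hφ, rfl, by simp⟩
    | insert j t hj ih =>
      obtain ⟨ψ, hψ, h1, h2⟩ := ih
      by_cases hM : M.Has j
      · refine ⟨fockMul j (fockDer j ψ), ha _ _ (hb _ _ hψ), ?_, ?_⟩
        · rw [fockMul_apply, if_pos hM, fockDer_apply, if_neg (M.not_has_ers_self j),
            M.ins_ers hM, M.sgn_ers_self, smul_smul, M.sgn_mul_self, one_smul, h1]
        · rintro M' ⟨i, hi, hne⟩
          rw [fockMul_apply]
          split_ifs with hM'
          · rw [fockDer_apply, if_neg (M'.not_has_ers_self j), M'.ins_ers hM', h2, smul_zero,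
              smul_zero]
            rcases Finset.mem_insert.1 hi with rfl | hi
            · simp [hM, hM'] at hne
            · exact ⟨i, hi, hne⟩
          · rfl
      · refine ⟨fockDer j (fockMul j ψ), hb _ _ (ha _ _ hψ), ?_, ?_⟩
        · rw [fockDer_apply, if_neg hM, fockMul_apply, if_pos (M.has_ins_self j),
            M.ers_ins hM, M.sgn_ins_self, smul_smul, M.sgn_mul_self, one_smul, h1]
        · rintro M' ⟨i, hi, hne⟩
          rw [fockDer_apply]
          split_ifs with hM'
          · rfl
          · rw [fockMul_apply, if_pos (M'.has_ins_self j), M'.ers_ins hM', h2, smul_zero,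
              smul_zero]
            rcases Finset.mem_insert.1 hi with rfl | hi
            · simp [hM, hM'] at hne
            · exact ⟨i, hi, hne⟩
  obtain ⟨ψ, hψ, h1, h2⟩ := key Finset.univ
  have hM : Pi.single M (φ M) ∈ W := by
    convert hψ
    funext N
    by_cases hN : N = M
    · subst hN; simp [h1]
    · rw [Pi.single_eq_of_ne hN, h2]
      by_contra! H
      refine hN (Prod.ext ?_ ?_) <;> ext i
      · exact H (.inl i) (Finset.mem_univ _)
      · exact H (.inr i) (Finset.mem_univ _)
  have hvac : ∀ N : Monomial r s, Pi.single N (φ M) ∈ W → Pi.single (∅, ∅) (φ M) ∈ W := by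
    intro N
    induction N using Monomial.induction_ins with
    | h0 => exact id
    | h1 N j hj ih =>
      intro h
      have h3 := hb j _ h
      rw [fockDer_single (N.has_ins_self j), N.ers_ins hj] at h3
      have h4 := W.smul_mem ((N.ins j).sgn j) h3
      rw [hsgn] at h4
      exact ih h4
  have h0 := hvac M hM
  induction M' using Monomial.induction_ins with
  | h0 => exact h0
  | h1 N j hj ih =>
    have h3 := ha j _ ih
    rw [fockMul_single hj] at h3
    have h4 := W.smul_mem (N.sgn j) h3
    rwa [hsgn] at h4

/-- A superinvariant sesquilinear form on the Fock space is determined by its values on the pairs of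
a vacuum vector and a vector of top degree in `ξ`. -/
theorem form_eq_zero_of_invariant (F : (Monomial r s → A) →ₗ⋆[ℂ] (Monomial r s → A) →ₗ[ℂ] ℂ)
    (a' b' : Fin r ⊕ Fin s → Module.End ℂ (Monomial r s → A))
    (ha : ∀ j, ∃ c : ℂ, ∀ φ ψ, F (fockMul j φ) ψ = c * F (fockGrading φ) (a' j ψ))
    (hb : ∀ j, ∃ c : ℂ, c ≠ 0 ∧ ∀ φ ψ, F (fockDer j φ) ψ = c * F (fockGrading φ) (b' j ψ))
    (hξ : ∀ j, b' (.inl j) = fockDer (.inl j)) (hζ : ∀ k, b' (.inr k) = fockMul (.inr k))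
    (h0 : ∀ x y, F (Pi.single (∅, ∅) x) (Pi.single (Finset.univ, ∅) y) = 0) : F = 0 := by
  have hvac : ∀ x : A, fockGrading (r := r) (s := s) (Pi.single (∅, ∅) x) = Pi.single (∅, ∅) x :=
    fun x => by rw [fockGrading_single]; simp [Monomial.degree]
  have hb0 : ∀ j (x : A) ψ, F (Pi.single (∅, ∅) x) (b' j ψ) = 0 := by
    intro j x ψ
    obtain ⟨c, hc, h⟩ := hb j
    have h1 := h (Pi.single (∅, ∅) x) ψ
    rw [hvac, fockDer_single_of_not_has (by rcases j with j | j <;> simp [Monomial.Has]),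
      map_zero, LinearMap.zero_apply] at h1
    simpa [hc] using h1.symm
  have h1 : ∀ (x : A) M y, F (Pi.single (∅, ∅) x) (Pi.single M y) = 0 := by
    rintro x ⟨I, J⟩ y
    have hsgn : ∀ (M : Monomial r s) j, M.sgn j ≠ 0 := fun M j h => by
      simpa [h] using M.sgn_mul_self j
    by_cases hJ : J = ∅
    · subst hJ
      by_cases hI : I = Finset.univ
      · rw [hI, h0]
      · obtain ⟨j, hj⟩ : ∃ j, j ∉ I := by
          by_contra! H
          exact hI (Finset.eq_univ_iff_forall.2 H)
        have hj' : ¬ Monomial.Has (s := s) (I, ∅) (.inl j) := hj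
        have h2 := hb0 (.inl j) x (Pi.single (Monomial.ins (I, ∅) (.inl j)) y)
        rw [hξ, fockDer_single (Monomial.has_ins_self _ _), Monomial.ers_ins hj', map_smul,
          smul_eq_mul] at h2
        exact (mul_eq_zero.1 h2).resolve_left (hsgn _ _)
    · obtain ⟨k, hk⟩ := Finset.nonempty_iff_ne_empty.2 hJ
      have hk' : Monomial.Has (I, J) (.inr k) := hk
      have h2 := hb0 (.inr k) x (Pi.single (Monomial.ers (I, J) (.inr k)) y)
      rw [hζ, fockMul_single (Monomial.not_has_ers_self _ _), Monomial.ins_ers hk', map_smul,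
        smul_eq_mul] at h2
      exact (mul_eq_zero.1 h2).resolve_left (hsgn _ _)
  have h2 : ∀ M (x : A), F (Pi.single M x) = 0 := by
    intro M x
    induction M using Monomial.induction_ins with
    | h0 => exact LinearMap.pi_ext fun N y => by rw [h1, LinearMap.zero_apply]
    | h1 M j hj ih =>
      obtain ⟨c, h⟩ := ha j
      have h3 : M.sgn j • fockMul j (Pi.single M x) =
          (Pi.single (M.ins j) x : Monomial r s → A) := by
        rw [fockMul_single hj, smul_smul, M.sgn_mul_self, one_smul]
      refine LinearMap.ext fun ψ => ?_
      rw [← h3, LinearMap.map_smulₛₗ, LinearMap.smul_apply, h, fockGrading_single,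
        LinearMap.map_smulₛₗ, ih]
      simp
  refine LinearMap.ext fun φ => ?_
  have h3 : φ = ∑ M, Pi.single M (φ M) := (Finset.univ_sum_single φ).symm
  rw [h3, map_sum]
  simp [h2]

end Fock

/-! ### The odd part and the anticommutation relations -/

section Odd

variable {r s : ℕ}

/-- The signs of the diagonal form `omegaOdd`. -/
def oddSign : OddIndex r s → ℂ := Sum.elim (fun _ => 1) (fun _ => -1)

/-- The complexification of `omegaOdd`. -/
def omegaC : (OddIndex r s → ℂ) →ₗ[ℂ] (OddIndex r s → ℂ) →ₗ[ℂ] ℂ :=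
  LinearMap.mk₂ ℂ (fun X Y => ∑ i, oddSign i * (X i * Y i))
    (by intro X X' Y; simp [add_mul, mul_add, Finset.sum_add_distrib])
    (by
      intro c X Y
      simp only [Pi.smul_apply, smul_eq_mul, Finset.mul_sum]
      exact Finset.sum_congr rfl fun _ _ => by ring)
    (by intro X Y Y'; simp [mul_add, Finset.sum_add_distrib])
    (by
      intro c X Y
      simp only [Pi.smul_apply, smul_eq_mul, Finset.mul_sum]
      exact Finset.sum_congr rfl fun _ _ => by ring)

theorem omegaC_apply (X Y : OddIndex r s → ℂ) : omegaC X Y = ∑ i, oddSign i * (X i * Y i) := rfl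

theorem omegaC_comm (X Y : OddIndex r s → ℂ) : omegaC X Y = omegaC Y X := by
  simp only [omegaC_apply, mul_comm (X _)]

theorem omegaC_single (i j : OddIndex r s) :
    omegaC (Pi.single i 1) (Pi.single j 1) = if i = j then oddSign i else 0 := by
  rw [omegaC_apply, Finset.sum_eq_single i]
  · simp [Pi.single_apply]
  · intro k _ hk
    simp [hk]
  · simp

/-- The inclusion of the real odd part into its complexification. -/
def OddPart.toC (X : OddPart r s) : OddIndex r s → ℂ := fun i => (X i : ℂ)

theorem omegaC_toC (X Y : OddPart r s) : omegaC X.toC Y.toC = (omegaOdd X Y : ℂ) := by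
  simp [omegaC_apply, oddSign, omegaOdd, OddPart.toC, sub_eq_add_neg]

/-- The isotropic odd vectors that act as creation operators. -/
noncomputable def creationVector (θ : ℝ) : Fin r ⊕ Fin s → OddIndex r s → ℂ
  | .inl j => ((θ : ℂ) / (2 * Complex.I) / (Real.sqrt 2 : ℂ)) •
      (Pi.single (.inl (.inl j)) 1 - Pi.single (.inr j) 1)
  | .inr k => ((θ : ℂ) / (2 * Complex.I)) •
      (Pi.single (.inl (.inr (.inl k))) 1 + Complex.I • Pi.single (.inl (.inr (.inr k))) 1)

/-- The isotropic odd vectors that act as annihilation operators. -/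
noncomputable def annihilationVector : Fin r ⊕ Fin s → OddIndex r s → ℂ
  | .inl j => (-(1 / (Real.sqrt 2 : ℂ))) •
      (Pi.single (.inl (.inl j)) 1 + Pi.single (.inr j) 1)
  | .inr k => (-(1 / 2 : ℂ)) •
      (Pi.single (.inl (.inr (.inl k))) 1 - Complex.I • Pi.single (.inl (.inr (.inr k))) 1)

/-- Coordinates of an odd vector along the creation vectors. -/
noncomputable def OddPart.creationCoord (θ : ℝ) (X : OddPart r s) : Fin r ⊕ Fin s → ℂ
  | .inl j => (X.eta j : ℂ) * (2 * Complex.I / θ)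
  | .inr k => conj (X.zeta k) * (Complex.I / θ)

/-- Coordinates of an odd vector along the annihilation vectors. -/
noncomputable def OddPart.annihilationCoord (X : OddPart r s) : Fin r ⊕ Fin s → ℂ
  | .inl j => -(X.xi j : ℂ)
  | .inr k => -X.zeta k

theorem sqrt_two_mul_self : (Real.sqrt 2 : ℂ) * (Real.sqrt 2 : ℂ) = 2 := by
  rw [← Complex.ofReal_mul, Real.mul_self_sqrt (by norm_num)]
  simp

theorem sqrt_two_ne_zero : (Real.sqrt 2 : ℂ) ≠ 0 := by simp

theorem OddPart.toC_eq_sum {θ : ℝ} (hθ : θ ≠ 0) (X : OddPart r s) :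
    X.toC = ∑ i, (X.annihilationCoord i • annihilationVector i +
      X.creationCoord θ i • creationVector θ i) := by
  have hθ' : (θ : ℂ) ≠ 0 := by exact_mod_cast hθ
  have h2 := sqrt_two_mul_self
  have h2' := sqrt_two_ne_zero
  have h2'' : (Real.sqrt 2 : ℂ) ^ 2 = 2 := by rw [sq, h2]
  rw [Fintype.sum_sum_type]
  simp only [annihilationCoord, creationCoord, annihilationVector, creationVector, xi, eta, zeta,
    map_add, map_mul, Complex.conj_ofReal, Complex.conj_I]
  funext i
  simp only [Pi.add_apply, Finset.sum_apply, Pi.smul_apply, Pi.sub_apply, smul_eq_mul,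
    Pi.single_apply, toC]
  have hI := Complex.I_mul_I
  rcases i with (j | k | k) | j
  · simp [Finset.sum_add_distrib, sub_eq_add_neg]
    field_simp
    rw [h2'']
    ring
  · simp [Finset.sum_add_distrib]
    field_simp
    ring
  · simp [Finset.sum_add_distrib]
    field_simp
    linear_combination (2 * (X (Sum.inl (Sum.inr (Sum.inr k))) : ℂ)) * hI
  · simp [Finset.sum_add_distrib, sub_eq_add_neg]
    field_simp
    rw [h2'']
    ring

theorem omegaC_creation_creation (θ : ℝ) (i j : Fin r ⊕ Fin s) :
    omegaC (creationVector θ i) (creationVector θ j) = 0 := by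
  rcases i with i | i <;> rcases j with j | j <;>
    simp only [creationVector, map_smul, map_add, map_sub, LinearMap.smul_apply, LinearMap.add_apply,
      LinearMap.sub_apply, omegaC_single, smul_eq_mul, Sum.inl.injEq, Sum.inr.injEq, oddSign,
      Sum.elim_inl, Sum.elim_inr, reduceCtorEq, if_false]
  all_goals (try split_ifs)
  all_goals ring_nf
  all_goals simp

theorem omegaC_annihilation_annihilation (i j : Fin r ⊕ Fin s) :
    omegaC (annihilationVector i) (annihilationVector j) = 0 := by
  rcases i with i | i <;> rcases j with j | j <;>
    simp only [annihilationVector, map_smul, map_add, map_sub, LinearMap.smul_apply,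
      LinearMap.add_apply,
      LinearMap.sub_apply, omegaC_single, smul_eq_mul, Sum.inl.injEq, Sum.inr.injEq, oddSign,
      Sum.elim_inl, Sum.elim_inr, reduceCtorEq, if_false]
  all_goals (try split_ifs)
  all_goals ring_nf
  all_goals simp

theorem omegaC_creation_annihilation {θ : ℝ} (hθ : θ ≠ 0) (i j : Fin r ⊕ Fin s) :
    -(2 * Complex.I / θ) * omegaC (creationVector θ i) (annihilationVector j) =
      if i = j then 1 else 0 := by
  have hθ' : (θ : ℂ) ≠ 0 := by exact_mod_cast hθ
  have h2 := sqrt_two_mul_self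
  have h2' := sqrt_two_ne_zero
  have h2'' : (Real.sqrt 2 : ℂ) ^ 2 = 2 := by rw [sq, h2]
  rcases i with i | i <;> rcases j with j | j <;>
    simp only [creationVector, annihilationVector, map_smul, map_add, map_sub, LinearMap.smul_apply,
      LinearMap.add_apply,
      LinearMap.sub_apply, omegaC_single, smul_eq_mul, Sum.inl.injEq, Sum.inr.injEq, oddSign,
      Sum.elim_inl, Sum.elim_inr, reduceCtorEq, if_false]
  · split_ifs
    · field_simp
      rw [h2'']
      ring
    · simp
  · simp
  · simp
  · split_ifs
    · field_simp
      simp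
      norm_num
    · simp

variable {A : Type*} [Ring A] [Algebra ℂ A]

/-- Operators that satisfy the bracket relations of the odd part. -/
def IsOddRep (θ : ℝ) (R : (OddIndex r s → ℂ) →ₗ[ℂ] A) : Prop :=
  ∀ X Y, R X * R Y + R Y * R X = (-(2 * Complex.I / θ) * omegaC X Y) • 1

theorem IsOddRep.isCAR {θ : ℝ} (hθ : θ ≠ 0) {R : (OddIndex r s → ℂ) →ₗ[ℂ] A} (h : IsOddRep θ R) :
    IsCAR (fun i => R (creationVector θ i)) (fun i => R (annihilationVector i)) where
  aa i j := by rw [h, omegaC_creation_creation, mul_zero, zero_smul]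
  bb i j := by rw [h, omegaC_annihilation_annihilation, mul_zero, zero_smul]
  ab i j := by rw [h, omegaC_creation_annihilation hθ, ite_smul, one_smul, zero_smul]

theorem IsOddRep.apply_toC {θ : ℝ} (hθ : θ ≠ 0) (R : (OddIndex r s → ℂ) →ₗ[ℂ] A) (X : OddPart r s) :
    R X.toC = ∑ i, (X.annihilationCoord i • R (annihilationVector i) +
      X.creationCoord θ i • R (creationVector θ i)) := by
  rw [OddPart.toC_eq_sum hθ X]
  simp

/-- The odd operators defined by creation and annihilation operators. -/
noncomputable def oddElement (θ : ℝ) (a b : Fin r ⊕ Fin s → A) (X : OddPart r s) : A :=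
  ∑ i, (X.annihilationCoord i • b i + X.creationCoord θ i • a i)

theorem oddElement_add (θ : ℝ) (a b : Fin r ⊕ Fin s → A) (X Y : OddPart r s) :
    oddElement θ a b (X + Y) = oddElement θ a b X + oddElement θ a b Y := by
  rw [oddElement, oddElement, oddElement, ← Finset.sum_add_distrib]
  refine Finset.sum_congr rfl fun i _ => ?_
  rcases i with j | k
  · simp only [OddPart.annihilationCoord, OddPart.creationCoord, OddPart.xi, OddPart.eta,
      Pi.add_apply]
    push_cast
    module
  · simp only [OddPart.annihilationCoord, OddPart.creationCoord, OddPart.zeta, Pi.add_apply, map_add,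
      map_mul, Complex.conj_ofReal, Complex.conj_I]
    push_cast
    module

theorem oddElement_smul (θ : ℝ) (a b : Fin r ⊕ Fin s → A) (c : ℝ) (X : OddPart r s) :
    oddElement θ a b (c • X) = (c : ℂ) • oddElement θ a b X := by
  rw [oddElement, oddElement, Finset.smul_sum]
  refine Finset.sum_congr rfl fun i _ => ?_
  rcases i with j | k
  · simp only [OddPart.annihilationCoord, OddPart.creationCoord, OddPart.xi, OddPart.eta,
      Pi.smul_apply, smul_eq_mul]
    push_cast
    module
  · simp only [OddPart.annihilationCoord, OddPart.creationCoord, OddPart.zeta, Pi.smul_apply, map_add,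
      map_mul, Complex.conj_ofReal, Complex.conj_I, smul_eq_mul]
    push_cast
    module

theorem sum_coord_eq_omega {θ : ℝ} (hθ : θ ≠ 0) (X Y : OddPart r s) :
    ∑ i, (X.annihilationCoord i * Y.creationCoord θ i + X.creationCoord θ i * Y.annihilationCoord i)
      = -(2 * Complex.I / θ) * omegaOdd X Y := by
  rw [← omegaC_toC]
  conv_rhs => rw [OddPart.toC_eq_sum hθ X, OddPart.toC_eq_sum hθ Y]
  have hθ' : (θ : ℂ) ≠ 0 := by exact_mod_cast hθ
  have h1 : ∀ i j : Fin r ⊕ Fin s, omegaC (creationVector θ i) (annihilationVector j) =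
      if i = j then -(θ / (2 * Complex.I)) else 0 := fun i j => by
    have h := omegaC_creation_annihilation hθ i j
    split_ifs at h ⊢
    · field_simp
      field_simp at h
      linear_combination -h
    · simpa [hθ'] using h
  have h2 : ∀ i j : Fin r ⊕ Fin s, omegaC (annihilationVector i) (creationVector θ j) =
      if i = j then -(θ / (2 * Complex.I)) else 0 := fun i j => by
    rw [omegaC_comm, h1]
    simp only [eq_comm]
  simp only [map_sum, map_add, map_smul, LinearMap.sum_apply, LinearMap.add_apply,
    LinearMap.smul_apply, omegaC_creation_creation, omegaC_annihilation_annihilation, smul_eq_mul,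
    mul_zero, add_zero, zero_add, Finset.mul_sum, h1, h2, mul_ite, Finset.sum_ite_eq',
     Finset.mem_univ, if_true]
  refine Finset.sum_congr rfl fun i _ => ?_
  field_simp
  ring

theorem oddElement_inl_inl (θ : ℝ) (a b : Fin r ⊕ Fin s → A) (j : Fin r) :
    oddElement θ a b (Pi.single (.inl (.inl j)) 1) = (-(1 / (Real.sqrt 2 : ℂ))) • b (.inl j) +
      (1 / (Real.sqrt 2 : ℂ) * (2 * Complex.I / θ)) • a (.inl j) := by
  rw [oddElement, Fintype.sum_sum_type, Finset.sum_eq_single j, Finset.sum_eq_zero, add_zero]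
  · simp [OddPart.annihilationCoord, OddPart.creationCoord, OddPart.xi, OddPart.eta]
  · intro k _
    simp [OddPart.annihilationCoord, OddPart.creationCoord, OddPart.zeta]
  · intro k _ hk
    simp [OddPart.annihilationCoord, OddPart.creationCoord, OddPart.xi, OddPart.eta, hk]
  · simp

theorem oddElement_inr (θ : ℝ) (a b : Fin r ⊕ Fin s → A) (j : Fin r) :
    oddElement θ a b (Pi.single (.inr j) 1) = (-(1 / (Real.sqrt 2 : ℂ))) • b (.inl j) -
      (1 / (Real.sqrt 2 : ℂ) * (2 * Complex.I / θ)) • a (.inl j) := by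
  rw [oddElement, Fintype.sum_sum_type, Finset.sum_eq_single j, Finset.sum_eq_zero, add_zero]
  · simp [OddPart.annihilationCoord, OddPart.creationCoord, OddPart.xi, OddPart.eta, neg_div,
      sub_eq_add_neg]
  · intro k _
    simp [OddPart.annihilationCoord, OddPart.creationCoord, OddPart.zeta]
  · intro k _ hk
    simp [OddPart.annihilationCoord, OddPart.creationCoord, OddPart.xi, OddPart.eta, hk]
  · simp

theorem oddElement_inl_inr_inl (θ : ℝ) (a b : Fin r ⊕ Fin s → A) (k : Fin s) :
    oddElement θ a b (Pi.single (.inl (.inr (.inl k))) 1) = (-1 : ℂ) • b (.inr k) +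
      (Complex.I / θ) • a (.inr k) := by
  rw [oddElement, Fintype.sum_sum_type, Finset.sum_eq_zero, Finset.sum_eq_single k, zero_add]
  · simp [OddPart.annihilationCoord, OddPart.creationCoord, OddPart.zeta]
  · intro j _ hj
    simp [OddPart.annihilationCoord, OddPart.creationCoord, OddPart.zeta, hj]
  · simp
  · intro j _
    simp [OddPart.annihilationCoord, OddPart.creationCoord, OddPart.xi, OddPart.eta]

theorem oddElement_inl_inr_inr (θ : ℝ) (a b : Fin r ⊕ Fin s → A) (k : Fin s) :
    oddElement θ a b (Pi.single (.inl (.inr (.inr k))) 1) = (-Complex.I) • b (.inr k) +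
      (-Complex.I * (Complex.I / θ)) • a (.inr k) := by
  rw [oddElement, Fintype.sum_sum_type, Finset.sum_eq_zero, Finset.sum_eq_single k, zero_add]
  · simp [OddPart.annihilationCoord, OddPart.creationCoord, OddPart.zeta]
  · intro j _ hj
    simp [OddPart.annihilationCoord, OddPart.creationCoord, OddPart.zeta, hj]
  · simp
  · intro j _
    simp [OddPart.annihilationCoord, OddPart.creationCoord, OddPart.xi, OddPart.eta]

/-- The creation and annihilation operators are complex combinations of the odd operators. -/
theorem mem_of_oddElement_mem {θ : ℝ} (hθ : θ ≠ 0) {a b : Fin r ⊕ Fin s → A} {N : Submodule ℂ A}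
    (h : ∀ X : OddPart r s, oddElement θ a b X ∈ N) (i) : a i ∈ N ∧ b i ∈ N := by
  have hθ' : (θ : ℂ) ≠ 0 := by exact_mod_cast hθ
  have h2 : (Real.sqrt 2 : ℂ) ≠ 0 := sqrt_two_ne_zero
  rcases i with j | k
  · have h1 := h (Pi.single (.inl (.inl j)) 1)
    have h3 := h (Pi.single (.inr j) 1)
    rw [oddElement_inl_inl] at h1
    rw [oddElement_inr] at h3
    constructor
    · convert N.smul_mem ((Real.sqrt 2 : ℂ) * θ / (4 * Complex.I)) (N.sub_mem h1 h3) using 1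
      match_scalars
      · field_simp; norm_num
      · ring
    · convert N.smul_mem (-(Real.sqrt 2 : ℂ) / 2) (N.add_mem h1 h3) using 1
      match_scalars
      · field_simp; norm_num
      · ring
  · have h1 := h (Pi.single (.inl (.inr (.inl k))) 1)
    have h3 := N.smul_mem Complex.I (h (Pi.single (.inl (.inr (.inr k))) 1))
    rw [oddElement_inl_inr_inl] at h1
    rw [oddElement_inl_inr_inr] at h3
    have hI := Complex.I_mul_I
    constructor
    · convert N.smul_mem (θ / (2 * Complex.I)) (N.add_mem h1 h3) using 1
      match_scalars
      · field_simp; simp; norm_num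
      · field_simp; simp
    · convert N.smul_mem (-(1 / 2 : ℂ)) (N.sub_mem h1 h3) using 1
      match_scalars
      · field_simp; simp; norm_num
      · field_simp; simp

theorem IsCAR.oddElement_mul_add {θ : ℝ} (hθ : θ ≠ 0) {a b : Fin r ⊕ Fin s → A} (h : IsCAR a b)
    (X Y : OddPart r s) :
    oddElement θ a b X * oddElement θ a b Y + oddElement θ a b Y * oddElement θ a b X =
      (-(2 * Complex.I / θ) * (omegaOdd X Y : ℂ)) • (1 : A) := by
  have key : ∀ i j : Fin r ⊕ Fin s,
      (X.annihilationCoord i • b i + X.creationCoord θ i • a i) *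
        (Y.annihilationCoord j • b j + Y.creationCoord θ j • a j) +
      (Y.annihilationCoord j • b j + Y.creationCoord θ j • a j) *
        (X.annihilationCoord i • b i + X.creationCoord θ i • a i) =
      if i = j then (X.annihilationCoord i * Y.creationCoord θ i +
        X.creationCoord θ i * Y.annihilationCoord i) • (1 : A) else 0 := by
    intro i j
    have e1 := h.ab i j
    have e2 := h.ab j i
    have e3 := h.aa i j
    have e4 := h.bb i j
    simp only [add_mul, mul_add, smul_mul_smul_comm]
    by_cases hij : i = j
    · subst hij
      rw [if_pos rfl] at e1 ⊢
      linear_combination (norm := module) (X.annihilationCoord i * Y.creationCoord θ i +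
        X.creationCoord θ i * Y.annihilationCoord i) • e1 +
        (X.creationCoord θ i * Y.creationCoord θ i) • e3 +
        (X.annihilationCoord i * Y.annihilationCoord i) • e4
    · rw [if_neg hij] at e1 ⊢
      rw [if_neg (Ne.symm hij)] at e2
      linear_combination (norm := module) (X.annihilationCoord i * Y.creationCoord θ j) • e2 +
        (X.creationCoord θ i * Y.annihilationCoord j) • e1 +
        (X.creationCoord θ i * Y.creationCoord θ j) • e3 +
        (X.annihilationCoord i * Y.annihilationCoord j) • e4
  rw [← sum_coord_eq_omega hθ, Finset.sum_smul, oddElement, oddElement, Finset.sum_mul_sum,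
    Finset.sum_mul_sum, Finset.sum_comm (s := Finset.univ) (t := Finset.univ)
      (f := fun i j => (Y.annihilationCoord i • b i + Y.creationCoord θ i • a i) *
        (X.annihilationCoord j • b j + X.creationCoord θ j • a j)), ← Finset.sum_add_distrib]
  refine Finset.sum_congr rfl fun i _ => ?_
  rw [← Finset.sum_add_distrib]
  simp only [key, Finset.sum_ite_eq, Finset.mem_univ, if_true]

end Odd

/-! ### The inner product of the model -/

theorem neg_one_pow_val_natCast (n : ℕ) : (-1 : ℂ) ^ (n : ZMod 2).val = (-1) ^ n := by
  rw [ZMod.val_natCast, ← neg_one_pow_eq_pow_mod_two]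

theorem neg_one_pow_val_mul_natCast (m n : ℕ) :
    (-1 : ℂ) ^ ((m : ZMod 2).val * (n : ZMod 2).val) = (-1) ^ (m * n) := by
  rw [pow_mul, neg_one_pow_val_natCast, ← pow_mul, mul_comm, pow_mul, neg_one_pow_val_natCast,
    ← pow_mul, mul_comm]

theorem neg_one_pow_mul_self (n : ℕ) : (-1 : ℂ) ^ n * (-1) ^ n = 1 := by
  rw [← mul_pow]; simp

theorem neg_one_pow_val_add (a b : ZMod 2) :
    (-1 : ℂ) ^ (a + b).val = (-1) ^ a.val * (-1) ^ b.val := by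
  have h := neg_one_pow_val_natCast (a.val + b.val)
  rwa [Nat.cast_add, ZMod.natCast_zmod_val, ZMod.natCast_zmod_val, pow_add] at h

theorem neg_one_pow_val_add_one (a : ZMod 2) : (-1 : ℂ) ^ (a + 1).val = -(-1) ^ a.val := by
  rw [neg_one_pow_val_add, ZMod.val_one, pow_one, mul_neg_one]

section Sign

variable {r : ℕ}

theorem grassmannSign_eq_prod {I J : Finset (Fin r)} (h : Disjoint I J) :
    grassmannSign I J = ∏ x ∈ I, ∏ y ∈ J, if y < x then (-1 : ℂ) else 1 := by
  rw [grassmannSign, if_pos h, ← Finset.prod_product', Finset.prod_ite]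
  simp

theorem moveSign_eq_prod (j : Fin r) (I : Finset (Fin r)) :
    moveSign j I = ∏ x ∈ I, if x < j then (-1 : ℂ) else 1 := by
  rw [moveSign, Finset.prod_ite]
  simp

theorem grassmannSign_mul_self {I J : Finset (Fin r)} (h : Disjoint I J) :
    grassmannSign I J * grassmannSign I J = 1 := by
  rw [grassmannSign, if_pos h, neg_one_pow_mul_self]

theorem grassmannSign_swap {I J : Finset (Fin r)} (h : Disjoint I J) :
    grassmannSign J I = (-1) ^ (I.card * J.card) * grassmannSign I J := by
  rw [grassmannSign_eq_prod h, grassmannSign_eq_prod h.symm, Finset.prod_comm, mul_comm I.card,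
    pow_mul, ← Finset.prod_const, ← Finset.prod_mul_distrib]
  refine Finset.prod_congr rfl fun x hx => ?_
  rw [← Finset.prod_const, ← Finset.prod_mul_distrib]
  refine Finset.prod_congr rfl fun y hy => ?_
  have hxy : x ≠ y := fun e => Finset.disjoint_left.1 h hx (e ▸ hy)
  rcases lt_or_gt_of_ne hxy with h1 | h1 <;> simp [h1, h1.not_gt]

theorem prod_gt_eq {j : Fin r} {I : Finset (Fin r)} (hj : j ∉ I) :
    (∏ x ∈ I, if j < x then (-1 : ℂ) else 1) = (-1) ^ I.card * moveSign j I := by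
  rw [moveSign_eq_prod, ← Finset.prod_const, ← Finset.prod_mul_distrib]
  refine Finset.prod_congr rfl fun x hx => ?_
  have hxj : x ≠ j := fun e => hj (e ▸ hx)
  rcases lt_or_gt_of_ne hxj with h1 | h1 <;> simp [h1, h1.not_gt]

theorem grassmannSign_insert_compl {j : Fin r} {I : Finset (Fin r)} (hj : j ∉ I) :
    moveSign j I * grassmannSign (insert j I) (insert j I)ᶜ =
      (-1) ^ I.card * (moveSign j Iᶜ * grassmannSign I Iᶜ) := by
  have h1 : Iᶜ = insert j (insert j I)ᶜ := by
    rw [Finset.compl_insert, Finset.insert_erase (by simp [hj])]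
  have hj' : j ∉ (insert j I)ᶜ := by simp
  rw [grassmannSign_eq_prod disjoint_compl_right, grassmannSign_eq_prod disjoint_compl_right,
    Finset.prod_insert hj, ← moveSign_eq_prod, h1, moveSign_insert_self]
  simp_rw [Finset.prod_insert hj']
  rw [Finset.prod_mul_distrib, prod_gt_eq hj]
  have h3 := neg_one_pow_mul_self I.card
  linear_combination (-moveSign j I * moveSign j (insert j I)ᶜ *
    ∏ x ∈ I, ∏ y ∈ (insert j I)ᶜ, if y < x then (-1 : ℂ) else 1) * h3

end Sign

section Coeff

variable {r s : ℕ}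

/-- The monomial paired with a given one by the inner product. -/
def Monomial.dual (M : Monomial r s) : Monomial r s := (M.1ᶜ, M.2)

@[simp]
theorem Monomial.dual_dual (M : Monomial r s) : M.dual.dual = M := by
  simp [Monomial.dual]

theorem Monomial.dual_degree (M : Monomial r s) : M.dual.degree = M.degree + r := by
  have h : M.1.card + M.1ᶜ.card = r := by simp [Finset.card_add_card_compl]
  have h' : ((M.1.card + M.1ᶜ.card : ℕ) : ZMod 2) = r := by rw [h]
  have h2 : (2 : ZMod 2) = 0 := rfl
  rw [Monomial.degree, Monomial.degree, Monomial.dual, ← h']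
  push_cast
  linear_combination (-(M.1.card : ZMod 2)) * h2

theorem berezinCoeff_ne_zero {θ : ℝ} (hθ : θ ≠ 0) (M : Monomial r s) : berezinCoeff θ M ≠ 0 := by
  have hθ' : (θ : ℂ) ≠ 0 := by exact_mod_cast hθ
  have h : grassmannSign M.1 M.1ᶜ ≠ 0 := fun h => by
    simpa [h] using grassmannSign_mul_self (disjoint_compl_right (a := M.1))
  simp [berezinCoeff, h, hθ']

theorem conj_berezinCoeff (θ : ℝ) (M : Monomial r s) :
    conj (berezinCoeff θ M) =
      (-1) ^ (M.degree.val * M.dual.degree.val) * berezinCoeff θ M.dual := by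
  have h1 : conj (grassmannSign M.1 M.1ᶜ) = grassmannSign M.1 M.1ᶜ := by
    rw [grassmannSign, if_pos disjoint_compl_right]; simp
  have h2 : M.2.card + M.2ᶜ.card = s := by simp [Finset.card_add_card_compl]
  have h3 : (-1 : ℂ) ^ s = (-1) ^ M.2.card * (-1) ^ M.2ᶜ.card := by rw [← pow_add, h2]
  have h4 : (-1 : ℂ) ^ ((M.1.card + M.2.card) * (M.1ᶜ.card + M.2.card)) =
      (-1) ^ (M.1.card * M.1ᶜ.card) * (-1) ^ (M.2.card * M.1.card) *
        (-1) ^ (M.2.card * M.1ᶜ.card) * (-1) ^ M.2.card := by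
    have h5 : (-1 : ℂ) ^ (M.2.card * M.2.card) = (-1) ^ M.2.card := by
      rcases Nat.even_or_odd M.2.card with h | h
      · rw [(h.mul_right _).neg_one_pow, h.neg_one_pow]
      · rw [(h.mul h).neg_one_pow, h.neg_one_pow]
    rw [← h5, ← pow_add, ← pow_add, ← pow_add]
    congr 1
    ring
  rw [Monomial.degree, Monomial.degree, neg_one_pow_val_mul_natCast, berezinCoeff, berezinCoeff]
  simp only [Monomial.dual, compl_compl, map_mul, map_pow, h1, map_neg, map_div₀, map_one,
    map_ofNat, Complex.conj_I, Complex.conj_ofReal]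
  rw [grassmannSign_swap disjoint_compl_right, neg_div, neg_neg, mul_neg, neg_pow (2 * Complex.I),
    neg_pow (Complex.I / (θ : ℂ)), h3, h4]
  have e1 := neg_one_pow_mul_self (M.1.card * M.1ᶜ.card)
  have e2 := neg_one_pow_mul_self (M.2.card * M.1.card)
  generalize (-1 : ℂ) ^ (M.1.card * M.1ᶜ.card) = x at *
  generalize (-1 : ℂ) ^ (M.2.card * M.1.card) = y at *
  generalize (-1 : ℂ) ^ (M.2.card * M.1ᶜ.card) = z
  generalize (2 * Complex.I) ^ s = t
  generalize (Complex.I / (θ : ℂ)) ^ M.2ᶜ.card = p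
  generalize (-1 : ℂ) ^ M.2.card.choose 2 = q
  generalize (-1 : ℂ) ^ M.2ᶜ.card = b
  generalize (-1 : ℂ) ^ M.2.card = a
  generalize grassmannSign M.1 M.1ᶜ = g
  linear_combination (-a * b * t * p * q * z * g) * (y * y * e1 + e2)

theorem berezinCoeff_ins_inl (θ : ℝ) {M : Monomial r s} {j : Fin r} (h : j ∉ M.1) :
    M.sgn (.inl j) * berezinCoeff θ (M.ins (.inl j)) =
      (-1) ^ M.degree.val * (M.dual.sgn (.inl j) * berezinCoeff θ M) := by
  have h1 := grassmannSign_insert_compl h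
  have h2 : M.1ᶜ.card = (insert j M.1)ᶜ.card + 1 := by
    rw [Finset.compl_insert, Finset.card_erase_add_one (by simpa using h)]
  rw [Monomial.degree, neg_one_pow_val_natCast, berezinCoeff, berezinCoeff]
  simp only [Monomial.sgn, Monomial.ins, Monomial.dual, h2, mul_add, mul_one, pow_add]
  have e1 := neg_one_pow_mul_self M.2.card
  generalize (-1 : ℂ) ^ (M.2.card * (insert j M.1)ᶜ.card) = x at *
  generalize (-1 : ℂ) ^ M.2.card = y at *
  linear_combination ((2 * Complex.I) ^ s * (-(Complex.I / θ)) ^ M.2ᶜ.card *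
    (-1) ^ M.2.card.choose 2 * x) * (h1 - (-1) ^ M.1.card * moveSign j M.1ᶜ *
      grassmannSign M.1 M.1ᶜ * e1)

theorem berezinCoeff_ins_inr {θ : ℝ} {M : Monomial r s} {k : Fin s} (h : k ∉ M.2) :
    M.sgn (.inr k) * berezinCoeff θ M =
      -(Complex.I / θ) * (-1) ^ M.degree.val *
        (M.dual.sgn (.inr k) * berezinCoeff θ (M.ins (.inr k))) := by
  have h2 : M.2ᶜ.card = (insert k M.2)ᶜ.card + 1 := by
    rw [Finset.compl_insert, Finset.card_erase_add_one (by simpa using h)]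
  rw [Monomial.degree, neg_one_pow_val_natCast, berezinCoeff, berezinCoeff]
  simp only [Monomial.sgn, Monomial.ins, Monomial.dual, h2, Finset.card_insert_of_notMem h,
    add_mul, one_mul, pow_add, pow_one, Nat.choose_succ_succ' _ 1, Nat.choose_one_right]
  have e1 := neg_one_pow_mul_self M.2.card
  have e2 := neg_one_pow_mul_self M.1ᶜ.card
  generalize (-1 : ℂ) ^ (M.2.card * M.1ᶜ.card) = x
  generalize (-1 : ℂ) ^ M.1ᶜ.card = z at *
  generalize (-1 : ℂ) ^ M.2.card.choose 2 = q at *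
  generalize (-1 : ℂ) ^ M.2.card = y at *
  linear_combination ((-1) ^ M.1.card * moveSign k M.2 * (2 * Complex.I) ^ s *
    (-(Complex.I / θ)) ^ (insert k M.2)ᶜ.card * (Complex.I / θ) * q * x *
      grassmannSign M.1 M.1ᶜ) * (y * y * e2 + e1)

end Coeff

section ModelForm

variable {m r s : ℕ} {θ : ℝ}

theorem coe_mulXi (j : Fin r) :
    (mulXi m r s j : ModelSpace m r s →ₗ[ℂ] ModelSpace m r s) = fockMul (.inl j) := by
  refine LinearMap.ext fun φ => funext fun M => ?_
  rw [fockMul_apply]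
  change (if j ∈ M.1 then moveSign j M.1 • ContinuousLinearMap.proj (R := ℂ) (φ := fun _ => L2 m)
    ((M.1.erase j, M.2) : Monomial r s) else 0 : ModelSpace m r s →L[ℂ] L2 m) φ = _
  by_cases h : j ∈ M.1
  · rw [if_pos h, if_pos (show M.Has (.inl j) from h)]; rfl
  · rw [if_neg h, if_neg (show ¬ M.Has (.inl j) from h)]; rfl

theorem coe_dXi (j : Fin r) :
    (dXi m r s j : ModelSpace m r s →ₗ[ℂ] ModelSpace m r s) = fockDer (.inl j) := by
  refine LinearMap.ext fun φ => funext fun M => ?_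
  rw [fockDer_apply]
  change (if j ∉ M.1 then moveSign j M.1 • ContinuousLinearMap.proj (R := ℂ) (φ := fun _ => L2 m)
    ((insert j M.1, M.2) : Monomial r s) else 0 : ModelSpace m r s →L[ℂ] L2 m) φ = _
  by_cases h : j ∈ M.1
  · rw [if_neg (not_not.2 h), if_pos (show M.Has (.inl j) from h)]; rfl
  · rw [if_pos h, if_neg (show ¬ M.Has (.inl j) from h)]; rfl

theorem coe_mulZeta (k : Fin s) :
    (mulZeta m r s k : ModelSpace m r s →ₗ[ℂ] ModelSpace m r s) = fockMul (.inr k) := by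
  refine LinearMap.ext fun φ => funext fun M => ?_
  rw [fockMul_apply]
  change (if k ∈ M.2 then ((-1 : ℂ) ^ M.1.card * moveSign k M.2) •
    ContinuousLinearMap.proj (R := ℂ) (φ := fun _ => L2 m)
    ((M.1, M.2.erase k) : Monomial r s) else 0 : ModelSpace m r s →L[ℂ] L2 m) φ = _
  by_cases h : k ∈ M.2
  · rw [if_pos h, if_pos (show M.Has (.inr k) from h)]; rfl
  · rw [if_neg h, if_neg (show ¬ M.Has (.inr k) from h)]; rfl

theorem coe_dZeta (k : Fin s) :
    (dZeta m r s k : ModelSpace m r s →ₗ[ℂ] ModelSpace m r s) = fockDer (.inr k) := by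
  refine LinearMap.ext fun φ => funext fun M => ?_
  rw [fockDer_apply]
  change (if k ∉ M.2 then ((-1 : ℂ) ^ M.1.card * moveSign k M.2) •
    ContinuousLinearMap.proj (R := ℂ) (φ := fun _ => L2 m)
    ((M.1, insert k M.2) : Monomial r s) else 0 : ModelSpace m r s →L[ℂ] L2 m) φ = _
  by_cases h : k ∈ M.2
  · rw [if_neg (not_not.2 h), if_pos (show M.Has (.inr k) from h)]; rfl
  · rw [if_pos h, if_neg (show ¬ M.Has (.inr k) from h)]; rfl

theorem coe_oddOperator (X : OddPart r s) :
    (oddOperator m θ X : ModelSpace m r s →ₗ[ℂ] ModelSpace m r s) =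
      oddElement θ fockMul fockDer X := by
  rw [oddElement, Fintype.sum_sum_type, oddOperator]
  simp only [ContinuousLinearMap.toLinearMap_add, ContinuousLinearMap.toLinearMap_sum,
    ContinuousLinearMap.toLinearMap_smul, coe_mulXi, coe_dXi,
    coe_mulZeta, coe_dZeta, OddPart.annihilationCoord, OddPart.creationCoord]

theorem oddOperator_apply (X : OddPart r s) (φ : ModelSpace m r s) :
    oddOperator m θ X φ = oddElement θ fockMul fockDer X φ :=
  DFunLike.congr_fun (coe_oddOperator X) φ

theorem modelForm_apply (φ ψ : ModelSpace m r s) :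
    modelForm m r s θ φ ψ = ∑ M, berezinCoeff θ M * inner ℂ (φ M) (ψ M.dual) := rfl

theorem modelForm_single (M N : Monomial r s) (x y : L2 m) :
    modelForm m r s θ (Pi.single M x) (Pi.single N y) =
      if N = M.dual then berezinCoeff θ M * inner ℂ x y else 0 := by
  rw [modelForm_apply, Finset.sum_eq_single M]
  · split_ifs with h
    · rw [h, Pi.single_eq_same, Pi.single_eq_same]
    · rw [Pi.single_eq_of_ne (Ne.symm h), inner_zero_right, mul_zero]
  · intro M' _ hM'
    rw [Pi.single_eq_of_ne hM', inner_zero_left, mul_zero]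
  · simp

/-- Sesquilinear forms agree when they agree on monomials. -/
theorem sesq_ext {A : Type*} [AddCommGroup A] [Module ℂ A]
    {F G : (Monomial r s → A) →ₗ⋆[ℂ] (Monomial r s → A) →ₗ[ℂ] ℂ}
    (h : ∀ M N x y, F (Pi.single M x) (Pi.single N y) = G (Pi.single M x) (Pi.single N y)) :
    F = G := by
  refine LinearMap.ext fun φ => ?_
  rw [← Finset.univ_sum_single φ, map_sum, map_sum]
  exact Finset.sum_congr rfl fun M _ => LinearMap.pi_ext fun N y => h _ _ _ _

theorem modelForm_adjoint_of_single {S T : Module.End ℂ (ModelSpace m r s)} {c : ℂ}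
    (h : ∀ M N x y, modelForm m r s θ (S (Pi.single M x)) (Pi.single N y) =
      c * ((-1) ^ M.degree.val * modelForm m r s θ (Pi.single M x) (T (Pi.single N y))))
    (φ ψ : ModelSpace m r s) :
    modelForm m r s θ (S φ) ψ = c * modelForm m r s θ (fockGrading φ) (T ψ) := by
  have h1 : (modelForm m r s θ).comp S =
      c • ((modelForm m r s θ).comp fockGrading).compl₂ T := by
    refine sesq_ext fun M N x y => ?_
    simp only [LinearMap.comp_apply, LinearMap.smul_apply, LinearMap.compl₂_apply, smul_eq_mul]
    rw [h, fockGrading_single, LinearMap.map_smulₛₗ, LinearMap.smul_apply, map_pow, map_neg, map_one,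
      smul_eq_mul]
  have h2 := DFunLike.congr_fun (DFunLike.congr_fun h1 φ) ψ
  simpa only [LinearMap.comp_apply, LinearMap.smul_apply, LinearMap.compl₂_apply, smul_eq_mul]
    using h2

theorem Monomial.conj_sgn (M : Monomial r s) (j) : conj (M.sgn j) = M.sgn j := by
  rcases j with j | k <;> simp [Monomial.sgn, moveSign]

theorem Monomial.dual_ins_inl (M : Monomial r s) (j : Fin r) :
    (M.ins (.inl j)).dual = M.dual.ers (.inl j) := by
  simp [Monomial.dual, Monomial.ins, Monomial.ers, Finset.compl_insert]

theorem Monomial.dual_ins_inr (M : Monomial r s) (k : Fin s) :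
    (M.ins (.inr k)).dual = M.dual.ins (.inr k) := rfl

theorem Monomial.has_dual_inl (M : Monomial r s) (j : Fin r) :
    M.dual.Has (.inl j) ↔ ¬ M.Has (.inl j) := by
  simp [Monomial.dual, Monomial.Has]

theorem Monomial.has_dual_inr (M : Monomial r s) (k : Fin s) :
    M.dual.Has (.inr k) ↔ M.Has (.inr k) := Iff.rfl

theorem Monomial.ers_eq_iff {M N : Monomial r s} {j} (hM : ¬ M.Has j) (hN : N.Has j) :
    N.ers j = M ↔ N = M.ins j :=
  ⟨fun h => by rw [← h, ins_ers hN], fun h => by rw [h, ers_ins hM]⟩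

theorem modelForm_mul_inl (j : Fin r) (φ ψ : ModelSpace m r s) :
    modelForm m r s θ (fockMul (.inl j) φ) ψ =
      1 * modelForm m r s θ (fockGrading φ) (fockMul (.inl j) ψ) := by
  refine modelForm_adjoint_of_single (fun M N x y => ?_) φ ψ
  by_cases hN : N.Has (.inl j)
  · rw [fockMul_single_of_has hN, map_zero]
    by_cases hM : M.Has (.inl j)
    · rw [fockMul_single_of_has hM]; simp
    · rw [fockMul_single hM, LinearMap.map_smulₛₗ, LinearMap.smul_apply, modelForm_single, if_neg]
      · simp
      · rintro rfl
        exact (Monomial.has_dual_inl _ _).1 hN (M.has_ins_self _)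
  · by_cases hM : M.Has (.inl j)
    · rw [fockMul_single_of_has hM, fockMul_single hN, map_smul, modelForm_single, if_neg]
      · simp
      · intro h
        exact (Monomial.has_dual_inl _ _).1 (h ▸ N.has_ins_self (.inl j)) hM
    · have hd : M.dual.Has (.inl j) := (M.has_dual_inl j).2 hM
      rw [fockMul_single hM, fockMul_single hN, LinearMap.map_smulₛₗ, LinearMap.smul_apply, map_smul,
        modelForm_single, modelForm_single, M.conj_sgn]
      have hiff : N = (M.ins (.inl j)).dual ↔ N.ins (.inl j) = M.dual := by
        rw [M.dual_ins_inl, eq_comm, Monomial.ers_eq_iff hN hd, eq_comm]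
      simp only [hiff]
      split_ifs with h
      · have h1 := berezinCoeff_ins_inl θ (M := M) hM
        rw [← h, N.sgn_ins_self] at h1
        simp only [smul_eq_mul]
        linear_combination inner ℂ x y * h1
      · simp

theorem modelForm_der_inl (j : Fin r) (φ ψ : ModelSpace m r s) :
    modelForm m r s θ (fockDer (.inl j) φ) ψ =
      -1 * modelForm m r s θ (fockGrading φ) (fockDer (.inl j) ψ) := by
  refine modelForm_adjoint_of_single (fun M N x y => ?_) φ ψ
  by_cases hM : M.Has (.inl j)
  · obtain ⟨M, hM', rfl⟩ : ∃ M' : Monomial r s, ¬ M'.Has (.inl j) ∧ M = M'.ins (.inl j) :=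
      ⟨_, M.not_has_ers_self _, (M.ins_ers hM).symm⟩
    have hd : M.dual.Has (.inl j) := (M.has_dual_inl j).2 hM'
    rw [fockDer_single hM, M.ers_ins hM', LinearMap.map_smulₛₗ, LinearMap.smul_apply,
      modelForm_single, Monomial.conj_sgn, M.sgn_ins_self]
    by_cases hN : N.Has (.inl j)
    · rw [fockDer_single hN, map_smul, modelForm_single]
      have hiff : N.ers (.inl j) = (M.ins (.inl j)).dual ↔ N = M.dual := by
        rw [M.dual_ins_inl, Monomial.ers_eq_iff (M.dual.not_has_ers_self _) hN, Monomial.ins_ers hd]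
      simp only [hiff]
      split_ifs with h
      · have h1 := berezinCoeff_ins_inl θ (M := M) hM'
        have h2 := neg_one_pow_mul_self M.degree.val
        rw [Monomial.degree_ins hM', neg_one_pow_val_add_one, h]
        simp only [smul_eq_mul]
        have h3 := M.sgn_mul_self (.inl j)
        have h4 := M.dual.sgn_mul_self (.inl j)
        generalize (-1 : ℂ) ^ M.degree.val = e at *
        generalize M.sgn (.inl j) = σ at *
        generalize M.dual.sgn (.inl j) = d at *
        generalize berezinCoeff θ M = b at *
        generalize berezinCoeff θ (M.ins (.inl j)) = B at *
        linear_combination inner ℂ x y * ((-(e * d * σ)) * h1 - (σ * b) * (d * d * h2 + h4) +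
          (e * d * B) * h3)
      · simp
    · rw [fockDer_single_of_not_has hN, if_neg]
      · simp
      · rintro rfl
        exact hN hd
  · rw [fockDer_single_of_not_has hM]
    by_cases hN : N.Has (.inl j)
    · rw [fockDer_single hN, map_smul, modelForm_single, if_neg]
      · simp
      · intro h
        exact hM (by_contra fun h' => N.not_has_ers_self _ (h ▸ (M.has_dual_inl j).2 h'))
    · rw [fockDer_single_of_not_has hN]; simp

theorem modelForm_mul_inr (hθ : θ ≠ 0) (k : Fin s) (φ ψ : ModelSpace m r s) :
    modelForm m r s θ (fockMul (.inr k) φ) ψ =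
      θ * Complex.I * modelForm m r s θ (fockGrading φ) (fockDer (.inr k) ψ) := by
  refine modelForm_adjoint_of_single (fun M N x y => ?_) φ ψ
  by_cases hN : N.Has (.inr k)
  · rw [fockDer_single hN, map_smul, modelForm_single]
    by_cases hM : M.Has (.inr k)
    · rw [fockMul_single_of_has hM, if_neg]
      · simp
      · intro h
        exact N.not_has_ers_self _ (h ▸ (M.has_dual_inr k).2 hM)
    · rw [fockMul_single hM, LinearMap.map_smulₛₗ, LinearMap.smul_apply, modelForm_single,
        M.conj_sgn]
      have hiff : N.ers (.inr k) = M.dual ↔ N = (M.ins (.inr k)).dual := by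
        rw [M.dual_ins_inr, Monomial.ers_eq_iff ((M.has_dual_inr k).not.2 hM) hN]
      simp only [hiff]
      split_ifs with h
      · have h1 := berezinCoeff_ins_inr (θ := θ) (M := M) hM
        have hc : θ * Complex.I * (Complex.I / θ) = -1 := by
          have hθ' : (θ : ℂ) ≠ 0 := by exact_mod_cast hθ
          field_simp
          simp
        have h2 := neg_one_pow_mul_self M.degree.val
        have h3 := M.sgn_mul_self (.inr k)
        have h4 := M.dual.sgn_mul_self (.inr k)
        rw [h, M.dual_ins_inr, Monomial.sgn_ins_self]
        simp only [smul_eq_mul]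
        generalize Complex.I / (θ : ℂ) = c at *
        generalize (-1 : ℂ) ^ M.degree.val = e at *
        generalize M.sgn (.inr k) = σ at *
        generalize M.dual.sgn (.inr k) = d at *
        generalize berezinCoeff θ M = b at *
        generalize berezinCoeff θ (M.ins (.inr k)) = B at *
        linear_combination inner ℂ x y * ((-(θ * Complex.I * e * d * σ)) * h1 +
          (e * e * d * d * σ * B) * hc - (σ * B) * (d * d * h2 + h4) + (θ * Complex.I * e * d * b) * h3)
      · simp
  · rw [fockDer_single_of_not_has hN, map_zero]
    by_cases hM : M.Has (.inr k)
    · rw [fockMul_single_of_has hM]; simp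
    · rw [fockMul_single hM, LinearMap.map_smulₛₗ, LinearMap.smul_apply, modelForm_single, if_neg]
      · simp
      · rintro rfl
        exact hN ((M.ins (.inr k)).has_dual_inr k |>.2 (M.has_ins_self _))

theorem modelForm_der_inr (k : Fin s) (φ ψ : ModelSpace m r s) :
    modelForm m r s θ (fockDer (.inr k) φ) ψ =
      Complex.I / θ * modelForm m r s θ (fockGrading φ) (fockMul (.inr k) ψ) := by
  refine modelForm_adjoint_of_single (fun M N x y => ?_) φ ψ
  by_cases hM : M.Has (.inr k)
  · obtain ⟨M, hM', rfl⟩ : ∃ M' : Monomial r s, ¬ M'.Has (.inr k) ∧ M = M'.ins (.inr k) :=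
      ⟨_, M.not_has_ers_self _, (M.ins_ers hM).symm⟩
    rw [fockDer_single hM, M.ers_ins hM', LinearMap.map_smulₛₗ, LinearMap.smul_apply,
      modelForm_single, Monomial.conj_sgn, M.sgn_ins_self]
    by_cases hN : N.Has (.inr k)
    · rw [fockMul_single_of_has hN, if_neg]
      · simp
      · rintro rfl
        exact hM' hN
    · rw [fockMul_single hN, map_smul, modelForm_single]
      have hiff : N.ins (.inr k) = (M.ins (.inr k)).dual ↔ N = M.dual := by
        rw [M.dual_ins_inr, ← Monomial.ers_eq_iff ((M.has_dual_inr k).not.2 hM') (N.has_ins_self _),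
          N.ers_ins hN]
      simp only [hiff]
      split_ifs with h
      · have h1 := berezinCoeff_ins_inr (θ := θ) (M := M) hM'
        rw [Monomial.degree_ins hM', neg_one_pow_val_add_one, h]
        simp only [smul_eq_mul]
        linear_combination inner ℂ x y * h1
      · simp
  · rw [fockDer_single_of_not_has hM]
    by_cases hN : N.Has (.inr k)
    · rw [fockMul_single_of_has hN]; simp
    · rw [fockMul_single hN, map_smul, modelForm_single, if_neg]
      · simp
      · intro h
        exact hM ((M.has_dual_inr k).1 (h ▸ N.has_ins_self (.inr k)))

theorem modelForm_oddOperator (hθ : θ ≠ 0) (X : OddPart r s) (φ ψ : ModelSpace m r s) :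
    modelForm m r s θ (oddOperator m θ X φ) ψ =
      -modelForm m r s θ (fockGrading φ) (oddOperator m θ X ψ) := by
  have hθ' : (θ : ℂ) ≠ 0 := by exact_mod_cast hθ
  simp only [oddOperator_apply, oddElement, Fintype.sum_sum_type, LinearMap.add_apply,
    LinearMap.sum_apply, map_add, map_sum, LinearMap.smul_apply, LinearMap.map_smulₛₗ, smul_eq_mul,
    modelForm_mul_inl, modelForm_der_inl, modelForm_mul_inr hθ, modelForm_der_inr,
    OddPart.annihilationCoord, OddPart.creationCoord, neg_add, ← Finset.sum_neg_distrib]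
  congr 1
  · refine Finset.sum_congr rfl fun j _ => ?_
    simp [Complex.conj_ofNat]
    ring
  · refine Finset.sum_congr rfl fun k _ => ?_
    simp
    field_simp
    linear_combination (-(θ * X.zeta k) * modelForm m r s θ (fockGrading φ)
      (fockDer (.inr k) ψ)) * Complex.I_sq

end ModelForm

/-! ### The model is a superunitary representation -/

section Model

variable {m r s : ℕ} {θ : ℝ}

theorem mem_modelComp {a : ZMod 2} {φ : ModelSpace m r s} :
    φ ∈ modelComp m r s a ↔ ∀ M : Monomial r s, M.degree ≠ a → φ M = 0 := Iff.rfl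

theorem sum_dual {E : Type*} [AddCommMonoid E] (f : Monomial r s → E) :
    ∑ M : Monomial r s, f M.dual = ∑ M, f M :=
  Equiv.sum_comp (Function.Involutive.toPerm _ fun M : Monomial r s => M.dual_dual) f

theorem norm_berezinCoeff_dual (θ : ℝ) (M : Monomial r s) :
    ‖berezinCoeff θ M.dual‖ = ‖berezinCoeff θ M‖ := by
  rw [← RCLike.norm_conj (berezinCoeff θ M), conj_berezinCoeff]
  simp

/-- The phase of the model symmetry on a monomial. -/
noncomputable def modelPhase (θ : ℝ) (M : Monomial r s) : ℂ :=
  conj (berezinCoeff θ M) / ‖berezinCoeff θ M‖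

/-- The fundamental symmetry of the model. -/
noncomputable def modelSymmetry (m r s : ℕ) (θ : ℝ) : ModelSpace m r s →ₗ[ℂ] ModelSpace m r s :=
  LinearMap.pi fun M => modelPhase θ M.dual • LinearMap.proj M.dual

theorem modelSymmetry_apply (φ : ModelSpace m r s) (M : Monomial r s) :
    modelSymmetry m r s θ φ M = modelPhase θ M.dual • φ M.dual := rfl

theorem berezinCoeff_mul_modelPhase (hθ : θ ≠ 0) (M : Monomial r s) :
    berezinCoeff θ M * modelPhase θ M = ‖berezinCoeff θ M‖ := by
  have h : (‖berezinCoeff θ M‖ : ℂ) ≠ 0 := by simp [berezinCoeff_ne_zero hθ]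
  rw [modelPhase, mul_div_assoc', Complex.mul_conj, div_eq_iff h, Complex.normSq_eq_norm_sq]
  push_cast
  ring

theorem norm_mul_conj_modelPhase (hθ : θ ≠ 0) (M : Monomial r s) :
    ‖berezinCoeff θ M‖ * conj (modelPhase θ M) = berezinCoeff θ M := by
  have h : (‖berezinCoeff θ M‖ : ℂ) ≠ 0 := by simp [berezinCoeff_ne_zero hθ]
  rw [modelPhase, map_div₀, Complex.conj_conj, Complex.conj_ofReal, mul_div_cancel₀ _ h]

theorem modelPhase_mul_dual (hθ : θ ≠ 0) (M : Monomial r s) :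
    modelPhase θ M * modelPhase θ M.dual = (-1) ^ (M.degree.val * M.dual.degree.val) := by
  have h : (‖berezinCoeff θ M‖ : ℂ) ≠ 0 := by simp [berezinCoeff_ne_zero hθ]
  have h1 := conj_berezinCoeff θ M
  have h2 := neg_one_pow_mul_self (M.degree.val * M.dual.degree.val)
  have h3 : modelPhase θ M =
      (-1) ^ (M.degree.val * M.dual.degree.val) * berezinCoeff θ M.dual / ‖berezinCoeff θ M‖ := by
    rw [modelPhase, h1]
  have h4 := berezinCoeff_mul_modelPhase hθ M.dual
  rw [h3, div_mul_eq_mul_div, mul_assoc, h4, norm_berezinCoeff_dual, mul_div_cancel_right₀ _ h]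

theorem modelForm_symmetry (hθ : θ ≠ 0) (φ ψ : ModelSpace m r s) :
    modelForm m r s θ φ (modelSymmetry m r s θ ψ) =
      ∑ M, (‖berezinCoeff θ M‖ : ℂ) * inner ℂ (φ M) (ψ M) := by
  rw [modelForm_apply]
  refine Finset.sum_congr rfl fun M _ => ?_
  rw [modelSymmetry_apply, M.dual_dual, inner_smul_right, ← mul_assoc,
    berezinCoeff_mul_modelPhase hθ]

theorem isFundamentalSymmetry_model (hθ : θ ≠ 0) :
    (modelSuperspace m r s θ).IsFundamentalSymmetry (r : ZMod 2) (modelSymmetry m r s θ) where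
  degree a φ hφ M hM := by
    rw [modelSymmetry_apply, mem_modelComp.1 hφ, smul_zero]
    rw [M.dual_degree]
    rintro rfl
    refine hM ?_
    rw [add_assoc, CharTwo.add_self_eq_zero, add_zero]
  square a φ hφ := by
    funext M
    have hpar : ∀ a n : ZMod 2, (Even (a.val * (a + n).val) ↔ Even ((n + 1).val * a.val)) := by
      decide
    rw [modelSymmetry_apply, modelSymmetry_apply, M.dual_dual, smul_smul, mul_comm,
      modelPhase_mul_dual hθ, Pi.smul_apply]
    by_cases h : M.degree = a
    · rw [M.dual_degree, h]
      congr 1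
      exact neg_one_pow_congr (hpar _ _)
    · rw [mem_modelComp.1 hφ M h, smul_zero, smul_zero]
  isometric φ ψ := by
    change modelForm m r s θ _ _ = modelForm m r s θ _ _
    rw [modelForm_symmetry hθ, modelForm_apply, ← sum_dual]
    refine Finset.sum_congr rfl fun M _ => ?_
    rw [modelSymmetry_apply, M.dual_dual, norm_berezinCoeff_dual, inner_smul_left, ← mul_assoc,
      norm_mul_conj_modelPhase hθ]
  hermitian φ ψ := by
    change conj (modelForm m r s θ _ _) = modelForm m r s θ _ _
    rw [modelForm_symmetry hθ, modelForm_symmetry hθ, map_sum]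
    exact Finset.sum_congr rfl fun M _ => by
      rw [map_mul, Complex.conj_ofReal, inner_conj_symm]
  equivalent_norm := by
    obtain ⟨M₀, -, h₀⟩ := Finset.exists_min_image Finset.univ
      (fun M : Monomial r s => ‖berezinCoeff θ M‖) ⟨(∅, ∅), Finset.mem_univ _⟩
    have hpos : 0 < ‖berezinCoeff θ M₀‖ := norm_pos_iff.2 (berezinCoeff_ne_zero hθ _)
    refine ⟨‖berezinCoeff θ M₀‖, ∑ M : Monomial r s, ‖berezinCoeff θ M‖, hpos, fun φ => ?_⟩
    have h1 : (modelForm m r s θ φ (modelSymmetry m r s θ φ)).re =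
        ∑ M, ‖berezinCoeff θ M‖ * ‖φ M‖ ^ 2 := by
      rw [modelForm_symmetry hθ, Complex.re_sum]
      refine Finset.sum_congr rfl fun M _ => ?_
      rw [inner_self_eq_norm_sq_to_K]
      exact (congrArg Complex.re (by push_cast; rfl)).trans (Complex.ofReal_re _)
    change _ ≤ (modelForm m r s θ φ (modelSymmetry m r s θ φ)).re ∧
      (modelForm m r s θ φ (modelSymmetry m r s θ φ)).re ≤ _
    rw [h1]
    constructor
    · obtain ⟨M, hM⟩ : ∃ M, ‖φ M‖ = ‖φ‖ := by
        obtain ⟨M, -, hM⟩ := Finset.exists_max_image Finset.univ (fun M => ‖φ M‖)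
          ⟨((∅, ∅) : Monomial r s), Finset.mem_univ _⟩
        exact ⟨M, le_antisymm (norm_le_pi_norm φ M)
          ((pi_norm_le_iff_of_nonneg (norm_nonneg _)).2 fun M' => hM M' (Finset.mem_univ _))⟩
      rw [← hM]
      refine le_trans ?_ (Finset.single_le_sum (f := fun M => ‖berezinCoeff θ M‖ * ‖φ M‖ ^ 2)
        (fun M _ => by positivity) (Finset.mem_univ M))
      exact mul_le_mul_of_nonneg_right (h₀ M (Finset.mem_univ _)) (by positivity)
    · rw [Finset.sum_mul]
      exact Finset.sum_le_sum fun M _ => mul_le_mul_of_nonneg_left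
        (pow_le_pow_left₀ (norm_nonneg _) (norm_le_pi_norm φ M) 2) (norm_nonneg _)

theorem isHilbertSuperspace_model (hθ : θ ≠ 0) :
    (modelSuperspace m r s θ).IsHilbertSuperspace (r : ZMod 2) where
  complete := inferInstance
  grading := by
    constructor
    · rw [Submodule.disjoint_def]
      intro φ h0 h1
      funext M
      by_cases h : M.degree = 0
      · exact h1 M (by rw [h]; decide)
      · exact h0 M h
    · rw [codisjoint_iff, eq_top_iff]
      intro φ _
      refine Submodule.mem_sup.2 ⟨fun M => if M.degree = 0 then φ M else 0, fun M hM => if_neg hM,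
        fun M => if M.degree = 0 then 0 else φ M, fun M hM => if_pos ?_, ?_⟩
      · generalize M.degree = a at *
        revert a; decide
      · funext M
        by_cases h : M.degree = 0 <;> simp [h]
  superhermitian a b φ hφ ψ hψ := by
    change conj (modelForm m r s θ φ ψ) = _ * modelForm m r s θ ψ φ
    rw [modelForm_apply, modelForm_apply, ← sum_dual (fun M => berezinCoeff θ M * _), map_sum,
      Finset.mul_sum]
    refine Finset.sum_congr rfl fun M _ => ?_
    rw [map_mul, inner_conj_symm, conj_berezinCoeff, M.dual_dual]
    by_cases h1 : M.dual.degree = a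
    · by_cases h2 : M.degree = b
      · rw [h1, h2]; ring
      · rw [hψ _ h2]; simp
    · rw [hφ _ h1]; simp
  homogeneous a b hab φ hφ ψ hψ := by
    change modelForm m r s θ φ ψ = 0
    rw [modelForm_apply]
    refine Finset.sum_eq_zero fun M _ => ?_
    by_cases h1 : M.degree = a
    · rw [hψ M.dual, inner_zero_right, mul_zero]
      rw [M.dual_degree, h1]
      rintro rfl
      exact hab (by rw [← add_assoc, CharTwo.add_self_eq_zero, zero_add])
    · rw [hφ _ h1]; simp
  exists_symmetry := ⟨_, isFundamentalSymmetry_model hθ⟩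

end Model

section Smooth

variable {m : ℕ} {H K : Type*} [NormedAddCommGroup H] [NormedSpace ℂ H] [NormedAddCommGroup K]
  [NormedSpace ℂ K] {π : HeisBody m → H →L[ℂ] H} {π' : HeisBody m → K →L[ℂ] K}

theorem mem_smoothVectors {v : H} :
    v ∈ smoothVectors π ↔ ContDiff ℝ ((⊤ : ℕ∞) : WithTop ℕ∞) fun g => π g v := Iff.rfl

theorem map_mem_smoothVectors {T : H →L[ℂ] K} (hT : ∀ g v, T (π g v) = π' g (T v)) {v : H}
    (hv : v ∈ smoothVectors π) : T v ∈ smoothVectors π' := by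
  rw [mem_smoothVectors] at *
  simp_rw [← hT]
  exact (T.restrictScalars ℝ).contDiff.comp hv

theorem contDiff_heisMul (h : HeisBody m) :
    ContDiff ℝ ((⊤ : ℕ∞) : WithTop ℕ∞) fun g => heisMul g h := by
  unfold heisMul omegaEven
  refine ContDiff.prodMk (by fun_prop) (ContDiff.prodMk (by fun_prop) ?_)
  have h1 : ContDiff ℝ ((⊤ : ℕ∞) : WithTop ℕ∞) fun g : HeisBody m => inner ℝ g.1 h.2.1 :=
    contDiff_fst.inner ℝ contDiff_const
  have h2 : ContDiff ℝ ((⊤ : ℕ∞) : WithTop ℕ∞) fun g : HeisBody m => inner ℝ g.2.1 h.1 :=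
    (contDiff_fst.comp contDiff_snd).inner ℝ contDiff_const
  have h3 : ContDiff ℝ ((⊤ : ℕ∞) : WithTop ℕ∞) fun g : HeisBody m => g.2.2 + h.2.2 := by fun_prop
  exact h3.add ((h1.sub h2).div_const _)

theorem body_mem_smoothVectors (hmul : ∀ g h, π (heisMul g h) = π g ∘L π h) (h : HeisBody m) {v : H}
    (hv : v ∈ smoothVectors π) : π h v ∈ smoothVectors π := by
  rw [mem_smoothVectors] at *
  have h1 : (fun g => π g (π h v)) = (fun g => π g v) ∘ fun g => heisMul g h := by
    funext g
    simp [hmul]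
  rw [h1]
  exact hv.comp (contDiff_heisMul h)

theorem deriv_central {θ : ℝ} (hchar : ∀ (t : ℝ) (v : H), π (0, 0, t) v =
    Complex.exp (2 * Complex.I / θ * t) • v) (v : H) :
    deriv (fun t : ℝ => π (0, 0, t) v) 0 = (2 * Complex.I / θ) • v := by
  simp_rw [hchar]
  have h : HasDerivAt (fun t : ℝ => Complex.exp (2 * Complex.I / θ * t)) (2 * Complex.I / θ) 0 := by
    have h1 : HasDerivAt (fun t : ℝ => 2 * Complex.I / θ * (t : ℂ)) (2 * Complex.I / θ) 0 := by
      simpa only [id, Complex.ofReal_one, mul_one] using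
        (hasDerivAt_id (0 : ℝ)).ofReal_comp.const_mul (2 * Complex.I / (θ : ℂ))
    have h2 := h1.cexp
    rw [Complex.ofReal_zero, mul_zero, Complex.exp_zero, one_mul] at h2
    exact h2
  exact (h.smul_const v).deriv

theorem proj_mem_smoothVectors [CompleteSpace H] {θ : ℝ}
    (hmul : ∀ g h, π (heisMul g h) = π g ∘L π h)
    (hchar : ∀ (t : ℝ) (v : H), π (0, 0, t) v = Complex.exp (2 * Complex.I / θ * t) • v)
    (hW : IsWeylSystem θ⁻¹ (phaseRot m) fun z => π (phaseBody z)) (x : H) :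
    hW.proj x ∈ smoothVectors π := by
  rw [mem_smoothVectors]
  rw [funext fun g => body_eq hmul hchar g (hW.proj x)]
  have h1 : ContDiff ℝ ((⊤ : ℕ∞) : WithTop ℕ∞) fun g : HeisBody m =>
      Complex.exp (2 * Complex.I / θ * (g.2.2 : ℝ)) := by
    have h2 : ContDiff ℝ ((⊤ : ℕ∞) : WithTop ℕ∞) fun g : HeisBody m => ((g.2.2 : ℝ) : ℂ) :=
      Complex.ofRealCLM.contDiff.comp (contDiff_snd.comp contDiff_snd)
    exact (contDiff_const.mul h2).cexp
  have h3 : ContDiff ℝ ((⊤ : ℕ∞) : WithTop ℕ∞) fun g : HeisBody m =>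
      (WithLp.toLp 2 (g.1, g.2.1) : PhaseSpace m) :=
    (WithLp.prodContinuousLinearEquiv 2 ℝ (EuclideanSpace ℝ (Fin m))
      (EuclideanSpace ℝ (Fin m))).symm.contDiff.comp
      (contDiff_fst.prodMk (contDiff_fst.comp contDiff_snd))
  exact h1.smul ((hW.contDiff_proj x).comp h3)

end Smooth

section Model

variable {m r s : ℕ} {θ : ℝ}

theorem modelBody_apply (g : HeisBody m) (φ : ModelSpace m r s) (M : Monomial r s) :
    modelBody m r s θ g φ M = schrodinger θ g (φ M) := rfl

theorem fockMul_modelBody (g : HeisBody m) (j : Fin r ⊕ Fin s) (φ : ModelSpace m r s) :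
    fockMul j (modelBody m r s θ g φ) = modelBody m r s θ g (fockMul j φ) := by
  funext M
  rw [fockMul_apply, modelBody_apply, modelBody_apply, fockMul_apply]
  split_ifs <;> simp

theorem fockDer_modelBody (g : HeisBody m) (j : Fin r ⊕ Fin s) (φ : ModelSpace m r s) :
    fockDer j (modelBody m r s θ g φ) = modelBody m r s θ g (fockDer j φ) := by
  funext M
  rw [fockDer_apply, modelBody_apply, modelBody_apply, fockDer_apply]
  split_ifs <;> simp

theorem oddOperator_modelBody (g : HeisBody m) (X : OddPart r s) (φ : ModelSpace m r s) :
    oddOperator m θ X (modelBody m r s θ g φ) = modelBody m r s θ g (oddOperator m θ X φ) := by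
  simp only [oddOperator_apply, oddElement, LinearMap.sum_apply, LinearMap.add_apply,
    LinearMap.smul_apply, fockMul_modelBody, fockDer_modelBody, map_sum, map_add, map_smul]

theorem modelBody_central (t : ℝ) (φ : ModelSpace m r s) :
    modelBody m r s θ (0, 0, t) φ = Complex.exp (2 * Complex.I / θ * t) • φ :=
  funext fun M => schrodinger_central θ t (φ M)

theorem modelBody_mul (g h : HeisBody m) :
    modelBody m r s θ (heisMul g h) = modelBody m r s θ g ∘L modelBody m r s θ h := by
  refine ContinuousLinearMap.ext fun φ => funext fun M => ?_
  simp only [modelBody_apply, schrodinger_mul, ContinuousLinearMap.comp_apply]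

theorem fockMul_mem_modelComp {a : ZMod 2} {φ : ModelSpace m r s} (hφ : φ ∈ modelComp m r s a) (j) :
    fockMul j φ ∈ modelComp m r s (a + 1) := by
  intro M hM
  rw [fockMul_apply]
  split_ifs with h
  · rw [mem_modelComp.1 hφ, smul_zero]
    rw [Monomial.degree_ers h]
    rintro rfl
    exact hM (by rw [add_assoc, CharTwo.add_self_eq_zero, add_zero])
  · rfl

theorem fockDer_mem_modelComp {a : ZMod 2} {φ : ModelSpace m r s} (hφ : φ ∈ modelComp m r s a) (j) :
    fockDer j φ ∈ modelComp m r s (a + 1) := by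
  intro M hM
  rw [fockDer_apply]
  split_ifs with h
  · rfl
  · rw [mem_modelComp.1 hφ, smul_zero]
    rw [Monomial.degree_ins h]
    rintro rfl
    exact hM (by rw [add_assoc, CharTwo.add_self_eq_zero, add_zero])

theorem oddOperator_mem_modelComp {a : ZMod 2} {φ : ModelSpace m r s} (hφ : φ ∈ modelComp m r s a)
    (X : OddPart r s) : oddOperator m θ X φ ∈ modelComp m r s (a + 1) := by
  rw [oddOperator_apply, oddElement, LinearMap.sum_apply]
  exact Submodule.sum_mem _ fun i _ => Submodule.add_mem _
    (Submodule.smul_mem _ _ (fockDer_mem_modelComp hφ i))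
    (Submodule.smul_mem _ _ (fockMul_mem_modelComp hφ i))

theorem fockGrading_of_mem {a : ZMod 2} {φ : ModelSpace m r s} (hφ : φ ∈ modelComp m r s a) :
    fockGrading φ = (-1 : ℂ) ^ a.val • φ := by
  funext M
  change (-1 : ℂ) ^ M.degree.val • φ M = (-1 : ℂ) ^ a.val • φ M
  by_cases h : M.degree = a
  · rw [h]
  · rw [mem_modelComp.1 hφ M h, smul_zero, smul_zero]

theorem isSuperunitaryRep_model (hθ : θ ≠ 0) :
    IsSuperunitaryRep (r : ZMod 2) (modelSuperspace m r s θ) (modelRep m r s θ) where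
  hilbert := isHilbertSuperspace_model hθ
  π_one := ContinuousLinearMap.ext fun φ => funext fun M => by
    change schrodinger θ 0 (φ M) = φ M
    rw [schrodinger_one]
    rfl
  π_mul := modelBody_mul
  π_continuous φ := continuous_pi fun M => continuous_schrodinger hθ (φ M)
  π_bounded := ⟨1, fun g => ContinuousLinearMap.opNorm_le_bound _ zero_le_one fun φ => by
    rw [one_mul]
    exact (pi_norm_le_iff_of_nonneg (norm_nonneg _)).2 fun M =>
      (norm_schrodinger θ g (φ M)).trans_le (norm_le_pi_norm φ M)⟩
  π_even g a φ hφ M hM := by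
    change schrodinger θ g (φ M) = 0
    rw [mem_modelComp.1 hφ M hM, map_zero]
  π_superunitary g φ ψ := by
    change modelForm m r s θ (modelBody m r s θ g φ) (modelBody m r s θ g ψ) = modelForm m r s θ φ ψ
    simp only [modelForm_apply, modelBody_apply, inner_schrodinger]
  ρ_add X Y φ := by
    change oddOperator m θ (X + Y) φ.1 = oddOperator m θ X φ.1 + oddOperator m θ Y φ.1
    have h : oddElement θ (fockMul (A := L2 m)) fockDer (X + Y) =
        oddElement θ fockMul fockDer X + oddElement θ fockMul fockDer Y :=
      oddElement_add θ _ _ X Y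
    simp only [oddOperator_apply, h, LinearMap.add_apply]
  ρ_smul c X φ := by
    change oddOperator m θ (c • X) φ.1 = (c : ℂ) • oddOperator m θ X φ.1
    have h : oddElement θ (fockMul (A := L2 m)) fockDer (c • X) =
        (c : ℂ) • oddElement θ fockMul fockDer X := oddElement_smul θ _ _ c X
    simp only [oddOperator_apply, h, LinearMap.smul_apply]
  ρ_odd X a φ hφ := oddOperator_mem_modelComp hφ X
  ρ_equivariant g X φ := ⟨body_mem_smoothVectors modelBody_mul g φ.2,
    oddOperator_modelBody g X φ.1⟩
  ρ_bracket X Y φ := by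
    have hs : ∀ X, oddOperator m θ X φ.1 ∈ smoothVectors (modelBody m r s θ) := fun X =>
      map_mem_smoothVectors (fun g v => oddOperator_modelBody g X v) φ.2
    refine ⟨hs X, hs Y, ?_⟩
    change oddOperator m θ X (oddOperator m θ Y φ.1) + oddOperator m θ Y (oddOperator m θ X φ.1) =
      -(omegaOdd X Y : ℂ) • deriv (fun t : ℝ => modelBody m r s θ (0, 0, t) φ.1) 0
    rw [show deriv (fun t : ℝ => modelBody m r s θ (0, 0, t) φ.1) 0 = _ from
      deriv_central (π := modelBody m r s θ) modelBody_central φ.1, smul_smul]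
    have h := DFunLike.congr_fun ((isCAR_fock (A := L2 m)).oddElement_mul_add hθ X Y) φ.1
    simp only [oddOperator_apply]
    refine h.trans ?_
    rw [LinearMap.smul_apply, Module.End.one_apply]
    congr 1
    ring
  ρ_superunitary X a φ ψ hφ := by
    change modelForm m r s θ (oddOperator m θ X φ.1) ψ.1 +
      (-1) ^ a.val * modelForm m r s θ φ.1 (oddOperator m θ X ψ.1) = 0
    rw [modelForm_oddOperator hθ, fockGrading_of_mem hφ, LinearMap.map_smulₛₗ, LinearMap.smul_apply]
    simp

/-- A closed subspace stable under a Weyl system is stable under the Gaussian projection. -/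
theorem IsWeylSystem.proj_mem {Z H : Type*} [NormedAddCommGroup Z] [InnerProductSpace ℝ Z]
    [FiniteDimensional ℝ Z] [MeasurableSpace Z] [BorelSpace Z] [NormedAddCommGroup H]
    [NormedSpace ℂ H] [CompleteSpace H] {c : ℝ} {K : Z →ₗᵢ[ℝ] Z} {W : Z → H →L[ℂ] H}
    (hW : IsWeylSystem c K W) {Y : Submodule ℂ H} (hc : IsClosed (Y : Set H))
    (hY : ∀ z, ∀ x ∈ Y, W z x ∈ Y) {x : H} (hx : x ∈ Y) : hW.proj x ∈ Y := by
  rw [← Submodule.Quotient.mk_eq_zero]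
  change Y.mkQL (hW.proj x) = 0
  rw [hW.map_proj' Y.mkQL]
  have h : ∀ z, Y.mkQL (W z x) = 0 := fun z => (Submodule.Quotient.mk_eq_zero _).2 (hY z x hx)
  simp [h]

theorem isIrreducible_model (hθ : θ ≠ 0) :
    IsIrreducibleRep (modelSuperspace m r s θ) (modelRep m r s θ) := by
  have hΩ : vacuum m hθ ≠ 0 := by
    rw [← norm_ne_zero_iff, norm_vacuum]
    exact one_ne_zero
  have hR := isSuperunitaryRep_model (m := m) (r := r) (s := s) hθ
  have hW : IsWeylSystem θ⁻¹ (phaseRot m) fun z => modelBody m r s θ (phaseBody z) :=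
    isWeylSystem_of_body hθ hR.π_one hR.π_mul hR.π_continuous hR.π_bounded modelBody_central
  refine ⟨⟨Pi.single (∅, ∅) (vacuum m hθ), 0, by simpa using hΩ⟩, fun Y hc _ hπ hρ => ?_⟩
  by_cases hY : Y = ⊥
  · exact Or.inl hY
  right
  obtain ⟨φ, hφ, hφ0⟩ := (Submodule.ne_bot_iff _).1 hY
  obtain ⟨w, hw⟩ : ∃ w, hW.proj (modelBody m r s θ (phaseBody (-w)) φ) ≠ 0 := by
    by_contra! H
    have h := hW.mem_closure_span φ
    simp only [H, map_zero] at h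
    rw [show (Set.range fun _ : PhaseSpace m => (0 : ModelSpace m r s)) = {0} from
      Set.range_const, Submodule.span_zero_singleton] at h
    have h2 : (⊥ : Submodule ℂ (ModelSpace m r s)).topologicalClosure = ⊥ :=
      (isClosed_singleton (x := (0 : ModelSpace m r s))).submodule_topologicalClosure_eq
    rw [h2] at h
    exact hφ0 h
  set ψ := hW.proj (modelBody m r s θ (phaseBody (-w)) φ) with hψ
  have hψY : ψ ∈ Y := hW.proj_mem hc (fun z x hx => hπ _ x hx) (hπ _ _ hφ)
  have hψs : ψ ∈ smoothVectors (modelBody m r s θ) :=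
    proj_mem_smoothVectors modelBody_mul modelBody_central hW _
  let Y' : Submodule ℂ (ModelSpace m r s) := Y ⊓ smoothVectors (modelBody m r s θ)
  let N : Submodule ℂ (Module.End ℂ (ModelSpace m r s)) :=
    { carrier := {T | ∀ x ∈ Y', T x ∈ Y'}
      zero_mem' := fun x _ => Y'.zero_mem
      add_mem' := fun hS hT x hx => Y'.add_mem (hS x hx) (hT x hx)
      smul_mem' := fun c T hT x hx => Y'.smul_mem c (hT x hx) }
  have hN : ∀ X : OddPart r s, oddElement θ fockMul fockDer X ∈ N := fun X x hx => by
    have h1 := hρ X ⟨x, hx.2⟩ hx.1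
    have h2 : oddOperator m θ X x ∈ smoothVectors (modelBody m r s θ) :=
      map_mem_smoothVectors (fun g v => oddOperator_modelBody g X v) hx.2
    rw [← oddOperator_apply]
    exact ⟨h1, h2⟩
  obtain ⟨M₀, hM₀⟩ : ∃ M, ψ M ≠ 0 := by
    by_contra! H
    exact hw (funext H)
  have hψM : ∃ c : ℂ, ψ M₀ = c • vacuum m hθ := by
    have h1 := hW.intertwine_proj (schrodinger_isWeylSystem hθ)
      (ContinuousLinearMap.proj (R := ℂ) (φ := fun _ : Monomial r s => L2 m) M₀) (fun z x => rfl)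
      (modelBody m r s θ (phaseBody (-w)) φ)
    rw [schrodinger_proj hθ] at h1
    exact ⟨_, h1⟩
  obtain ⟨c, hcM⟩ := hψM
  have hc0 : c ≠ 0 := by
    rintro rfl
    exact hM₀ (by rw [hcM, zero_smul])
  have h1 : ∀ M f, Pi.single M f ∈ Y := by
    intro M f
    have h2 := (single_mem_of_invariant (W := Y') (fun j => (mem_of_oddElement_mem hθ hN j).1)
      (fun j => (mem_of_oddElement_mem hθ hN j).2) ⟨hψY, hψs⟩ M₀ M).1
    have h3 : Pi.single M (vacuum m hθ) ∈ Y := by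
      have h4 := Y.smul_mem c⁻¹ h2
      rwa [← Pi.single_smul, hcM, smul_smul, inv_mul_cancel₀ hc0, one_smul] at h4
    let L : L2 m →L[ℂ] ModelSpace m r s := ContinuousLinearMap.single ℂ (fun _ => L2 m) M
    have h5 : (⊤ : Submodule ℂ (L2 m)) ≤ Y.comap L.toLinearMap := by
      rw [← span_coherent_dense hθ]
      refine Submodule.topologicalClosure_minimal _ ?_ (hc.preimage L.continuous)
      rw [Submodule.span_le]
      rintro _ ⟨z, rfl⟩
      have h6 := hπ (phaseBody z) _ h3
      have h7 : (Pi.single M (schrodinger θ (phaseBody z) (vacuum m hθ)) : ModelSpace m r s) =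
          modelBody m r s θ (phaseBody z) (Pi.single M (vacuum m hθ)) := by
        funext M'
        rw [modelBody_apply]
        by_cases hM : M' = M
        · subst hM; simp
        · simp [Pi.single_eq_of_ne hM]
      change Pi.single M (schrodinger θ (phaseBody z) (vacuum m hθ)) ∈ Y
      rw [h7]
      exact h6
    exact h5 (Submodule.mem_top (x := f))
  rw [eq_top_iff]
  intro x _
  rw [← Finset.univ_sum_single x]
  exact Y.sum_mem fun M _ => h1 M _

end Model

/-- The two parities. -/
theorem ZMod.eq_zero_or_eq_one (a : ZMod 2) : a = 0 ∨ a = 1 := by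
  revert a
  decide

/-! ### Bounded operators attached to a Hilbert superspace -/

namespace SuperspaceData

section

variable {H : Type*} [NormedAddCommGroup H] [NormedSpace ℂ H] {S : SuperspaceData H} {n : ZMod 2}

theorem IsFundamentalSymmetry.isScalarProduct {J : H →ₗ[ℂ] H} (hJ : S.IsFundamentalSymmetry n J) :
    IsScalarProduct (S.form.compl₂ J) :=
  ⟨hJ.hermitian, hJ.equivalent_norm⟩

theorem IsHilbertSuperspace.exists_add (hS : S.IsHilbertSuperspace n) (x : H) :
    ∃ y ∈ S.comp 0, ∃ z ∈ S.comp 1, y + z = x :=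
  Submodule.mem_sup.1 (hS.grading.sup_eq_top ▸ Submodule.mem_top)

theorem IsHilbertSuperspace.ext_comp (hS : S.IsHilbertSuperspace n) {E : Type*} [AddCommGroup E]
    [Module ℂ E] {f g : H →ₗ[ℂ] E} (h : ∀ a, ∀ x ∈ S.comp a, f x = g x) : f = g := by
  ext x
  obtain ⟨y, hy, z, hz, rfl⟩ := hS.exists_add x
  rw [map_add, map_add, h 0 y hy, h 1 z hz]

/-- A linear map that preserves a scalar product is bounded. -/
theorem exists_bound_of_isometric {B : H →ₗ⋆[ℂ] H →ₗ[ℂ] ℂ} (hB : IsScalarProduct B)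
    (T : H →ₗ[ℂ] H) (hT : ∀ x, (B (T x) (T x)).re = (B x x).re) : ∃ C, ∀ x, ‖T x‖ ≤ C * ‖x‖ := by
  obtain ⟨c, C, hc, h⟩ := hB.bounds
  refine ⟨Real.sqrt (C / c), fun x => ?_⟩
  have h1 := (h (T x)).1
  rw [hT] at h1
  have h2 : ‖T x‖ ^ 2 ≤ C / c * ‖x‖ ^ 2 := by
    rw [div_mul_eq_mul_div, le_div_iff₀ hc, mul_comm]
    exact h1.trans (h x).2
  rw [← Real.sqrt_sq (norm_nonneg x), ← Real.sqrt_mul' _ (by positivity)]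
  exact Real.le_sqrt_of_sq_le h2

theorem IsFundamentalSymmetry.pow_four (hS : S.IsHilbertSuperspace n) {J : H →ₗ[ℂ] H}
    (hJ : S.IsFundamentalSymmetry n J) (x : H) : J (J (J (J x))) = x := by
  have h : J ∘ₗ J ∘ₗ J ∘ₗ J = LinearMap.id := hS.ext_comp fun a x hx => by
    simp only [LinearMap.comp_apply, LinearMap.id_apply]
    rw [hJ.square a x hx, map_smul, map_smul, hJ.square a x hx, smul_smul, neg_one_pow_mul_self,
      one_smul]
  exact DFunLike.congr_fun h x

theorem IsFundamentalSymmetry.exists_bound {J : H →ₗ[ℂ] H} (hJ : S.IsFundamentalSymmetry n J) :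
    ∃ C, ∀ x, ‖J x‖ ≤ C * ‖x‖ :=
  exists_bound_of_isometric hJ.isScalarProduct J fun x => by
    simp only [LinearMap.compl₂_apply]
    rw [hJ.isometric]

/-- The inner product of a Hilbert superspace is bounded. -/
theorem IsHilbertSuperspace.exists_form (hS : S.IsHilbertSuperspace n) :
    ∃ F : H →L⋆[ℂ] H →L[ℂ] ℂ, ∀ x y, F x y = S.form x y := by
  obtain ⟨J, hJ⟩ := hS.exists_symmetry
  obtain ⟨C, hC0, hC⟩ := hJ.isScalarProduct.exists_norm_le
  obtain ⟨D, hD⟩ := hJ.exists_bound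
  have hD' : ∀ x, ‖J x‖ ≤ |D| * ‖x‖ := fun x =>
    (hD x).trans (mul_le_mul_of_nonneg_right (le_abs_self D) (norm_nonneg x))
  refine ⟨LinearMap.mkContinuous₂ S.form (C * (|D| * (|D| * |D|))) fun x y => ?_, fun x y => rfl⟩
  have h1 := hC x (J (J (J y)))
  rw [LinearMap.compl₂_apply, hJ.pow_four hS] at h1
  refine h1.trans ?_
  have h2 : ‖J (J (J y))‖ ≤ |D| * (|D| * (|D| * ‖y‖)) :=
    (hD' _).trans (mul_le_mul_of_nonneg_left ((hD' _).trans
      (mul_le_mul_of_nonneg_left (hD' _) (abs_nonneg _))) (abs_nonneg _))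
  calc _ ≤ C * ‖x‖ * (|D| * (|D| * (|D| * ‖y‖))) :=
        mul_le_mul_of_nonneg_left h2 (by positivity)
    _ = _ := by ring

theorem IsHilbertSuperspace.eq_zero_of_form (hS : S.IsHilbertSuperspace n) {y : H}
    (h : ∀ x, S.form x y = 0) : y = 0 := by
  obtain ⟨J, hJ⟩ := hS.exists_symmetry
  obtain ⟨c, C, hc, hb⟩ := hJ.equivalent_norm
  have h1 := (hb (J (J (J y)))).1
  rw [hJ.pow_four hS, h, Complex.zero_re] at h1
  have h2 : ‖J (J (J y))‖ ^ 2 = 0 := le_antisymm (by nlinarith) (by positivity)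
  have h3 : J (J (J y)) = 0 := by simpa using h2
  rw [← hJ.pow_four hS y, h3, map_zero]

theorem IsFundamentalSymmetry.orthogonal (hS : S.IsHilbertSuperspace n) {J : H →ₗ[ℂ] H}
    (hJ : S.IsFundamentalSymmetry n J) {a b : ZMod 2} (hab : a ≠ b) {x y : H} (hx : x ∈ S.comp a)
    (hy : y ∈ S.comp b) : S.form x (J y) = 0 := by
  refine hS.homogeneous a (b + n) ?_ x hx _ (hJ.degree b y hy)
  intro h
  refine hab ?_
  have h2 : a + b = 0 := by linear_combination h
  rw [← sub_eq_zero, sub_eq_add_neg, ZMod.neg_eq_self_mod_two, h2]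

/-- `Γ` is the grading operator of the superspace. -/
def IsGrading (S : SuperspaceData H) (Γ : H →L[ℂ] H) : Prop :=
  ∀ a, ∀ x ∈ S.comp a, Γ x = (-1 : ℂ) ^ a.val • x

theorem IsHilbertSuperspace.exists_grading (hS : S.IsHilbertSuperspace n) :
    ∃ Γ : H →L[ℂ] H, S.IsGrading Γ := by
  obtain ⟨J, hJ⟩ := hS.exists_symmetry
  set Γ : H →ₗ[ℂ] H := LinearMap.id - (2 : ℂ) • (S.comp 1).subtype ∘ₗ
    Submodule.projectionOnto _ _ hS.grading.symm with hΓ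
  have h : ∀ a, ∀ x ∈ S.comp a, Γ x = (-1 : ℂ) ^ a.val • x := by
    intro a x hx
    obtain rfl | rfl : a = 0 ∨ a = 1 := ZMod.eq_zero_or_eq_one a
    · have hx : x ∈ S.comp 0 := hx
      have h1 : Submodule.projectionOnto _ _ hS.grading.symm x = 0 :=
        (Submodule.projectionOnto_apply_eq_zero_iff hS.grading.symm).2 hx
      simp [hΓ, h1]
    · have hx : x ∈ S.comp 1 := hx
      have h1 : Submodule.projectionOnto _ _ hS.grading.symm x = ⟨x, hx⟩ :=
        Submodule.projectionOnto_apply_left hS.grading.symm ⟨x, hx⟩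
      have h2 : Γ x = (-1 : ℂ) • x := by
        simp only [hΓ, LinearMap.sub_apply, LinearMap.id_apply, LinearMap.smul_apply,
          LinearMap.comp_apply, h1, Submodule.subtype_apply]
        module
      simpa [ZMod.val_one] using h2
  obtain ⟨C, hC⟩ := exists_bound_of_isometric hJ.isScalarProduct Γ fun x => by
    obtain ⟨y, hy, z, hz, rfl⟩ := hS.exists_add x
    have h0 : Γ y = y := by simpa using h 0 y hy
    have h1 : Γ z = -z := by simpa [ZMod.val_one] using h 1 z hz
    simp only [LinearMap.compl₂_apply, map_add, h0, h1, map_neg, LinearMap.add_apply,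
      LinearMap.neg_apply, hJ.orthogonal hS (a := 0) (b := 1) (by decide) hy hz,
      hJ.orthogonal hS (a := 1) (b := 0) (by decide) hz hy]
    simp
  exact ⟨Γ.mkContinuous C hC, h⟩

theorem IsGrading.ext (hS : S.IsHilbertSuperspace n) {E : Type*} [AddCommGroup E] [Module ℂ E]
    [TopologicalSpace E] {f g : H →L[ℂ] E} (h : ∀ a, ∀ x ∈ S.comp a, f x = g x) : f = g :=
  ContinuousLinearMap.coe_injective (hS.ext_comp h)

theorem IsGrading.apply_apply (hS : S.IsHilbertSuperspace n) {Γ : H →L[ℂ] H} (hΓ : S.IsGrading Γ)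
    (x : H) : Γ (Γ x) = x := by
  have h : Γ ∘L Γ = ContinuousLinearMap.id ℂ H := IsGrading.ext hS fun a x hx => by
    rw [ContinuousLinearMap.comp_apply, hΓ a x hx, map_smul, hΓ a x hx, smul_smul,
      neg_one_pow_mul_self, one_smul]
    rfl
  exact DFunLike.congr_fun h x

theorem IsGrading.mem_comp_iff (hS : S.IsHilbertSuperspace n) {Γ : H →L[ℂ] H} (hΓ : S.IsGrading Γ)
    {a : ZMod 2} {x : H} : x ∈ S.comp a ↔ Γ x = (-1 : ℂ) ^ a.val • x := by
  refine ⟨hΓ a x, fun h => ?_⟩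
  obtain ⟨y, hy, z, hz, rfl⟩ := hS.exists_add x
  have h0 : Γ y = y := by simpa using hΓ 0 y hy
  have h1 : Γ z = -z := by simpa [ZMod.val_one] using hΓ 1 z hz
  rw [map_add, h0, h1] at h
  have h2 : (2 : ℂ) ≠ 0 := two_ne_zero
  obtain rfl | rfl : a = 0 ∨ a = 1 := ZMod.eq_zero_or_eq_one a
  · have h3 : y + -z = y + z := by simpa using h
    have h4 : z = 0 := by
      have h5 : (2 : ℂ) • z = 0 := by linear_combination (norm := module) -h3
      exact (smul_eq_zero.1 h5).resolve_left h2
    rw [h4, add_zero]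
    exact hy
  · have h3 : y + -z = -(y + z) := by rw [h, ZMod.val_one, pow_one, neg_one_smul]
    have h4 : y = 0 := by
      have h5 : (2 : ℂ) • y = 0 := by linear_combination (norm := module) h3
      exact (smul_eq_zero.1 h5).resolve_left h2
    rw [h4, zero_add]
    exact hz

theorem IsGrading.isClosed_comp (hS : S.IsHilbertSuperspace n) {Γ : H →L[ℂ] H} (hΓ : S.IsGrading Γ)
    (a : ZMod 2) : IsClosed (S.comp a : Set H) := by
  have h : (S.comp a : Set H) = {x | Γ x = (-1 : ℂ) ^ a.val • x} :=
    Set.ext fun x => hΓ.mem_comp_iff hS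
  rw [h]
  exact isClosed_eq Γ.continuous (continuous_const_smul _)

end

end SuperspaceData

/-! ### Boundedness of the odd operators -/

/-- A Weyl system may be transported along an isomorphism. -/
theorem IsWeylSystem.map {Z H H' : Type*} [NormedAddCommGroup Z] [InnerProductSpace ℝ Z]
    [NormedAddCommGroup H] [NormedSpace ℂ H] [NormedAddCommGroup H'] [NormedSpace ℂ H']
    {c : ℝ} {K : Z →ₗᵢ[ℝ] Z} {W : Z → H →L[ℂ] H} (hW : IsWeylSystem c K W) (e : H ≃L[ℂ] H') :
    IsWeylSystem c K fun z => (e : H →L[ℂ] H') ∘L W z ∘L (e.symm : H' →L[ℂ] H) where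
  ne_zero := hW.ne_zero
  skew := hW.skew
  zero := by
    ext x
    simp [hW.zero]
  mul z w x := by simp [hW.mul]
  cont x := e.continuous.comp (hW.cont _)
  bdd := by
    obtain ⟨C, hC⟩ := hW.bdd
    refine ⟨‖(e : H →L[ℂ] H')‖ * (C * ‖(e.symm : H' →L[ℂ] H)‖), fun z => ?_⟩
    refine (ContinuousLinearMap.opNorm_comp_le _ _).trans
      (mul_le_mul_of_nonneg_left ?_ (norm_nonneg _))
    exact (ContinuousLinearMap.opNorm_comp_le _ _).trans
      (mul_le_mul_of_nonneg_right (hC z) (norm_nonneg _))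

theorem IsScalarProduct.isUnitaryWeyl_map {m : ℕ} {H : Type u} [NormedAddCommGroup H]
    [NormedSpace ℂ H] {θ : ℝ} (hθ : θ ≠ 0) {W : PhaseSpace m → H →L[ℂ] H}
    (hW : IsWeylSystem θ⁻¹ (phaseRot m) W) {B : H →ₗ⋆[ℂ] H →ₗ[ℂ] ℂ}
    (hB : ∀ z x y, B (W z x) (W z y) = B x y) {K : Type*} [NormedAddCommGroup K]
    [InnerProductSpace ℂ K] (e : H ≃L[ℂ] K) (he : ∀ x y, inner ℂ (e x) (e y) = B x y) :
    IsUnitaryWeyl θ fun z => (e : H →L[ℂ] K) ∘L W z ∘L (e.symm : K →L[ℂ] H) where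
  ne := hθ
  weyl := hW.map e
  isom z x := by
    have h : inner ℂ (e (W z (e.symm x))) (e (W z (e.symm x))) = inner ℂ x x := by
      rw [he, hB, ← he, e.apply_symm_apply]
    rw [inner_self_eq_norm_sq_to_K, inner_self_eq_norm_sq_to_K] at h
    have h2 : ‖e (W z (e.symm x))‖ ^ 2 = ‖x‖ ^ 2 := by
      apply Complex.ofReal_injective
      simpa using h
    exact (sq_eq_sq₀ (norm_nonneg _) (norm_nonneg _)).1 h2

/-- Bounded operators on the vacuum vectors extend to the commutant of a bounded Weyl system. -/
theorem IsScalarProduct.exists_extension {m : ℕ} {H : Type u} [NormedAddCommGroup H]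
    [NormedSpace ℂ H] [CompleteSpace H] {θ : ℝ} (hθ : θ ≠ 0) {W : PhaseSpace m → H →L[ℂ] H}
    (hW : IsWeylSystem θ⁻¹ (phaseRot m) W) {B : H →ₗ⋆[ℂ] H →ₗ[ℂ] ℂ} (hB : IsScalarProduct B)
    (A : H →L[ℂ] H) (hA : Commute A hW.proj) :
    ∃ T : H →L[ℂ] H, ∀ z x, T (W z (hW.proj x)) = W z (A (hW.proj x)) := by
  obtain ⟨B', hB', hinv, -⟩ := hB.exists_invariant hW
  obtain ⟨K, _, _, e, he⟩ := hB'.exists_hilbert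
  have : CompleteSpace K := (completeSpace_congr (e := e.toEquiv) e.isUniformEmbedding).1 ‹_›
  have hU := IsScalarProduct.isUnitaryWeyl_map hθ hW hinv e he
  have hP : ∀ x, e (hW.proj x) = hU.P (e x) :=
    hW.intertwine_proj (hW.map e) (e : H →L[ℂ] K) fun z x => by simp
  have hP' : ∀ x, e.symm (hU.P x) = hW.proj (e.symm x) := fun x => by
    rw [e.symm_apply_eq, hP, e.apply_symm_apply]
  have hA' : Commute ((e : H →L[ℂ] K) ∘L A ∘L (e.symm : K →L[ℂ] H)) hU.P := by
    ext x
    have h : A (hW.proj (e.symm x)) = hW.proj (A (e.symm x)) := DFunLike.congr_fun hA.eq _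
    change e (A (e.symm (hU.P x))) = hU.P (e (A (e.symm x)))
    rw [hP', h, hP]
  obtain ⟨T, hT⟩ := hU.exists_extension _ hA'
  refine ⟨(e.symm : K →L[ℂ] H) ∘L T ∘L (e : H →L[ℂ] K), fun z x => ?_⟩
  have h1 : ∀ x, hU.lift (e x) (hU.coherent z) = e (W z (hW.proj x)) := fun x => by
    rw [hU.lift_coherent, ← hP]
    simp
  have h2 := hT (e (hW.proj x)) (hU.coherent z)
  rw [h1, hW.proj_proj] at h2
  simp only [ContinuousLinearMap.comp_apply, ContinuousLinearEquiv.coe_coe] at h2 ⊢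
  rw [h2, e.symm_apply_apply, h1, e.symm_apply_apply]
  have h3 : A (hW.proj (hW.proj x)) = hW.proj (A (hW.proj x)) := DFunLike.congr_fun hA.eq _
  rw [← h3, hW.proj_proj]

/-- `Q` is an extension of the odd operators of `R` to bounded operators. -/
structure IsBoundedOddPart {m r s : ℕ} {H : Type*} [NormedAddCommGroup H] [NormedSpace ℂ H]
    (θ : ℝ) (S : SuperspaceData H) (R : HeisRep m r s H)
    (Q : (OddIndex r s → ℂ) →ₗ[ℂ] (H →L[ℂ] H)) : Prop where
  rep : IsOddRep θ Q
  apply : ∀ X (v : smoothVectors R.π), Q (OddPart.toC X) v = R.ρ X v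
  comm : ∀ X g x, Q X (R.π g x) = R.π g (Q X x)
  odd : ∀ X a, ∀ x ∈ S.comp a, Q X x ∈ S.comp (a + 1)
  adjoint : ∀ (X : OddPart r s) a, ∀ x ∈ S.comp a, ∀ y,
    S.form (Q X.toC x) y = -((-1 : ℂ) ^ a.val * S.form x (Q X.toC y))

namespace IsSuperunitaryRep

variable {m r s : ℕ} {H : Type u} [NormedAddCommGroup H] [NormedSpace ℂ H]
  {θ : ℝ} {n : ZMod 2} {S : SuperspaceData H} {R : HeisRep m r s H}

theorem weyl (hR : IsSuperunitaryRep n S R) (hθ : θ ≠ 0) (hχ : HasCentralCharacter θ R) :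
    IsWeylSystem θ⁻¹ (phaseRot m) fun z => R.π (phaseBody z) :=
  isWeylSystem_of_body hθ hR.π_one hR.π_mul hR.π_continuous hR.π_bounded hχ

theorem isClosed_comp (hR : IsSuperunitaryRep n S R) (a : ZMod 2) :
    IsClosed (S.comp a : Set H) := by
  obtain ⟨Γ, hΓ⟩ := hR.hilbert.exists_grading
  exact hΓ.isClosed_comp hR.hilbert a

theorem form_smooth (hR : IsSuperunitaryRep n S R) (X : OddPart r s) {a : ZMod 2}
    {v w : H} (hv : v ∈ smoothVectors R.π) (hva : v ∈ S.comp a) (hw : w ∈ smoothVectors R.π) :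
    S.form v (R.ρ X ⟨w, hw⟩) = -((-1 : ℂ) ^ a.val * S.form (R.ρ X ⟨v, hv⟩) w) := by
  have h := hR.ρ_superunitary X a ⟨v, hv⟩ ⟨w, hw⟩ hva
  have h2 := neg_one_pow_mul_self a.val
  simp only at h
  linear_combination (-1 : ℂ) ^ a.val * h - S.form v (R.ρ X ⟨w, hw⟩) * h2

variable [CompleteSpace H]

theorem proj_mem_comp (hR : IsSuperunitaryRep n S R)
    (hW : IsWeylSystem θ⁻¹ (phaseRot m) fun z => R.π (phaseBody z)) {a : ZMod 2} {x : H}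
    (hx : x ∈ S.comp a) : hW.proj x ∈ S.comp a :=
  hW.proj_mem (hR.isClosed_comp a) (fun _ => hR.π_even _ a) hx

theorem proj_smooth (hR : IsSuperunitaryRep n S R) (hχ : HasCentralCharacter θ R)
    (hW : IsWeylSystem θ⁻¹ (phaseRot m) fun z => R.π (phaseBody z)) (x : H) :
    hW.proj x ∈ smoothVectors R.π :=
  proj_mem_smoothVectors hR.π_mul hχ hW x

theorem orbit_smooth (hR : IsSuperunitaryRep n S R) (hχ : HasCentralCharacter θ R)
    (hW : IsWeylSystem θ⁻¹ (phaseRot m) fun z => R.π (phaseBody z)) (g : HeisBody m) (x : H) :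
    R.π g (hW.proj x) ∈ smoothVectors R.π :=
  body_mem_smoothVectors hR.π_mul g (hR.proj_smooth hχ hW x)

theorem comp_le_of_orbit (hR : IsSuperunitaryRep n S R)
    (hW : IsWeylSystem θ⁻¹ (phaseRot m) fun z => R.π (phaseBody z)) {a : ZMod 2}
    {Y : Submodule ℂ H} (hY : IsClosed (Y : Set H))
    (h : ∀ z, ∀ x ∈ S.comp a, R.π (phaseBody z) (hW.proj x) ∈ Y) : S.comp a ≤ Y := by
  intro x hx
  have h1 := hW.mem_closure_span x
  refine Submodule.topologicalClosure_minimal _ (Submodule.span_le.2 ?_) hY h1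
  rintro _ ⟨z, rfl⟩
  exact h z _ (hR.π_even _ _ _ hx)

theorem eq_top_of_orbit (hR : IsSuperunitaryRep n S R)
    (hW : IsWeylSystem θ⁻¹ (phaseRot m) fun z => R.π (phaseBody z))
    {Y : Submodule ℂ H} (hY : IsClosed (Y : Set H))
    (h : ∀ a z, ∀ x ∈ S.comp a, R.π (phaseBody z) (hW.proj x) ∈ Y) : Y = ⊤ := by
  rw [← top_le_iff, ← hR.hilbert.grading.sup_eq_top]
  exact sup_le (hR.comp_le_of_orbit hW hY (h 0)) (hR.comp_le_of_orbit hW hY (h 1))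

theorem ext_orbit (hR : IsSuperunitaryRep n S R)
    (hW : IsWeylSystem θ⁻¹ (phaseRot m) fun z => R.π (phaseBody z)) {E : Type*}
    [NormedAddCommGroup E] [NormedSpace ℂ E] {f g : H →L[ℂ] E}
    (h : ∀ a z, ∀ x ∈ S.comp a, f (R.π (phaseBody z) (hW.proj x)) =
      g (R.π (phaseBody z) (hW.proj x))) : f = g := by
  have h1 := hR.eq_top_of_orbit hW (Y := LinearMap.eqLocus f.toLinearMap g.toLinearMap)
    (isClosed_eq f.continuous g.continuous) h
  ext x
  have h2 : x ∈ LinearMap.eqLocus f.toLinearMap g.toLinearMap := h1 ▸ Submodule.mem_top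
  exact h2

theorem eq_of_form_orbit (hR : IsSuperunitaryRep n S R)
    (hW : IsWeylSystem θ⁻¹ (phaseRot m) fun z => R.π (phaseBody z)) {y y' : H}
    (h : ∀ a z, ∀ x ∈ S.comp a, S.form (R.π (phaseBody z) (hW.proj x)) y =
      S.form (R.π (phaseBody z) (hW.proj x)) y') : y = y' := by
  obtain ⟨F, hF⟩ := hR.hilbert.exists_form
  have h1 := hR.eq_top_of_orbit hW (Y := LinearMap.ker (F.flip (y - y')).toLinearMap)
    (isClosed_singleton.preimage (F.flip (y - y')).continuous) fun a z x hx => by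
      rw [LinearMap.mem_ker]
      change F _ (y - y') = 0
      rw [hF, map_sub, h a z x hx, sub_self]
  rw [← sub_eq_zero]
  refine hR.hilbert.eq_zero_of_form fun x => ?_
  have h2 : x ∈ LinearMap.ker (F.flip (y - y')).toLinearMap := h1 ▸ Submodule.mem_top
  rw [← hF]
  exact h2

/-- The odd operators on the vacuum vectors. -/
theorem exists_bounded_proj (hR : IsSuperunitaryRep n S R) (hχ : HasCentralCharacter θ R)
    (hW : IsWeylSystem θ⁻¹ (phaseRot m) fun z => R.π (phaseBody z)) (X : OddPart r s) :
    ∃ A : H →L[ℂ] H, Commute A hW.proj ∧ ∀ x, A x = R.ρ X ⟨_, hR.proj_smooth hχ hW x⟩ := by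
  obtain ⟨F, hF⟩ := hR.hilbert.exists_form
  let A : H →ₗ[ℂ] H := R.ρ X ∘ₗ hW.proj.toLinearMap.codRestrict (smoothVectors R.π)
    (hR.proj_smooth hχ hW)
  have hA : ∀ x, A x = R.ρ X ⟨_, hR.proj_smooth hχ hW x⟩ := fun x => rfl
  have hAF : ∀ a z, ∀ x ∈ S.comp a, ∀ y, F (R.π (phaseBody z) (hW.proj x)) (A y) =
      -((-1 : ℂ) ^ a.val * F (R.ρ X ⟨_, hR.orbit_smooth hχ hW (phaseBody z) x⟩) (hW.proj y)) := by
    intro a z x hx y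
    rw [hF, hF, hA, hR.form_smooth X _ (hR.π_even _ _ _ (hR.proj_mem_comp hW hx))]
  have hcont : Continuous A := by
    refine A.continuous_of_seq_closed_graph fun u x y hu hy => ?_
    refine hR.eq_of_form_orbit hW fun a z w hw => ?_
    rw [← hF, ← hF, hAF a z w hw]
    refine tendsto_nhds_unique (((F _).continuous.tendsto y).comp hy) ?_
    simp only [Function.comp_def, hAF a z w hw]
    exact ((((F _).continuous.comp hW.proj.continuous).tendsto x).comp hu).const_mul _ |>.neg
  refine ⟨⟨A, hcont⟩, ?_, hA⟩
  ext x
  have h1 : A (hW.proj x) = A x := by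
    rw [hA, hA]
    congr 2
    exact hW.proj_proj x
  have h2 : hW.proj (A x) = A x := by
    refine hR.eq_of_form_orbit hW fun a z w hw => ?_
    rw [← hF, ← hF, hW.map_proj' (F _), hAF a z w hw]
    have h3 : ∀ z', F (R.π (phaseBody z) (hW.proj w)) (R.π (phaseBody z') (A x)) =
        -((-1 : ℂ) ^ a.val * F (R.ρ X ⟨_, hR.orbit_smooth hχ hW (phaseBody z) w⟩)
          (R.π (phaseBody z') (hW.proj x))) := fun z' => by
      obtain ⟨h, h'⟩ := hR.ρ_equivariant (phaseBody z') X ⟨_, hR.proj_smooth hχ hW x⟩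
      rw [hA, ← h', hF, hF, hR.form_smooth X _ (hR.π_even _ _ _ (hR.proj_mem_comp hW hw))]
    simp_rw [h3]
    have h4 := hW.map_proj' (-((-1 : ℂ) ^ a.val •
      F (R.ρ X ⟨_, hR.orbit_smooth hχ hW (phaseBody z) w⟩))) (hW.proj x)
    rw [hW.proj_proj] at h4
    exact h4.symm
  exact h1.trans h2.symm

theorem exists_bounded (hR : IsSuperunitaryRep n S R) (hθ : θ ≠ 0) (hχ : HasCentralCharacter θ R)
    (X : OddPart r s) : ∃ T : H →L[ℂ] H, (∀ v : smoothVectors R.π, T v = R.ρ X v) ∧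
      ∀ a, ∀ x ∈ S.comp a, ∀ y, S.form (T x) y = -((-1 : ℂ) ^ a.val * S.form x (T y)) := by
  have hW := hR.weyl hθ hχ
  obtain ⟨F, hF⟩ := hR.hilbert.exists_form
  obtain ⟨J, hJ⟩ := hR.hilbert.exists_symmetry
  obtain ⟨A, hA, hA'⟩ := hR.exists_bounded_proj hχ hW X
  obtain ⟨T, hT⟩ := IsScalarProduct.exists_extension hθ hW hJ.isScalarProduct A hA
  have hT0 : ∀ z x, T (R.π (phaseBody z) (hW.proj x)) =
      R.ρ X ⟨_, hR.orbit_smooth hχ hW (phaseBody z) x⟩ := fun z x => by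
    obtain ⟨h, h'⟩ := hR.ρ_equivariant (phaseBody z) X ⟨_, hR.proj_smooth hχ hW x⟩
    rw [hT, h', hA']
    congr 3
    exact hW.proj_proj x
  have h1 : ∀ a z, ∀ x ∈ S.comp a, ∀ y, F (T (R.π (phaseBody z) (hW.proj x))) y =
      -((-1 : ℂ) ^ a.val * F (R.π (phaseBody z) (hW.proj x)) (T y)) := by
    intro a z x hx y
    have h2 : F (T (R.π (phaseBody z) (hW.proj x))) =
        -((-1 : ℂ) ^ a.val • (F (R.π (phaseBody z) (hW.proj x)) ∘L T)) :=
      hR.ext_orbit hW fun b z' x' hx' => by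
        have hx2 := hR.π_even (phaseBody z) _ _ (hR.proj_mem_comp hW hx)
        have h3 := hR.ρ_superunitary X a ⟨_, hR.orbit_smooth hχ hW (phaseBody z) x⟩
          ⟨_, hR.orbit_smooth hχ hW (phaseBody z') x'⟩ hx2
        simp only [neg_apply, smul_apply, ContinuousLinearMap.comp_apply, hF, smul_eq_mul, hT0]
        exact eq_neg_of_add_eq_zero_left h3
    rw [h2]
    rfl
  refine ⟨T, fun v => ?_, fun a => ?_⟩
  · refine hR.eq_of_form_orbit hW fun a z x hx => ?_
    have h2 := h1 a z x hx v
    have hx2 := hR.π_even (phaseBody z) _ _ (hR.proj_mem_comp hW hx)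
    rw [hR.form_smooth X (hR.orbit_smooth hχ hW (phaseBody z) x) hx2 v.2, ← hT0, ← hF, ← hF, h2,
      mul_neg, neg_neg, ← mul_assoc, neg_one_pow_mul_self, one_mul]
  · intro x hx y
    let L : H →L⋆[ℂ] ℂ := (F.flip y).comp T + (-1 : ℂ) ^ a.val • F.flip (T y)
    have h3 := hR.comp_le_of_orbit hW (a := a) (Y := LinearMap.ker L.toLinearMap)
      (isClosed_singleton.preimage L.continuous) fun z x hx => by
        rw [LinearMap.mem_ker]
        change F (T (R.π (phaseBody z) (hW.proj x))) y +
          (-1 : ℂ) ^ a.val • F (R.π (phaseBody z) (hW.proj x)) (T y) = 0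
        rw [h1 a z x hx, smul_eq_mul, neg_add_cancel]
    have h4 := h3 hx
    rw [LinearMap.mem_ker] at h4
    rw [← hF, ← hF]
    exact eq_neg_of_add_eq_zero_left h4

/-- The odd operators extend to bounded operators. -/
theorem exists_oddPart (hR : IsSuperunitaryRep n S R) (hθ : θ ≠ 0)
    (hχ : HasCentralCharacter θ R) : ∃ Q, IsBoundedOddPart θ S R Q := by
  have hW := hR.weyl hθ hχ
  choose T hT hT' using fun i => hR.exists_bounded hθ hχ (Pi.single i 1)
  set Q : (OddIndex r s → ℂ) →ₗ[ℂ] (H →L[ℂ] H) := Fintype.linearCombination ℂ T with hQ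
  have hQ1 : ∀ X x, Q X x = ∑ i, X i • T i x := fun X x => by
    simp [hQ, Fintype.linearCombination_apply]
  have hρ : ∀ X (v : smoothVectors R.π), R.ρ X v = ∑ i, (X i : ℂ) • R.ρ (Pi.single i 1) v := by
    intro X v
    let L : OddPart r s →ₗ[ℝ] H :=
      { toFun := fun X => R.ρ X v
        map_add' := fun X Y => hR.ρ_add X Y v
        map_smul' := fun c X => by rw [hR.ρ_smul]; rfl }
    have h : L X = ∑ i, X i • L (Pi.single i 1) := by
      conv_lhs => rw [pi_eq_sum_univ' X]
      rw [map_sum]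
      refine Finset.sum_congr rfl fun i _ => ?_
      rw [map_smul]
    exact h
  have happ : ∀ X (v : smoothVectors R.π), Q (OddPart.toC X) v = R.ρ X v := fun X v => by
    rw [hQ1, hρ]
    exact Finset.sum_congr rfl fun i _ => by rw [hT]; rfl
  refine ⟨Q, ?_, happ, ?_, ?_, ?_⟩
  · have h1 : ∀ i j, T i * T j + T j * T i =
        (-(2 * Complex.I / θ) * omegaC (Pi.single i 1) (Pi.single j 1)) • (1 : H →L[ℂ] H) := by
      intro i j
      refine hR.ext_orbit hW fun a z x _ => ?_
      have hv := hR.orbit_smooth hχ hW (phaseBody z) x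
      obtain ⟨hi, hj, h⟩ := hR.ρ_bracket (Pi.single i 1) (Pi.single j 1) ⟨_, hv⟩
      rw [deriv_central hχ, ← omegaC_toC] at h
      change T i (T j (R.π (phaseBody z) (hW.proj x))) + T j (T i (R.π (phaseBody z) (hW.proj x))) =
        (-(2 * Complex.I / θ) * omegaC (Pi.single i 1) (Pi.single j 1)) •
          R.π (phaseBody z) (hW.proj x)
      rw [hT j ⟨_, hv⟩, hT i ⟨_, hv⟩, hT i ⟨_, hj⟩, hT j ⟨_, hi⟩, h, smul_smul]
      congr 1
      have h2 : ∀ i : OddIndex r s, (OddPart.toC (Pi.single i 1)) = Pi.single i 1 := fun i => by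
        ext j
        simp only [OddPart.toC, Pi.single_apply]
        split_ifs <;> simp
      rw [h2, h2]
      ring
    intro X Y
    have h2 : omegaC X Y = ∑ i, ∑ j, X i * (Y j * omegaC (Pi.single i 1) (Pi.single j 1)) := by
      simp only [omegaC_single, omegaC_apply X, mul_ite, mul_zero, Finset.sum_ite_eq,
        Finset.mem_univ, if_true]
      exact Finset.sum_congr rfl fun _ _ => by ring
    have h3 : Q Y * Q X = ∑ i, ∑ j, (X i * Y j) • (T j * T i) := by
      simp only [hQ, Fintype.linearCombination_apply, Finset.sum_mul, Finset.mul_sum,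
        smul_mul_smul_comm, mul_comm (Y _)]
    have h4 : Q X * Q Y = ∑ i, ∑ j, (X i * Y j) • (T i * T j) := by
      simp only [hQ, Fintype.linearCombination_apply, Finset.sum_mul, Finset.mul_sum,
        smul_mul_smul_comm]
      exact Finset.sum_comm
    rw [h2, h3, h4, ← Finset.sum_add_distrib, Finset.mul_sum, Finset.sum_smul]
    refine Finset.sum_congr rfl fun i _ => ?_
    rw [← Finset.sum_add_distrib, Finset.mul_sum, Finset.sum_smul]
    refine Finset.sum_congr rfl fun j _ => ?_
    rw [← smul_add, h1, smul_smul]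
    congr 1
    ring
  · intro X g x
    have h1 : ∀ i, T i ∘L R.π g = R.π g ∘L T i := fun i => hR.ext_orbit hW fun a z x _ => by
      have hv := hR.orbit_smooth hχ hW (phaseBody z) x
      obtain ⟨h, h'⟩ := hR.ρ_equivariant g (Pi.single i 1) ⟨_, hv⟩
      rw [ContinuousLinearMap.comp_apply, ContinuousLinearMap.comp_apply, hT i ⟨_, hv⟩, ← h',
        ← hT i]
    rw [hQ1, hQ1, map_sum]
    refine Finset.sum_congr rfl fun i _ => ?_
    rw [map_smul]
    congr 1
    exact DFunLike.congr_fun (h1 i) x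
  · intro X a
    have h1 : ∀ i, S.comp a ≤ (S.comp (a + 1)).comap (T i).toLinearMap := fun i =>
      hR.comp_le_of_orbit hW ((hR.isClosed_comp _).preimage (T i).continuous) fun z x hx => by
        rw [Submodule.mem_comap]
        change T i _ ∈ _
        rw [hT i ⟨_, hR.orbit_smooth hχ hW (phaseBody z) x⟩]
        exact hR.ρ_odd _ _ _ (hR.π_even _ _ _ (hR.proj_mem_comp hW hx))
    intro x hx
    rw [hQ1]
    exact Submodule.sum_mem _ fun i _ => Submodule.smul_mem _ _ (h1 i hx)
  · intro X a x hx y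
    simp only [hQ1, map_sum, map_smulₛₗ, LinearMap.sum_apply, LinearMap.smul_apply, smul_eq_mul,
      Finset.mul_sum, ← Finset.sum_neg_distrib, OddPart.toC, Complex.conj_ofReal, RingHom.id_apply]
    refine Finset.sum_congr rfl fun i _ => ?_
    rw [hT' i a x hx y]
    ring

end IsSuperunitaryRep

/-! ### Fundamental symmetries adapted to a group of symmetries -/

section Polar

variable {K : Type*} [NormedAddCommGroup K] [InnerProductSpace ℂ K]

theorem ContinuousLinearMap.ext_inner {A B : K →L[ℂ] K} (h : ∀ x y, inner ℂ x (A y) = inner ℂ x (B y)) :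
    A = B :=
  ContinuousLinearMap.ext fun y => ext_inner_left ℂ fun x => h x y

variable [CompleteSpace K]

theorem mem_unitary_of_surjective {U : K →L[ℂ] K} (hU : ∀ x, ‖U x‖ = ‖x‖)
    (hs : Function.Surjective U) : U ∈ unitary (K →L[ℂ] K) := by
  have hi : ∀ x y, inner ℂ (U x) (U y) = inner ℂ x y := (⟨U, hU⟩ : K →ₗᵢ[ℂ] K).inner_map_map
  have h1 : star U * U = 1 := by
    ext x
    refine ext_inner_left ℂ fun y => ?_
    change inner ℂ y (star U (U x)) = inner ℂ y x
    rw [ContinuousLinearMap.star_eq_adjoint, ContinuousLinearMap.adjoint_inner_right, hi]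
  refine ⟨h1, ?_⟩
  ext x
  obtain ⟨y, rfl⟩ := hs x
  exact congrArg U (DFunLike.congr_fun h1 y)

theorem inner_star_right (A : K →L[ℂ] K) (x y : K) : inner ℂ x (star A y) = inner ℂ (A x) y :=
  ContinuousLinearMap.adjoint_inner_right A x y

theorem inner_star_left (A : K →L[ℂ] K) (x y : K) : inner ℂ (star A x) y = inner ℂ x (A y) :=
  ContinuousLinearMap.adjoint_inner_left A y x

/-- A positive invertible operator is coercive. -/
theorem exists_coercive {D : K →L[ℂ] K} (hD : 0 ≤ D) (hu : IsUnit D) :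
    ∃ c : ℝ, 0 < c ∧ ∀ x, c * ‖x‖ ^ 2 ≤ (inner ℂ x (D x)).re := by
  set E := CFC.sqrt D with hE
  have h1 : E * E = D := CFC.sqrt_mul_sqrt_self D hD
  have h2 : star E = E := (CFC.sqrt_nonneg D).isSelfAdjoint.star_eq
  obtain ⟨A, -, hA⟩ : ∃ A : K →L[ℂ] K, E * A = 1 ∧ A * E = 1 := by
    have h3 : IsUnit E := ((Commute.refl E).isUnit_mul_iff.1 (h1 ▸ hu)).1
    obtain ⟨⟨a, b, h, h'⟩, rfl⟩ := h3
    exact ⟨b, h, h'⟩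
  refine ⟨(‖A‖ ^ 2 + 1)⁻¹, by positivity, fun x => ?_⟩
  have h3 : inner ℂ x (D x) = inner ℂ (E x) (E x) := by
    rw [← h1]
    change inner ℂ x (E (E x)) = _
    rw [← inner_star_left, h2]
  rw [h3, inner_self_eq_norm_sq_to_K, inv_mul_le_iff₀ (by positivity)]
  have h4 : ‖x‖ ≤ ‖A‖ * ‖E x‖ := by
    have h5 : A (E x) = x := DFunLike.congr_fun hA x
    conv_lhs => rw [← h5]
    exact A.le_opNorm _
  have h5 : ‖x‖ ^ 2 ≤ (‖A‖ * ‖E x‖) ^ 2 := pow_le_pow_left₀ (norm_nonneg _) h4 2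
  have h6 : (((‖E x‖ : ℝ) : ℂ) ^ 2).re = ‖E x‖ ^ 2 := by
    rw [← Complex.ofReal_pow, Complex.ofReal_re]
  refine h5.trans (le_of_le_of_eq ?_ (congrArg _ h6.symm))
  nlinarith [sq_nonneg ‖E x‖]

/-- The polar decomposition of a bounded nondegenerate form. -/
theorem exists_polar (F : K →L⋆[ℂ] K →L[ℂ] ℂ) (u J₀ : K →L[ℂ] K) (hJ₀ : IsUnit J₀) {c : ℝ}
    (hc : 0 < c) (hF : ∀ x, c * ‖x‖ ^ 2 ≤ ‖F x (J₀ x)‖)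
    (hu : ∀ x y, inner ℂ (u x) y = inner ℂ x (u y)) (hFu : ∀ x y, F (u x) y = F x (u y))
    (hsymm : ∀ x y, conj (F x y) = F y (u x)) :
    ∃ J : K →L[ℂ] K, (∀ x y, F (J x) (J y) = F x y) ∧ (∀ x y, conj (F x (J y)) = F y (J x)) ∧
      (∃ d : ℝ, 0 < d ∧ ∀ x, d * ‖x‖ ^ 2 ≤ (F x (J x)).re) ∧
      ∀ U ∈ unitary (K →L[ℂ] K), ∀ V ∈ unitary (K →L[ℂ] K), ∀ ε : ℂ, ‖ε‖ = 1 →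
        (∀ x y, F (U x) (V y) = ε * F x y) → ∀ x y, F (V x) (J (V y)) = F x (J y) := by
  set A := InnerProductSpace.continuousLinearMapOfBilin F with hA
  obtain ⟨G, hG⟩ : ∃ G, G = star A := ⟨_, rfl⟩
  have hFG : ∀ x y, F x y = inner ℂ x (G y) := fun x y => by
    rw [hG, inner_star_right, hA, InnerProductSpace.continuousLinearMapOfBilin_apply]
  have hAu : IsUnit A := by
    have h1 : IsUnit (star J₀ * A) := by
      refine ContinuousLinearMap.isUnit_of_forall_le_norm_inner_map _ (c := ⟨c, hc.le⟩) hc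
        fun x => ?_
      change ‖x‖ ^ 2 * c ≤ ‖inner ℂ (star J₀ (A x)) x‖
      rw [inner_star_left, hA, InnerProductSpace.continuousLinearMapOfBilin_apply, mul_comm]
      exact hF x
    have h2 := hJ₀.star
    exact (h2.mul_left_iff).1 h1
  have hGu : IsUnit G := hG ▸ hAu.star
  have hGs : star G = G * u := ContinuousLinearMap.ext_inner fun x y => by
    rw [inner_star_right, ← inner_conj_symm, ← hFG, hsymm, hFG]
    rfl
  have huG : u * G = G * u := ContinuousLinearMap.ext_inner fun x y => by
    change inner ℂ x (u (G y)) = inner ℂ x (G (u y))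
    rw [← hu, ← hFG, ← hFG, hFu]
  have hnorm : IsStarNormal G := ⟨by
    change star G * G = G * star G
    rw [hGs, mul_assoc, huG]⟩
  set D := CFC.abs G with hD
  have hDD : D * D = star G * G := CFC.abs_mul_abs G
  have hD0 : 0 ≤ D := CFC.abs_nonneg G
  have hDs : star D = D := hD0.isSelfAdjoint.star_eq
  have hDc : Commute D G := CFC.commute_abs_self G hnorm
  obtain ⟨B, hGB, hBG⟩ : ∃ B : K →L[ℂ] K, G * B = 1 ∧ B * G = 1 := by
    obtain ⟨⟨a, b, h, h'⟩, h2⟩ := hGu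
    exact ⟨b, by rw [← h2]; exact h, by rw [← h2]; exact h'⟩
  have hDu : IsUnit D := by
    have h1 : IsUnit (D * D) := hDD ▸ hGu.star.mul hGu
    exact ((Commute.refl D).isUnit_mul_iff.1 h1).1
  have hFJ : ∀ x y, F x ((B * D) y) = inner ℂ x (D y) := fun x y => by
    rw [hFG]
    change inner ℂ x ((G * (B * D)) y) = _
    rw [← mul_assoc, hGB, one_mul]
  refine ⟨B * D, fun x y => ?_, fun x y => ?_, ?_, ?_⟩
  · rw [hFJ, hFG, ← inner_star_right]
    have h1 : star (B * D) * D = G := by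
      have h3 : star B * star G = 1 := by rw [← star_mul, hGB, star_one]
      have h4 : star B * D = D * star B := by
        have h5 : Commute D (star G) := by
          have := hDc.star_star
          rwa [hDs] at this
        calc star B * D = star B * D * (star G * star B) := by
              rw [← star_mul, hBG, star_one, mul_one]
          _ = star B * (D * star G) * star B := by noncomm_ring
          _ = D * star B := by rw [h5.eq, ← mul_assoc, h3, one_mul]
      rw [star_mul, hDs, ← h4, mul_assoc, hDD, ← mul_assoc, h3, one_mul]
    rw [← h1]
    rfl
  · rw [hFJ, hFJ, inner_conj_symm, ← inner_star_right, hDs]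
  · obtain ⟨d, hd, h⟩ := exists_coercive hD0 hDu
    exact ⟨d, hd, fun x => by rw [hFJ]; exact h x⟩
  · intro U hU V hV ε hε hUV x y
    have h1 : star U * G * V = ε • G := ContinuousLinearMap.ext_inner fun x y => by
      change inner ℂ x (star U (G (V y))) = inner ℂ x (ε • G y)
      rw [inner_star_right, ← hFG, hUV, inner_smul_right, hFG]
    have h2 : G * V = ε • (U * G) := by
      rw [← mul_smul_comm, ← h1, ← mul_assoc, ← mul_assoc, (Unitary.mem_iff.1 hU).2, one_mul]
    have h3 : star G * U = conj ε • (V * star G) := by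
      have h4 := congrArg star h1
      rw [star_mul, star_mul, star_star, star_smul] at h4
      rw [show conj ε = star ε from rfl, ← mul_smul_comm, ← h4, ← mul_assoc, (Unitary.mem_iff.1 hV).2, one_mul]
    have h4 : Commute (star G * G) V := by
      change star G * G * V = V * (star G * G)
      rw [mul_assoc, h2, mul_smul_comm, ← mul_assoc, h3, smul_mul_assoc, smul_smul, mul_assoc,
        Complex.mul_conj, Complex.normSq_eq_norm_sq, hε]
      simp
    have h5 : D * V = V * D := by
      rw [hD, CFC.abs]
      exact h4.cfcₙ_nnreal _
    rw [hFJ, hFJ]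
    have h6 : inner ℂ (V x) (D (V y)) = inner ℂ (V x) (V (D y)) :=
      congrArg (inner ℂ (V x)) (DFunLike.congr_fun h5 y)
    rw [h6, ← inner_star_left]
    have h7 : star V (V x) = x := DFunLike.congr_fun (Unitary.mem_iff.1 hV).1 x
    rw [h7]

end Polar

/-- A sesquilinear form is conjugate-linear in the first variable. -/
theorem LinearMap.sesq_smul {H : Type*} [AddCommGroup H] [Module ℂ H] (B : H →ₗ⋆[ℂ] H →ₗ[ℂ] ℂ)
    (c d : ℂ) (x y : H) : B (c • x) (d • y) = conj c * (d * B x y) := by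
  rw [LinearMap.map_smulₛₗ₂, map_smul, smul_eq_mul, smul_eq_mul]

section Average

variable {H : Type u} [NormedAddCommGroup H] [NormedSpace ℂ H]

/-- Averaging a scalar product over an operator with scalar square. -/
theorem IsScalarProduct.exists_average {B : H →ₗ⋆[ℂ] H →ₗ[ℂ] ℂ} (hB : IsScalarProduct B)
    (T : H →L[ℂ] H) {c : ℂ} (hc : ‖c‖ = 1) (hT : ∀ x, T (T x) = c • x) :
    ∃ B' : H →ₗ⋆[ℂ] H →ₗ[ℂ] ℂ, IsScalarProduct B' ∧ (∀ x y, B' (T x) (T y) = B' x y) ∧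
      ∀ (U : H →L[ℂ] H) (d : ℂ), ‖d‖ = 1 → (∀ x, T (U x) = d • U (T x)) →
        (∀ x y, B (U x) (U y) = B x y) → ∀ x y, B' (U x) (U y) = B' x y := by
  have hn : ∀ d : ℂ, ‖d‖ = 1 → ∀ x y, B (d • x) (d • y) = B x y := fun d hd x y => by
    rw [LinearMap.sesq_smul, ← mul_assoc, Complex.conj_mul', hd]
    simp
  refine ⟨B + (B.comp T.toLinearMap).compl₂ T.toLinearMap, ⟨fun x y => ?_, ?_⟩, fun x y => ?_,
    fun U d hd hTU hU x y => ?_⟩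
  · change conj (B x y + B (T x) (T y)) = B y x + B (T y) (T x)
    rw [map_add, hB.conj_symm, hB.conj_symm]
  · obtain ⟨c, C, hc, h⟩ := hB.bounds
    refine ⟨c, C + |C| * ‖T‖ ^ 2, hc, fun x => ?_⟩
    change _ ≤ (B x x + B (T x) (T x)).re ∧ (B x x + B (T x) (T x)).re ≤ _
    rw [Complex.add_re]
    have h1 : (0 : ℝ) ≤ c * ‖T x‖ ^ 2 := by positivity
    have h2 : ‖T x‖ ^ 2 ≤ ‖T‖ ^ 2 * ‖x‖ ^ 2 := by
      rw [← mul_pow]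
      exact pow_le_pow_left₀ (norm_nonneg _) (T.le_opNorm x) 2
    have h3 : C * ‖T x‖ ^ 2 ≤ |C| * (‖T‖ ^ 2 * ‖x‖ ^ 2) :=
      mul_le_mul (le_abs_self C) h2 (by positivity) (abs_nonneg C)
    refine ⟨?_, ?_⟩
    · linarith [(h x).1, (h (T x)).1]
    · linarith [(h x).2, (h (T x)).2]
  · change B (T x) (T y) + B (T (T x)) (T (T y)) = B x y + B (T x) (T y)
    rw [hT, hT, hn c hc, add_comm]
  · change B (U x) (U y) + B (T (U x)) (T (U y)) = B x y + B (T x) (T y)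
    rw [hTU, hTU, hn d hd, hU, hU]

theorem IsScalarProduct.exists_averages {ι : Type*} {T : ι → H →L[ℂ] H} {c : ι → ℂ}
    (hc : ∀ i, ‖c i‖ = 1) (hT : ∀ i x, T i (T i x) = c i • x)
    (hTT : ∀ i j, ∃ d : ℂ, ‖d‖ = 1 ∧ ∀ x, T i (T j x) = d • T j (T i x))
    {A : Set (H →L[ℂ] H)} (hA : ∀ i, ∀ U ∈ A, ∃ d : ℂ, ‖d‖ = 1 ∧ ∀ x, T i (U x) = d • U (T i x))
    {B : H →ₗ⋆[ℂ] H →ₗ[ℂ] ℂ} (hB : IsScalarProduct B)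
    (hBA : ∀ U ∈ A, ∀ x y, B (U x) (U y) = B x y) (s : Finset ι) :
    ∃ B' : H →ₗ⋆[ℂ] H →ₗ[ℂ] ℂ, IsScalarProduct B' ∧ (∀ U ∈ A, ∀ x y, B' (U x) (U y) = B' x y) ∧
      ∀ i ∈ s, ∀ x y, B' (T i x) (T i y) = B' x y := by
  classical
  induction s using Finset.induction_on with
  | empty => exact ⟨B, hB, hBA, fun i hi => absurd hi (Finset.notMem_empty i)⟩
  | insert i s _ ih =>
    obtain ⟨B₁, h1, h2, h3⟩ := ih
    obtain ⟨B₂, h4, h5, h6⟩ := h1.exists_average (T i) (hc i) (hT i)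
    refine ⟨B₂, h4, fun U hU => ?_, fun j hj => ?_⟩
    · obtain ⟨d, hd, h⟩ := hA i U hU
      exact h6 U d hd h (h2 U hU)
    · rcases Finset.mem_insert.1 hj with rfl | hj
      · exact h5
      · obtain ⟨d, hd, h⟩ := hTT i j
        exact h6 _ d hd h (h3 j hj)

end Average

theorem OddPart.toC_single {r s : ℕ} (i : OddIndex r s) :
    OddPart.toC (Pi.single i 1) = Pi.single i 1 := by
  ext j
  simp only [OddPart.toC, Pi.single_apply]
  split_ifs <;> simp

namespace SuperspaceData

variable {H : Type u} [NormedAddCommGroup H] [NormedSpace ℂ H] {S : SuperspaceData H} {n : ZMod 2}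

theorem IsHilbertSuperspace.form_ext (hS : S.IsHilbertSuperspace n) {B B' : H →ₗ⋆[ℂ] H →ₗ[ℂ] ℂ}
    (h : ∀ a b, ∀ x ∈ S.comp a, ∀ y ∈ S.comp b, B x y = B' x y) (x y : H) : B x y = B' x y := by
  obtain ⟨x₀, h0, x₁, h1, rfl⟩ := hS.exists_add x
  obtain ⟨y₀, h0', y₁, h1', rfl⟩ := hS.exists_add y
  simp only [map_add, LinearMap.add_apply, h 0 0 _ h0 _ h0', h 0 1 _ h0 _ h1', h 1 0 _ h1 _ h0',
    h 1 1 _ h1 _ h1']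

theorem IsGrading.form_apply (hS : S.IsHilbertSuperspace n) {Γ : H →L[ℂ] H} (hΓ : S.IsGrading Γ)
    (x y : H) : S.form (Γ x) (Γ y) = (-1 : ℂ) ^ n.val * S.form x y := by
  refine hS.form_ext (B := (S.form.comp Γ.toLinearMap).compl₂ Γ.toLinearMap)
    (B' := (-1 : ℂ) ^ n.val • S.form) (fun a b x hx y hy => ?_) x y
  change S.form (Γ x) (Γ y) = (-1 : ℂ) ^ n.val * S.form x y
  rw [hΓ a x hx, hΓ b y hy, LinearMap.sesq_smul]
  by_cases hab : a + b = n
  · subst hab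
    rw [neg_one_pow_val_add]
    simp [mul_assoc]
  · rw [hS.homogeneous a b hab x hx y hy]
    simp

/-- The square of the fundamental symmetries. -/
def IsSquare (S : SuperspaceData H) (n : ZMod 2) (u : H →L[ℂ] H) : Prop :=
  ∀ a, ∀ x ∈ S.comp a, u x = (-1 : ℂ) ^ ((n + 1).val * a.val) • x

theorem IsGrading.isSquare {Γ : H →L[ℂ] H} (hΓ : S.IsGrading Γ) :
    S.IsSquare n (Γ ^ (n + 1).val) := by
  intro a x hx
  obtain rfl | rfl := ZMod.eq_zero_or_eq_one n
  · rw [show ((0 : ZMod 2) + 1).val = 1 from rfl, pow_one, one_mul]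
    exact hΓ a x hx
  · rw [show ((1 : ZMod 2) + 1).val = 0 from rfl]
    simp

theorem IsSquare.apply_apply (hS : S.IsHilbertSuperspace n) {u : H →L[ℂ] H} (hu : S.IsSquare n u)
    (x : H) : u (u x) = x := by
  have h : u ∘L u = ContinuousLinearMap.id ℂ H := IsGrading.ext hS fun a x hx => by
    rw [ContinuousLinearMap.comp_apply, hu a x hx, map_smul, hu a x hx, smul_smul,
      neg_one_pow_mul_self, one_smul]
    rfl
  exact DFunLike.congr_fun h x

theorem IsSquare.conj_form (hS : S.IsHilbertSuperspace n) {u : H →L[ℂ] H} (hu : S.IsSquare n u)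
    (x y : H) : conj (S.form x y) = S.form y (u x) := by
  have h1 : ∀ a b, ∀ x ∈ S.comp a, ∀ y ∈ S.comp b, conj (S.form x y) = S.form y (u x) := by
    intro a b x hx y hy
    rw [hS.superhermitian a b x hx y hy, hu a x hx, map_smul, smul_eq_mul]
    by_cases hab : a + b = n
    · congr 1
      subst hab
      rw [neg_one_pow_eq_pow_mod_two, neg_one_pow_eq_pow_mod_two (n := (a + b + 1).val * a.val)]
      congr 1
      exact (by decide : ∀ a b : ZMod 2, a.val * b.val % 2 = (a + b + 1).val * a.val % 2) a b
    · rw [hS.homogeneous b a (by rwa [add_comm]) y hy x hx]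
      simp
  obtain ⟨x₀, h0, x₁, h1', rfl⟩ := hS.exists_add x
  obtain ⟨y₀, h0', y₁, h1'', rfl⟩ := hS.exists_add y
  simp only [map_add, LinearMap.add_apply, h1 0 0 _ h0 _ h0', h1 0 1 _ h0 _ h1'',
    h1 1 0 _ h1' _ h0', h1 1 1 _ h1' _ h1'']
  ring

theorem IsSquare.form_apply (hS : S.IsHilbertSuperspace n) {u : H →L[ℂ] H} (hu : S.IsSquare n u)
    (x y : H) : S.form (u x) y = S.form x (u y) := by
  refine hS.form_ext (B := S.form.comp u.toLinearMap)
    (B' := S.form.compl₂ u.toLinearMap) (fun a b x hx y hy => ?_) x y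
  change S.form (u x) y = S.form x (u y)
  rw [hu a x hx, hu b y hy, LinearMap.map_smulₛₗ₂, map_smul, map_pow, map_neg, map_one]
  by_cases hab : a + b = n
  · congr 1
    subst hab
    rw [neg_one_pow_eq_pow_mod_two, neg_one_pow_eq_pow_mod_two (n := (a + b + 1).val * b.val)]
    congr 1
    exact (by decide : ∀ a b : ZMod 2,
      (a + b + 1).val * a.val % 2 = (a + b + 1).val * b.val % 2) a b
  · rw [hS.homogeneous a b hab x hx y hy]
    simp

theorem IsHilbertSuperspace.eq_of_form (hS : S.IsHilbertSuperspace n) {y y' : H}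
    (h : ∀ x, S.form x y = S.form x y') : y = y' := by
  rw [← sub_eq_zero]
  exact hS.eq_zero_of_form fun x => by rw [map_sub, h, sub_self]

end SuperspaceData

namespace IsBoundedOddPart

variable {m r s : ℕ} {H : Type u} [NormedAddCommGroup H] [NormedSpace ℂ H]
  {θ : ℝ} {n : ZMod 2} {S : SuperspaceData H} {R : HeisRep m r s H}
  {Q : (OddIndex r s → ℂ) →ₗ[ℂ] (H →L[ℂ] H)} {Γ : H →L[ℂ] H}

theorem form_apply (hQ : IsBoundedOddPart θ S R Q) (hS : S.IsHilbertSuperspace n)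
    (hΓ : S.IsGrading Γ) (i : OddIndex r s) (x y : H) :
    S.form (Q (Pi.single i 1) x) y = -S.form (Γ x) (Q (Pi.single i 1) y) := by
  refine hS.form_ext (B := S.form.comp (Q (Pi.single i 1)).toLinearMap)
    (B' := -((S.form.comp Γ.toLinearMap).compl₂ (Q (Pi.single i 1)).toLinearMap))
    (fun a b x hx y hy => ?_) x y
  change S.form (Q (Pi.single i 1) x) y = -S.form (Γ x) (Q (Pi.single i 1) y)
  rw [← OddPart.toC_single, hQ.adjoint _ a x hx, hΓ a x hx]
  simp

theorem grading_apply (hQ : IsBoundedOddPart θ S R Q) (hS : S.IsHilbertSuperspace n)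
    (hΓ : S.IsGrading Γ) (X : OddIndex r s → ℂ) (x : H) : Γ (Q X x) = -Q X (Γ x) := by
  have h : Γ ∘L Q X = -(Q X ∘L Γ) := SuperspaceData.IsGrading.ext hS fun a x hx => by
    change Γ (Q X x) = -(Q X (Γ x))
    rw [hΓ _ _ (hQ.odd X a x hx), hΓ a x hx, map_smul, neg_one_pow_val_add_one, neg_smul]
  exact DFunLike.congr_fun h x

theorem single_apply_apply (hQ : IsBoundedOddPart θ S R Q) (i : OddIndex r s) (x : H) :
    Q (Pi.single i 1) (Q (Pi.single i 1) x) = (-(Complex.I / θ) * oddSign i) • x := by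
  have h := DFunLike.congr_fun (hQ.rep (Pi.single i 1) (Pi.single i 1)) x
  rw [omegaC_single, if_pos rfl] at h
  change Q (Pi.single i 1) (Q (Pi.single i 1) x) + Q (Pi.single i 1) (Q (Pi.single i 1) x) =
    (-(2 * Complex.I / θ) * oddSign i) • x at h
  have h2 : (2 : ℂ) • Q (Pi.single i 1) (Q (Pi.single i 1) x) =
      (2 : ℂ) • (-(Complex.I / θ) * oddSign i) • x := by
    rw [two_smul, h, smul_smul]
    congr 1
    ring
  exact (smul_right_injective H (two_ne_zero (α := ℂ))) h2

theorem single_anticomm (hQ : IsBoundedOddPart θ S R Q) {i j : OddIndex r s} (hij : i ≠ j) (x : H) :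
    Q (Pi.single i 1) (Q (Pi.single j 1) x) = -Q (Pi.single j 1) (Q (Pi.single i 1) x) := by
  have h := DFunLike.congr_fun (hQ.rep (Pi.single i 1) (Pi.single j 1)) x
  rw [omegaC_single, if_neg hij, mul_zero, zero_smul] at h
  exact eq_neg_of_add_eq_zero_left h

end IsBoundedOddPart

/-- A fundamental symmetry whose scalar product is invariant under the body and, up to
normalization, under the odd basis vectors. -/
structure IsAdaptedSymmetry {m r s : ℕ} {H : Type*} [NormedAddCommGroup H] [NormedSpace ℂ H]
    (θ : ℝ) (n : ZMod 2) (S : SuperspaceData H) (R : HeisRep m r s H)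
    (Q : (OddIndex r s → ℂ) →ₗ[ℂ] (H →L[ℂ] H)) (J : H →L[ℂ] H) : Prop where
  symm : S.IsFundamentalSymmetry n J.toLinearMap
  body : ∀ z x y, S.form (R.π (phaseBody z) x) (J (R.π (phaseBody z) y)) = S.form x (J y)
  odd : ∀ i x y, S.form (Q (Pi.single i 1) x) (J (Q (Pi.single i 1) y)) =
    ((|θ|⁻¹ : ℝ) : ℂ) * S.form x (J y)

namespace IsSuperunitaryRep

variable {m r s : ℕ} {H : Type u} [NormedAddCommGroup H] [NormedSpace ℂ H]
  {θ : ℝ} {n : ZMod 2} {S : SuperspaceData H} {R : HeisRep m r s H}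
  {Q : (OddIndex r s → ℂ) →ₗ[ℂ] (H →L[ℂ] H)}

/-- A scalar product that is invariant under the body, the grading and, up to normalization, the
odd basis vectors. -/
theorem exists_scalarProduct (hR : IsSuperunitaryRep n S R) (hθ : θ ≠ 0)
    (hχ : HasCentralCharacter θ R) (hQ : IsBoundedOddPart θ S R Q) {Γ : H →L[ℂ] H}
    (hΓ : S.IsGrading Γ) :
    ∃ B : H →ₗ⋆[ℂ] H →ₗ[ℂ] ℂ, IsScalarProduct B ∧
      (∀ z x y, B (R.π (phaseBody z) x) (R.π (phaseBody z) y) = B x y) ∧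
      (∀ x y, B (Γ x) (Γ y) = B x y) ∧
      ∀ i x y, B ((Real.sqrt |θ| : ℂ) • Q (Pi.single i 1) x)
        ((Real.sqrt |θ| : ℂ) • Q (Pi.single i 1) y) = B x y := by
  have hS := hR.hilbert
  obtain ⟨J₀, hJ₀⟩ := hS.exists_symmetry
  obtain ⟨B₀, hB₀, hB₁, hB₂⟩ := hJ₀.isScalarProduct.exists_invariant (hR.weyl hθ hχ)
  have hB₃ : ∀ a b, a ≠ b → ∀ x ∈ S.comp a, ∀ y ∈ S.comp b, B₀ x y = 0 :=
    fun a b hab x hx y hy => hB₂ x y fun z =>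
      hJ₀.orthogonal hS hab (hR.π_even _ _ _ hx) (hR.π_even _ _ _ hy)
  have hB₄ : ∀ x y, B₀ (Γ x) (Γ y) = B₀ x y := fun x y => by
    refine hS.form_ext (B := (B₀.comp Γ.toLinearMap).compl₂ Γ.toLinearMap) (B' := B₀)
      (fun a b x hx y hy => ?_) x y
    change B₀ (Γ x) (Γ y) = B₀ x y
    rw [hΓ a x hx, hΓ b y hy, LinearMap.sesq_smul]
    by_cases hab : a = b
    · subst hab
      rw [map_pow, map_neg, map_one, ← mul_assoc, neg_one_pow_mul_self, one_mul]
    · rw [hB₃ a b hab x hx y hy]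
      simp
  have hθ' : (0 : ℝ) < |θ| := abs_pos.2 hθ
  have hsq : (Real.sqrt |θ| : ℂ) * (Real.sqrt |θ| : ℂ) = (|θ| : ℝ) := by
    rw [← Complex.ofReal_mul, Real.mul_self_sqrt hθ'.le]
  obtain ⟨B, hB, h1, h2⟩ := hB₀.exists_averages
    (T := fun i => (Real.sqrt |θ| : ℂ) • Q (Pi.single i 1))
    (c := fun i => ((|θ| : ℝ) : ℂ) * (-(Complex.I / θ) * oddSign i))
    (A := {U | U = Γ ∨ ∃ z, U = R.π (phaseBody z)})
    (fun i => by
      have h3 : ‖(oddSign i : ℂ)‖ = 1 := by rcases i with i | i <;> simp [oddSign]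
      rw [norm_mul, norm_mul, h3, norm_neg, norm_div, Complex.norm_I, Complex.norm_real,
        Complex.norm_real, Real.norm_eq_abs, Real.norm_eq_abs, abs_abs, mul_one,
        mul_one_div_cancel hθ'.ne'])
    (fun i x => by
      simp only [smul_apply, map_smul, smul_smul, hQ.single_apply_apply, ← mul_assoc, hsq])
    (fun i j => by
      by_cases hij : i = j
      · exact ⟨1, by simp, fun x => by rw [hij, one_smul]⟩
      · refine ⟨-1, by simp, fun x => ?_⟩
        simp only [smul_apply, map_smul, hQ.single_anticomm hij]
        module)
    (fun i U hU => by
      rcases hU with rfl | ⟨z, rfl⟩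
      · refine ⟨-1, by simp, fun x => ?_⟩
        simp only [smul_apply, map_smul, hQ.grading_apply hS hΓ]
        module
      · refine ⟨1, by simp, fun x => ?_⟩
        simp only [smul_apply, map_smul, hQ.comm, one_smul])
    (fun U hU => by
      rcases hU with rfl | ⟨z, rfl⟩
      · exact hB₄
      · exact hB₁ z) Finset.univ
  exact ⟨B, hB, fun z => h1 _ (Or.inr ⟨z, rfl⟩), h1 _ (Or.inl rfl),
    fun i => h2 i (Finset.mem_univ i)⟩

theorem exists_adapted [CompleteSpace H] (hR : IsSuperunitaryRep n S R) (hθ : θ ≠ 0)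
    (hχ : HasCentralCharacter θ R) (hQ : IsBoundedOddPart θ S R Q) :
    ∃ J : H →L[ℂ] H, IsAdaptedSymmetry θ n S R Q J := by
  have hS := hR.hilbert
  have hW := hR.weyl hθ hχ
  obtain ⟨Γ, hΓ⟩ := hS.exists_grading
  obtain ⟨B, hB, hBW, hBΓ, hBQ⟩ := hR.exists_scalarProduct hθ hχ hQ hΓ
  have hθ' : (0 : ℝ) < |θ| := abs_pos.2 hθ
  have hsq : (Real.sqrt |θ| : ℂ) * (Real.sqrt |θ| : ℂ) = (|θ| : ℝ) := by
    rw [← Complex.ofReal_mul, Real.mul_self_sqrt hθ'.le]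
  obtain ⟨u, hu⟩ : ∃ u, S.IsSquare n u := ⟨_, hΓ.isSquare⟩
  have hΓu : ∃ k : ℕ, u = Γ ^ k := ⟨(n + 1).val, SuperspaceData.IsGrading.ext hS fun a x hx =>
    (hu a x hx).trans (hΓ.isSquare a x hx).symm⟩
  have hBu : ∀ x y, B (u x) (u y) = B x y := by
    obtain ⟨k, hk⟩ := hΓu
    rw [hk]
    clear hk
    induction k with
    | zero => intro x y; rfl
    | succ k ih =>
      intro x y
      rw [pow_succ']
      exact (hBΓ _ _).trans (ih x y)
  obtain ⟨F, hF⟩ := hS.exists_form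
  obtain ⟨J₀, hJ₀⟩ := hS.exists_symmetry
  obtain ⟨K, _, _, e, he⟩ := hB.exists_hilbert
  have : CompleteSpace K := (completeSpace_congr (e := e.toEquiv) e.isUniformEmbedding).1 ‹_›
  let tr : (H →L[ℂ] H) → (K →L[ℂ] K) := fun U => (e : H →L[ℂ] K) ∘L U ∘L (e.symm : K →L[ℂ] H)
  have htr : ∀ U x, tr U (e x) = e (U x) := fun U x => by simp [tr]
  let F' : K →L⋆[ℂ] K →L[ℂ] ℂ := F.bilinearComp (e.symm : K →L[ℂ] H) (e.symm : K →L[ℂ] H)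
  have hF' : ∀ x y, F' (e x) (e y) = S.form x y := fun x y => by simp [F', hF]
  have hunit : ∀ U : H →L[ℂ] H, (∀ x y, B (U x) (U y) = B x y) → Function.Surjective U →
      tr U ∈ unitary (K →L[ℂ] K) := by
    intro U hU hs
    refine mem_unitary_of_surjective (fun x => ?_) fun x => ?_
    · obtain ⟨x, rfl⟩ := e.surjective x
      have h : inner ℂ (tr U (e x)) (tr U (e x)) = inner ℂ (e x) (e x) := by
        rw [htr, he, hU, he]
      rw [inner_self_eq_norm_sq_to_K, inner_self_eq_norm_sq_to_K] at h
      have h2 : ‖tr U (e x)‖ ^ 2 = ‖e x‖ ^ 2 := by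
        apply Complex.ofReal_injective
        simpa using h
      exact (sq_eq_sq₀ (norm_nonneg _) (norm_nonneg _)).1 h2
    · obtain ⟨x, rfl⟩ := e.surjective x
      obtain ⟨y, rfl⟩ := hs x
      exact ⟨e y, htr U y⟩
  obtain ⟨D, hD⟩ := hJ₀.exists_bound
  obtain ⟨c, C, hc, hcC⟩ := hJ₀.equivalent_norm
  obtain ⟨b, b', hb, hbb⟩ := hB.bounds
  have hJ₀u : IsUnit (tr (J₀.mkContinuous D hD)) := by
    set A := tr (J₀.mkContinuous D hD) with hA
    have hA' : ∀ x, A (e x) = e (J₀ x) := fun x => htr _ x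
    have h4 : A ^ 4 = 1 := by
      ext x
      obtain ⟨x, rfl⟩ := e.surjective x
      change A (A (A (A (e x)))) = e x
      rw [hA', hA', hA', hA', hJ₀.pow_four hS]
    exact IsUnit.of_pow_eq_one h4 (by norm_num)
  obtain ⟨J, hJ1, hJ2, ⟨d, hd, hJ3⟩, hJ4⟩ := exists_polar F' (tr u) _ hJ₀u
    (c := c / (|b'| + 1)) (by positivity)
    (fun x => by
      obtain ⟨x, rfl⟩ := e.surjective x
      rw [htr, hF']
      refine le_trans ?_ ((hcC x).1.trans (Complex.re_le_norm _))
      have h1 : ‖e x‖ ^ 2 ≤ (|b'| + 1) * ‖x‖ ^ 2 := by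
        have h2 := (hbb x).2
        rw [← he, inner_self_eq_norm_sq_to_K] at h2
        have h3 : (((‖e x‖ : ℝ) : ℂ) ^ 2).re = ‖e x‖ ^ 2 := by
          rw [← Complex.ofReal_pow, Complex.ofReal_re]
        refine (h3.symm.le.trans h2).trans ?_
        nlinarith [le_abs_self b', sq_nonneg ‖x‖]
      rw [div_mul_eq_mul_div, div_le_iff₀ (by positivity)]
      nlinarith)
    (fun x y => by
      obtain ⟨x, rfl⟩ := e.surjective x
      obtain ⟨y, rfl⟩ := e.surjective y
      rw [htr, htr, he, he, ← hBu, hu.apply_apply hS])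
    (fun x y => by
      obtain ⟨x, rfl⟩ := e.surjective x
      obtain ⟨y, rfl⟩ := e.surjective y
      rw [htr, htr, hF', hF', hu.form_apply hS])
    (fun x y => by
      obtain ⟨x, rfl⟩ := e.surjective x
      obtain ⟨y, rfl⟩ := e.surjective y
      rw [htr, hF', hF', hu.conj_form hS])
  set j : H →L[ℂ] H := (e.symm : K →L[ℂ] H) ∘L J ∘L (e : H →L[ℂ] K) with hj
  have hej : ∀ x, J (e x) = e (j x) := fun x => by simp [hj]
  have h1 : ∀ x y, S.form (j x) (j y) = S.form x y := fun x y => by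
    rw [← hF', ← hej, ← hej, hJ1, hF']
  have h2 : ∀ x y, conj (S.form x (j y)) = S.form y (j x) := fun x y => by
    rw [← hF', ← hF', ← hej, ← hej, hJ2]
  have h4 : ∀ U V : H →L[ℂ] H, (∀ x y, B (U x) (U y) = B x y) → Function.Surjective U →
      (∀ x y, B (V x) (V y) = B x y) → Function.Surjective V → ∀ ε : ℂ, ‖ε‖ = 1 →
      (∀ x y, S.form (U x) (V y) = ε * S.form x y) →
      ∀ x y, S.form (V x) (j (V y)) = S.form x (j y) := by
    intro U V hU hUs hV hVs ε hε h x y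
    have h5 := hJ4 _ (hunit U hU hUs) _ (hunit V hV hVs) ε hε
      (fun x y => by
        obtain ⟨x, rfl⟩ := e.surjective x
        obtain ⟨y, rfl⟩ := e.surjective y
        rw [htr, htr, hF', hF', h]) (e x) (e y)
    rwa [htr, htr, hej, hej, hF', hF'] at h5
  have hΓs : Function.Surjective Γ := fun x => ⟨Γ x, hΓ.apply_apply hS x⟩
  have hΓj : ∀ x, Γ (j (Γ x)) = (-1 : ℂ) ^ n.val • j x := by
    intro x
    refine hS.eq_of_form fun y => ?_
    have h5 := h4 Γ Γ hBΓ hΓs hBΓ hΓs ((-1 : ℂ) ^ n.val) (by simp) (hΓ.form_apply hS) y x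
    have h6 := hΓ.form_apply hS (Γ y) (j (Γ x))
    rw [hΓ.apply_apply hS, h5] at h6
    rw [h6, map_smul, smul_eq_mul]
  have hjj : ∀ x, j (j x) = u x := by
    intro x
    refine hS.eq_of_form fun y => ?_
    have h5 := h2 y (j x)
    rw [h1] at h5
    rw [← hu.conj_form hS, ← h5, Complex.conj_conj]
  refine ⟨j, ⟨fun a x hx => ?_, fun a x hx => ?_, h1, h2, ?_⟩, fun z => ?_, fun i x y => ?_⟩
  · rw [hΓ.mem_comp_iff hS]
    change Γ (j x) = _ • j x
    have h5 := hΓj (Γ x)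
    rw [hΓ.apply_apply hS, hΓ a x hx, map_smul, smul_smul] at h5
    rw [h5, neg_one_pow_val_add, mul_comm]
  · change j (j x) = _
    rw [hjj, hu a x hx]
  · refine ⟨d * b, ‖F‖ * ‖j‖, by positivity, fun x => ⟨?_, ?_⟩⟩
    · change _ ≤ (S.form x (j x)).re
      rw [← hF', ← hej]
      refine le_trans ?_ (hJ3 (e x))
      rw [mul_assoc]
      refine mul_le_mul_of_nonneg_left ?_ hd.le
      have h5 := (hbb x).1
      rw [← he, inner_self_eq_norm_sq_to_K] at h5
      have h3 : (((‖e x‖ : ℝ) : ℂ) ^ 2).re = ‖e x‖ ^ 2 := by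
        rw [← Complex.ofReal_pow, Complex.ofReal_re]
      exact h5.trans h3.le
    · change (S.form x (j x)).re ≤ _
      rw [← hF]
      refine (Complex.re_le_norm _).trans ((F.le_opNorm₂ x (j x)).trans ?_)
      have h5 := j.le_opNorm x
      calc ‖F‖ * ‖x‖ * ‖j x‖ ≤ ‖F‖ * ‖x‖ * (‖j‖ * ‖x‖) :=
            mul_le_mul_of_nonneg_left h5 (by positivity)
        _ = _ := by ring
  · have hs : Function.Surjective (R.π (phaseBody z)) := fun x => ⟨_, hW.apply_neg z x⟩
    exact h4 _ _ (hBW z) hs (hBW z) hs 1 (by simp) fun x y => by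
      rw [hR.π_superunitary, one_mul]
  · set T : H →L[ℂ] H := (Real.sqrt |θ| : ℂ) • Q (Pi.single i 1) with hT
    have hTx : ∀ x, T x = (Real.sqrt |θ| : ℂ) • Q (Pi.single i 1) x := fun x => rfl
    obtain ⟨c, hc0, hcT⟩ : ∃ c : ℂ, ‖c‖ = 1 ∧ ∀ x, T (T x) = c • x := by
      refine ⟨((|θ| : ℝ) : ℂ) * (-(Complex.I / θ) * oddSign i), ?_, fun x => ?_⟩
      · have h3 : ‖(oddSign i : ℂ)‖ = 1 := by rcases i with i | i <;> simp [oddSign]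
        rw [norm_mul, norm_mul, h3, norm_neg, norm_div, Complex.norm_I, Complex.norm_real,
          Complex.norm_real, Real.norm_eq_abs, Real.norm_eq_abs, abs_abs, mul_one,
          mul_one_div_cancel hθ'.ne']
      · simp only [hTx, map_smul, smul_smul, hQ.single_apply_apply, ← mul_assoc, hsq]
    have hTB : ∀ x y, B (T x) (T y) = B x y := hBQ i
    have hc1 : c ≠ 0 := by
      rintro rfl
      simp at hc0
    have hTs : Function.Surjective T := fun x => ⟨c⁻¹ • T x, by
      rw [map_smul, hcT, inv_smul_smul₀ hc1]⟩
    have hT2 : ∀ x y, S.form (T x) y = -S.form (Γ x) (T y) := fun x y => by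
      rw [hTx, hTx, LinearMap.map_smulₛₗ₂, map_smul, hQ.form_apply hS hΓ, Complex.conj_ofReal,
        smul_neg]
    have h5 := h4 (T ∘L Γ) T (fun x y => (hTB _ _).trans (hBΓ x y)) (hTs.comp hΓs) hTB hTs (-c)
      (by rwa [norm_neg]) (fun x y => by
        change S.form (T (Γ x)) (T y) = _
        rw [hT2, hΓ.apply_apply hS, hcT, map_smul (S.form x), smul_eq_mul, neg_mul]) x y
    rw [hTx, hTx, map_smul j, LinearMap.sesq_smul, Complex.conj_ofReal, ← mul_assoc, hsq] at h5
    rw [← h5, ← mul_assoc, ← Complex.ofReal_mul, inv_mul_cancel₀ hθ'.ne', Complex.ofReal_one,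
      one_mul]

end IsSuperunitaryRep

/-! ### Scalar products: bases and projections -/

namespace IsScalarProduct

variable {H : Type u} [NormedAddCommGroup H] [NormedSpace ℂ H] {B : H →ₗ⋆[ℂ] H →ₗ[ℂ] ℂ}

theorem exists_continuous (hB : IsScalarProduct B) : ∃ F : H →L⋆[ℂ] H →L[ℂ] ℂ, ∀ x y, F x y = B x y := by
  obtain ⟨C, -, hC⟩ := hB.exists_norm_le
  exact ⟨LinearMap.mkContinuous₂ B C hC, fun x y => rfl⟩

theorem eq_zero (hB : IsScalarProduct B) {x : H} (h : B x x = 0) : x = 0 := by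
  obtain ⟨c, C, hc, hb⟩ := hB.bounds
  have h1 := (hb x).1
  rw [h, Complex.zero_re] at h1
  have h2 : ‖x‖ ^ 2 = 0 := le_antisymm (by nlinarith) (by positivity)
  simpa using h2

variable [CompleteSpace H]

/-- Orthonormal bases of closed subspaces. -/
theorem exists_basis (hB : IsScalarProduct B) {E : Submodule ℂ H} (hE : IsClosed (E : Set H)) :
    ∃ (ι : Type u) (b : ι → H), (∀ i, b i ∈ E) ∧ (∀ i, B (b i) (b i) = 1) ∧
      (∀ i j, i ≠ j → B (b i) (b j) = 0) ∧
      E ≤ (Submodule.span ℂ (Set.range b)).topologicalClosure := by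
  obtain ⟨K, _, _, e, he⟩ := hB.exists_hilbert
  have : CompleteSpace K := (completeSpace_congr (e := e.toEquiv) e.isUniformEmbedding).1 ‹_›
  set E' : Submodule ℂ K := E.comap (e.symm : K →L[ℂ] H).toLinearMap with hE'
  have hE'c : IsClosed (E' : Set K) := hE.preimage e.symm.continuous
  have : CompleteSpace E' := hE'c.completeSpace_coe
  obtain ⟨w, b, -⟩ := exists_hilbertBasis ℂ E'
  refine ⟨w, fun i => e.symm (b i), fun i => (b i).2, fun i => ?_, fun i j hij => ?_, fun x hx => ?_⟩
  · rw [← he, e.apply_symm_apply]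
    have h := b.orthonormal.1 i
    have h2 : ‖((b i : E') : K)‖ = 1 := h
    rw [inner_self_eq_norm_sq_to_K, h2]
    simp
  · rw [← he, e.apply_symm_apply, e.apply_symm_apply]
    exact b.orthonormal.2 hij
  · have hx' : e x ∈ E' := by simpa [hE'] using hx
    have h1 : (⟨e x, hx'⟩ : E') ∈ (Submodule.span ℂ (Set.range b)).topologicalClosure := by
      rw [b.dense_span]
      trivial
    have h2 : Continuous fun y : E' => e.symm (y : K) := e.symm.continuous.comp continuous_subtype_val
    have h3 := map_mem_closure h2 h1 (t := (Submodule.span ℂ (Set.range fun i => e.symm (b i)) : Set H))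
      (fun y hy => by
        have h4 : (Submodule.span ℂ (Set.range b)) ≤ (Submodule.span ℂ
            (Set.range fun i => e.symm (b i))).comap
            ((e.symm : K →L[ℂ] H).toLinearMap ∘ₗ E'.subtype) := by
          rw [Submodule.span_le]
          rintro _ ⟨i, rfl⟩
          exact Submodule.subset_span ⟨i, rfl⟩
        exact h4 hy)
    rw [← SetLike.mem_coe, Submodule.topologicalClosure_coe]
    simpa using h3

/-- Orthogonal projections on closed subspaces. -/
theorem exists_projection (hB : IsScalarProduct B) {E : Submodule ℂ H} (hE : IsClosed (E : Set H))
    (x : H) : ∃ p ∈ E, ∀ y ∈ E, B y (x - p) = 0 := by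
  obtain ⟨K, _, _, e, he⟩ := hB.exists_hilbert
  have : CompleteSpace K := (completeSpace_congr (e := e.toEquiv) e.isUniformEmbedding).1 ‹_›
  set E' : Submodule ℂ K := E.comap (e.symm : K →L[ℂ] H).toLinearMap with hE'
  have hE'c : IsClosed (E' : Set K) := hE.preimage e.symm.continuous
  have : CompleteSpace E' := hE'c.completeSpace_coe
  refine ⟨e.symm (E'.starProjection (e x)), (E'.starProjection_apply_mem (e x)), fun y hy => ?_⟩
  have hy' : e y ∈ E' := by simpa [hE'] using hy
  rw [← he, map_sub, e.apply_symm_apply]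
  exact Submodule.starProjection_inner_eq_zero (K := E') (e x) (e y) hy' |> inner_eq_zero_symm.1

/-- Each member of an orthogonal family of closed subspaces with dense sum contains the vectors
orthogonal to the other members. -/
theorem mem_of_orthogonal (hB : IsScalarProduct B) {ι : Type*} {E : ι → Submodule ℂ H}
    (hE : ∀ i, IsClosed (E i : Set H))
    (ho : ∀ i j, i ≠ j → ∀ x ∈ E i, ∀ y ∈ E j, B x y = 0)
    (hd : (⨆ i, E i).topologicalClosure = ⊤) {i : ι} {x : H}
    (hx : ∀ j, j ≠ i → ∀ y ∈ E j, B y x = 0) : x ∈ E i := by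
  obtain ⟨p, hp, h⟩ := hB.exists_projection (hE i) x
  obtain ⟨F, hF⟩ := hB.exists_continuous
  let L : H →L⋆[ℂ] ℂ := F.flip (x - p)
  have hL : ∀ y, L y = B y (x - p) := fun y => hF y _
  have h1 : (⨆ i, E i).topologicalClosure ≤ LinearMap.ker L.toLinearMap := by
    refine Submodule.topologicalClosure_minimal _ (iSup_le fun j y hy => ?_)
      (isClosed_singleton.preimage L.continuous)
    rw [LinearMap.mem_ker]
    change L y = 0
    rw [hL]
    by_cases hj : j = i
    · subst hj
      exact h y hy
    · rw [map_sub, hx j hj y hy, ho j i hj y hy p hp, sub_zero]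
  have h2 : L (x - p) = 0 := h1 (hd ▸ Submodule.mem_top)
  rw [hL] at h2
  rw [sub_eq_zero.1 (hB.eq_zero h2)]
  exact hp

end IsScalarProduct

/-- An operator that is bounded below for the scalar products has closed range. -/
theorem isClosed_range_of_bound {H K : Type*} [NormedAddCommGroup H] [NormedSpace ℂ H]
    [NormedAddCommGroup K] [NormedSpace ℂ K] [CompleteSpace K] (V : K →L[ℂ] H) {c : ℝ} (hc : 0 < c)
    (h : ∀ x, c * ‖x‖ ≤ ‖V x‖) : IsClosed (LinearMap.range V.toLinearMap : Set H) := by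
  have h1 : AntilipschitzWith (Real.toNNReal c⁻¹) V :=
    ContinuousLinearMap.antilipschitz_of_bound V fun x => by
      rw [Real.coe_toNNReal _ (inv_nonneg.2 hc.le), ← div_eq_inv_mul, le_div_iff₀ hc, mul_comm]
      exact h x
  exact h1.isClosed_range V.uniformContinuous

section Lift

variable {m : ℕ} {H : Type u} [NormedAddCommGroup H] [NormedSpace ℂ H] [CompleteSpace H]

/-- The intertwiners defined by the vacuum vectors of a bounded Weyl system. -/
theorem IsScalarProduct.exists_lift {θ : ℝ} (hθ : θ ≠ 0) {W : PhaseSpace m → H →L[ℂ] H}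
    (hW : IsWeylSystem θ⁻¹ (phaseRot m) W) {B : H →ₗ⋆[ℂ] H →ₗ[ℂ] ℂ} (hB : IsScalarProduct B)
    (hBW : ∀ z x y, B (W z x) (W z y) = B x y) :
    ∃ L : H →ₗ[ℂ] (L2 m →L[ℂ] H), (∀ x, L x (vacuum m hθ) = hW.proj x) ∧
      (∀ x z f, L x (schrodinger θ (phaseBody z) f) = W z (L x f)) ∧
      (∀ F : H →L⋆[ℂ] H →L[ℂ] ℂ, (∀ z x y, F (W z x) (W z y) = F x y) → ∀ x y f g,
        F (L x f) (L y g) = inner ℂ f g * F (hW.proj x) (hW.proj y)) ∧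
      ∀ T : H →L[ℂ] H, (∀ z x, T (W z x) = W z (T x)) → ∀ x f, T (L x f) = L (T x) f := by
  obtain ⟨K, _, _, e, he⟩ := hB.exists_hilbert
  have : CompleteSpace K := (completeSpace_congr (e := e.toEquiv) e.isUniformEmbedding).1 ‹_›
  have hU := IsScalarProduct.isUnitaryWeyl_map hθ hW hBW e he
  have hP : ∀ x, e (hW.proj x) = hU.P (e x) :=
    hW.intertwine_proj (hW.map e) (e : H →L[ℂ] K) fun z x => by simp
  have hP' : ∀ x, e.symm (hU.P x) = hW.proj (e.symm x) := fun x => by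
    rw [e.symm_apply_eq, hP, e.apply_symm_apply]
  let L : H →ₗ[ℂ] (L2 m →L[ℂ] H) :=
    { toFun := fun x => (e.symm : K →L[ℂ] H) ∘L hU.lift (e x)
      map_add' := fun x y => by
        rw [map_add, hU.lift_add, ContinuousLinearMap.comp_add]
      map_smul' := fun c x => by
        rw [map_smul, hU.lift_smul, ContinuousLinearMap.comp_smul]
        rfl }
  have hL : ∀ x f, L x f = e.symm (hU.lift (e x) f) := fun x f => rfl
  have hLc : ∀ x z, L x (hU.coherent z) = W z (hW.proj x) := fun x z => by
    rw [hL, hU.lift_coherent, ← hP]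
    simp
  have h0 : hU.coherent 0 = vacuum m hθ := by
    have h1 : phaseBody (0 : PhaseSpace m) = 0 := by simp [phaseBody]
    rw [IsUnitaryWeyl.coherent, h1, schrodinger_one]
    rfl
  refine ⟨L, fun x => ?_, fun x z f => ?_, fun F hF x y f g => ?_, fun T hT x f => ?_⟩
  · rw [← h0, hLc, hW.zero]
    rfl
  · rw [hL, hL, hU.lift_schrodinger]
    simp
  · have h1 := hU.form_lift (F.bilinearComp (e.symm : K →L[ℂ] H) (e.symm : K →L[ℂ] H))
      (fun z x y => by simp [hF]) (e x) (e y) f g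
    simpa [hL, hP'] using h1
  · have h1 : T ∘L L x = L (T x) := hU.ext_lift fun z => by
      rw [ContinuousLinearMap.comp_apply, hLc, hLc, hT, hW.map_proj' T, hW.proj_apply]
      simp_rw [hT]
    exact DFunLike.congr_fun h1 f

end Lift

/-! ### Vacuum vectors of a superunitary representation -/

/-- The structure used to decompose a superunitary representation: the bounded odd part `Q`, the
grading operator `Γ`, an adapted fundamental symmetry `J`, the projection `P` onto the Gaussian
vectors, and the intertwiners `L x` defined by the vectors `P x`. -/
structure IsFrame {m r s : ℕ} {H : Type*} [NormedAddCommGroup H] [NormedSpace ℂ H] {θ : ℝ}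
    (hθ : θ ≠ 0) (n : ZMod 2) (S : SuperspaceData H) (R : HeisRep m r s H)
    (Q : (OddIndex r s → ℂ) →ₗ[ℂ] (H →L[ℂ] H)) (Γ J P : H →L[ℂ] H) (L : H →ₗ[ℂ] (L2 m →L[ℂ] H)) :
    Prop where
  rep : IsSuperunitaryRep n S R
  odd : IsBoundedOddPart θ S R Q
  grading : S.IsGrading Γ
  adapted : IsAdaptedSymmetry θ n S R Q J
  proj_proj : ∀ x, P (P x) = P x
  proj_odd : ∀ X x, P (Q X x) = Q X (P x)
  proj_symm : ∀ x, P (J x) = J (P x)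
  proj_mem : ∀ a, ∀ x ∈ S.comp a, P x ∈ S.comp a
  lift_vacuum : ∀ x, L x (vacuum m hθ) = P x
  lift_body : ∀ x g f, L x (schrodinger θ g f) = R.π g (L x f)
  form_lift : ∀ x y f g, S.form (L x f) (L y g) = inner ℂ f g * S.form (P x) (P y)
  odd_lift : ∀ X x f, Q X (L x f) = L (Q X x) f
  symm_lift : ∀ x f, J (L x f) = L (J x) f
  lift_mem : ∀ a, ∀ x ∈ S.comp a, ∀ f, L x f ∈ S.comp a
  eq_top : ∀ Y : Submodule ℂ H, IsClosed (Y : Set H) → (∀ g, ∀ x ∈ Y, R.π g x ∈ Y) →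
    (∀ x, P x ∈ Y) → Y = ⊤

theorem IsSuperunitaryRep.exists_frame {m r s : ℕ} {H : Type u} [NormedAddCommGroup H]
    [NormedSpace ℂ H] {θ : ℝ} (hθ : θ ≠ 0) {n : ZMod 2} {S : SuperspaceData H}
    {R : HeisRep m r s H} (hR : IsSuperunitaryRep n S R) (hχ : HasCentralCharacter θ R) :
    ∃ Q Γ J P L, IsFrame hθ n S R Q Γ J P L := by
  have : CompleteSpace H := hR.hilbert.complete
  obtain ⟨Q, hQ⟩ := hR.exists_oddPart hθ hχ
  obtain ⟨Γ, hΓ⟩ := hR.hilbert.exists_grading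
  obtain ⟨J, hJ⟩ := hR.exists_adapted hθ hχ hQ
  have hW := hR.weyl hθ hχ
  obtain ⟨L, hL1, hL2, hL3, hL4⟩ := hJ.symm.isScalarProduct.exists_lift hθ hW hJ.body
  obtain ⟨F, hF⟩ := hR.hilbert.exists_form
  have hJc : ∀ z x, J (R.π (phaseBody z) x) = R.π (phaseBody z) (J x) := fun z x => by
    refine hR.hilbert.eq_of_form fun y => ?_
    obtain ⟨y, rfl⟩ : ∃ y', y = R.π (phaseBody z) y' :=
      ⟨R.π (phaseBody (-z)) y, (hW.apply_neg z y).symm⟩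
    rw [hJ.body, hR.π_superunitary]
  have hΓc : ∀ z x, Γ (R.π (phaseBody z) x) = R.π (phaseBody z) (Γ x) := fun z x => by
    refine DFunLike.congr_fun (SuperspaceData.IsGrading.ext hR.hilbert (f := Γ ∘L R.π (phaseBody z))
      (g := R.π (phaseBody z) ∘L Γ) fun a x hx => ?_) x
    rw [ContinuousLinearMap.comp_apply, ContinuousLinearMap.comp_apply, hΓ a x hx,
      hΓ a _ (hR.π_even _ _ _ hx), map_smul]
  refine ⟨Q, Γ, J, hW.proj, L, hR, hQ, hΓ, hJ, hW.proj_proj, fun X x => ?_, fun x => ?_,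
    fun a x hx => hR.proj_mem_comp hW hx, hL1, fun x g f => ?_, fun x y f g => ?_, fun X => hL4 (Q X) fun z x => hQ.comm X _ x,
    hL4 J hJc, fun a x hx f => ?_, fun Y hY hY' hP => ?_⟩
  · exact (hW.intertwine_proj hW (Q X) (fun z x => hQ.comm X _ x) x).symm
  · exact (hW.intertwine_proj hW J hJc x).symm
  · rw [body_eq (fun g h => schrodinger_mul θ g h) (fun t v => schrodinger_central θ t v),
      body_eq hR.π_mul hχ, map_smul, hL2]
  · have h := hL3 F (fun z x y => by rw [hF, hF, hR.π_superunitary]) x y f g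
    rwa [hF, hF] at h
  · rw [hΓ.mem_comp_iff hR.hilbert, hL4 Γ hΓc, hΓ a x hx, map_smul, smul_apply]
  · exact hR.eq_top_of_orbit hW hY fun a z x _ => hY' _ _ (hP x)

section Map

variable {r s : ℕ}

theorem IsCAR.map_monomialProd {A A' : Type*} [Ring A] [Ring A'] (f : A →+* A')
    (a : Fin r ⊕ Fin s → A) (M : Monomial r s) :
    f (monomialProd a M) = monomialProd (fun j => f (a j)) M := by
  simp [monomialProd, orderedProd, map_list_prod, Function.comp_def]

end Map

namespace IsFrame

variable {m r s : ℕ} {H : Type u} [NormedAddCommGroup H] [NormedSpace ℂ H]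
  {θ : ℝ} {hθ : θ ≠ 0} {n : ZMod 2} {S : SuperspaceData H} {R : HeisRep m r s H}
  {Q : (OddIndex r s → ℂ) →ₗ[ℂ] (H →L[ℂ] H)} {Γ J P : H →L[ℂ] H} {L : H →ₗ[ℂ] (L2 m →L[ℂ] H)}

theorem isCAR (h : IsFrame hθ n S R Q Γ J P L) :
    IsCAR (fun j => Q (creationVector θ j)) (fun j => Q (annihilationVector j)) :=
  h.odd.rep.isCAR hθ

theorem isCAR_end (h : IsFrame hθ n S R Q Γ J P L) :
    IsCAR (fun j => ((Q (creationVector θ j)).toLinearMap : Module.End ℂ H))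
      (fun j => ((Q (annihilationVector j)).toLinearMap : Module.End ℂ H)) :=
  h.isCAR.map ContinuousLinearMap.toLinearMapRingHom

/-- The adapted scalar product. -/
theorem isScalarProduct (h : IsFrame hθ n S R Q Γ J P L) :
    IsScalarProduct (S.form.compl₂ J.toLinearMap) := h.adapted.symm.isScalarProduct

theorem form_symm_symm (h : IsFrame hθ n S R Q Γ J P L) (x y : H) :
    S.form (J x) (J (J y)) = S.form x (J y) := h.adapted.symm.isometric x (J y)

theorem scalar_single (h : IsFrame hθ n S R Q Γ J P L) (i : OddIndex r s) (x y : H) :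
    S.form (Q (Pi.single i 1) x) (J y) =
      ((|θ|⁻¹ : ℝ) : ℂ) * (θ * Complex.I * oddSign i * S.form x (J (Q (Pi.single i 1) y))) := by
  have hθ' : (θ : ℂ) ≠ 0 := by exact_mod_cast hθ
  have h1 := h.adapted.odd i x ((θ * Complex.I * oddSign i) • Q (Pi.single i 1) y)
  have h2 : (θ * Complex.I * oddSign i) * (-(Complex.I / θ) * oddSign i) = 1 := by
    have h3 : oddSign i * oddSign i = 1 := by
      rcases i with i | i <;> simp [oddSign]
    have hI := Complex.I_mul_I
    field_simp
    linear_combination -hI * (oddSign i * oddSign i) + h3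
  rw [map_smul, h.odd.single_apply_apply, smul_smul, h2, one_smul, map_smul, map_smul,
    smul_eq_mul] at h1
  exact h1

/-- The adapted fundamental symmetry and the odd operators. -/
theorem exists_symm_single (h : IsFrame hθ n S R Q Γ J P L) : ∃ k : ℂ, k ≠ 0 ∧ ∀ i y,
    J (Q (Pi.single i 1) y) = (k * oddSign i) • Γ (Q (Pi.single i 1) (J y)) := by
  have hθ' : (θ : ℂ) ≠ 0 := by exact_mod_cast hθ
  have hθa : ((|θ| : ℝ) : ℂ) ≠ 0 := by simpa using hθ
  refine ⟨|θ| / θ * Complex.I * (-1) ^ n.val, by simp [hθ], fun i y => ?_⟩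
  refine h.rep.hilbert.eq_of_form fun x => ?_
  have h1 := h.scalar_single i x y
  rw [h.odd.form_apply h.rep.hilbert h.grading] at h1
  have h2 := h.grading.form_apply h.rep.hilbert x (Γ (Q (Pi.single i 1) (J y)))
  rw [h.grading.apply_apply h.rep.hilbert] at h2
  rw [h2] at h1
  have h3 : oddSign i * oddSign i = 1 := by
    rcases i with i | i <;> simp [oddSign]
  have hI := Complex.I_mul_I
  rw [map_smul, smul_eq_mul]
  push_cast at h1
  have h4 : (θ : ℂ) * Complex.I * oddSign i * S.form x (J (Q (Pi.single i 1) y)) =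
      -(|θ| : ℝ) * ((-1) ^ n.val * S.form x (Γ (Q (Pi.single i 1) (J y)))) := by
    field_simp at h1
    linear_combination -h1
  have h5 : (θ : ℂ) * Complex.I * oddSign i ≠ 0 := by
    have : oddSign i ≠ 0 := fun h => by simp [h] at h3
    simp [hθ', this]
  refine mul_left_cancel₀ h5 ?_
  rw [h4]
  have h6 : (θ : ℂ) * ((|θ| : ℝ) / θ) = (|θ| : ℝ) := by field_simp
  linear_combination (-(Complex.I * Complex.I * oddSign i * oddSign i * (-1) ^ n.val *
    S.form x (Γ (Q (Pi.single i 1) (J y))))) * h6 - (|θ| : ℝ) * (-1) ^ n.val *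
    S.form x (Γ (Q (Pi.single i 1) (J y))) * (Complex.I * Complex.I * h3 + hI)

end IsFrame

/-- The norms of the creation operators for the adapted scalar product. -/
noncomputable def modeWeight {r s : ℕ} (θ : ℝ) : Fin r ⊕ Fin s → ℝ
  | .inl _ => |θ| / 2
  | .inr _ => |θ|

section Odd

variable {r s : ℕ} {H : Type*} [NormedAddCommGroup H] [NormedSpace ℂ H]
  (Q : (OddIndex r s → ℂ) →ₗ[ℂ] (H →L[ℂ] H))

theorem odd_creation_inl (θ : ℝ) (j : Fin r) (x : H) : Q (creationVector θ (.inl j)) x =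
    ((θ : ℂ) / (2 * Complex.I) / (Real.sqrt 2 : ℂ)) •
      (Q (Pi.single (.inl (.inl j)) 1) x - Q (Pi.single (.inr j) 1) x) := by
  simp only [creationVector, map_smul, map_sub]
  rfl

theorem odd_creation_inr (θ : ℝ) (k : Fin s) (x : H) : Q (creationVector θ (.inr k)) x =
    ((θ : ℂ) / (2 * Complex.I)) • (Q (Pi.single (.inl (.inr (.inl k))) 1) x +
      Complex.I • Q (Pi.single (.inl (.inr (.inr k))) 1) x) := by
  simp only [creationVector, map_smul, map_add]
  rfl

theorem odd_annihilation_inl (j : Fin r) (x : H) : Q (annihilationVector (.inl j)) x =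
    (-(1 / (Real.sqrt 2 : ℂ))) •
      (Q (Pi.single (.inl (.inl j)) 1) x + Q (Pi.single (.inr j) 1) x) := by
  simp only [annihilationVector, map_smul, map_add]
  rfl

theorem odd_annihilation_inr (k : Fin s) (x : H) : Q (annihilationVector (.inr k)) x =
    (-(1 / 2 : ℂ)) • (Q (Pi.single (.inl (.inr (.inl k))) 1) x -
      Complex.I • Q (Pi.single (.inl (.inr (.inr k))) 1) x) := by
  simp only [annihilationVector, map_smul, map_sub]
  rfl

end Odd

namespace IsFrame

variable {m r s : ℕ} {H : Type u} [NormedAddCommGroup H] [NormedSpace ℂ H]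
  {θ : ℝ} {hθ : θ ≠ 0} {n : ZMod 2} {S : SuperspaceData H} {R : HeisRep m r s H}
  {Q : (OddIndex r s → ℂ) →ₗ[ℂ] (H →L[ℂ] H)} {Γ J P : H →L[ℂ] H} {L : H →ₗ[ℂ] (L2 m →L[ℂ] H)}

/-- The annihilation operators are adjoint to the creation operators. -/
theorem scalar_creation (h : IsFrame hθ n S R Q Γ J P L) (j) (x y : H) :
    S.form (Q (creationVector θ j) x) (J y) =
      (modeWeight θ j : ℂ) * S.form x (J (Q (annihilationVector j) y)) := by
  have hθa : ((|θ| : ℝ) : ℂ) ≠ 0 := by simpa using hθ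
  have h0 : ((|θ| : ℝ) : ℂ) * (|θ| : ℝ) = θ * θ := by
    rw [← Complex.ofReal_mul, abs_mul_abs_self, Complex.ofReal_mul]
  have h2 := sqrt_two_ne_zero
  have hI := Complex.I_mul_I
  rcases j with j | k
  · rw [odd_creation_inl, odd_annihilation_inl]
    simp only [LinearMap.map_smulₛₗ, LinearMap.smul_apply, map_sub, LinearMap.sub_apply, map_smul,
      map_add, h.scalar_single, smul_eq_mul, oddSign, Sum.elim_inl, Sum.elim_inr, modeWeight,
      map_div₀, map_mul, Complex.conj_ofReal, Complex.conj_I, Complex.conj_ofNat, Complex.ofReal_div,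
      Complex.ofReal_inv, Complex.ofReal_ofNat]
    field_simp
    linear_combination (S.form x (J (Q (Pi.single (.inl (.inl j)) 1) y)) +
      S.form x (J (Q (Pi.single (.inr j) 1) y))) * h0
  · rw [odd_creation_inr, odd_annihilation_inr]
    simp only [LinearMap.map_smulₛₗ, LinearMap.smul_apply, map_sub, LinearMap.add_apply, map_smul,
      map_add, h.scalar_single, smul_eq_mul, oddSign, Sum.elim_inl, modeWeight,
      map_div₀, map_mul, Complex.conj_ofReal, Complex.conj_I, Complex.conj_ofNat,
      Complex.ofReal_inv]
    field_simp
    linear_combination (S.form x (J (Q (Pi.single (.inl (.inr (.inl k))) 1) y)) -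
      Complex.I * S.form x (J (Q (Pi.single (.inl (.inr (.inr k))) 1) y))) * h0

theorem form_creation_inl (h : IsFrame hθ n S R Q Γ J P L) (j : Fin r) (x y : H) :
    S.form (Q (creationVector θ (.inl j)) x) y = S.form (Γ x) (Q (creationVector θ (.inl j)) y) := by
  simp only [odd_creation_inl, LinearMap.map_smulₛₗ, LinearMap.smul_apply, map_sub,
    LinearMap.sub_apply, map_smul, h.odd.form_apply h.rep.hilbert h.grading, smul_eq_mul,
    map_div₀, map_mul, Complex.conj_ofReal, Complex.conj_I, Complex.conj_ofNat]
  field_simp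
  ring

theorem form_annihilation_inl (h : IsFrame hθ n S R Q Γ J P L) (j : Fin r) (x y : H) :
    S.form (Q (annihilationVector (.inl j)) x) y =
      -1 * S.form (Γ x) (Q (annihilationVector (.inl j)) y) := by
  simp only [odd_annihilation_inl, LinearMap.map_smulₛₗ, LinearMap.smul_apply, map_add,
    LinearMap.add_apply, map_smul, h.odd.form_apply h.rep.hilbert h.grading, smul_eq_mul,
    map_div₀, map_neg, map_one, Complex.conj_ofReal]
  ring

theorem form_creation_inr (h : IsFrame hθ n S R Q Γ J P L) (k : Fin s) (x y : H) :
    S.form (Q (creationVector θ (.inr k)) x) y =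
      θ * Complex.I * S.form (Γ x) (Q (annihilationVector (.inr k)) y) := by
  have hI := Complex.I_mul_I
  simp only [odd_creation_inr, odd_annihilation_inr, LinearMap.map_smulₛₗ, LinearMap.smul_apply,
    map_add, map_sub,
    LinearMap.add_apply, map_smul, h.odd.form_apply h.rep.hilbert h.grading, smul_eq_mul,
    map_div₀, map_mul, Complex.conj_ofReal, Complex.conj_I, Complex.conj_ofNat]
  field_simp
  simp only [Complex.I_sq]
  ring

theorem form_annihilation_inr (h : IsFrame hθ n S R Q Γ J P L) (k : Fin s) (x y : H) :
    S.form (Q (annihilationVector (.inr k)) x) y =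
      Complex.I / θ * S.form (Γ x) (Q (creationVector θ (.inr k)) y) := by
  have hI := Complex.I_mul_I
  have hθ' : (θ : ℂ) ≠ 0 := by exact_mod_cast hθ
  simp only [odd_creation_inr, odd_annihilation_inr, LinearMap.map_smulₛₗ, LinearMap.smul_apply,
    map_add, map_sub,
    LinearMap.sub_apply, map_smul, h.odd.form_apply h.rep.hilbert h.grading, smul_eq_mul,
    map_div₀, map_neg, map_one, Complex.conj_I, Complex.conj_ofNat]
  field_simp
  ring

theorem annihilation_inr_symm (h : IsFrame hθ n S R Q Γ J P L) {k : Fin s} {y : H}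
    (hy : Q (annihilationVector (.inr k)) y = 0) : Q (annihilationVector (.inr k)) (J y) = 0 := by
  obtain ⟨c, hc, hJ⟩ := h.exists_symm_single
  have h1 : c • Γ (Q (annihilationVector (.inr k)) (J y)) = J (Q (annihilationVector (.inr k)) y) := by
    simp only [odd_annihilation_inr, map_smul, map_sub, hJ, oddSign, Sum.elim_inl]
    module
  rw [hy, map_zero, smul_eq_zero_iff_right hc] at h1
  rw [← h.grading.apply_apply h.rep.hilbert (Q (annihilationVector (.inr k)) (J y)), h1, map_zero]

theorem annihilation_inl_symm (h : IsFrame hθ n S R Q Γ J P L) {j : Fin r} {y : H}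
    (hy : Q (creationVector θ (.inl j)) y = 0) : Q (annihilationVector (.inl j)) (J y) = 0 := by
  obtain ⟨c, hc, hJ⟩ := h.exists_symm_single
  have hθ' : (θ : ℂ) ≠ 0 := by exact_mod_cast hθ
  have h2 := sqrt_two_ne_zero
  rw [odd_creation_inl, smul_eq_zero_iff_right (by simp [hθ])] at hy
  have h1 := congrArg J hy
  rw [map_sub, hJ, hJ, map_zero] at h1
  have h3 : c • Γ (Q (Pi.single (.inl (.inl j)) 1) (J y) + Q (Pi.single (.inr j) 1) (J y)) = 0 := by
    rw [← h1, map_add]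
    simp only [oddSign, Sum.elim_inl, Sum.elim_inr]
    module
  rw [smul_eq_zero_iff_right hc] at h3
  rw [odd_annihilation_inl, ← h.grading.apply_apply h.rep.hilbert (_ + _), h3, map_zero, smul_zero]

theorem creation_inl_symm (h : IsFrame hθ n S R Q Γ J P L) {j : Fin r} {y : H}
    (hy : Q (annihilationVector (.inl j)) y = 0) : Q (creationVector θ (.inl j)) (J y) = 0 := by
  obtain ⟨c, hc, hJ⟩ := h.exists_symm_single
  have h2 := sqrt_two_ne_zero
  rw [odd_annihilation_inl, smul_eq_zero_iff_right (by simp)] at hy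
  have h1 := congrArg J hy
  rw [map_add, hJ, hJ, map_zero] at h1
  have h3 : c • Γ (Q (Pi.single (.inl (.inl j)) 1) (J y) - Q (Pi.single (.inr j) 1) (J y)) = 0 := by
    rw [← h1, map_sub]
    simp only [oddSign, Sum.elim_inl, Sum.elim_inr]
    module
  rw [smul_eq_zero_iff_right hc] at h3
  rw [odd_creation_inl, ← h.grading.apply_apply h.rep.hilbert (_ - _), h3, map_zero, smul_zero]

end IsFrame

namespace IsCAR

variable {r s : ℕ}

theorem commute_monomialProd {A : Type*} [Ring A] {a : Fin r ⊕ Fin s → A} {T : A}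
    (hT : ∀ j, Commute T (a j)) (M : Monomial r s) : Commute T (monomialProd a M) := by
  have h : ∀ {k : ℕ} (c : Fin k → A) (_ : ∀ i, Commute T (c i)) (I : Finset (Fin k)),
      Commute T (orderedProd c I) := fun c hc I =>
    Commute.list_prod_right _ _ fun x hx => by
      obtain ⟨i, _, rfl⟩ := List.mem_map.1 hx
      exact hc i
  exact (h _ (fun i => hT _) _).mul_right (h _ (fun i => hT _) _)

theorem monomialProd_ins {A : Type*} [Ring A] [Algebra ℂ A] {a b : Fin r ⊕ Fin s → A}
    (h : IsCAR a b) {M : Monomial r s} {j} (hj : ¬ M.Has j) :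
    monomialProd a (M.ins j) = M.sgn j • (a j * monomialProd a M) := by
  rw [h.mul_monomialProd, if_neg hj, smul_smul, M.sgn_mul_self, one_smul]

end IsCAR

section Fock

variable {r s : ℕ} {A : Type*} [AddCommGroup A] [Module ℂ A]

theorem fockGrading_mul (j) (φ : Monomial r s → A) :
    fockGrading (fockMul j φ) = -fockMul j (fockGrading φ) := by
  have h : (fockGrading (A := A) (r := r) (s := s)) ∘ₗ fockMul j = -(fockMul j ∘ₗ fockGrading) := by
    refine LinearMap.pi_ext fun M x => ?_
    simp only [LinearMap.comp_apply, LinearMap.neg_apply]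
    rw [fockGrading_single, map_smul]
    by_cases hM : M.Has j
    · rw [fockMul_single_of_has hM]; simp
    · rw [fockMul_single hM, map_smul, fockGrading_single, Monomial.degree_ins hM]
      obtain e | e := ZMod.eq_zero_or_eq_one M.degree <;> rw [e]
      · simp [ZMod.val_one]
      · simp [ZMod.val_one, show (1 : ZMod 2) + 1 = 0 from rfl]
  exact DFunLike.congr_fun h φ

theorem fockGrading_der (j) (φ : Monomial r s → A) :
    fockGrading (fockDer j φ) = -fockDer j (fockGrading φ) := by
  have h : (fockGrading (A := A) (r := r) (s := s)) ∘ₗ fockDer j = -(fockDer j ∘ₗ fockGrading) := by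
    refine LinearMap.pi_ext fun M x => ?_
    simp only [LinearMap.comp_apply, LinearMap.neg_apply]
    rw [fockGrading_single, map_smul]
    by_cases hM : M.Has j
    · rw [fockDer_single hM, map_smul, fockGrading_single, Monomial.degree_ers hM]
      obtain e | e := ZMod.eq_zero_or_eq_one M.degree <;> rw [e]
      · simp [ZMod.val_one]
      · simp [ZMod.val_one, show (1 : ZMod 2) + 1 = 0 from rfl]
    · rw [fockDer_single_of_not_has hM]; simp
  exact DFunLike.congr_fun h φ

theorem fockGrading_pow_mul (k : ℕ) (j) (φ : Monomial r s → A) :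
    (fockGrading ^ k) (fockMul j φ) = (-1 : ℂ) ^ k • fockMul j ((fockGrading ^ k) φ) := by
  induction k with
  | zero => simp
  | succ k ih =>
    rw [pow_succ', Module.End.mul_apply, ih, map_smul, fockGrading_mul, pow_succ',
      Module.End.mul_apply]
    module

theorem fockGrading_pow_der (k : ℕ) (j) (φ : Monomial r s → A) :
    (fockGrading ^ k) (fockDer j φ) = (-1 : ℂ) ^ k • fockDer j ((fockGrading ^ k) φ) := by
  induction k with
  | zero => simp
  | succ k ih =>
    rw [pow_succ', Module.End.mul_apply, ih, map_smul, fockGrading_der, pow_succ',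
      Module.End.mul_apply]
    module

theorem fockGrading_pow_single (k : ℕ) (M : Monomial r s) (x : A) :
    (fockGrading ^ k) (Pi.single M x) =
      (-1 : ℂ) ^ (M.degree.val * k) • Pi.single (M := fun _ => A) M x := by
  induction k with
  | zero => simp
  | succ k ih =>
    rw [pow_succ', Module.End.mul_apply, ih, map_smul, fockGrading_single, smul_smul, ← pow_add]
    rfl

/-- The norm of a monomial in the creation operators for the adapted scalar product. -/
noncomputable def Monomial.weight (θ : ℝ) (M : Monomial r s) : ℝ :=
  (|θ| / 2) ^ M.1.card * |θ| ^ M.2.card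

theorem Monomial.weight_pos {θ : ℝ} (hθ : θ ≠ 0) (M : Monomial r s) : 0 < M.weight θ := by
  have := abs_pos.2 hθ
  unfold Monomial.weight
  positivity

theorem Monomial.weight_ins (θ : ℝ) {M : Monomial r s} {j} (h : ¬ M.Has j) :
    (M.ins j).weight θ = modeWeight θ j * M.weight θ := by
  rcases j with j | k
  · simp only [Monomial.weight, Monomial.ins, modeWeight]
    rw [Finset.card_insert_of_notMem h, pow_succ]
    ring
  · simp only [Monomial.weight, Monomial.ins, modeWeight]
    rw [Finset.card_insert_of_notMem h, pow_succ]
    ring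

end Fock

section ModelMap

variable {m r s : ℕ} {H : Type u} [NormedAddCommGroup H] [NormedSpace ℂ H]

/-- The product of creation operators attached to a monomial. -/
noncomputable def oddMonomial (θ : ℝ) (Q : (OddIndex r s → ℂ) →ₗ[ℂ] (H →L[ℂ] H))
    (M : Monomial r s) : H →L[ℂ] H :=
  IsCAR.monomialProd (fun j => Q (creationVector θ j)) M

/-- The map from the model defined by a vacuum vector. -/
noncomputable def modelMap (θ : ℝ) (Q : (OddIndex r s → ℂ) →ₗ[ℂ] (H →L[ℂ] H))
    (L : H →ₗ[ℂ] (L2 m →L[ℂ] H)) (x : H) : ModelSpace m r s →L[ℂ] H :=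
  ∑ M, oddMonomial θ Q M ∘L L x ∘L ContinuousLinearMap.proj M

/-- The vacuum vectors. -/
noncomputable def vacuumSpace (Q : (OddIndex r s → ℂ) →ₗ[ℂ] (H →L[ℂ] H)) (P : H →L[ℂ] H) : Submodule ℂ H :=
  LinearMap.ker (P - 1).toLinearMap ⊓ ⨅ j, LinearMap.ker (Q (annihilationVector j)).toLinearMap

theorem mem_vacuumSpace {Q : (OddIndex r s → ℂ) →ₗ[ℂ] (H →L[ℂ] H)} {P : H →L[ℂ] H} {x : H} :
    x ∈ vacuumSpace Q P ↔ P x = x ∧ ∀ j, Q (annihilationVector j) x = 0 := by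
  simp [vacuumSpace, sub_eq_zero]

theorem isClosed_vacuumSpace (Q : (OddIndex r s → ℂ) →ₗ[ℂ] (H →L[ℂ] H)) (P : H →L[ℂ] H) :
    IsClosed (vacuumSpace Q P : Set H) := by
  rw [vacuumSpace, Submodule.coe_inf, Submodule.coe_iInf]
  exact (P - 1).isClosed_ker.inter (isClosed_iInter fun j => ContinuousLinearMap.isClosed_ker _)

theorem modelMap_coe (θ : ℝ) (Q : (OddIndex r s → ℂ) →ₗ[ℂ] (H →L[ℂ] H))
    (L : H →ₗ[ℂ] (L2 m →L[ℂ] H)) (x : H) (φ : ModelSpace m r s) : modelMap θ Q L x φ =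
      IsCAR.fockMap (fun j => ((Q (creationVector θ j)).toLinearMap : Module.End ℂ H))
        (L x).toLinearMap φ := by
  rw [modelMap, IsCAR.fockMap, LinearMap.sum_apply, _root_.sum_apply]
  refine Finset.sum_congr rfl fun M _ => ?_
  have h := IsCAR.map_monomialProd ContinuousLinearMap.toLinearMapRingHom
    (fun j => Q (creationVector θ j)) M
  change oddMonomial θ Q M (L x (φ M)) = _
  exact DFunLike.congr_fun h (L x (φ M))

theorem modelMap_single (θ : ℝ) (Q : (OddIndex r s → ℂ) →ₗ[ℂ] (H →L[ℂ] H))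
    (L : H →ₗ[ℂ] (L2 m →L[ℂ] H)) (x : H) (M : Monomial r s) (f : L2 m) :
    modelMap θ Q L x (Pi.single M f) = oddMonomial θ Q M (L x f) := by
  rw [modelMap_coe, IsCAR.fockMap_single]
  exact (DFunLike.congr_fun (IsCAR.map_monomialProd ContinuousLinearMap.toLinearMapRingHom
    (fun j => Q (creationVector θ j)) M) (L x f)).symm

end ModelMap

namespace IsFrame

variable {m r s : ℕ} {H : Type u} [NormedAddCommGroup H] [NormedSpace ℂ H]
  {θ : ℝ} {hθ : θ ≠ 0} {n : ZMod 2} {S : SuperspaceData H} {R : HeisRep m r s H}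
  {Q : (OddIndex r s → ℂ) →ₗ[ℂ] (H →L[ℂ] H)} {Γ J P : H →L[ℂ] H} {L : H →ₗ[ℂ] (L2 m →L[ℂ] H)}

theorem oddMonomial_comm {T : H →L[ℂ] H}
    (hT : ∀ X x, T (Q X x) = Q X (T x)) (M : Monomial r s) (x : H) :
    T (oddMonomial θ Q M x) = oddMonomial θ Q M (T x) :=
  DFunLike.congr_fun (IsCAR.commute_monomialProd (a := fun j => Q (creationVector θ j)) (T := T)
    (fun _ => ContinuousLinearMap.ext fun x => hT _ x) M).eq x

theorem oddMonomial_ins (h : IsFrame hθ n S R Q Γ J P L) {M : Monomial r s} {j} (hj : ¬ M.Has j)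
    (x : H) : oddMonomial θ Q (M.ins j) x =
      M.sgn j • Q (creationVector θ j) (oddMonomial θ Q M x) :=
  DFunLike.congr_fun (h.isCAR.monomialProd_ins hj) x

theorem oddMonomial_empty (x : H) : oddMonomial θ Q (∅, ∅) x = x := by
  rw [oddMonomial, IsCAR.monomialProd_empty]
  rfl

theorem oddMonomial_lift (h : IsFrame hθ n S R Q Γ J P L) (M : Monomial r s) (x : H) (f : L2 m) :
    oddMonomial θ Q M (L x f) = L (oddMonomial θ Q M x) f := by
  induction M using Monomial.induction_ins with
  | h0 => rw [oddMonomial_empty, oddMonomial_empty]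
  | h1 M j hj ih =>
    rw [h.oddMonomial_ins hj, h.oddMonomial_ins hj, ih, h.odd_lift, map_smul]
    rfl

theorem oddMonomial_mem (h : IsFrame hθ n S R Q Γ J P L) (M : Monomial r s) {d : ZMod 2} {x : H}
    (hx : x ∈ S.comp d) : oddMonomial θ Q M x ∈ S.comp (M.degree + d) := by
  induction M using Monomial.induction_ins with
  | h0 => simpa [oddMonomial_empty, Monomial.degree] using hx
  | h1 M j hj ih =>
    rw [h.oddMonomial_ins hj, Monomial.degree_ins hj, add_right_comm]
    exact Submodule.smul_mem _ _ (h.odd.odd _ _ _ ih)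

theorem modelMap_mul (h : IsFrame hθ n S R Q Γ J P L) (x : H) (j) (φ : ModelSpace m r s) :
    modelMap θ Q L x (fockMul j φ) = Q (creationVector θ j) (modelMap θ Q L x φ) := by
  rw [modelMap_coe, modelMap_coe, h.isCAR_end.fockMap_mul]
  rfl

theorem annihilation_lift (h : IsFrame hθ n S R Q Γ J P L) {x : H} (hx : x ∈ vacuumSpace Q P) (j)
    (f : L2 m) : Q (annihilationVector j) (L x f) = 0 := by
  rw [h.odd_lift, (mem_vacuumSpace.1 hx).2, map_zero]
  rfl

theorem modelMap_der (h : IsFrame hθ n S R Q Γ J P L) {x : H} (hx : x ∈ vacuumSpace Q P) (j)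
    (φ : ModelSpace m r s) :
    modelMap θ Q L x (fockDer j φ) = Q (annihilationVector j) (modelMap θ Q L x φ) := by
  rw [modelMap_coe, modelMap_coe, h.isCAR_end.fockMap_der fun j f => h.annihilation_lift hx j f]
  rfl

theorem modelMap_body (h : IsFrame hθ n S R Q Γ J P L) (x : H) (g) (φ : ModelSpace m r s) :
    modelMap θ Q L x (modelBody m r s θ g φ) = R.π g (modelMap θ Q L x φ) := by
  simp only [modelMap, _root_.sum_apply, ContinuousLinearMap.comp_apply, map_sum,
    ContinuousLinearMap.proj_apply, modelBody_apply, h.lift_body]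
  exact Finset.sum_congr rfl fun M _ =>
    (oddMonomial_comm (fun X x => (h.odd.comm X g x).symm) M _).symm

theorem modelMap_oddOperator (h : IsFrame hθ n S R Q Γ J P L) {x : H} (hx : x ∈ vacuumSpace Q P)
    (X : OddPart r s) (φ : ModelSpace m r s) :
    modelMap θ Q L x (oddOperator m θ X φ) = Q X.toC (modelMap θ Q L x φ) := by
  rw [oddOperator_apply, oddElement, IsOddRep.apply_toC hθ Q]
  simp only [LinearMap.sum_apply, LinearMap.add_apply, LinearMap.smul_apply, map_sum, map_add,
    map_smul, h.modelMap_mul, h.modelMap_der hx, _root_.sum_apply, add_apply, smul_apply]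

theorem intertwines (h : IsFrame hθ n S R Q Γ J P L) {x : H} (hx : x ∈ vacuumSpace Q P) :
    Intertwines (modelRep m r s θ) R (modelMap θ Q L x) := by
  refine ⟨fun g φ => h.modelMap_body x g φ, fun X φ => ?_⟩
  have h1 : modelMap θ Q L x φ ∈ smoothVectors R.π :=
    map_mem_smoothVectors (fun g v => h.modelMap_body x g v) φ.2
  refine ⟨h1, ?_⟩
  rw [← h.odd.apply X ⟨_, h1⟩]
  exact (h.modelMap_oddOperator hx X φ).symm

theorem modelMap_single_mem (h : IsFrame hθ n S R Q Γ J P L) {d : ZMod 2} {x : H}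
    (hx : x ∈ S.comp d) (M : Monomial r s) (f : L2 m) :
    modelMap θ Q L x (Pi.single M f) ∈ S.comp (M.degree + d) := by
  rw [modelMap_single]
  exact h.oddMonomial_mem M (h.lift_mem d x hx f)

theorem modelMap_mem (h : IsFrame hθ n S R Q Γ J P L) {d a : ZMod 2} {x : H}
    (hx : x ∈ S.comp d) {φ : ModelSpace m r s} (hφ : φ ∈ modelComp m r s a) :
    modelMap θ Q L x φ ∈ S.comp (a + d) := by
  rw [← Finset.univ_sum_single φ, map_sum]
  refine Submodule.sum_mem _ fun M _ => ?_
  by_cases hM : M.degree = a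
  · exact hM ▸ h.modelMap_single_mem hx M _
  · rw [mem_modelComp.1 hφ M hM, Pi.single_zero, map_zero]
    exact zero_mem _

theorem grading_modelMap (h : IsFrame hθ n S R Q Γ J P L) {d : ZMod 2} {x : H}
    (hx : x ∈ S.comp d) (φ : ModelSpace m r s) :
    Γ (modelMap θ Q L x φ) = (-1 : ℂ) ^ d.val • modelMap θ Q L x (fockGrading φ) := by
  have h1 : Γ.toLinearMap ∘ₗ (modelMap θ Q L x).toLinearMap =
      (-1 : ℂ) ^ d.val • (modelMap θ Q L x).toLinearMap ∘ₗ fockGrading := by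
    refine LinearMap.pi_ext fun M f => ?_
    have h2 := h.grading _ _ (h.modelMap_single_mem hx M f)
    simp only [LinearMap.comp_apply, LinearMap.smul_apply, ContinuousLinearMap.coe_coe]
    rw [h2, fockGrading_single, map_smul, smul_smul]
    congr 1
    obtain rfl | rfl := ZMod.eq_zero_or_eq_one d <;>
      obtain e | e := ZMod.eq_zero_or_eq_one M.degree <;> rw [e]
    all_goals simp [ZMod.val_one, show (1 : ZMod 2) + 1 = 0 from rfl]
  exact DFunLike.congr_fun h1 φ

end IsFrame

namespace IsFrame

variable {m r s : ℕ} {H : Type u} [NormedAddCommGroup H] [NormedSpace ℂ H]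
  {θ : ℝ} {hθ : θ ≠ 0} {n : ZMod 2} {S : SuperspaceData H} {R : HeisRep m r s H}
  {Q : (OddIndex r s → ℂ) →ₗ[ℂ] (H →L[ℂ] H)} {Γ J P : H →L[ℂ] H} {L : H →ₗ[ℂ] (L2 m →L[ℂ] H)}

theorem scalar_conj (h : IsFrame hθ n S R Q Γ J P L) (x y : H) :
    conj (S.form x (J y)) = S.form y (J x) := h.adapted.symm.hermitian x y

theorem scalar_lift (h : IsFrame hθ n S R Q Γ J P L) {x y : H} (hx : x ∈ vacuumSpace Q P)
    (hy : y ∈ vacuumSpace Q P) (f : L2 m) (ψ : ModelSpace m r s) :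
    S.form (L x f) (J (modelMap θ Q L y ψ)) = inner ℂ f (ψ (∅, ∅)) * S.form x (J y) := by
  have h1 : ((S.form.compl₂ J.toLinearMap) (L x f)) ∘ₗ (modelMap θ Q L y).toLinearMap =
      S.form x (J y) • (innerSL ℂ f).toLinearMap ∘ₗ LinearMap.proj (∅, ∅) := by
    refine LinearMap.pi_ext fun N g => ?_
    change S.form (L x f) (J (modelMap θ Q L y (Pi.single N g))) =
      S.form x (J y) * inner ℂ f ((Pi.single N g : ModelSpace m r s) (∅, ∅))
    induction N using Monomial.induction_ins with
    | h0 =>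
      rw [modelMap_single, oddMonomial_empty, h.symm_lift, h.form_lift, h.proj_symm,
        (mem_vacuumSpace.1 hx).1, (mem_vacuumSpace.1 hy).1, Pi.single_eq_same, mul_comm]
    | h1 N j hj ih =>
      have hN : ((∅, ∅) : Monomial r s) ≠ N.ins j := fun e => by
        have h2 := N.has_ins_self j
        rw [← e] at h2
        rcases j with j | j <;> simp [Monomial.Has] at h2
      rw [modelMap_single, h.oddMonomial_ins hj, Pi.single_eq_of_ne hN, inner_zero_right, mul_zero,
        map_smul, map_smul, ← h.scalar_conj, h.scalar_creation, h.annihilation_lift hx, map_zero,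
        map_zero, mul_zero, map_zero, smul_zero]
  rw [mul_comm]
  exact DFunLike.congr_fun h1 ψ

theorem scalar_modelMap_single (h : IsFrame hθ n S R Q Γ J P L) {x y : H}
    (hx : x ∈ vacuumSpace Q P) (hy : y ∈ vacuumSpace Q P) (M : Monomial r s) (f : L2 m)
    (ψ : ModelSpace m r s) : S.form (modelMap θ Q L x (Pi.single M f)) (J (modelMap θ Q L y ψ)) =
      M.weight θ * (inner ℂ f (ψ M) * S.form x (J y)) := by
  induction M using Monomial.induction_ins generalizing ψ with
  | h0 =>
    rw [modelMap_single, oddMonomial_empty, h.scalar_lift hx hy]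
    simp [Monomial.weight]
  | h1 M j hj ih =>
    rw [modelMap_single, h.oddMonomial_ins hj, ← modelMap_single, LinearMap.map_smulₛₗ,
      LinearMap.smul_apply, h.scalar_creation, ← h.modelMap_der hy, ih, M.conj_sgn,
      fockDer_apply, if_neg hj, inner_smul_right, Monomial.weight_ins θ hj, smul_eq_mul]
    push_cast
    linear_combination (modeWeight θ j * M.weight θ * inner ℂ f (ψ (M.ins j)) * S.form x (J y)) *
      M.sgn_mul_self j

theorem scalar_modelMap (h : IsFrame hθ n S R Q Γ J P L) {x y : H}
    (hx : x ∈ vacuumSpace Q P) (hy : y ∈ vacuumSpace Q P) (φ ψ : ModelSpace m r s) :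
    S.form (modelMap θ Q L x φ) (J (modelMap θ Q L y ψ)) =
      (∑ M : Monomial r s, M.weight θ * inner ℂ (φ M) (ψ M)) * S.form x (J y) := by
  conv_lhs => rw [← Finset.univ_sum_single φ]
  rw [map_sum, map_sum, LinearMap.sum_apply, Finset.sum_mul]
  exact Finset.sum_congr rfl fun M _ => by rw [h.scalar_modelMap_single hx hy, mul_assoc]

end IsFrame

/-- The monomial of top degree in `ξ`, dual to the empty monomial. -/
def Monomial.top (r s : ℕ) : Monomial r s := (Finset.univ, ∅)

theorem Monomial.dual_empty (r s : ℕ) : Monomial.dual ((∅, ∅) : Monomial r s) = Monomial.top r s := by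
  simp [Monomial.dual, Monomial.top]

theorem Monomial.dual_top (r s : ℕ) : (Monomial.top r s).dual = (∅, ∅) := by
  simp [Monomial.dual, Monomial.top]

theorem Monomial.degree_top (r s : ℕ) : (Monomial.top r s).degree = r := by
  simp [Monomial.degree, Monomial.top]

theorem Monomial.degree_empty (r s : ℕ) : Monomial.degree ((∅, ∅) : Monomial r s) = 0 := by
  simp [Monomial.degree]

/-- The coefficient of the pairing of two copies of the model in terms of their vacuum vectors, the
first of which has degree `d`. -/
noncomputable def vacuumCoeff {r s : ℕ} {H : Type*} [NormedAddCommGroup H] [NormedSpace ℂ H]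
    (θ : ℝ) (S : SuperspaceData H)
    (Q : (OddIndex r s → ℂ) →ₗ[ℂ] (H →L[ℂ] H)) (d : ZMod 2) (x y : H) : ℂ :=
  (-1) ^ ((r : ZMod 2).val * d.val) * S.form x (oddMonomial θ Q (Monomial.top r s) y) /
    berezinCoeff θ ((∅, ∅) : Monomial r s)

namespace IsFrame

variable {m r s : ℕ} {H : Type u} [NormedAddCommGroup H] [NormedSpace ℂ H]
  {θ : ℝ} {hθ : θ ≠ 0} {n : ZMod 2} {S : SuperspaceData H} {R : HeisRep m r s H}
  {Q : (OddIndex r s → ℂ) →ₗ[ℂ] (H →L[ℂ] H)} {Γ J P : H →L[ℂ] H} {L : H →ₗ[ℂ] (L2 m →L[ℂ] H)}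

theorem form_modelMap (h : IsFrame hθ n S R Q Γ J P L) {d : ZMod 2} {x y : H}
    (hx : x ∈ vacuumSpace Q P) (hxd : x ∈ S.comp d) (hy : y ∈ vacuumSpace Q P)
    (φ ψ : ModelSpace m r s) : S.form (modelMap θ Q L x φ) (modelMap θ Q L y ψ) =
      vacuumCoeff θ S Q d x y * modelForm m r s θ φ ((fockGrading ^ d.val) ψ) := by
  set c := vacuumCoeff θ S Q d x y with hc
  have hθ' : (θ : ℂ) ≠ 0 := by exact_mod_cast hθ
  have hΓ : ∀ φ z, S.form (Γ (modelMap θ Q L x φ)) z =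
      (-1 : ℂ) ^ d.val * S.form (modelMap θ Q L x (fockGrading φ)) z := fun φ z => by
    rw [h.grading_modelMap hxd, LinearMap.map_smulₛₗ, LinearMap.smul_apply, map_pow, map_neg,
      map_one, smul_eq_mul]
  let F : ModelSpace m r s →ₗ⋆[ℂ] ModelSpace m r s →ₗ[ℂ] ℂ :=
    (S.form.comp (modelMap θ Q L x).toLinearMap).compl₂ (modelMap θ Q L y).toLinearMap -
      c • (modelForm m r s θ).compl₂ (fockGrading ^ d.val)
  have hF : ∀ φ ψ, F φ ψ = S.form (modelMap θ Q L x φ) (modelMap θ Q L y ψ) -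
    c * modelForm m r s θ φ ((fockGrading ^ d.val) ψ) := fun φ ψ => rfl
  have hF0 : F = 0 := by
    refine form_eq_zero_of_invariant F (Sum.elim (fun j => fockMul (.inl j)) fun k => fockDer (.inr k))
      (Sum.elim (fun j => fockDer (.inl j)) fun k => fockMul (.inr k)) ?_ ?_ (fun _ => rfl)
      (fun _ => rfl) fun f g => ?_
    · rintro (j | k)
      · refine ⟨(-1) ^ d.val, fun φ ψ => ?_⟩
        simp only [hF, Sum.elim_inl, h.modelMap_mul, h.form_creation_inl, hΓ, modelForm_mul_inl,
          fockGrading_pow_mul, map_smul, smul_eq_mul]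
        linear_combination (-c * modelForm m r s θ (fockGrading φ)
          (fockMul (.inl j) ((fockGrading ^ d.val) ψ))) * -neg_one_pow_mul_self d.val
      · refine ⟨(-1) ^ d.val * (θ * Complex.I), fun φ ψ => ?_⟩
        simp only [hF, Sum.elim_inr, h.modelMap_mul, h.modelMap_der hy, h.form_creation_inr, hΓ,
          modelForm_mul_inr hθ, fockGrading_pow_der, map_smul, smul_eq_mul]
        linear_combination (-c * (θ * Complex.I) * modelForm m r s θ (fockGrading φ)
          (fockDer (.inr k) ((fockGrading ^ d.val) ψ))) * -neg_one_pow_mul_self d.val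
    · rintro (j | k)
      · refine ⟨(-1) ^ d.val * -1, by simp, fun φ ψ => ?_⟩
        simp only [hF, Sum.elim_inl, h.modelMap_der hx, h.modelMap_der hy, h.form_annihilation_inl,
          hΓ, modelForm_der_inl, fockGrading_pow_der, map_smul, smul_eq_mul]
        linear_combination (c * modelForm m r s θ (fockGrading φ)
          (fockDer (.inl j) ((fockGrading ^ d.val) ψ))) * -neg_one_pow_mul_self d.val
      · refine ⟨(-1) ^ d.val * (Complex.I / θ), by simp [hθ], fun φ ψ => ?_⟩
        simp only [hF, Sum.elim_inr, h.modelMap_mul, h.modelMap_der hx, h.form_annihilation_inr,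
          hΓ, modelForm_der_inr, fockGrading_pow_mul, map_smul, smul_eq_mul]
        linear_combination (-c * (Complex.I / θ) * modelForm m r s θ (fockGrading φ)
          (fockMul (.inr k) ((fockGrading ^ d.val) ψ))) * -neg_one_pow_mul_self d.val
    · change F (Pi.single (∅, ∅) f) (Pi.single (Monomial.top r s) g) = 0
      rw [hF, modelMap_single, modelMap_single, oddMonomial_empty, fockGrading_pow_single, map_smul,
        modelForm_single, if_pos (Monomial.dual_empty r s).symm, h.oddMonomial_lift, h.form_lift,
        oddMonomial_comm h.proj_odd, (mem_vacuumSpace.1 hx).1, (mem_vacuumSpace.1 hy).1,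
        Monomial.degree_top, smul_eq_mul, hc, vacuumCoeff]
      have hb := berezinCoeff_ne_zero hθ ((∅, ∅) : Monomial r s)
      have e := neg_one_pow_mul_self ((r : ZMod 2).val * d.val)
      field_simp
      linear_combination (-inner ℂ f g * S.form x (oddMonomial θ Q (Monomial.top r s) y)) * e
  have h1 := DFunLike.congr_fun (DFunLike.congr_fun hF0 φ) ψ
  rw [hF] at h1
  exact sub_eq_zero.1 h1

theorem modelForm_top (r s : ℕ) (hθ : θ ≠ 0) :
    modelForm m r s θ (Pi.single (∅, ∅) (vacuum m hθ)) (Pi.single (Monomial.top r s) (vacuum m hθ)) =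
      berezinCoeff θ ((∅, ∅) : Monomial r s) := by
  rw [modelForm_single, if_pos (Monomial.dual_empty r s).symm, inner_self_eq_norm_sq_to_K,
    norm_vacuum]
  simp

/-- The coefficients are superhermitian. -/
theorem conj_vacuumCoeff (h : IsFrame hθ n S R Q Γ J P L) {d d' : ZMod 2} {x y : H}
    (hx : x ∈ vacuumSpace Q P) (hxd : x ∈ S.comp d) (hy : y ∈ vacuumSpace Q P)
    (hyd : y ∈ S.comp d') : conj (vacuumCoeff θ S Q d x y) =
      (-1) ^ (d.val * d'.val) * vacuumCoeff θ S Q d' y x := by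
  set φ : ModelSpace m r s := Pi.single (∅, ∅) (vacuum m hθ)
  set ψ : ModelSpace m r s := Pi.single (Monomial.top r s) (vacuum m hθ)
  have hb := berezinCoeff_ne_zero hθ ((∅, ∅) : Monomial r s)
  have h1 := h.form_modelMap hx hxd hy φ ψ
  have h2 := h.form_modelMap hy hyd hx ψ φ
  have h3 : modelForm m r s θ ψ φ = conj (berezinCoeff θ ((∅, ∅) : Monomial r s)) := by
    rw [conj_berezinCoeff, Monomial.degree_empty, ZMod.val_zero, zero_mul, pow_zero, one_mul,
      Monomial.dual_empty, modelForm_single, if_pos (Monomial.dual_top r s).symm,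
      inner_self_eq_norm_sq_to_K, norm_vacuum]
    simp
  have h4 := h.rep.hilbert.superhermitian _ _ _ (h.modelMap_single_mem hxd (∅, ∅) (vacuum m hθ)) _
    (h.modelMap_single_mem hyd (Monomial.top r s) (vacuum m hθ))
  rw [fockGrading_pow_single, map_smul, modelForm_top, Monomial.degree_top, smul_eq_mul] at h1
  rw [fockGrading_pow_single, map_smul, h3, Monomial.degree_empty, ZMod.val_zero, zero_mul, pow_zero,
    one_smul] at h2
  rw [h1, h2, map_mul, map_mul, map_pow, map_neg, map_one, Monomial.degree_empty, zero_add,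
    Monomial.degree_top, mul_comm d.val, pow_mul _ ((r : ZMod 2) + d').val,
    neg_one_pow_val_add, mul_pow, ← pow_mul, ← pow_mul] at h4
  have e := neg_one_pow_mul_self ((r : ZMod 2).val * d.val)
  have hb' : conj (berezinCoeff θ ((∅, ∅) : Monomial r s)) ≠ 0 := by simpa using hb
  refine mul_right_cancel₀ hb' ?_
  rw [mul_comm d.val]
  linear_combination ((-1) ^ ((r : ZMod 2).val * d.val)) * h4 +
    (((-1) ^ (d'.val * d.val)) * vacuumCoeff θ S Q d' y x *
      conj (berezinCoeff θ ((∅, ∅) : Monomial r s)) - conj (vacuumCoeff θ S Q d x y) *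
      conj (berezinCoeff θ ((∅, ∅) : Monomial r s))) * e

end IsFrame

/-- The operator on the vacuum vectors that relates the inner product to the adapted scalar product. -/
noncomputable def vacuumSymm {r s : ℕ} {H : Type*} [NormedAddCommGroup H] [NormedSpace ℂ H]
    (θ : ℝ) (Q : (OddIndex r s → ℂ) →ₗ[ℂ] (H →L[ℂ] H)) (J : H →L[ℂ] H) : H →L[ℂ] H :=
  J ∘L J ∘L J ∘L oddMonomial θ Q (Monomial.top r s)

/-- The normalization of `vacuumCoeff` in degree `d`. -/
noncomputable def vacuumConst (r s : ℕ) (θ : ℝ) (d : ZMod 2) : ℂ :=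
  (-1) ^ ((r : ZMod 2).val * d.val) / berezinCoeff θ ((∅, ∅) : Monomial r s)

theorem vacuumConst_ne_zero {r s : ℕ} {θ : ℝ} (hθ : θ ≠ 0) (d : ZMod 2) :
    vacuumConst r s θ d ≠ 0 := by
  have := berezinCoeff_ne_zero hθ ((∅, ∅) : Monomial r s)
  simp [vacuumConst, this]

theorem norm_vacuumConst (r s : ℕ) (θ : ℝ) (d : ZMod 2) :
    ‖vacuumConst r s θ d‖ = ‖berezinCoeff θ ((∅, ∅) : Monomial r s)‖⁻¹ := by
  simp [vacuumConst]

namespace IsFrame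

variable {m r s : ℕ} {H : Type u} [NormedAddCommGroup H] [NormedSpace ℂ H]
  {θ : ℝ} {hθ : θ ≠ 0} {n : ZMod 2} {S : SuperspaceData H} {R : HeisRep m r s H}
  {Q : (OddIndex r s → ℂ) →ₗ[ℂ] (H →L[ℂ] H)} {Γ J P : H →L[ℂ] H} {L : H →ₗ[ℂ] (L2 m →L[ℂ] H)}

theorem vacuumCoeff_eq (h : IsFrame hθ n S R Q Γ J P L) (d : ZMod 2) (x y : H) :
    vacuumCoeff θ S Q d x y = vacuumConst r s θ d * S.form x (J (vacuumSymm θ Q J y)) := by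
  have h1 : J (vacuumSymm θ Q J y) = oddMonomial θ Q (Monomial.top r s) y :=
    h.adapted.symm.pow_four h.rep.hilbert _
  rw [h1, vacuumCoeff, vacuumConst]
  ring

theorem vacuumSymm_mem_comp (h : IsFrame hθ n S R Q Γ J P L) {d : ZMod 2} {x : H}
    (hx : x ∈ S.comp d) : vacuumSymm θ Q J x ∈ S.comp (d + (r + n)) := by
  have h1 := h.adapted.symm.degree _ _ (h.adapted.symm.degree _ _ (h.adapted.symm.degree _ _
    (h.oddMonomial_mem (Monomial.top r s) hx)))
  rw [Monomial.degree_top] at h1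
  have e : (r : ZMod 2) + d + n + n + n = d + (r + n) := by
    linear_combination CharTwo.add_self_eq_zero n
  rw [e] at h1
  exact h1

theorem creation_oddMonomial (h : IsFrame hθ n S R Q Γ J P L) {M : Monomial r s} {j} (hj : M.Has j)
    (x : H) : Q (creationVector θ j) (oddMonomial θ Q M x) = 0 := by
  have h1 := DFunLike.congr_fun (h.isCAR.mul_monomialProd j M) x
  rw [if_pos hj] at h1
  exact h1

theorem annihilation_oddMonomial (h : IsFrame hθ n S R Q Γ J P L) {M : Monomial r s} {j}
    (hj : ¬ M.Has j) {x : H} (hx : Q (annihilationVector j) x = 0) :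
    Q (annihilationVector j) (oddMonomial θ Q M x) = 0 := by
  have h1 := DFunLike.congr_fun (h.isCAR.annihilate_mul_monomialProd j M) x
  rw [if_neg hj, add_zero] at h1
  have h2 : Q (annihilationVector j) (oddMonomial θ Q M x) = (-1 : ℂ) ^ (M.1.card + M.2.card) •
    oddMonomial θ Q M (Q (annihilationVector j) x) := h1
  rw [h2, hx, map_zero, smul_zero]

theorem vacuumSymm_mem (h : IsFrame hθ n S R Q Γ J P L) {x : H} (hx : x ∈ vacuumSpace Q P) :
    vacuumSymm θ Q J x ∈ vacuumSpace Q P := by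
  rw [mem_vacuumSpace] at hx ⊢
  refine ⟨?_, ?_⟩
  · change P (J (J (J (oddMonomial θ Q _ x)))) = J (J (J (oddMonomial θ Q _ x)))
    rw [h.proj_symm, h.proj_symm, h.proj_symm, oddMonomial_comm h.proj_odd, hx.1]
  · rintro (j | k)
    · exact h.annihilation_inl_symm (h.creation_inl_symm (h.annihilation_inl_symm
        (h.creation_oddMonomial (by simp [Monomial.Has, Monomial.top]) x)))
    · exact h.annihilation_inr_symm (h.annihilation_inr_symm (h.annihilation_inr_symm
        (h.annihilation_oddMonomial (by simp [Monomial.Has, Monomial.top]) (hx.2 _))))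

theorem scalar_vacuumSymm (h : IsFrame hθ n S R Q Γ J P L) {x y : H} (hx : x ∈ vacuumSpace Q P)
    (hy : y ∈ vacuumSpace Q P) : S.form (vacuumSymm θ Q J x) (J (vacuumSymm θ Q J y)) =
      (Monomial.top r s).weight θ * S.form x (J y) := by
  have h1 := h.scalar_modelMap_single hx hy (Monomial.top r s) (vacuum m hθ)
    (Pi.single (Monomial.top r s) (vacuum m hθ))
  have h2 : ∀ z, z ∈ vacuumSpace Q P → modelMap θ Q L z (Pi.single (Monomial.top r s) (vacuum m hθ)) =
      oddMonomial θ Q (Monomial.top r s) z := fun z hz => by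
    rw [modelMap_single, h.lift_vacuum, (mem_vacuumSpace.1 hz).1]
  rw [h2 x hx, h2 y hy, Pi.single_eq_same, inner_self_eq_norm_sq_to_K, norm_vacuum] at h1
  change S.form (J (J (J (oddMonomial θ Q _ x)))) (J (J (J (J (oddMonomial θ Q _ y))))) = _
  rw [h.form_symm_symm, h.form_symm_symm, h.form_symm_symm, h1]
  simp

theorem eq_of_scalar (h : IsFrame hθ n S R Q Γ J P L) {E : Submodule ℂ H} {x y : H} (hx : x ∈ E)
    (hy : y ∈ E) (hxy : ∀ z ∈ E, S.form x (J z) = S.form y (J z)) : x = y := by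
  refine sub_eq_zero.1 (h.isScalarProduct.eq_zero (x := x - y) ?_)
  change S.form (x - y) (J (x - y)) = 0
  have h1 := hxy (x - y) (E.sub_mem hx hy)
  rw [map_sub S.form, LinearMap.sub_apply, h1, sub_self]

theorem exists_vacuumSymm_sq (h : IsFrame hθ n S R Q Γ J P L) (d : ZMod 2) :
    ∃ τ : ℂ, τ ≠ 0 ∧ ‖τ‖ = (Monomial.top r s).weight θ ∧ ∀ x ∈ vacuumSpace Q P ⊓ S.comp d,
      vacuumSymm θ Q J (vacuumSymm θ Q J x) = τ • x := by
  set T := vacuumSymm θ Q J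
  set e := d + (r + n)
  have hw := Monomial.weight_pos hθ (Monomial.top r s)
  have hK := fun d => vacuumConst_ne_zero (r := r) (s := s) hθ d
  set τ : ℂ := (-1) ^ (d.val * e.val) * vacuumConst r s θ e * (Monomial.top r s).weight θ /
    conj (vacuumConst r s θ d) with hτ
  have hτn : ‖τ‖ = (Monomial.top r s).weight θ := by
    rw [hτ, norm_div, norm_mul, norm_mul, RCLike.norm_conj, norm_vacuumConst, norm_vacuumConst,
      Complex.norm_real, Real.norm_of_nonneg hw.le]
    have := norm_ne_zero_iff.2 (berezinCoeff_ne_zero hθ ((∅, ∅) : Monomial r s))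
    simp only [norm_pow, norm_neg, norm_one, one_pow]
    field_simp
  have hτ0 : τ ≠ 0 := norm_ne_zero_iff.1 (hτn ▸ hw.ne')
  refine ⟨conj τ, by simpa using hτ0, by rw [RCLike.norm_conj, hτn], fun x hx => ?_⟩
  have hT : ∀ y ∈ vacuumSpace Q P ⊓ S.comp d, T (T y) ∈ vacuumSpace Q P ⊓ S.comp d :=
    fun y hy => ⟨h.vacuumSymm_mem (h.vacuumSymm_mem hy.1), by
      have h1 := h.vacuumSymm_mem_comp (h.vacuumSymm_mem_comp hy.2)
      have e1 : d + (r + n) + (r + n) = d := by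
        linear_combination CharTwo.add_self_eq_zero ((r : ZMod 2) + n)
      rwa [e1] at h1⟩
  refine h.eq_of_scalar (hT x hx) (Submodule.smul_mem _ _ hx) fun z hz => ?_
  have h1 := h.conj_vacuumCoeff hz.1 hz.2 (h.vacuumSymm_mem hx.1) (h.vacuumSymm_mem_comp hx.2)
  rw [h.vacuumCoeff_eq, h.vacuumCoeff_eq, h.scalar_vacuumSymm hx.1 hz.1, map_mul, h.scalar_conj] at h1
  have hKd : conj (vacuumConst r s θ d) ≠ 0 := by simpa using hK d
  rw [LinearMap.map_smulₛₗ, LinearMap.smul_apply, Complex.conj_conj, smul_eq_mul, hτ]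
  field_simp
  linear_combination h1

/-- A family of orthogonal copies of a representation that contains the vacuum vectors. -/
theorem isOrthogonalSum (h : IsFrame hθ n S R Q Γ J P L) {K : Type*} [NormedAddCommGroup K]
    [NormedSpace ℂ K] [CompleteSpace K] [CompleteSpace H] {S₀ : SuperspaceData K} {R₀ : HeisRep m r s K}
    {ι : Type u} (d : ι → ZMod 2) (ε : ι → ℤˣ) (V : ι → K →L[ℂ] H)
    (hV : ∀ i, IsIsometryUpTo S₀ S (d i) (ε i) (V i)) (hV' : ∀ i, Intertwines R₀ R (V i))
    (ho : ∀ i j, i ≠ j → ∀ x y, S.form (V i x) (V j y) = 0)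
    (ho' : ∀ i j, i ≠ j → ∀ x y, S.form (V i x) (J (V j y)) = 0)
    (hb : ∃ c C : ℝ, 0 < c ∧ ∀ i x, c * ‖x‖ ≤ ‖V i x‖ ∧ ‖V i x‖ ≤ C * ‖x‖)
    (ha : ∀ i j x, ∃ y, Q (creationVector θ j) (V i x) = V i y)
    (hd : vacuumSpace Q P ≤
      (⨆ i, LinearMap.range (V i : K →ₗ[ℂ] H)).topologicalClosure) :
    IsOrthogonalSumOfCopies S₀ R₀ n S R := by
  set Y := (⨆ i, LinearMap.range (V i : K →ₗ[ℂ] H)).topologicalClosure with hY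
  have hYc : IsClosed (Y : Set H) := Submodule.isClosed_topologicalClosure _
  have hstab : ∀ T : H →L[ℂ] H, (∀ i x, ∃ y, T (V i x) = V i y) → ∀ x ∈ Y, T x ∈ Y := fun T hT => by
    have h1 : Y ≤ Y.comap T.toLinearMap := by
      refine Submodule.topologicalClosure_minimal _ (iSup_le fun i => ?_) (hYc.preimage T.continuous)
      rintro _ ⟨x, rfl⟩
      obtain ⟨y, hy⟩ := hT i x
      change T (V i x) ∈ Y
      rw [hy]
      exact Submodule.le_topologicalClosure _ (Submodule.mem_iSup_of_mem i ⟨y, rfl⟩)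
    exact h1
  have htop : Y = ⊤ := by
    refine h.eq_top Y hYc (fun g => hstab _ fun i x => ⟨_, ((hV' i).1 g x).symm⟩) fun x => ?_
    refine h.isCAR_end.le_of_vacuum_le (E := LinearMap.ker (P - 1).toLinearMap) (Y := Y)
      (fun j x hx => ?_) (fun j x hx => ?_) (fun j => hstab _ fun i x => ha i j x)
      (fun x hx hb => hd (mem_vacuumSpace.2 ⟨?_, hb⟩)) ?_
    · simp only [LinearMap.mem_ker, ContinuousLinearMap.coe_coe, sub_apply, sub_eq_zero] at hx ⊢
      rw [h.proj_odd, hx]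
      simp
    · simp only [LinearMap.mem_ker, ContinuousLinearMap.coe_coe, sub_apply, sub_eq_zero] at hx ⊢
      rw [h.proj_odd, hx]
      simp
    · simpa [sub_eq_zero] using hx
    · simp [h.proj_proj]
  obtain ⟨c, C, hc, hcC⟩ := hb
  refine ⟨ι, d, ε, V, J.toLinearMap, hV, hV', ho, h.adapted.symm, fun i x => ?_, ⟨c, C, hc, hcC⟩, htop⟩
  obtain ⟨y, hy⟩ := h.isScalarProduct.mem_of_orthogonal (E := fun i => LinearMap.range (V i).toLinearMap)
    (fun i => isClosed_range_of_bound (V i) hc fun x => (hcC i x).1)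
    (by
      rintro i j hij _ ⟨x, rfl⟩ _ ⟨y, rfl⟩
      exact ho' i j hij x y) htop (i := i) (x := J (V i x)) (by
      rintro j hij _ ⟨y, rfl⟩
      change S.form (V j y) (J (J (V i x))) = 0
      have e : S.form (J (V i x)) (J (V j y)) = S.form (V i x) (V j y) :=
        h.adapted.symm.isometric (V i x) (V j y)
      rw [← h.scalar_conj, e, ho i j hij.symm, map_zero])
  exact ⟨y, hy.symm⟩

end IsFrame

theorem exists_sign {d : ZMod 2} {z : ℂ} (hz : conj z = (-1) ^ (d.val * d.val) * z) (hn : ‖z‖ = 1) :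
    ∃ ε : ℤˣ, z = ((ε : ℤ) : ℂ) * Complex.I ^ d.val := by
  have key : ∀ y : ℂ, conj y = y → ‖y‖ = 1 → ∃ ε : ℤˣ, y = ((ε : ℤ) : ℂ) := fun y hy hn => by
    obtain ⟨t, rfl⟩ := Complex.conj_eq_iff_real.1 hy
    rw [Complex.norm_real, Real.norm_eq_abs] at hn
    rcases eq_or_eq_neg_of_abs_eq hn with rfl | rfl
    · exact ⟨1, by simp⟩
    · exact ⟨-1, by simp⟩
  obtain rfl | rfl := ZMod.eq_zero_or_eq_one d
  · obtain ⟨ε, h⟩ := key z (by simpa using hz) hn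
    exact ⟨ε, by simpa using h⟩
  · obtain ⟨ε, h⟩ := key (-Complex.I * z) (by
      simp only [ZMod.val_one, mul_one, pow_one] at hz
      rw [map_mul, hz, map_neg, Complex.conj_I]
      ring) (by simpa using hn)
    refine ⟨ε, ?_⟩
    rw [ZMod.val_one, pow_one, ← h]
    linear_combination z * Complex.I_mul_I

section Model

variable {m r s : ℕ} {θ : ℝ}

theorem fockGrading_pow_of_mem (k : ℕ) {a : ZMod 2} {φ : ModelSpace m r s}
    (hφ : φ ∈ modelComp m r s a) : (fockGrading ^ k) φ = (-1 : ℂ) ^ (a.val * k) • φ := by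
  induction k with
  | zero => simp
  | succ k ih =>
    rw [pow_succ', Module.End.mul_apply, ih, map_smul, fockGrading_of_mem hφ, smul_smul, ← pow_add]
    rfl

theorem sum_weight_re (φ : ModelSpace m r s) :
    (∑ M : Monomial r s, (M.weight θ : ℂ) * inner ℂ (φ M) (φ M)) =
      ((∑ M : Monomial r s, M.weight θ * ‖φ M‖ ^ 2 : ℝ) : ℂ) := by
  push_cast
  refine Finset.sum_congr rfl fun M _ => ?_
  rw [inner_self_eq_norm_sq_to_K]
  rfl

theorem exists_weight_bounds (hθ : θ ≠ 0) : ∃ a b : ℝ, 0 < a ∧ 0 < b ∧ ∀ φ : ModelSpace m r s,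
    a * ‖φ‖ ^ 2 ≤ ∑ M, M.weight θ * ‖φ M‖ ^ 2 ∧ ∑ M, M.weight θ * ‖φ M‖ ^ 2 ≤ b * ‖φ‖ ^ 2 := by
  obtain ⟨M₀, _, hM₀⟩ := Finset.exists_min_image (Finset.univ : Finset (Monomial r s))
    (fun M => M.weight θ) ⟨(∅, ∅), Finset.mem_univ _⟩
  refine ⟨M₀.weight θ, ∑ M : Monomial r s, M.weight θ, M₀.weight_pos hθ,
    Finset.sum_pos (fun M _ => M.weight_pos hθ) ⟨(∅, ∅), Finset.mem_univ _⟩, fun φ => ⟨?_, ?_⟩⟩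
  · have h1 : ‖φ‖ ≤ Real.sqrt (∑ M, ‖φ M‖ ^ 2) := (pi_norm_le_iff_of_nonneg (Real.sqrt_nonneg _)).2
      fun M => Real.le_sqrt_of_sq_le
        (Finset.single_le_sum (f := fun M => ‖φ M‖ ^ 2) (fun M _ => sq_nonneg _) (Finset.mem_univ M))
    have h2 : ‖φ‖ ^ 2 ≤ ∑ M, ‖φ M‖ ^ 2 := by
      refine (pow_le_pow_left₀ (norm_nonneg _) h1 2).trans (Real.sq_sqrt ?_).le
      exact Finset.sum_nonneg fun M _ => sq_nonneg _
    refine (mul_le_mul_of_nonneg_left h2 (M₀.weight_pos hθ).le).trans ?_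
    rw [Finset.mul_sum]
    exact Finset.sum_le_sum fun M _ => mul_le_mul_of_nonneg_right (hM₀ M (Finset.mem_univ M))
      (sq_nonneg _)
  · rw [Finset.sum_mul]
    exact Finset.sum_le_sum fun M _ => mul_le_mul_of_nonneg_left
      (pow_le_pow_left₀ (norm_nonneg _) (norm_le_pi_norm φ M) 2) (M.weight_pos hθ).le

end Model

namespace IsFrame

variable {m r s : ℕ} {H : Type u} [NormedAddCommGroup H] [NormedSpace ℂ H]
  {θ : ℝ} {hθ : θ ≠ 0} {n : ZMod 2} {S : SuperspaceData H} {R : HeisRep m r s H}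
  {Q : (OddIndex r s → ℂ) →ₗ[ℂ] (H →L[ℂ] H)} {Γ J P : H →L[ℂ] H} {L : H →ₗ[ℂ] (L2 m →L[ℂ] H)}

theorem exists_norm_bounds (h : IsFrame hθ n S R Q Γ J P L) {a b : ℝ} (ha : 0 < a) (hb : 0 < b) :
    ∃ c C : ℝ, 0 < c ∧ ∀ (t : ℝ) (z : H), 0 ≤ t → a * t ^ 2 ≤ (S.form z (J z)).re →
      (S.form z (J z)).re ≤ b * t ^ 2 → c * t ≤ ‖z‖ ∧ ‖z‖ ≤ C * t := by
  obtain ⟨c, C, hc, hcC⟩ := h.adapted.symm.equivalent_norm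
  have hC : ∀ z, (S.form z (J z)).re ≤ |C| * ‖z‖ ^ 2 + ‖z‖ ^ 2 := fun z => by
    have h1 := (hcC z).2
    have h2 := mul_le_mul_of_nonneg_right (le_abs_self C) (sq_nonneg ‖z‖)
    have h3 := sq_nonneg ‖z‖
    simp only [ContinuousLinearMap.coe_coe] at h1
    linarith
  refine ⟨Real.sqrt (a / (|C| + 1)), Real.sqrt (b / c), by positivity, fun t z ht h1 h2 => ⟨?_, ?_⟩⟩
  · refine (pow_le_pow_iff_left₀ (by positivity) (norm_nonneg z) two_ne_zero).1 ?_
    rw [mul_pow, Real.sq_sqrt (by positivity), div_mul_eq_mul_div, div_le_iff₀ (by positivity)]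
    linarith [hC z]
  · refine (pow_le_pow_iff_left₀ (norm_nonneg z) (by positivity) two_ne_zero).1 ?_
    rw [mul_pow, Real.sq_sqrt (by positivity), div_mul_eq_mul_div, le_div_iff₀ hc]
    have h3 := (hcC z).1
    simp only [ContinuousLinearMap.coe_coe] at h3
    linarith

theorem isIsometry (h : IsFrame hθ n S R Q Γ J P L) {d : ZMod 2} {x : H}
    (hx : x ∈ vacuumSpace Q P ⊓ S.comp d) {ε : ℤˣ}
    (hε : vacuumCoeff θ S Q d x x = ((ε : ℤ) : ℂ) * Complex.I ^ d.val) :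
    IsIsometryUpTo (modelSuperspace m r s θ) S d ε (modelMap θ Q L x) := by
  refine ⟨fun a φ hφ => h.modelMap_mem hx.2 hφ, fun b φ ψ hψ => ?_⟩
  rw [h.form_modelMap hx.1 hx.2 hx.1, hε, fockGrading_pow_of_mem _ hψ, map_smul, mul_comm d.val,
    smul_eq_mul, ← mul_assoc]
  rfl

theorem modelMap_vacuum (h : IsFrame hθ n S R Q Γ J P L) {x : H} (hx : x ∈ vacuumSpace Q P) :
    modelMap θ Q L x (Pi.single (∅, ∅) (vacuum m hθ)) = x := by
  rw [modelMap_single, oddMonomial_empty, h.lift_vacuum, (mem_vacuumSpace.1 hx).1]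

theorem exists_vacuum_add (h : IsFrame hθ n S R Q Γ J P L) {x : H} (hx : x ∈ vacuumSpace Q P) :
    ∃ y ∈ vacuumSpace Q P ⊓ S.comp 0, ∃ z ∈ vacuumSpace Q P ⊓ S.comp 1, y + z = x := by
  obtain ⟨y, hy, z, hz, rfl⟩ := h.rep.hilbert.exists_add x
  have hΓ : Γ (y + z) ∈ vacuumSpace Q P := by
    rw [mem_vacuumSpace] at hx ⊢
    have hPΓ : P ∘L Γ = Γ ∘L P := SuperspaceData.IsGrading.ext h.rep.hilbert fun a x hx => by
      rw [ContinuousLinearMap.comp_apply, ContinuousLinearMap.comp_apply, h.grading a x hx,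
        h.grading a _ (h.proj_mem a x hx), map_smul]
    refine ⟨(DFunLike.congr_fun hPΓ (y + z)).trans (congrArg Γ hx.1), fun j => ?_⟩
    have h1 := h.odd.grading_apply h.rep.hilbert h.grading (annihilationVector j) (y + z)
    rw [hx.2, map_zero] at h1
    exact neg_eq_zero.1 h1.symm
  rw [map_add, h.grading 0 y hy, h.grading 1 z hz, ZMod.val_zero, ZMod.val_one, pow_zero, pow_one,
    one_smul] at hΓ
  refine ⟨y, ⟨?_, hy⟩, z, ⟨?_, hz⟩, rfl⟩
  · have h1 := Submodule.smul_mem _ (1 / 2 : ℂ) (Submodule.add_mem _ hx hΓ)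
    have e : (1 / 2 : ℂ) • (y + z + (y + (-1 : ℂ) • z)) = y := by module
    rwa [e] at h1
  · have h1 := Submodule.smul_mem _ (1 / 2 : ℂ) (Submodule.sub_mem _ hx hΓ)
    have e : (1 / 2 : ℂ) • (y + z - (y + (-1 : ℂ) • z)) = z := by module
    rwa [e] at h1

/-- An orthonormal family of homogeneous eigenvectors of `vacuumSymm`. -/
theorem exists_eigenbasis [CompleteSpace H] (h : IsFrame hθ n S R Q Γ J P L) (hn : n = r) :
    ∃ (ι : Type u) (d : ι → ZMod 2) (x : ι → H) (w : ι → ℂ),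
      (∀ i, x i ∈ vacuumSpace Q P ⊓ S.comp (d i)) ∧
      (∀ i, vacuumSymm θ Q J (x i) = w i • x i) ∧
      (∀ i, ‖w i‖ ^ 2 = (Monomial.top r s).weight θ) ∧
      (∀ i, S.form (x i) (J (x i)) = 1) ∧
      (∀ i j, i ≠ j → S.form (x i) (J (x j)) = 0) ∧
      vacuumSpace Q P ≤ (Submodule.span ℂ (Set.range x)).topologicalClosure := by
  set T := vacuumSymm θ Q J
  choose τ hτ0 hτn hτ using h.exists_vacuumSymm_sq
  choose w hw using fun d => IsAlgClosed.exists_pow_nat_eq (τ d) (n := 2) (by norm_num)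
  have hwn : ∀ d, ‖w d‖ ^ 2 = (Monomial.top r s).weight θ := fun d => by
    rw [← norm_pow, hw, hτn]
  have hw0 : ∀ d, w d ≠ 0 := fun d h0 => hτ0 d (by rw [← hw, h0]; simp)
  let E : ZMod 2 × ℤˣ → Submodule ℂ H := fun p => vacuumSpace Q P ⊓ S.comp p.1 ⊓
    LinearMap.ker (T - (((p.2 : ℤ) : ℂ) * w p.1) • (1 : H →L[ℂ] H)).toLinearMap
  have hE : ∀ p x, x ∈ E p ↔ x ∈ vacuumSpace Q P ⊓ S.comp p.1 ∧
      T x = (((p.2 : ℤ) : ℂ) * w p.1) • x := fun p x => by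
    simp [E, sub_eq_zero]
  have hEc : ∀ p, IsClosed (E p : Set H) := fun p =>
    ((isClosed_vacuumSpace Q P).inter (h.rep.isClosed_comp p.1)).inter
      (ContinuousLinearMap.isClosed_ker _)
  choose ι b hb1 hb2 hb3 hb4 using fun p => h.isScalarProduct.exists_basis (hEc p)
  have hEd : ∀ p q, p ≠ q → ∀ x ∈ E p, ∀ y ∈ E q, S.form x (J y) = 0 := by
    rintro ⟨d, σ⟩ ⟨d', σ'⟩ hpq x hx y hy
    rw [hE] at hx hy
    by_cases hdd : d = d'
    · subst hdd
      have hσ : ((σ : ℤ) : ℂ) * ((σ' : ℤ) : ℂ) = -1 := by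
        have hne : σ ≠ σ' := fun e => hpq (by rw [e])
        rcases Int.units_eq_one_or σ with rfl | rfl <;> rcases Int.units_eq_one_or σ' with rfl | rfl
        · exact absurd rfl hne
        · simp
        · simp
        · exact absurd rfl hne
      have h1 := h.scalar_vacuumSymm hx.1.1 hy.1.1
      change S.form (T x) (J (T y)) = _ at h1
      rw [hx.2, hy.2, map_smul J, LinearMap.sesq_smul, ← hwn d] at h1
      have h2 : conj (w d) * w d = ((‖w d‖ ^ 2 : ℝ) : ℂ) := by
        rw [mul_comm, Complex.mul_conj, Complex.normSq_eq_norm_sq]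
      have h3 : conj ((σ : ℤ) : ℂ) = ((σ : ℤ) : ℂ) := by simp
      have h4 : ((‖w d‖ ^ 2 : ℝ) : ℂ) ≠ 0 := by
        simpa using hw0 d
      rw [map_mul (starRingEnd ℂ), h3] at h1
      refine mul_left_cancel₀ h4 ?_
      rw [mul_zero]
      linear_combination (-1 / 2 : ℂ) * h1 + (1 / 2 : ℂ) * conj (w d) * w d * S.form x (J y) * hσ -
        (1 / 2 : ℂ) * S.form x (J y) * h2
    · exact h.adapted.symm.orthogonal h.rep.hilbert hdd hx.1.2 hy.1.2
  refine ⟨Σ p, ι p, fun i => i.1.1, fun i => b i.1 i.2, fun i => ((i.1.2 : ℤ) : ℂ) * w i.1.1,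
    fun i => ((hE _ _).1 (hb1 i.1 i.2)).1, fun i => ((hE _ _).1 (hb1 i.1 i.2)).2, fun i => ?_,
    fun i => hb2 i.1 i.2, ?_, ?_⟩
  · rw [norm_mul, mul_pow, hwn]
    rcases Int.units_eq_one_or i.1.2 with e | e <;> rw [e] <;> simp
  · rintro ⟨p, i⟩ ⟨q, j⟩ hij
    by_cases hpq : p = q
    · subst hpq
      exact hb3 p i j fun e => hij (by rw [e])
    · exact hEd p q hpq _ (hb1 p i) _ (hb1 q j)
  · set Y := (Submodule.span ℂ (Set.range fun i : Σ p, ι p => b i.1 i.2)).topologicalClosure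
    have hEY : ∀ p, E p ≤ Y := fun p => (hb4 p).trans (Submodule.topologicalClosure_mono
      (Submodule.span_mono (by rintro _ ⟨i, rfl⟩; exact ⟨⟨p, i⟩, rfl⟩)))
    have hdY : ∀ d, vacuumSpace Q P ⊓ S.comp d ≤ Y := fun d x hx => by
      have hT : T x ∈ vacuumSpace Q P ⊓ S.comp d := ⟨h.vacuumSymm_mem hx.1, by
        have h1 := h.vacuumSymm_mem_comp hx.2
        rwa [hn, CharTwo.add_self_eq_zero, add_zero] at h1⟩
      have h1 : x + (w d)⁻¹ • T x ∈ E (d, 1) := by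
        rw [hE]
        refine ⟨Submodule.add_mem _ hx (Submodule.smul_mem _ _ hT), ?_⟩
        rw [map_add, map_smul, hτ d x hx, ← hw]
        match_scalars
        · simp [hw0 d]
        · field_simp [hw0 d]
      have h2 : x - (w d)⁻¹ • T x ∈ E (d, -1) := by
        rw [hE]
        refine ⟨Submodule.sub_mem _ hx (Submodule.smul_mem _ _ hT), ?_⟩
        rw [map_sub, map_smul, hτ d x hx, ← hw]
        match_scalars
        · simp [hw0 d]
        · field_simp [hw0 d]
      have h3 := Y.smul_mem (1 / 2 : ℂ) (Y.add_mem (hEY _ h1) (hEY _ h2))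
      have e : (1 / 2 : ℂ) • (x + (w d)⁻¹ • T x + (x - (w d)⁻¹ • T x)) = x := by module
      rwa [e] at h3
    intro x hx
    obtain ⟨y, hy, z, hz, rfl⟩ := h.exists_vacuum_add hx
    exact Y.add_mem (hdY _ hy) (hdY _ hz)

end IsFrame

/-! ### The decomposition -/

namespace IsFrame

variable {m r s : ℕ} {H : Type u} [NormedAddCommGroup H] [NormedSpace ℂ H]
  {θ : ℝ} {hθ : θ ≠ 0} {n : ZMod 2} {S : SuperspaceData H} {R : HeisRep m r s H}
  {Q : (OddIndex r s → ℂ) →ₗ[ℂ] (H →L[ℂ] H)} {Γ J P : H →L[ℂ] H} {L : H →ₗ[ℂ] (L2 m →L[ℂ] H)}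

theorem isOrthogonalSum_model [CompleteSpace H] (h : IsFrame hθ n S R Q Γ J P L) (hn : n = r) :
    IsOrthogonalSumOfCopies (modelSuperspace m r s θ) (modelRep m r s θ) n S R := by
  obtain ⟨ι, d, x, w, hx, hxw, hw, hx1, hx0, hxd⟩ := h.exists_eigenbasis hn
  have hwt := Monomial.weight_pos hθ (Monomial.top r s)
  have hβ := norm_pos_iff.2 (berezinCoeff_ne_zero hθ ((∅, ∅) : Monomial r s))
  set k : ℝ := ‖berezinCoeff θ ((∅, ∅) : Monomial r s)‖⁻¹ * Real.sqrt ((Monomial.top r s).weight θ)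
    with hk
  have hk0 : 0 < k := by positivity
  set l : ℝ := (Real.sqrt k)⁻¹ with hl
  have hl0 : 0 < l := by positivity
  have hlk : l * l * k = 1 := by
    have := Real.mul_self_sqrt hk0.le
    have h0 : Real.sqrt k ≠ 0 := by positivity
    rw [hl]
    field_simp
    linear_combination -this
  have hlC : (l : ℂ) ≠ 0 := by exact_mod_cast hl0.ne'
  have hsx : ∀ i, (l : ℂ) • x i ∈ vacuumSpace Q P ⊓ S.comp (d i) := fun i =>
    Submodule.smul_mem _ _ (hx i)
  have hB : ∀ i j, S.form ((l : ℂ) • x i) (J ((l : ℂ) • x j)) = (l * l : ℝ) * S.form (x i) (J (x j)) :=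
    fun i j => by
      rw [map_smul J, LinearMap.sesq_smul, Complex.conj_ofReal]
      push_cast
      ring
  have hc : ∀ i j, vacuumCoeff θ S Q (d i) ((l : ℂ) • x i) ((l : ℂ) • x j) =
      (l * l : ℝ) * (vacuumConst r s θ (d i) * w j * S.form (x i) (J (x j))) := fun i j => by
    rw [h.vacuumCoeff_eq, map_smul (vacuumSymm θ Q J), hxw, smul_smul, mul_comm (l : ℂ), ← smul_smul, map_smul J,
      map_smul (S.form ((l : ℂ) • x i)), smul_eq_mul, hB]
    ring
  have hε : ∀ i, ∃ ε : ℤˣ, vacuumCoeff θ S Q (d i) ((l : ℂ) • x i) ((l : ℂ) • x i) =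
      ((ε : ℤ) : ℂ) * Complex.I ^ (d i).val := fun i => by
    refine exists_sign (h.conj_vacuumCoeff (hsx i).1 (hsx i).2 (hsx i).1 (hsx i).2) ?_
    have h1 : ‖w i‖ = Real.sqrt ((Monomial.top r s).weight θ) := by
      rw [← hw i, Real.sqrt_sq (norm_nonneg _)]
    rw [hc, hx1, mul_one, norm_mul, norm_mul, norm_vacuumConst, h1, ← hk, Complex.norm_real,
      Real.norm_of_nonneg (by positivity), hlk]
  choose ε hε using hε
  obtain ⟨a, b, ha, hb, hab⟩ := exists_weight_bounds (m := m) (r := r) (s := s) hθ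
  obtain ⟨c, C, hcp, hcC⟩ := h.exists_norm_bounds (a := a * (l * l)) (b := b * (l * l))
    (by positivity) (by positivity)
  refine h.isOrthogonalSum d ε (fun i => modelMap θ Q L ((l : ℂ) • x i))
    (fun i => h.isIsometry (hsx i) (hε i)) (fun i => h.intertwines (hsx i).1)
    (fun i j hij φ ψ => ?_) (fun i j hij φ ψ => ?_) ⟨c, C, hcp, fun i φ => ?_⟩
    (fun i j φ => ⟨_, (h.modelMap_mul _ j φ).symm⟩) (hxd.trans (Submodule.topologicalClosure_mono ?_))
  · rw [h.form_modelMap (hsx i).1 (hsx i).2 (hsx j).1, hc, hx0 i j hij]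
    ring
  · rw [h.scalar_modelMap (hsx i).1 (hsx j).1, hB, hx0 i j hij]
    ring
  · have h1 := h.scalar_modelMap (hsx i).1 (hsx i).1 φ φ
    rw [hB, hx1, mul_one, sum_weight_re, ← Complex.ofReal_mul] at h1
    have h2 := hab φ
    refine hcC ‖φ‖ _ (norm_nonneg _) ?_ ?_
    · rw [h1, Complex.ofReal_re]
      nlinarith [mul_le_mul_of_nonneg_right h2.1 (mul_pos hl0 hl0).le]
    · rw [h1, Complex.ofReal_re]
      nlinarith [mul_le_mul_of_nonneg_right h2.2 (mul_pos hl0 hl0).le]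
  · rw [Submodule.span_le]
    rintro _ ⟨i, rfl⟩
    refine Submodule.mem_iSup_of_mem i ⟨(l : ℂ)⁻¹ • Pi.single (∅, ∅) (vacuum m hθ), ?_⟩
    change modelMap θ Q L ((l : ℂ) • x i) _ = _
    rw [map_smul, h.modelMap_vacuum (hsx i).1, smul_smul, inv_mul_cancel₀ hlC, one_smul]

/-- The map from the double of the model defined by two vacuum vectors. -/
noncomputable def doubleMap (θ : ℝ) (Q : (OddIndex r s → ℂ) →ₗ[ℂ] (H →L[ℂ] H))
    (L : H →ₗ[ℂ] (L2 m →L[ℂ] H)) (x y : H) : ModelSpace m r s × ModelSpace m r s →L[ℂ] H :=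
  (modelMap θ Q L x).coprod (modelMap θ Q L y)

theorem doubleMap_apply (x y : H) (φ : ModelSpace m r s × ModelSpace m r s) :
    doubleMap θ Q L x y φ = modelMap θ Q L x φ.1 + modelMap θ Q L y φ.2 := rfl

theorem intertwines_double (h : IsFrame hθ n S R Q Γ J P L) {x y : H} (hx : x ∈ vacuumSpace Q P)
    (hy : y ∈ vacuumSpace Q P) : Intertwines (doubleRep m r s θ) R (doubleMap θ Q L x y) := by
  have h1 : ∀ g φ, doubleMap θ Q L x y ((doubleRep m r s θ).π g φ) =
      R.π g (doubleMap θ Q L x y φ) := fun g φ => by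
    rw [doubleMap_apply, doubleMap_apply, map_add, ← h.modelMap_body, ← h.modelMap_body]
    rfl
  refine ⟨h1, fun X φ => ?_⟩
  have h2 : doubleMap θ Q L x y φ ∈ smoothVectors R.π := map_mem_smoothVectors h1 φ.2
  refine ⟨h2, ?_⟩
  rw [← h.odd.apply X ⟨_, h2⟩]
  change Q X.toC (doubleMap θ Q L x y φ) = _
  rw [doubleMap_apply, map_add, ← h.modelMap_oddOperator hx,
    ← h.modelMap_oddOperator hy]
  rfl

theorem isOrthogonalSum_double [CompleteSpace H] (h : IsFrame hθ n S R Q Γ J P L) (hn : n = r + 1) :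
    IsOrthogonalSumOfCopies (doubleSuperspace m r s θ) (doubleRep m r s θ) n S R := by
  set T := vacuumSymm θ Q J with hT
  have hwt := Monomial.weight_pos hθ (Monomial.top r s)
  have hwC : ((Monomial.top r s).weight θ : ℂ) ≠ 0 := by exact_mod_cast hwt.ne'
  have hE : IsClosed ((vacuumSpace Q P ⊓ S.comp 0 : Submodule ℂ H) : Set H) :=
    (isClosed_vacuumSpace Q P).inter (h.rep.isClosed_comp 0)
  obtain ⟨ι, x, hx, hx1, hx0, hxd⟩ := h.isScalarProduct.exists_basis hE
  replace hx1 : ∀ i, S.form (x i) (J (x i)) = 1 := hx1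
  replace hx0 : ∀ i j, i ≠ j → S.form (x i) (J (x j)) = 0 := hx0
  have hrn : (r : ZMod 2) + n = 1 := by
    rw [hn, ← add_assoc, CharTwo.add_self_eq_zero, zero_add]
  have hTd : ∀ {d y}, y ∈ vacuumSpace Q P ⊓ S.comp d → T y ∈ vacuumSpace Q P ⊓ S.comp (d + 1) :=
    fun hy => ⟨h.vacuumSymm_mem hy.1, hrn ▸ h.vacuumSymm_mem_comp hy.2⟩
  have hK := vacuumConst_ne_zero (r := r) (s := s) hθ 1
  have hK' : conj (vacuumConst r s θ 1) ≠ 0 := by simpa using hK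
  set l : ℂ := (conj (vacuumConst r s θ 1) * (Monomial.top r s).weight θ)⁻¹ with hl
  have hl0 : l ≠ 0 := inv_ne_zero (mul_ne_zero hK' hwC)
  set y : ι → H := fun i => l • T (x i) with hy
  have hy1 : ∀ i, y i ∈ vacuumSpace Q P ⊓ S.comp 1 := fun i =>
    Submodule.smul_mem _ _ (by simpa using hTd (hx i))
  have hTy : ∀ i, T (y i) ∈ S.comp 0 := fun i => (hTd (hy1 i)).2
  have hBxx : ∀ i j, i ≠ j → S.form (x i) (J (x j)) = 0 := hx0
  have hByy : ∀ i j, S.form (y i) (J (y j)) =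
      conj l * (l * ((Monomial.top r s).weight θ * S.form (x i) (J (x j)))) := fun i j => by
    rw [hy]
    simp only
    rw [map_smul J, LinearMap.sesq_smul, h.scalar_vacuumSymm (hx i).1 (hx j).1]
  have hBxy : ∀ i j, S.form (x i) (J (y j)) = 0 := fun i j =>
    h.adapted.symm.orthogonal h.rep.hilbert (by decide) (hx i).2 (hy1 j).2
  have hByx : ∀ i j, S.form (y i) (J (x j)) = 0 := fun i j =>
    h.adapted.symm.orthogonal h.rep.hilbert (by decide) (hy1 i).2 (hx j).2
  have hcxx : ∀ i j, vacuumCoeff θ S Q 0 (x i) (x j) = 0 := fun i j => by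
    rw [h.vacuumCoeff_eq]
    rw [show S.form (x i) (J (vacuumSymm θ Q J (x j))) = 0 from
      h.adapted.symm.orthogonal h.rep.hilbert (by decide) (hx i).2 (hTd (hx j)).2, mul_zero]
  have hcyy : ∀ i j, vacuumCoeff θ S Q 1 (y i) (y j) = 0 := fun i j => by
    rw [h.vacuumCoeff_eq]
    rw [show S.form (y i) (J (vacuumSymm θ Q J (y j))) = 0 from
      h.adapted.symm.orthogonal h.rep.hilbert (by decide) (hy1 i).2 (hTd (hy1 j)).2, mul_zero]
  have hcyx : ∀ i j, vacuumCoeff θ S Q 1 (y i) (x j) = S.form (x i) (J (x j)) := fun i j => by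
    rw [h.vacuumCoeff_eq, hy]
    simp only
    rw [LinearMap.map_smulₛₗ, LinearMap.smul_apply, h.scalar_vacuumSymm (hx i).1 (hx j).1, hl,
      map_inv₀, map_mul, Complex.conj_conj, Complex.conj_ofReal, smul_eq_mul]
    field_simp
  have hcxy : ∀ i j, vacuumCoeff θ S Q 0 (x i) (y j) = S.form (x i) (J (x j)) := fun i j => by
    have h1 := h.conj_vacuumCoeff (hy1 j).1 (hy1 j).2 (hx i).1 (hx i).2
    rw [hcyx, h.scalar_conj, ZMod.val_zero, mul_zero, pow_zero, one_mul] at h1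
    exact h1.symm
  have hform : ∀ i j φ ψ, S.form (doubleMap θ Q L (x i) (y i) φ) (doubleMap θ Q L (x j) (y j) ψ) =
      S.form (x i) (J (x j)) * (doubleSuperspace m r s θ).form φ ψ := fun i j φ ψ => by
    simp only [doubleMap_apply, map_add, LinearMap.add_apply, h.form_modelMap (hx i).1 (hx i).2 (hx j).1,
      h.form_modelMap (hx i).1 (hx i).2 (hy1 j).1, h.form_modelMap (hy1 i).1 (hy1 i).2 (hx j).1,
      h.form_modelMap (hy1 i).1 (hy1 i).2 (hy1 j).1, hcxx, hcyy, hcyx, hcxy, ZMod.val_zero,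
      ZMod.val_one, pow_zero, pow_one, Module.End.one_apply]
    change _ = _ * (modelForm m r s θ φ.1 ψ.2 + modelForm m r s θ φ.2 (fockGrading ψ.1))
    ring
  have hscal : ∀ i j φ ψ, S.form (doubleMap θ Q L (x i) (y i) φ)
      (J (doubleMap θ Q L (x j) (y j) ψ)) = S.form (x i) (J (x j)) *
      ((∑ M : Monomial r s, M.weight θ * inner ℂ (φ.1 M) (ψ.1 M)) +
        conj l * l * (Monomial.top r s).weight θ *
          (∑ M : Monomial r s, M.weight θ * inner ℂ (φ.2 M) (ψ.2 M))) := fun i j φ ψ => by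
    simp only [doubleMap_apply, map_add, LinearMap.add_apply, h.scalar_modelMap (hx i).1 (hx j).1,
      h.scalar_modelMap (hx i).1 (hy1 j).1, h.scalar_modelMap (hy1 i).1 (hx j).1,
      h.scalar_modelMap (hy1 i).1 (hy1 j).1, hBxy, hByx, hByy]
    ring
  obtain ⟨a, b, ha, hb, hab⟩ := exists_weight_bounds (m := m) (r := r) (s := s) hθ
  set t : ℝ := ‖l‖ ^ 2 * (Monomial.top r s).weight θ with ht
  have ht0 : 0 < t := by positivity
  have hlt : conj l * l * (Monomial.top r s).weight θ = (t : ℂ) := by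
    rw [mul_comm (conj l), Complex.mul_conj, Complex.normSq_eq_norm_sq, ht]
    push_cast
    ring
  obtain ⟨c, C, hcp, hcC⟩ := h.exists_norm_bounds (a := a * min 1 t) (b := b * (1 + t))
    (by positivity) (by positivity)
  refine h.isOrthogonalSum (fun _ => 0) (fun _ => 1) (fun i => doubleMap θ Q L (x i) (y i))
    (fun i => ⟨fun a φ hφ => ?_, fun b φ ψ _ => ?_⟩) (fun i => h.intertwines_double (hx i).1 (hy1 i).1)
    (fun i j hij φ ψ => ?_) (fun i j hij φ ψ => ?_) ⟨c, C, hcp, fun i φ => ?_⟩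
    (fun i j φ => ⟨(fockMul j φ.1, fockMul j φ.2), ?_⟩) ?_
  · have h2 := h.modelMap_mem (hx i).2 hφ.1
    have h3 := h.modelMap_mem (hy1 i).2 hφ.2
    rw [add_assoc, CharTwo.add_self_eq_zero] at h3
    exact Submodule.add_mem _ h2 h3
  · rw [hform, hx1]
    simp
  · rw [hform, hx0 i j hij, zero_mul]
  · rw [hscal, hx0 i j hij, zero_mul]
  · have h1 := hscal i i φ φ
    rw [hx1, one_mul, hlt, sum_weight_re, sum_weight_re, ← Complex.ofReal_mul,
      ← Complex.ofReal_add] at h1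
    have h2 := hab φ.1
    have h3 := hab φ.2
    have h4 : ‖φ‖ = max ‖φ.1‖ ‖φ.2‖ := Prod.norm_def φ
    have h5 : ‖φ.1‖ ^ 2 ≤ ‖φ‖ ^ 2 := pow_le_pow_left₀ (norm_nonneg _) (norm_fst_le φ) 2
    have h6 : ‖φ.2‖ ^ 2 ≤ ‖φ‖ ^ 2 := pow_le_pow_left₀ (norm_nonneg _) (norm_snd_le φ) 2
    refine hcC ‖φ‖ _ (norm_nonneg _) ?_ ?_
    · rw [h1, Complex.ofReal_re]
      have h7 := mul_le_mul_of_nonneg_left h3.1 ht0.le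
      have h8 : 0 ≤ a * ‖φ.1‖ ^ 2 := by positivity
      have h9 : 0 ≤ t * (a * ‖φ.2‖ ^ 2) := by positivity
      rcases max_choice ‖φ.1‖ ‖φ.2‖ with e | e
      · have h10 : a * min 1 t * ‖φ‖ ^ 2 ≤ a * ‖φ.1‖ ^ 2 := by
          rw [h4, e]
          exact mul_le_mul_of_nonneg_right (mul_le_of_le_one_right ha.le (min_le_left _ _))
            (sq_nonneg _)
        linarith
      · have h10 : a * min 1 t * ‖φ‖ ^ 2 ≤ t * (a * ‖φ.2‖ ^ 2) := by
          rw [h4, e, ← mul_assoc, mul_comm t]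
          exact mul_le_mul_of_nonneg_right (mul_le_mul_of_nonneg_left (min_le_right _ _) ha.le)
            (sq_nonneg _)
        linarith
    · rw [h1, Complex.ofReal_re]
      have h7 := mul_le_mul_of_nonneg_left h3.2 ht0.le
      have h8 := mul_le_mul_of_nonneg_left h5 hb.le
      have h9 := mul_le_mul_of_nonneg_left (mul_le_mul_of_nonneg_left h6 hb.le) ht0.le
      linarith
  · rw [doubleMap_apply, doubleMap_apply, map_add, ← h.modelMap_mul, ← h.modelMap_mul]
  · set Y := (⨆ i, LinearMap.range (doubleMap θ Q L (x i) (y i) :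
      ModelSpace m r s × ModelSpace m r s →ₗ[ℂ] H)).topologicalClosure
    have hYc : IsClosed (Y : Set H) := Submodule.isClosed_topologicalClosure _
    have hxY : ∀ i, x i ∈ Y := fun i => Submodule.le_topologicalClosure _
      (Submodule.mem_iSup_of_mem i ⟨(Pi.single (∅, ∅) (vacuum m hθ), 0), by
        simp [doubleMap_apply, h.modelMap_vacuum (hx i).1]⟩)
    have hyY : ∀ i, y i ∈ Y := fun i => Submodule.le_topologicalClosure _
      (Submodule.mem_iSup_of_mem i ⟨(0, Pi.single (∅, ∅) (vacuum m hθ)), by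
        simp [doubleMap_apply, h.modelMap_vacuum (hy1 i).1]⟩)
    have hE0 : vacuumSpace Q P ⊓ S.comp 0 ≤ Y := hxd.trans
      (Submodule.topologicalClosure_minimal _ (Submodule.span_le.2 (by
        rintro _ ⟨i, rfl⟩; exact hxY i)) hYc)
    have hE0' : vacuumSpace Q P ⊓ S.comp 0 ≤ Y.comap T.toLinearMap := hxd.trans
      (Submodule.topologicalClosure_minimal _ (Submodule.span_le.2 (by
        rintro _ ⟨i, rfl⟩
        have h1 := Y.smul_mem l⁻¹ (hyY i)
        rwa [hy, smul_smul, inv_mul_cancel₀ hl0, one_smul] at h1)) (hYc.preimage T.continuous))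
    have hE1 : vacuumSpace Q P ⊓ S.comp 1 ≤ Y := fun z hz => by
      obtain ⟨τ, hτ0, _, hτ⟩ := h.exists_vacuumSymm_sq 1
      have h1 : T (T z) ∈ Y := hE0' (hTd hz)
      have h2 : T (T z) = τ • z := hτ z hz
      rw [h2] at h1
      exact (Y.smul_mem_iff hτ0).1 h1
    intro z hz
    obtain ⟨z₀, h0, z₁, h1, rfl⟩ := h.exists_vacuum_add hz
    exact Y.add_mem (hE0 h0) (hE1 h1)

end IsFrame

/-- The decomposition of superunitary representations. -/
theorem IsSuperunitaryRep.isOrthogonalSum {m r s : ℕ} {H : Type u} [NormedAddCommGroup H]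
    [NormedSpace ℂ H] {θ : ℝ} (hθ : θ ≠ 0) {n : ZMod 2} {S : SuperspaceData H}
    {R : HeisRep m r s H} (hR : IsSuperunitaryRep n S R) (hχ : HasCentralCharacter θ R) :
    (n = (r : ZMod 2) →
      IsOrthogonalSumOfCopies (modelSuperspace m r s θ) (modelRep m r s θ) n S R) ∧
    (n = (r : ZMod 2) + 1 →
      IsOrthogonalSumOfCopies (doubleSuperspace m r s θ) (doubleRep m r s θ) n S R) := by
  have : CompleteSpace H := hR.hilbert.complete
  obtain ⟨Q, Γ, J, P, L, h⟩ := hR.exists_frame hθ hχ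
  exact ⟨h.isOrthogonalSum_model, h.isOrthogonalSum_double⟩

/-! ### Irreducible representations -/

namespace IsFrame

variable {m r s : ℕ} {H : Type u} [NormedAddCommGroup H] [NormedSpace ℂ H]
  {θ : ℝ} {hθ : θ ≠ 0} {n : ZMod 2} {S : SuperspaceData H} {R : HeisRep m r s H}
  {Q : (OddIndex r s → ℂ) →ₗ[ℂ] (H →L[ℂ] H)} {Γ J P : H →L[ℂ] H} {L : H →ₗ[ℂ] (L2 m →L[ℂ] H)}

theorem exists_vacuum (h : IsFrame hθ n S R Q Γ J P L) [Nontrivial H] :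
    ∃ d, ∃ x ∈ vacuumSpace Q P ⊓ S.comp d, x ≠ 0 := by
  by_contra! hE
  have hv : ∀ x ∈ vacuumSpace Q P, x = 0 := fun x hx => by
    obtain ⟨y, hy, z, hz, rfl⟩ := h.exists_vacuum_add hx
    rw [hE 0 y hy, hE 1 z hz, add_zero]
  have h1 : (⊥ : Submodule ℂ H) = ⊤ := by
    refine h.eq_top ⊥ isClosed_singleton (fun g x hx => ?_) fun x => ?_
    · rw [Submodule.mem_bot] at hx ⊢
      rw [hx, map_zero]
    · refine h.isCAR_end.le_of_vacuum_le (E := LinearMap.ker (P - 1).toLinearMap) (Y := ⊥)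
        (fun j x hx => ?_) (fun j x hx => ?_) (fun j x hx => ?_)
        (fun x hx hb => hv x (mem_vacuumSpace.2 ⟨?_, hb⟩)) ?_
      · simp only [LinearMap.mem_ker, ContinuousLinearMap.coe_coe, sub_apply, sub_eq_zero] at hx ⊢
        rw [h.proj_odd, hx]
        simp
      · simp only [LinearMap.mem_ker, ContinuousLinearMap.coe_coe, sub_apply, sub_eq_zero] at hx ⊢
        rw [h.proj_odd, hx]
        simp
      · rw [Submodule.mem_bot] at hx ⊢
        rw [hx, map_zero]
      · simpa [sub_eq_zero] using hx
      · simp [h.proj_proj]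
  exact bot_ne_top h1

theorem exists_modelMap_bounds (h : IsFrame hθ n S R Q Γ J P L) {x : H} (hx : x ∈ vacuumSpace Q P)
    (hx0 : x ≠ 0) : ∃ c : ℝ, 0 < c ∧ ∀ φ : ModelSpace m r s, c * ‖φ‖ ≤ ‖modelMap θ Q L x φ‖ := by
  obtain ⟨a, b, ha, hb, hab⟩ := exists_weight_bounds (m := m) (r := r) (s := s) hθ
  obtain ⟨t, ht⟩ := Complex.conj_eq_iff_real.1 (h.scalar_conj x x)
  have ht0 : 0 < t := by
    obtain ⟨c, C, hc, hcC⟩ := h.adapted.symm.equivalent_norm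
    have h1 := (hcC x).1
    simp only [ContinuousLinearMap.coe_coe] at h1
    rw [ht, Complex.ofReal_re] at h1
    have := norm_pos_iff.2 hx0
    exact lt_of_lt_of_le (by positivity) h1
  obtain ⟨c, C, hc, hcC⟩ := h.exists_norm_bounds (a := a * t) (b := b * t) (by positivity)
    (by positivity)
  refine ⟨c, hc, fun φ => (hcC ‖φ‖ _ (norm_nonneg _) ?_ ?_).1⟩
  · rw [h.scalar_modelMap hx hx, ht, sum_weight_re, ← Complex.ofReal_mul, Complex.ofReal_re]
    nlinarith [mul_le_mul_of_nonneg_right (hab φ).1 ht0.le]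
  · rw [h.scalar_modelMap hx hx, ht, sum_weight_re, ← Complex.ofReal_mul, Complex.ofReal_re]
    nlinarith [mul_le_mul_of_nonneg_right (hab φ).2 ht0.le]

theorem range_modelMap (h : IsFrame hθ n S R Q Γ J P L) (hirr : IsIrreducibleRep S R) {d : ZMod 2}
    {x : H} (hx : x ∈ vacuumSpace Q P ⊓ S.comp d) (hx0 : x ≠ 0) :
    LinearMap.range (modelMap θ Q L x).toLinearMap = ⊤ := by
  obtain ⟨c, hc, hb⟩ := h.exists_modelMap_bounds hx.1 hx0
  refine (hirr.2 _ (isClosed_range_of_bound _ hc hb) (le_antisymm ?_ (sup_le inf_le_left inf_le_left))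
    ?_ ?_).resolve_left fun e => hx0 ?_
  · rintro _ ⟨φ, rfl⟩
    obtain ⟨φ₀, h0, φ₁, h1, rfl⟩ := (isHilbertSuperspace_model (m := m) (r := r) (s := s) hθ).exists_add φ
    rw [map_add]
    have e0 := h.modelMap_mem hx.2 h0
    have e1 := h.modelMap_mem hx.2 h1
    obtain rfl | rfl := ZMod.eq_zero_or_eq_one d
    · exact Submodule.add_mem_sup ⟨⟨φ₀, rfl⟩, e0⟩ ⟨⟨φ₁, rfl⟩, e1⟩
    · rw [add_comm]
      exact Submodule.add_mem_sup ⟨⟨φ₁, rfl⟩, e1⟩ ⟨⟨φ₀, rfl⟩, e0⟩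
  · rintro g _ ⟨φ, rfl⟩
    exact ⟨_, h.modelMap_body x g φ⟩
  · rintro X v ⟨φ, hφ⟩
    rw [← h.odd.apply X v, ← hφ]
    exact ⟨_, h.modelMap_oddOperator hx.1 X φ⟩
  · rw [← Submodule.mem_bot ℂ, ← e]
    exact ⟨_, h.modelMap_vacuum hx.1⟩

theorem vacuumCoeff_ne_zero (h : IsFrame hθ n S R Q Γ J P L) (hirr : IsIrreducibleRep S R) {d : ZMod 2}
    {x : H} (hx : x ∈ vacuumSpace Q P ⊓ S.comp d) (hx0 : x ≠ 0) : vacuumCoeff θ S Q d x x ≠ 0 := by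
  intro h0
  refine hx0 (h.rep.hilbert.eq_zero_of_form fun y => ?_)
  obtain ⟨φ, hφ⟩ : y ∈ LinearMap.range (modelMap θ Q L x).toLinearMap := by
    rw [h.range_modelMap hirr hx hx0]
    trivial
  have h1 := h.form_modelMap hx.1 hx.2 hx.1 φ (Pi.single (∅, ∅) (vacuum m hθ))
  rw [h0, zero_mul, h.modelMap_vacuum hx.1] at h1
  rw [← hφ]
  exact h1

theorem parity_eq (h : IsFrame hθ n S R Q Γ J P L) (hirr : IsIrreducibleRep S R) : n = r := by
  have := hirr.1
  obtain ⟨d, x, hx, hx0⟩ := h.exists_vacuum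
  by_contra hn
  refine h.vacuumCoeff_ne_zero hirr hx hx0 ?_
  have h1 := h.oddMonomial_mem (Monomial.top r s) hx.2
  rw [Monomial.degree_top] at h1
  rw [vacuumCoeff, h.rep.hilbert.homogeneous _ _ (fun e => hn ?_) _ hx.2 _ h1, mul_zero, zero_div]
  rw [← e]
  linear_combination CharTwo.add_self_eq_zero d

theorem equivalent_model [CompleteSpace H] (h : IsFrame hθ n S R Q Γ J P L)
    (hirr : IsIrreducibleRep S R) :
    EquivalentUpToParityAndSign (modelSuperspace m r s θ) (modelRep m r s θ) S R := by
  have := hirr.1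
  obtain ⟨d, x, hx, hx0⟩ := h.exists_vacuum
  have hc := norm_pos_iff.2 (h.vacuumCoeff_ne_zero hirr hx hx0)
  set k := ‖vacuumCoeff θ S Q d x x‖ with hk
  set l : ℝ := (Real.sqrt k)⁻¹ with hl
  have hl0 : 0 < l := by positivity
  have hlk : l * l * k = 1 := by
    have := Real.mul_self_sqrt hc.le
    have h0 : Real.sqrt k ≠ 0 := by positivity
    rw [hl]
    field_simp
    linear_combination -this
  have hy : (l : ℂ) • x ∈ vacuumSpace Q P ⊓ S.comp d := Submodule.smul_mem _ _ hx
  have hy0 : (l : ℂ) • x ≠ 0 := smul_ne_zero (by exact_mod_cast hl0.ne') hx0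
  obtain ⟨ε, hε⟩ := exists_sign (h.conj_vacuumCoeff hy.1 hy.2 hy.1 hy.2) (by
    have e : vacuumCoeff θ S Q d ((l : ℂ) • x) ((l : ℂ) • x) =
        (l * l : ℝ) * vacuumCoeff θ S Q d x x := by
      rw [vacuumCoeff, vacuumCoeff, map_smul (oddMonomial θ Q _), LinearMap.sesq_smul,
        Complex.conj_ofReal]
      push_cast
      ring
    rw [e, norm_mul, ← hk, Complex.norm_real, Real.norm_of_nonneg (by positivity), hlk])
  obtain ⟨c, hc, hb⟩ := h.exists_modelMap_bounds hy.1 hy0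
  have hker : LinearMap.ker (modelMap θ Q L ((l : ℂ) • x)).toLinearMap = ⊥ := by
    refine LinearMap.ker_eq_bot'.2 fun φ hφ => ?_
    have h1 := hb φ
    change modelMap θ Q L ((l : ℂ) • x) φ = 0 at hφ
    rw [hφ, norm_zero] at h1
    exact norm_le_zero_iff.1 (nonpos_of_mul_nonpos_right h1 hc)
  let V := ContinuousLinearEquiv.ofBijective (modelMap θ Q L ((l : ℂ) • x)) hker
    (h.range_modelMap hirr hy hy0)
  have hV : (V : ModelSpace m r s →L[ℂ] H) = modelMap θ Q L ((l : ℂ) • x) := rfl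
  exact ⟨d, ε, V, hV ▸ h.isIsometry hy hε, hV ▸ h.intertwines hy.1⟩

end IsFrame

section Equivalence

variable {m r s : ℕ} {H H' K : Type*} [NormedAddCommGroup H] [NormedSpace ℂ H]
  [NormedAddCommGroup H'] [NormedSpace ℂ H'] [NormedAddCommGroup K] [NormedSpace ℂ K]
  {S : SuperspaceData H} {S' : SuperspaceData H'} {S₀ : SuperspaceData K}
  {R : HeisRep m r s H} {R' : HeisRep m r s H'} {R₀ : HeisRep m r s K}

theorem Intertwines.symm {V : H ≃L[ℂ] K} (hV : Intertwines R R₀ (V : H →L[ℂ] K)) :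
    Intertwines R₀ R (V.symm : K →L[ℂ] H) := by
  have h1 : ∀ g v, (V.symm : K →L[ℂ] H) (R₀.π g v) = R.π g ((V.symm : K →L[ℂ] H) v) := fun g v => by
    have h2 := hV.1 g (V.symm v)
    simp only [ContinuousLinearEquiv.coe_coe, ContinuousLinearEquiv.apply_symm_apply] at h2 ⊢
    rw [← h2, ContinuousLinearEquiv.symm_apply_apply]
  refine ⟨h1, fun X v => ?_⟩
  have h2 : (V.symm : K →L[ℂ] H) v ∈ smoothVectors R.π := map_mem_smoothVectors h1 v.2
  refine ⟨h2, ?_⟩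
  obtain ⟨h3, h4⟩ := hV.2 X ⟨_, h2⟩
  have h5 : (⟨(V : H →L[ℂ] K) ((V.symm : K →L[ℂ] H) v), h3⟩ : smoothVectors R₀.π) = v :=
    Subtype.ext (V.apply_symm_apply _)
  rw [h5] at h4
  rw [h4]
  exact (V.symm_apply_apply _).symm

theorem Intertwines.comp {V : H →L[ℂ] K} {V' : K →L[ℂ] H'} (hV' : Intertwines R₀ R' V')
    (hV : Intertwines R R₀ V) : Intertwines R R' (V' ∘L V) := by
  refine ⟨fun g v => ?_, fun X v => ?_⟩
  · rw [ContinuousLinearMap.comp_apply, hV.1, hV'.1]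
    rfl
  · obtain ⟨h1, h2⟩ := hV.2 X v
    obtain ⟨h3, h4⟩ := hV'.2 X ⟨_, h1⟩
    exact ⟨h3, h4.trans (congrArg V' h2)⟩

theorem IsIsometryUpTo.symm_mem {n n' : ZMod 2} (hS : S.IsHilbertSuperspace n)
    (hS' : S₀.IsHilbertSuperspace n')
    {d : ZMod 2} {ε : ℤˣ} {V : H ≃L[ℂ] K} (hV : IsIsometryUpTo S S₀ d ε (V : H →L[ℂ] K)) {a : ZMod 2}
    {y : K} (hy : y ∈ S₀.comp a) : V.symm y ∈ S.comp (a + d) := by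
  obtain ⟨Γ, hΓ⟩ := hS.exists_grading
  obtain ⟨Γ', hΓ'⟩ := hS'.exists_grading
  have h1 : Γ' ∘L (V : H →L[ℂ] K) = (-1 : ℂ) ^ d.val • (V : H →L[ℂ] K) ∘L Γ :=
    SuperspaceData.IsGrading.ext hS fun b x hx => by
      rw [ContinuousLinearMap.comp_apply, hΓ' _ _ (hV.1 b x hx), smul_apply,
        ContinuousLinearMap.comp_apply, hΓ b x hx, map_smul, smul_smul, neg_one_pow_val_add, mul_comm]
  have h2 := DFunLike.congr_fun h1 (V.symm y)
  rw [ContinuousLinearMap.comp_apply, smul_apply, ContinuousLinearMap.comp_apply] at h2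
  simp only [ContinuousLinearEquiv.coe_coe, ContinuousLinearEquiv.apply_symm_apply] at h2
  rw [hΓ' a y hy] at h2
  rw [hΓ.mem_comp_iff hS]
  refine V.injective ?_
  rw [map_smul, V.apply_symm_apply, neg_one_pow_val_add, mul_comm, mul_smul, h2, smul_smul,
    neg_one_pow_mul_self, one_smul]

/-- Representations equivalent to the same one are equivalent. -/
theorem EquivalentUpToParityAndSign.of_common {n n₀ : ZMod 2} (hS : S.IsHilbertSuperspace n)
    (hS₀ : S₀.IsHilbertSuperspace n₀) (h : EquivalentUpToParityAndSign S₀ R₀ S R)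
    (h' : EquivalentUpToParityAndSign S₀ R₀ S' R') : EquivalentUpToParityAndSign S R S' R' := by
  obtain ⟨d, ε, V, hV, hVR⟩ := h
  obtain ⟨d', ε', V', hV', hVR'⟩ := h'
  refine ⟨d + d', ε * ε', V.symm.trans V', ⟨fun a x hx => ?_, fun b x y hy => ?_⟩,
    hVR'.comp hVR.symm⟩
  · rw [← add_assoc]
    exact hV'.1 _ _ (hV.symm_mem hS₀ hS hx)
  · have h1 := hV.symm_mem hS₀ hS hy
    have h2 := hV.2 _ (V.symm x) _ h1
    have h3 := hV'.2 _ (V.symm x) _ h1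
    simp only [ContinuousLinearEquiv.coe_coe, ContinuousLinearEquiv.apply_symm_apply] at h2 h3
    change S'.form (V' (V.symm x)) (V' (V.symm y)) = _
    rw [h3, h2]
    have hI := Complex.I_mul_I
    have hε : ((ε : ℤ) : ℂ) * ((ε : ℤ) : ℂ) = 1 := by
      rcases Int.units_eq_one_or ε with rfl | rfl <;> simp
    push_cast
    obtain rfl | rfl := ZMod.eq_zero_or_eq_one d <;> obtain rfl | rfl := ZMod.eq_zero_or_eq_one d' <;>
      obtain rfl | rfl := ZMod.eq_zero_or_eq_one b <;>
      simp [ZMod.val_one, show (1 : ZMod 2) + 1 = 0 from rfl]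
    all_goals set A := S₀.form (V.symm x) (V.symm y)
    all_goals first
      | linear_combination (-((ε' : ℤ) : ℂ) * Complex.I * A) * hε
      | linear_combination (-((ε' : ℤ) : ℂ) * A) * hε
      | linear_combination (((ε' : ℤ) : ℂ) * Complex.I * Complex.I * A) * hε +
          (((ε' : ℤ) : ℂ) * A) * hI

end Equivalence

/-! ### Clifford modules -/

theorem CorrespondsTo.transport {m r s : ℕ} {θ : ℝ} {H K E : Type*} [NormedAddCommGroup H]
    [NormedSpace ℂ H] [AddCommGroup E] [Module ℂ E] [Module (OddClifford r s θ) E] {R : HeisRep m r s H}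
    [NormedAddCommGroup K] [NormedSpace ℂ K] {R' : HeisRep m r s K}
    (h : CorrespondsTo (E := E) θ R) {V : H ≃L[ℂ] K} (hV : Intertwines R R' (V : H →L[ℂ] K)) :
    CorrespondsTo (E := E) θ R' := by
  obtain ⟨Φ, hinj, hΦ, hX⟩ := h
  refine ⟨(ContinuousLinearMap.compL ℂ (L2 m) H K (V : H →L[ℂ] K)).toLinearMap ∘ₗ Φ,
    fun e e' he => hinj (ContinuousLinearMap.ext fun f => V.injective (DFunLike.congr_fun he f)),
    fun T => ?_, fun X e f hf => ?_⟩
  · have h1 := hΦ ((V.symm : K →L[ℂ] H) ∘L T)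
    constructor
    · rintro ⟨e, rfl⟩ g
      refine ContinuousLinearMap.ext fun f => ?_
      have h2 := DFunLike.congr_fun ((hΦ (Φ e)).1 ⟨e, rfl⟩ g) f
      rw [ContinuousLinearMap.comp_apply, ContinuousLinearMap.comp_apply] at h2
      change V (Φ e (schrodinger θ g f)) = R'.π g (V (Φ e f))
      rw [h2]
      exact hV.1 g _
    · intro hT
      obtain ⟨e, he⟩ := h1.2 fun g => ContinuousLinearMap.ext fun f => by
        have h2 := DFunLike.congr_fun (hT g) f
        change V.symm (T (schrodinger θ g f)) = R.π g (V.symm (T f))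
        rw [ContinuousLinearMap.comp_apply, ContinuousLinearMap.comp_apply] at h2
        rw [h2]
        exact hV.symm.1 g _
      refine ⟨e, ContinuousLinearMap.ext fun f => ?_⟩
      change V (Φ e f) = T f
      rw [he]
      exact V.apply_symm_apply _
  · obtain ⟨h1, h2⟩ := hX X e f hf
    obtain ⟨h3, h4⟩ := hV.2 X ⟨_, h1⟩
    exact ⟨h3, h4.trans (congrArg V h2)⟩

section Clifford

variable {m r s : ℕ} {θ : ℝ} {H : Type*} [NormedAddCommGroup H] [NormedSpace ℂ H]
  {R : HeisRep m r s H}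
  {E E' : Type*} [AddCommGroup E] [Module ℂ E] [Module (OddClifford r s θ) E]
  [IsScalarTower ℂ (OddClifford r s θ) E]
  [AddCommGroup E'] [Module ℂ E'] [Module (OddClifford r s θ) E']
  [IsScalarTower ℂ (OddClifford r s θ) E']

/-- The action of the Clifford generators. -/
noncomputable def cliffordAction (r s : ℕ) (θ : ℝ) (E : Type*) [AddCommGroup E] [Module ℂ E]
    [Module (OddClifford r s θ) E] [IsScalarTower ℂ (OddClifford r s θ) E] :
    (OddIndex r s → ℂ) →ₗ[ℂ] Module.End ℂ E :=
  have : SMulCommClass (OddClifford r s θ) ℂ E := IsScalarTower.to_smulCommClass' 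
  (Algebra.lsmul ℂ ℂ E).toLinearMap ∘ₗ CliffordAlgebra.ι (cliffordForm r s θ)

theorem cliffordAction_apply (X : OddIndex r s → ℂ) (e : E) :
    cliffordAction r s θ E X e = CliffordAlgebra.ι (cliffordForm r s θ) X • e := rfl

theorem cliffordAction_toC (X : OddPart r s) (e : E) :
    cliffordAction r s θ E X.toC e = cliffordGen θ X • e := rfl

theorem eq_sum_toC (X : OddIndex r s → ℂ) : X = ∑ i, X i • OddPart.toC (Pi.single i 1) := by
  simp_rw [OddPart.toC_single]
  funext j
  simp [Finset.sum_apply, Pi.single_apply]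

theorem cliffordForm_apply (X : OddIndex r s → ℂ) :
    cliffordForm r s θ X = -(Complex.I / θ) * omegaC X X := by
  rw [cliffordForm, QuadraticMap.weightedSumSquares_apply, omegaC_apply, Finset.mul_sum]
  refine Finset.sum_congr rfl fun i _ => ?_
  rcases i with i | i <;> simp [oddSign]

theorem isOddRep_cliffordAction : IsOddRep θ (cliffordAction r s θ E) := fun X Y => by
  refine LinearMap.ext fun e => ?_
  have h := CliffordAlgebra.ι_mul_ι_add_swap (Q := cliffordForm r s θ) X Y
  rw [LinearMap.add_apply, Module.End.mul_apply, Module.End.mul_apply, cliffordAction_apply,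
    cliffordAction_apply, cliffordAction_apply, cliffordAction_apply, smul_smul, smul_smul, ← add_smul,
    h, algebraMap_smul, QuadraticMap.polar, cliffordForm_apply, cliffordForm_apply, cliffordForm_apply,
    LinearMap.smul_apply, Module.End.one_apply]
  congr 1
  rw [map_add, map_add, LinearMap.add_apply, LinearMap.add_apply, omegaC_comm Y X]
  ring

/-- A property of the generators attached to real vectors that is inherited by sums, products and
multiples holds for all elements of the Clifford algebra. -/
theorem OddClifford.induction {p : OddClifford r s θ → Prop} (hs : ∀ c : ℂ, p (algebraMap ℂ _ c))
    (hg : ∀ X : OddPart r s, p (cliffordGen θ X)) (hm : ∀ a b, p a → p b → p (a * b))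
    (ha : ∀ a b, p a → p b → p (a + b)) (a : OddClifford r s θ) : p a := by
  refine CliffordAlgebra.induction (Q := cliffordForm r s θ) (C := p) hs (fun X => ?_) hm ha a
  rw [eq_sum_toC X, map_sum]
  refine Finset.sum_induction _ p ha (by simpa using hs 0) fun i _ => ?_
  rw [map_smul, Algebra.smul_def]
  exact hm _ _ (hs _) (hg (Pi.single i 1))

/-- A complex-linear map that commutes with the generators is a map of Clifford modules. -/
theorem map_clifford_smul (T : E →ₗ[ℂ] E') (hT : ∀ (X : OddPart r s) e,
    T (cliffordGen θ X • e) = cliffordGen θ X • T e) (a : OddClifford r s θ) :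
    ∀ e, T (a • e) = a • T e := by
  refine OddClifford.induction (p := fun a => ∀ e, T (a • e) = a • T e) (fun c e => ?_) hT
    (fun a b h1 h2 e => ?_) (fun a b h1 h2 e => ?_) a
  · rw [algebraMap_smul, algebraMap_smul, map_smul]
  · rw [mul_smul, mul_smul, h1, h2]
  · rw [add_smul, add_smul, map_add, h1, h2]

theorem ext_smooth (hθ : θ ≠ 0) {T T' : L2 m →L[ℂ] H}
    (h : ∀ f ∈ smoothVectors (schrodinger (m := m) θ), T f = T' f) : T = T' :=
  ext_coherent hθ fun z => h _ (body_mem_smoothVectors (schrodinger_mul θ) _ (by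
    rw [← proj_vacuum hθ]
    exact proj_mem_smoothVectors (schrodinger_mul θ) (schrodinger_central θ)
      (schrodinger_isWeylSystem hθ) _))

namespace CorrespondsTo

/-- The Clifford module of a representation is unique up to isomorphism. -/
theorem unique (hθ : θ ≠ 0) (h : CorrespondsTo (E := E) θ R) (h' : CorrespondsTo (E := E') θ R) :
    Nonempty (E ≃ₗ[OddClifford r s θ] E') := by
  obtain ⟨Φ, hinj, hΦ, hX⟩ := h
  obtain ⟨Φ', hinj', hΦ', hX'⟩ := h'
  have hr : LinearMap.range Φ = LinearMap.range Φ' := by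
    ext T
    exact (hΦ T).trans (hΦ' T).symm
  let T : E ≃ₗ[ℂ] E' := (LinearEquiv.ofInjective Φ hinj).trans
    ((LinearEquiv.ofEq _ _ hr).trans (LinearEquiv.ofInjective Φ' hinj').symm)
  have hT : ∀ e, Φ' (T e) = Φ e := fun e =>
    congrArg Subtype.val ((LinearEquiv.ofInjective Φ' hinj').apply_symm_apply
      (LinearEquiv.ofEq _ _ hr (LinearEquiv.ofInjective Φ hinj e)))
  have hc : ∀ (X : OddPart r s) e, T (cliffordGen θ X • e) = cliffordGen θ X • T e := fun X e => by
    refine hinj' (ext_smooth hθ fun f hf => ?_)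
    obtain ⟨h1, h2⟩ := hX X e f hf
    obtain ⟨h3, h4⟩ := hX' X (T e) f hf
    rw [hT, ← h2, ← h4]
    congr 1
    exact Subtype.ext (DFunLike.congr_fun (hT e).symm f)
  exact ⟨{ T with map_smul' := map_clifford_smul T.toLinearMap hc }⟩

end CorrespondsTo

end Clifford

section CliffordModel

variable {m r s : ℕ} {θ : ℝ}

theorem map_oddElement {V W : Type*} [AddCommGroup V] [Module ℂ V] [AddCommGroup W] [Module ℂ W]
    {a b : Fin r ⊕ Fin s → Module.End ℂ V} {a' b' : Fin r ⊕ Fin s → Module.End ℂ W} (T : V →ₗ[ℂ] W)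
    (ha : ∀ j x, T (a j x) = a' j (T x)) (hb : ∀ j x, T (b j x) = b' j (T x)) (X : OddPart r s)
    (x : V) : T (oddElement θ a b X x) = oddElement θ a' b' X (T x) := by
  simp only [oddElement, LinearMap.sum_apply, LinearMap.add_apply, LinearMap.smul_apply, map_sum,
    map_add, map_smul, ha, hb]

theorem compLeft_fockMul {A B : Type*} [AddCommGroup A] [Module ℂ A] [AddCommGroup B] [Module ℂ B]
    (l : A →ₗ[ℂ] B) (j : Fin r ⊕ Fin s) (φ : Monomial r s → A) :
    l.compLeft (Monomial r s) (fockMul j φ) = fockMul j (l.compLeft (Monomial r s) φ) := by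
  funext M
  rw [LinearMap.compLeft_apply, Function.comp_apply, fockMul_apply, fockMul_apply]
  split_ifs <;> simp

theorem compLeft_fockDer {A B : Type*} [AddCommGroup A] [Module ℂ A] [AddCommGroup B] [Module ℂ B]
    (l : A →ₗ[ℂ] B) (j : Fin r ⊕ Fin s) (φ : Monomial r s → A) :
    l.compLeft (Monomial r s) (fockDer j φ) = fockDer j (l.compLeft (Monomial r s) φ) := by
  funext M
  rw [LinearMap.compLeft_apply, Function.comp_apply, fockDer_apply, fockDer_apply]
  split_ifs <;> simp

variable {E : Type*} [AddCommGroup E] [Module ℂ E] [Module (OddClifford r s θ) E]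
  [IsScalarTower ℂ (OddClifford r s θ) E]

/-- A simple Clifford module is the Fock space. -/
theorem exists_fock_equiv (hθ : θ ≠ 0) [IsSimpleModule (OddClifford r s θ) E] :
    ∃ Ψ : (Monomial r s → ℂ) ≃ₗ[ℂ] E, ∀ X φ,
      Ψ (oddElement θ fockMul fockDer X φ) = cliffordGen θ X • Ψ φ := by
  have hcar := (isOddRep_cliffordAction (r := r) (s := s) (θ := θ) (E := E)).isCAR hθ
  have := IsSimpleModule.nontrivial (OddClifford r s θ) E
  obtain ⟨e, -, he, hb⟩ := hcar.exists_vacuum (E := ⊤) (by simp) (by simp) top_ne_bot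
  set Ψ := IsCAR.fockMap (fun i => cliffordAction r s θ E (creationVector θ i))
    (LinearMap.toSpanSingleton ℂ E e) with hΨ
  have hmul : ∀ j φ, Ψ (fockMul j φ) = _ := hcar.fockMap_mul _
  have hder : ∀ j φ, Ψ (fockDer j φ) = _ := hcar.fockMap_der fun j c => by
    rw [LinearMap.toSpanSingleton_apply, map_smul, hb, smul_zero]
  have hX : ∀ X φ, Ψ (oddElement θ fockMul fockDer X φ) = cliffordGen θ X • Ψ φ := fun X φ => by
    rw [map_oddElement Ψ hmul hder, ← cliffordAction_toC, IsOddRep.apply_toC hθ]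
    rfl
  have hinj : Function.Injective Ψ := by
    refine (injective_iff_map_eq_zero _).2 fun φ hφ => funext fun M => ?_
    have h1 : Pi.single (∅, ∅) (φ M) ∈ LinearMap.ker Ψ :=
      single_mem_of_invariant (fun j ψ hψ => by
        rw [LinearMap.mem_ker] at hψ ⊢
        rw [hmul, hψ, map_zero]) (fun j ψ hψ => by
        rw [LinearMap.mem_ker] at hψ ⊢
        rw [hder, hψ, map_zero]) hφ M _
    rw [LinearMap.mem_ker, hΨ, IsCAR.fockMap_single, IsCAR.monomialProd_empty, Module.End.one_apply,
      LinearMap.toSpanSingleton_apply] at h1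
    exact (smul_eq_zero.1 h1).resolve_right he
  let N : Submodule (OddClifford r s θ) E :=
    { carrier := Set.range Ψ
      zero_mem' := ⟨0, map_zero _⟩
      add_mem' := by
        rintro _ _ ⟨x, rfl⟩ ⟨y, rfl⟩
        exact ⟨x + y, map_add _ _ _⟩
      smul_mem' := fun a => by
        refine OddClifford.induction (p := fun a => ∀ {x}, x ∈ Set.range Ψ → a • x ∈ Set.range Ψ)
          ?_ ?_ (fun a b h1 h2 x hx => ?_) (fun a b h1 h2 x hx => ?_) a
        · rintro c _ ⟨x, rfl⟩
          exact ⟨c • x, by rw [map_smul, algebraMap_smul]⟩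
        · rintro X _ ⟨x, rfl⟩
          exact ⟨_, hX X x⟩
        · rw [mul_smul]
          exact h1 (h2 hx)
        · obtain ⟨y, hy⟩ := h1 hx
          obtain ⟨z, hz⟩ := h2 hx
          exact ⟨y + z, by rw [map_add, hy, hz, add_smul]⟩ }
  have hN : N = ⊤ := (eq_bot_or_eq_top N).resolve_left fun h => by
    have h1 : Ψ (Pi.single (∅, ∅) 1) ∈ N := ⟨_, rfl⟩
    rw [h, Submodule.mem_bot, map_eq_zero_iff Ψ hinj] at h1
    simpa using congrFun h1 (∅, ∅)
  refine ⟨LinearEquiv.ofBijective Ψ ⟨hinj, fun x => ?_⟩, hX⟩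
  have h1 : x ∈ N := hN ▸ trivial
  exact h1

/-- Every irreducible Clifford module arises from the model representation. -/
theorem correspondsTo_model (hθ : θ ≠ 0) (hE : IsSimpleModule (OddClifford r s θ) E) :
    CorrespondsTo (E := E) θ (modelRep m r s θ) := by
  obtain ⟨Ψ, hΨ⟩ := exists_fock_equiv (r := r) (s := s) hθ (E := E)
  let Φ : E →ₗ[ℂ] (L2 m →L[ℂ] ModelSpace m r s) :=
    { toFun := fun e => ContinuousLinearMap.pi fun M => Ψ.symm e M • ContinuousLinearMap.id ℂ (L2 m)
      map_add' := fun e e' => ContinuousLinearMap.ext fun f => funext fun M => by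
        change (Ψ.symm (e + e') M) • f = Ψ.symm e M • f + Ψ.symm e' M • f
        rw [map_add, Pi.add_apply, add_smul]
      map_smul' := fun c e => ContinuousLinearMap.ext fun f => funext fun M => by
        change (Ψ.symm (c • e) M) • f = c • (Ψ.symm e M • f)
        rw [map_smul, Pi.smul_apply, smul_assoc] }
  have hΦ : ∀ e f, Φ e f = (LinearMap.toSpanSingleton ℂ (L2 m) f).compLeft _ (Ψ.symm e) :=
    fun e f => rfl
  have hΦM : ∀ e f M, Φ e f M = Ψ.symm e M • f := fun e f M => rfl
  have hg : ∀ e g f, Φ e (schrodinger θ g f) = modelBody m r s θ g (Φ e f) := fun e g f =>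
    funext fun M => (map_smul (schrodinger θ g) (Ψ.symm e M) f).symm
  refine ⟨Φ, fun e e' h => Ψ.symm.injective (funext fun M => ?_), fun T => ⟨?_, fun hT => ?_⟩,
    fun X e f hf => ?_⟩
  · have h1 : Ψ.symm e M • vacuum m hθ = Ψ.symm e' M • vacuum m hθ :=
      congrFun (DFunLike.congr_fun h (vacuum m hθ)) M
    refine smul_left_injective ℂ ?_ h1
    rw [← norm_ne_zero_iff, norm_vacuum]
    exact one_ne_zero
  · rintro ⟨e, rfl⟩ g
    exact ContinuousLinearMap.ext fun f => hg e g f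
  · refine ⟨Ψ fun M => inner ℂ (vacuum m hθ) (T (vacuum m hθ) M),
      ContinuousLinearMap.ext fun f => funext fun M => ?_⟩
    have h1 : ∀ z f, T (schrodinger θ (phaseBody z) f) = modelBody m r s θ (phaseBody z) (T f) :=
      fun z f => DFunLike.congr_fun (hT (phaseBody z)) f
    have h2 := schrodinger_schur hθ (ContinuousLinearMap.proj (R := ℂ) M ∘L T) (fun z f => by
      rw [ContinuousLinearMap.comp_apply, h1]
      rfl) f
    rw [hΦM, Ψ.symm_apply_apply]
    exact h2.symm
  · refine ⟨map_mem_smoothVectors (hg e) hf, ?_⟩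
    change oddOperator m θ X (Φ e f) = _
    have h1 := hΨ X (Ψ.symm e)
    rw [Ψ.apply_symm_apply, ← Ψ.eq_symm_apply] at h1
    rw [oddOperator_apply, hΦ, hΦ, ← h1, map_oddElement _ (compLeft_fockMul _) (compLeft_fockDer _)]

theorem exists_simple_cliffordModule (r s : ℕ) (θ : ℝ) :
    ∃ (E : Type) (_ : AddCommGroup E) (_ : Module ℂ E) (_ : Module (OddClifford r s θ) E)
      (_ : IsScalarTower ℂ (OddClifford r s θ) E), IsSimpleModule (OddClifford r s θ) E := by
  have : Invertible (2 : ℂ) := invertibleOfNonzero two_ne_zero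
  obtain ⟨I, hI⟩ := Ideal.exists_maximal (OddClifford r s θ)
  exact ⟨OddClifford r s θ ⧸ I, inferInstance, inferInstance, inferInstance, inferInstance,
    isSimpleModule_iff_isCoatom.2 hI.out⟩

end CliffordModel

namespace IsSuperunitaryRep

variable {m r s : ℕ} {θ : ℝ} {H : Type u} [NormedAddCommGroup H] [NormedSpace ℂ H] {n : ZMod 2}
  {S : SuperspaceData H} {R : HeisRep m r s H}

/-- An irreducible representation has the parity of the model and is equivalent to it. -/
theorem equivalent_model (hR : IsSuperunitaryRep n S R) (hθ : θ ≠ 0) (hχ : HasCentralCharacter θ R)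
    (hirr : IsIrreducibleRep S R) : n = r ∧
      EquivalentUpToParityAndSign (modelSuperspace m r s θ) (modelRep m r s θ) S R := by
  have := hR.hilbert.complete
  obtain ⟨Q, Γ, J, P, L, h⟩ := hR.exists_frame hθ hχ
  exact ⟨h.parity_eq hirr, h.equivalent_model hirr⟩

end IsSuperunitaryRep

theorem mainTheorem2 (m r s : ℕ) (θ : ℝ) (hθ : θ ≠ 0) :
    -- `U_θ` is an irreducible superunitary representation, of parity `r`
    (IsSuperunitaryRep (r : ZMod 2) (modelSuperspace m r s θ) (modelRep m r s θ) ∧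
      HasCentralCharacter θ (modelRep m r s θ) ∧
      IsIrreducibleRep (modelSuperspace m r s θ) (modelRep m r s θ)) ∧
    -- decomposition of every superunitary representation, on a Hilbert superspace of either parity
    (∀ (H : Type u) [NormedAddCommGroup H] [NormedSpace ℂ H]
      (n : ZMod 2) (S : SuperspaceData H) (R : HeisRep m r s H),
      IsSuperunitaryRep n S R → HasCentralCharacter θ R →
        (n = (r : ZMod 2) →
          IsOrthogonalSumOfCopies (modelSuperspace m r s θ) (modelRep m r s θ) n S R) ∧
        (n = (r : ZMod 2) + 1 →
          IsOrthogonalSumOfCopies (doubleSuperspace m r s θ) (doubleRep m r s θ) n S R)) ∧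
    -- every irreducible one is equivalent to `U_θ`, and its multiplicity space is an irreducible
    -- Clifford module
    (∀ (H : Type u) [NormedAddCommGroup H] [NormedSpace ℂ H]
      (n : ZMod 2) (S : SuperspaceData H) (R : HeisRep m r s H),
      IsSuperunitaryRep n S R → HasCentralCharacter θ R → IsIrreducibleRep S R →
        n = (r : ZMod 2) ∧
        EquivalentUpToParityAndSign (modelSuperspace m r s θ) (modelRep m r s θ) S R ∧
        ∃ (E : Type) (_ : AddCommGroup E) (_ : Module ℂ E) (_ : Module (OddClifford r s θ) E)
          (_ : IsScalarTower ℂ (OddClifford r s θ) E),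
          IsSimpleModule (OddClifford r s θ) E ∧ CorrespondsTo (E := E) θ R) ∧
    -- every irreducible Clifford module arises
    (∀ (E : Type v) [AddCommGroup E] [Module ℂ E] [Module (OddClifford r s θ) E]
      [IsScalarTower ℂ (OddClifford r s θ) E],
      IsSimpleModule (OddClifford r s θ) E → CorrespondsTo (E := E) θ (modelRep m r s θ)) ∧
    -- two irreducible representations are equivalent iff their Clifford modules are isomorphic
    (∀ (H H' : Type u) [NormedAddCommGroup H] [NormedSpace ℂ H]
      [NormedAddCommGroup H'] [NormedSpace ℂ H']
      (n n' : ZMod 2) (S : SuperspaceData H) (S' : SuperspaceData H')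
      (R : HeisRep m r s H) (R' : HeisRep m r s H')
      (E : Type v) [AddCommGroup E] [Module ℂ E] [Module (OddClifford r s θ) E]
      [IsScalarTower ℂ (OddClifford r s θ) E]
      (E' : Type w) [AddCommGroup E'] [Module ℂ E'] [Module (OddClifford r s θ) E']
      [IsScalarTower ℂ (OddClifford r s θ) E'],
      IsSuperunitaryRep n S R → HasCentralCharacter θ R → IsIrreducibleRep S R →
      IsSuperunitaryRep n' S' R' → HasCentralCharacter θ R' → IsIrreducibleRep S' R' →
      CorrespondsTo (E := E) θ R → CorrespondsTo (E := E') θ R' →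
        (EquivalentUpToParityAndSign S R S' R' ↔
          Nonempty (E ≃ₗ[OddClifford r s θ] E'))) := by
  refine ⟨⟨isSuperunitaryRep_model hθ, modelBody_central, isIrreducible_model hθ⟩,
    fun H _ _ n S R hR hχ => hR.isOrthogonalSum hθ hχ, fun H _ _ n S R hR hχ hirr => ?_,
    fun E _ _ _ _ hE => correspondsTo_model hθ hE, ?_⟩
  · obtain ⟨hn, he⟩ := hR.equivalent_model hθ hχ hirr
    obtain ⟨E, _, _, _, _, hE⟩ := exists_simple_cliffordModule r s θ
    obtain ⟨d, ε, V, -, hV⟩ := id he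
    exact ⟨hn, he, E, _, _, _, ‹_›, hE, (correspondsTo_model hθ hE).transport hV⟩
  · intro H H' _ _ _ _ n n' S S' R R' E _ _ _ _ E' _ _ _ _ hR hχ hirr hR' hχ' hirr' hE hE'
    have h : EquivalentUpToParityAndSign S R S' R' :=
      .of_common hR.hilbert (isHilbertSuperspace_model hθ) (hR.equivalent_model hθ hχ hirr).2
        (hR'.equivalent_model hθ hχ' hirr').2
    obtain ⟨d, ε, V, -, hV⟩ := id h
    exact ⟨fun _ => (hE.transport hV).unique hθ hE', fun _ => h⟩
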